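/- **Setting.** Let $d,k\ge 1$ and let $\mathcal D_0,\dots,\mathcal D_{k-1}$ be probability distributions of pairs $(x,y)\in\mathbb R^d\times\mathbb R$. A batch consists of i.i.d. samples from one of these distributions (which one is hidden), and samples in different batches are independent. There is a collection $B_s$ of small batches, with at least $2$ samples each, and a collection $B_m$ of medium batches, with at least $n_m$ samples each. Let $\Sigma_i=\mathbb E_{\mathcal D_i}[xx^\top]$, let $C,C_1,C_2,\sigma>0$, $M\ge 0$ and $\alpha_s,\alpha_m\in(0,1]$, and let $w_0,\dots,w_{k-1}\in\mathbb R^d$. For all $i$ assume $\|\Sigma_i\|\le C_1$ and $\|x\|\le C_2\sqrt d$ almost surely under $\mathcal D_i$. Let $I$ be the set of all $i$ such that at least an $\alpha_s$ fraction of the batches in $B_s$ and at least an $\alpha_m$ fraction of the batches in $B_m$ come from $\mathcal D_i$, and such that $\mathcal D_i$ satisfies: $\mathbb E[(x\cdot u)^4]\le C(\mathbb E[(x\cdot u)^2])^2$ for all $u\in\mathbb R^d$; $u^\top\Sigma_iu\ge 1$ for all unit vectors $u$ and $\|\Sigma_i\|\le C_1$; and $y=w_i\cdot x+\eta$ with $\eta$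 independent of $x$, symmetric around $0$, $\mathbb E[\eta]=0$ and $\mathbb E[\eta^2]\le\sigma^2$. Assume $\|w_i\|\le M$ for all $i\in I$. For $i\notin I$ the relation of $y$ to $x$ may be arbitrary. **Algorithm.** For $\kappa>0$ the clipped gradient of a sample is $\nabla f(x,y,w,\kappa)=\frac{x\cdot w-y}{\max(|x\cdot w-y|,\kappa)}\,\kappa x$; for a collection $S$ of samples, $\nabla f(S,w,\kappa)$ is the average over $S$. The constants hidden in the $\Theta(\cdot)$ of the algorithm are absolute. "Parts" are disjoint, random and of equal size (rounded down). The input is the batches, $k,\alpha_s,\alpha_m,\sigma,C,C_1,M$ and $\epsilon,\delta\in(0,1]$. *List algorithm.* Do $T=\lceil\Theta(\frac1{\alpha_m}\log\frac{2}{\alpha_m\delta})\rceil$ runs with independent randomness: in each one draw a uniformly random batch $b^*\in B_m$, run the main algorithm on $B_s$, $B_m\setminus\{b^*\}$, $b^*$ with failure probability $\delta_0=\delta/(2T)$, and put its output on the list $L$. *Main algorithm.* Put $R=\lceil\Theta(C_1\log(2+\frac M{\epsilon\sigma}))\rceil$, $\epsilon_1=\Theta(1)$, $\epsilon_2=\Theta\big(\frac1{C_1\sqrt{C+1}}\min\{\epsilon,\frac1{\sqrt{C_1}}\}\big)$,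 $\ell=\min\{k,\lceil\frac1{2\alpha_s\epsilon_2^2}\rceil,d\}$, $\delta'=\frac{\delta_0}{5R}$. Divide $B_s$ and $B_m\setminus\{b^*\}$ into $R$ parts $B_s^{(r)}$, $B_m^{(r)}$ and the samples of $b^*$ into $2R$ parts $S_1^{(r)},S_2^{(r)}$. Start at $\hat w=0$. In round $r=1,\dots,R$: (a) divide $S_1^{(r)}$ into $\lceil\Theta(\log\frac1{\delta'})\rceil$ parts, let $\theta$ be the median over the parts of the average of $(x\cdot\hat w-y)^2$, and put $\kappa=\sqrt{32(C+1)C_1(\theta+17\sigma^2)/\epsilon_1}$; (b) divide each $b\in B_s^{(r)}$ into two parts $S_1^b,S_2^b$ with clipped gradients $u^b=\nabla f(S_1^b,\hat w,\kappa)$, $v^b=\nabla f(S_2^b,\hat w,\kappa)$, and let $P$ be the orthogonal projection to the span of the top $\ell$ singular vectors of $A=\frac1{2|B_s^{(r)}|}\sum_{b\in B_s^{(r)}}(u^bv^{b\top}+v^bu^{b\top})$ (if singular values coincide, by a fixed rule); (c) put $T_1=\lceil\Theta(\log\frac{|B_m^{(r)}|}{\delta'})\rceil$ and $T_2=\lceil\Theta(\log\frac1{\delta'})\rceil$,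 divide each $b\in B_m^{(r)}$ into two parts $S_1^b,S_2^b$, divide $S_1^b$ into $2T_1$ parts $S_{1,j}^b$, $S_2^{(r)}$ into $2T_1$ parts $S_j^*$, and $S_2^b$ into $T_2$ parts $S_{2,j}^b$; with $g_j^b=P(\nabla f(S_{1,j}^b,\hat w,\kappa)-\nabla f(S_j^*,\hat w,\kappa))$ let $\tilde B$ be the set of $b\in B_m^{(r)}$ for which the median of $g_j^b\cdot g_{T_1+j}^b$ over $j\le T_1$ is at most $\epsilon_2^2\kappa^2C_1$; let $\Delta_j=\frac1{|\tilde B|}\sum_{b\in\tilde B}P\nabla f(S_{2,j}^b,\hat w,\kappa)$ for $j\le T_2$, and let $\Delta$ be a $\Delta_i$ for which the median over $j$ of $\|\Delta_i-\Delta_j\|$ is smallest; (d) replace $\hat w$ by $\hat w-\Delta/C_1$. The output is the last $\hat w$. Running time is the number of unit-cost operations on real numbers, where an exact singular value decomposition of a $d\times d$ matrix is charged $d^3$ steps, sorting $n$ numbers $n^2$ steps, and shuffling $n$ items $2n$ steps. **Statement.** There are absolute constants for the $\Theta(\cdot)$ in the algorithm and an absolute exponent $p$ such that for all $C,C_1,C_2>0$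 there is $K>0$, depending only on $C,C_1,C_2$, with the following property. For all data as above and all $\epsilon,\delta\in(0,1]$, put $\Lambda=\log\big(2+\frac{d}{\alpha_s\alpha_m\epsilon\delta}+\frac M\sigma\big)$. Suppose that $$|B_s|\ge K\,\frac d{\alpha_s^2\epsilon^4}\,\Lambda^p,\qquad n_m\ge K\,\min\Big\{\sqrt k,\frac1{\epsilon\sqrt{\alpha_s}}\Big\}\frac1{\epsilon^2}\,(\Lambda+\log|B_m|)^p,\qquad |B_m|\ge K\,\frac1{\alpha_m}\min\Big\{\sqrt k,\frac1{\epsilon\sqrt{\alpha_s}}\Big\}\Lambda^p .$$ Then, for all data and all random choices, the list algorithm runs in time at most $K\big(d+N+\frac1{\alpha_m}+\log\frac1\delta+\log(2+\frac M{\epsilon\sigma})\big)^p$, where $N$ is the total number of samples in all batches, and its list $L$ has size at most $K\frac1{\alpha_m}\log\frac2{\alpha_m\delta}=\tilde O(1/\alpha_m)$; and with probability at least $1-\delta$ over the data and the random choices, for every $i\in I$ there is $\hat w\in L$ with $\|\hat w-w_i\|\le\epsilon\sigma$. -/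

import Mathlib

open MeasureTheory ProbabilityTheory
open scoped ENNReal

noncomputable section

namespace BatchRegression

/-- Input vectors in `ℝ^d` with the Euclidean norm. -/
abbrev Vec (d : ℕ) : Type := EuclideanSpace ℝ (Fin d)

/-- An input-output pair `(x, y)`. -/
abbrev Sample (d : ℕ) : Type := Vec d × ℝ

/- ## Distributions -/

/-- The second-moment matrix `Σ = E[x xᵀ]` of the input. -/
def secondMoment {d : ℕ} (D : Measure (Sample d)) : Matrix (Fin d) (Fin d) ℝ :=
  Matrix.of fun a c => ∫ z, z.1 a * z.1 c ∂D

/-- The spectral norm of a matrix. -/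
def specNorm {d : ℕ} (A : Matrix (Fin d) (Fin d) ℝ) : ℝ :=
  ‖Matrix.toEuclideanCLM (n := Fin d) (𝕜 := ℝ) A‖

/-- The output noise `η = y - w · x`. -/
def noise {d : ℕ} (w : Vec d) (z : Sample d) : ℝ := z.2 - inner ℝ w z.1

/-- `D` is a well-behaved heavy-tailed linear regression model with regression vector `w`. -/
structure IsRegressionModel {d : ℕ} (C C₁ σ : ℝ) (D : Measure (Sample d)) (w : Vec d) : Prop where
  hypercontractive : ∀ u : Vec d,
    ∫ z, (inner ℝ z.1 u) ^ 4 ∂D ≤ C * (∫ z, (inner ℝ z.1 u) ^ 2 ∂D) ^ 2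
  one_le_secondMoment : ∀ u : Vec d, ‖u‖ = 1 → 1 ≤ ∑ a, ∑ c, u a * secondMoment D a c * u c
  secondMoment_le : specNorm (secondMoment D) ≤ C₁
  noise_indep : IndepFun (noise w) (fun z : Sample d => z.1) D
  noise_memLp : MemLp (noise w) 2 D
  noise_mean : ∫ z, noise w z ∂D = 0
  noise_var : ∫ z, noise w z ^ 2 ∂D ≤ σ ^ 2
  noise_symm : D.map (noise w) = D.map (fun z => -noise w z)

/-- The set `I` of the components that satisfy the regression assumptions and generate at least an
`αs` fraction of the small and an `αm` fraction of the medium batches; `cs b` and `cm b` are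
the (hidden) components that generate the small, respectively medium, batch `b`. -/
def largeComponents {d k Ns Nm : ℕ} (C C₁ σ αs αm : ℝ) (D : Fin k → Measure (Sample d))
    (w : Fin k → Vec d) (cs : Fin Ns → Fin k) (cm : Fin Nm → Fin k) : Set (Fin k) :=
  {i | αs * Ns ≤ (Finset.univ.filter fun b => cs b = i).card ∧
       αm * Nm ≤ (Finset.univ.filter fun b => cm b = i).card ∧
       IsRegressionModel C C₁ σ (D i) (w i)}

/- ## Cost model

A computation returns its value together with the number of elementary steps it made. The unit-cost
steps are the operations on real numbers `+ - * / √ |·| max ≤ log ⌈·⌉`; loops add up the costs of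
their bodies. Three standard routines are charged as a whole: sorting `n` numbers costs `n ^ 2`,
shuffling `n` items costs `2 n` (drawing a uniformly random order, then copying),
and an (exact) singular value decomposition of a `d × d` matrix costs `d ^ 3`. -/

structure Timed (α : Type) where
  val : α
  cost : ℕ

instance : Monad Timed where
  pure a := ⟨a, 0⟩
  bind x f := ⟨(f x.val).val, x.cost + (f x.val).cost⟩

/-- Return `a` after `n` steps. -/
def charge {α : Type} (n : ℕ) (a : α) : Timed α := ⟨a, n⟩

def addT (x y : ℝ) : Timed ℝ := charge 1 (x + y)
def subT (x y : ℝ) : Timed ℝ := charge 1 (x - y)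
def mulT (x y : ℝ) : Timed ℝ := charge 1 (x * y)
def divT (x y : ℝ) : Timed ℝ := charge 1 (x / y)
def absT (x : ℝ) : Timed ℝ := charge 1 |x|
def maxT (x y : ℝ) : Timed ℝ := charge 1 (max x y)
def sqrtT (x : ℝ) : Timed ℝ := charge 1 (Real.sqrt x)
def leT (x y : ℝ) : Timed Bool := charge 1 (decide (x ≤ y))

/-- A loop over `Fin n` that stores the results of its body in a table. -/
def tab {α : Type} {n : ℕ} (f : Fin n → Timed α) : Timed (Fin n → α) :=
  ⟨fun i => (f i).val, ∑ i, ((f i).cost + 1)⟩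

/-- The sum of `n` stored numbers. -/
def sumT {n : ℕ} (x : Fin n → ℝ) : Timed ℝ := charge n (∑ i, x i)

/-- The median of `n` numbers: the entry at position `⌊n/2⌋` (counted from `0`) of the sorted list. -/
def median {n : ℕ} (x : Fin n → ℝ) : ℝ :=
  ((List.ofFn x).insertionSort (· ≤ ·)).getD (n / 2) 0

def medianT {n : ℕ} (x : Fin n → ℝ) : Timed ℝ := charge (n ^ 2 + 1) (median x)

/-- The first index at which a list of `n` numbers is minimal (`none` if `n = 0`). -/
def argminT {n : ℕ} (x : Fin n → ℝ) : Timed (Option (Fin n)) :=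
  charge (n + 1) ((List.finRange n).argmin x)

def vecT {d : ℕ} (f : Fin d → Timed ℝ) : Timed (Vec d) := do
  let x ← tab f
  pure (WithLp.toLp 2 x)

def matT {d : ℕ} (f : Fin d → Fin d → Timed ℝ) : Timed (Matrix (Fin d) (Fin d) ℝ) := do
  let x ← tab fun a => tab fun c => f a c
  pure (Matrix.of x)

def dotT {d : ℕ} (x y : Vec d) : Timed ℝ := do
  let p ← tab fun a => mulT (x a) (y a)
  sumT p

def scaleT {d : ℕ} (c : ℝ) (x : Vec d) : Timed (Vec d) := vecT fun a => mulT c (x a)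

def vsubT {d : ℕ} (x y : Vec d) : Timed (Vec d) := vecT fun a => subT (x a) (y a)

def vsumT {d n : ℕ} (g : Fin n → Vec d) : Timed (Vec d) := vecT fun a => sumT fun t => g t a

def distT {d : ℕ} (x y : Vec d) : Timed ℝ := do
  let z ← vsubT x y
  let s ← dotT z z
  sqrtT s

def mulVecT {d : ℕ} (P : Matrix (Fin d) (Fin d) ℝ) (x : Vec d) : Timed (Vec d) :=
  vecT fun a => do
    let p ← tab fun c => mulT (P a c) (x c)
    sumT p

/- ## Collections, equal parts, random order -/

/-- A finite collection, stored in some order. -/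
structure Arr (α : Type) where
  size : ℕ
  get : Fin size → α

/-- A batch is a collection of samples. -/
abbrev Batch (d : ℕ) : Type := Arr (Sample d)

theorem part_index_lt {s p : ℕ} (j : Fin p) (t : Fin (s / p)) : j.val * (s / p) + t.val < s := by
  have h1 : (j.val + 1) * (s / p) ≤ p * (s / p) := Nat.mul_le_mul_right _ j.isLt
  have h2 : p * (s / p) ≤ s := Nat.mul_div_le s p
  have h3 : (j.val + 1) * (s / p) = j.val * (s / p) + s / p := by ring
  have h4 := t.isLt
  omega

/-- The `j`-th of `p` disjoint consecutive parts of equal size `⌊size / p⌋`. Of a collection in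
uniformly random order, these are `p` disjoint random parts of the same size. -/
def Arr.part {α : Type} (a : Arr α) (p : ℕ) (j : Fin p) : Arr α :=
  ⟨a.size / p, fun t => a.get ⟨j.val * (a.size / p) + t.val, part_index_lt j t⟩⟩

/-- The collection without its first element. -/
def Arr.tail {α : Type} (a : Arr α) : Arr α :=
  ⟨a.size - 1, fun t => a.get ⟨t.val + 1, by have := t.isLt; omega⟩⟩

/-- The first batch of a collection of batches (an empty batch if there is none). -/
def headBatch {d : ℕ} (a : Arr (Batch d)) : Batch d :=
  if h : 0 < a.size then a.get ⟨0, h⟩ else ⟨0, Fin.elim0⟩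

/-- List the items in the order given by `π`. -/
def shuffleT {α : Type} {n : ℕ} (π : Equiv.Perm (Fin n)) (f : Fin n → α) : Timed (Arr α) :=
  charge (2 * n) ⟨n, fun t => f (π t)⟩

/- ## Top singular vectors -/

/-- The largest eigenvalue of `AᵀA` that has an eigenvector in `W`. -/
def topEigenvalue {d : ℕ} (A : Matrix (Fin d) (Fin d) ℝ) (W : Submodule ℝ (Vec d)) : ℝ :=
  sSup {l | W ⊓ Module.End.eigenspace (Matrix.toEuclideanLin (A.transpose * A)) l ≠ ⊥}

/-- The eigenvectors in `W` for that eigenvalue. -/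
def topEigenspace {d : ℕ} (A : Matrix (Fin d) (Fin d) ℝ) (W : Submodule ℝ (Vec d)) :
    Submodule ℝ (Vec d) :=
  W ⊓ Module.End.eigenspace (Matrix.toEuclideanLin (A.transpose * A)) (topEigenvalue A W)

open scoped Classical in
/-- A unit vector in `topEigenspace A W`: the normalized projection of the first standard basis
vector whose projection to this space is nonzero. -/
def topUnitVec {d : ℕ} (A : Matrix (Fin d) (Fin d) ℝ) (W : Submodule ℝ (Vec d)) : Vec d :=
  let v := (((List.finRange d).map fun a =>
    (topEigenspace A W).starProjection (EuclideanSpace.single a (1 : ℝ))).find?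
      fun v => decide (v ≠ 0)).getD 0
  ‖v‖⁻¹ • v

/-- The orthogonal complement of the first `j` singular vectors. -/
def singComplement {d : ℕ} (A : Matrix (Fin d) (Fin d) ℝ) : ℕ → Submodule ℝ (Vec d)
  | 0 => ⊤
  | j + 1 => singComplement A j ⊓ (ℝ ∙ topUnitVec A (singComplement A j))ᗮ

/-- The `j`-th (from `0`) singular vector of `A`, in decreasing order of the singular values: a unit
eigenvector of `AᵀA` for the largest eigenvalue that has an eigenvector orthogonal to the previous
ones. (If singular values coincide, the choice of the vectors is the one in `topUnitVec`.) -/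
def singVec {d : ℕ} (A : Matrix (Fin d) (Fin d) ℝ) (j : ℕ) : Vec d :=
  topUnitVec A (singComplement A j)

/-- The top `l` singular vectors of `A`. -/
def svdT {d : ℕ} (A : Matrix (Fin d) (Fin d) ℝ) (l : ℕ) : Timed (Fin l → Vec d) :=
  charge (d ^ 3) fun j => singVec A j

/- ## The algorithm -/

/-- The absolute constants hidden in the `Θ(·)` of the algorithm. -/
structure Tuning where
  cRuns : ℝ
  cRounds : ℝ
  c₁ : ℝ
  c₂ : ℝ
  cClip : ℝ
  cTest : ℝ
  cEst : ℝ
  cRuns_pos : 0 < cRuns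
  cRounds_pos : 0 < cRounds
  c₁_pos : 0 < c₁
  c₂_pos : 0 < c₂
  cClip_pos : 0 < cClip
  cTest_pos : 0 < cTest
  cEst_pos : 0 < cEst

/-- The scalar parameters that are given to the algorithm. -/
structure Params where
  k : ℕ
  αs : ℝ
  αm : ℝ
  σ : ℝ
  C : ℝ
  C₁ : ℝ
  M : ℝ
  ε : ℝ
  δ : ℝ

/-- The clipped gradient `κ (x·w - y) / max(|x·w - y|, κ) • x` of one sample. -/
def clipGradT {d : ℕ} (z : Sample d) (w : Vec d) (κ : ℝ) : Timed (Vec d) := do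
  let s ← dotT z.1 w
  let r ← subT s z.2
  let a ← absT r
  let m ← maxT a κ
  let q ← divT r m
  let c ← mulT q κ
  scaleT c z.1

/-- The clipped gradient of a collection: the average over its samples. -/
def avgClipGradT {d : ℕ} (S : Batch d) (w : Vec d) (κ : ℝ) : Timed (Vec d) := do
  let g ← tab fun t : Fin S.size => clipGradT (S.get t) w κ
  let v ← vsumT g
  let c ← divT 1 S.size
  scaleT c v

/-- The average squared residual of a collection. -/
def avgSqResidualT {d : ℕ} (S : Batch d) (w : Vec d) : Timed ℝ := do
  let g ← tab fun t : Fin S.size => do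
    let s ← dotT (S.get t).1 w
    let r ← subT s (S.get t).2
    mulT r r
  let v ← sumT g
  divT v S.size

/-- Estimation of the clipping parameter. -/
def clipEst {d : ℕ} (τ : Tuning) (S : Batch d) (w : Vec d) (ε δ' σ C C₁ : ℝ) : Timed ℝ := do
  let T ← charge 4 ⌈τ.cClip * Real.log (1 / δ')⌉₊
  let m ← tab fun j : Fin T => avgSqResidualT (S.part T j) w
  let θ ← medianT m
  charge 10 (Real.sqrt (32 * (C + 1) * C₁ * (θ + 17 * σ ^ 2) / ε))

/-- Estimation of a subspace of dimension `l` that nearly contains the expected clipped gradient;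
the orthogonal projection `U Uᵀ` to it is returned. -/
def gradSubEst {d : ℕ} (B : Arr (Batch d)) (κ : ℝ) (w : Vec d) (l : ℕ) :
    Timed (Matrix (Fin d) (Fin d) ℝ) := do
  let u ← tab fun b : Fin B.size => avgClipGradT ((B.get b).part 2 0) w κ
  let v ← tab fun b : Fin B.size => avgClipGradT ((B.get b).part 2 1) w κ
  let A ← matT fun a c => do
    let p ← tab fun b => do
      let x ← mulT (u b a) (v b c)
      let y ← mulT (v b a) (u b c)
      addT x y
    let s ← sumT p
    divT s (2 * B.size)
  let U ← svdT A l
  matT fun a c => do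
    let p ← tab fun j => mulT (U j a) (U j c)
    sumT p

/-- Estimation of the projected clipped gradient: the batches that look alike `Sstar` are selected
by a median-of-means test, and their clipped gradients are averaged robustly. -/
def gradEst {d : ℕ} (τ : Tuning) (B : Arr (Batch d)) (Sstar : Batch d) (κ : ℝ) (w : Vec d)
    (P : Matrix (Fin d) (Fin d) ℝ) (ε δ' C₁ : ℝ) : Timed (Vec d) := do
  let T₁ ← charge 4 ⌈τ.cTest * Real.log (B.size / δ')⌉₊
  let T₂ ← charge 4 ⌈τ.cEst * Real.log (1 / δ')⌉₊
  let thr ← charge 5 (ε ^ 2 * κ ^ 2 * C₁)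
  let gs ← tab fun j : Fin (2 * T₁) => avgClipGradT (Sstar.part (2 * T₁) j) w κ
  let keep ← tab fun b : Fin B.size => do
    let g ← tab fun j : Fin (2 * T₁) => avgClipGradT (((B.get b).part 2 0).part (2 * T₁) j) w κ
    let ζ ← tab fun j : Fin T₁ => do
      let j₁ : Fin (2 * T₁) := ⟨j.val, by have := j.isLt; omega⟩
      let j₂ : Fin (2 * T₁) := ⟨T₁ + j.val, by have := j.isLt; omega⟩
      let x ← vsubT (g j₁) (gs j₁)
      let y ← vsubT (g j₂) (gs j₂)
      let Px ← mulVecT P x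
      let Py ← mulVecT P y
      dotT Px Py
    let m ← medianT ζ
    leT m thr
  let N ← charge B.size (Finset.univ.filter fun b => keep b = true).card
  let Δ ← tab fun i : Fin T₂ => do
    let g ← tab fun b : Fin B.size =>
      if keep b = true then do
        let g ← avgClipGradT (((B.get b).part 2 1).part T₂ i) w κ
        mulVecT P g
      else pure 0
    let s ← vsumT g
    let c ← divT 1 N
    scaleT c s
  let ξ ← tab fun i : Fin T₂ => do
    let r ← tab fun j : Fin T₂ => distT (Δ i) (Δ j)
    medianT r
  let i ← argminT ξ
  match i with
  | some i => pure (Δ i)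
  | none => pure 0

/-- The iterate after `r` out of `R` rounds. -/
def iterT {α : Type} {R : ℕ} (step : Fin R → α → Timed α) (a : α) : (r : ℕ) → r ≤ R → Timed α
  | 0, _ => pure a
  | r + 1, h => do
    let x ← iterT step a r (Nat.le_of_succ_le h)
    step ⟨r, h⟩ x

/-- Gradient descent for the component that generated the batch `Sstar`, run with failure
probability `δ`. The collections and the samples in each batch are in random order. -/
def mainAlgorithm {d : ℕ} (τ : Tuning) (q : Params) (δ : ℝ) (Bs Bm : Arr (Batch d))
    (Sstar : Batch d) : Timed (Vec d) := do
  let R ← charge 8 ⌈τ.cRounds * q.C₁ * Real.log (2 + q.M / (q.ε * q.σ))⌉₊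
  let ε₁ := τ.c₁
  let ε₂ ← charge 8 (τ.c₂ / (q.C₁ * Real.sqrt (q.C + 1)) * min q.ε (1 / Real.sqrt q.C₁))
  let l ← charge 8 (min (min q.k ⌈1 / (2 * q.αs * ε₂ ^ 2)⌉₊) d)
  let δ' ← charge 2 (δ / (5 * R))
  iterT (fun (r : Fin R) w => do
    let r₁ : Fin (2 * R) := ⟨r.val, by have := r.isLt; omega⟩
    let r₂ : Fin (2 * R) := ⟨R + r.val, by have := r.isLt; omega⟩
    let κ ← clipEst τ (Sstar.part (2 * R) r₁) w ε₁ δ' q.σ q.C q.C₁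
    let P ← gradSubEst (Bs.part R r) κ w l
    let Δ ← gradEst τ (Bm.part R r) (Sstar.part (2 * R) r₂) κ w P ε₂ δ' q.C₁
    let s ← scaleT (1 / q.C₁) Δ
    vsubT w s) 0 R le_rfl

/-- The number `Θ((1/αm) log (1/(αm δ)))` of runs. -/
def numRuns (τ : Tuning) (αm δ : ℝ) : ℕ := ⌈τ.cRuns * (1 / αm) * Real.log (2 / (αm * δ))⌉₊

/-- The observed data: the samples of all small and of all medium batches. -/
abbrev Data (d : ℕ) {Ns Nm : ℕ} (ns : Fin Ns → ℕ) (nm : Fin Nm → ℕ) : Type :=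
  ((b : Fin Ns) → Fin (ns b) → Sample d) × ((b : Fin Nm) → Fin (nm b) → Sample d)

/-- The random choices of one run: an order of the small batches, an order of the medium batches,
and an order of the samples in each batch. -/
abbrev RunSeed {Ns Nm : ℕ} (ns : Fin Ns → ℕ) (nm : Fin Nm → ℕ) : Type :=
  Equiv.Perm (Fin Ns) × Equiv.Perm (Fin Nm) ×
    ((b : Fin Ns) → Equiv.Perm (Fin (ns b))) × ((b : Fin Nm) → Equiv.Perm (Fin (nm b)))

/-- One run. The first medium batch in the random order is a uniformly random element of the
collection of medium batches; it is set aside as `Sstar`, and the remaining ones are in uniformly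
random order. -/
def oneRun {d Ns Nm : ℕ} {ns : Fin Ns → ℕ} {nm : Fin Nm → ℕ} (τ : Tuning) (q : Params) (δ : ℝ)
    (data : Data d ns nm) (s : RunSeed ns nm) : Timed (Vec d) := do
  let small ← tab fun b => shuffleT (s.2.2.1 b) (data.1 b)
  let medium ← tab fun b => shuffleT (s.2.2.2 b) (data.2 b)
  let Bs ← shuffleT s.1 small
  let Bm ← shuffleT s.2.1 medium
  mainAlgorithm τ q δ Bs Bm.tail (headBatch Bm)

/-- The random choices of all runs. -/
abbrev Seed {Ns Nm : ℕ} (ns : Fin Ns → ℕ) (nm : Fin Nm → ℕ) (T : ℕ) : Type :=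
  Fin T → RunSeed ns nm

/-- The list-producing algorithm: `T = numRuns τ αm δ` independent runs, each with failure
probability `δ / (2 T)`. -/
def listAlgorithm {d Ns Nm : ℕ} {ns : Fin Ns → ℕ} {nm : Fin Nm → ℕ} (τ : Tuning) (q : Params)
    (data : Data d ns nm) (s : Seed ns nm (numRuns τ q.αm q.δ)) : Timed (List (Vec d)) := do
  let T ← charge 8 (numRuns τ q.αm q.δ)
  let δrun ← charge 2 (q.δ / (2 * T))
  let W ← tab fun t => oneRun τ q δrun data (s t)
  pure (List.ofFn W)

/- ## Probability -/

/-- The law of the data: batch `b` consists of i.i.d. samples from the distribution of its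
component, and samples in different batches are independent. -/
def dataLaw {d k Ns Nm : ℕ} (D : Fin k → Measure (Sample d)) (ns : Fin Ns → ℕ) (nm : Fin Nm → ℕ)
    (cs : Fin Ns → Fin k) (cm : Fin Nm → Fin k) : Measure (Data d ns nm) :=
  (Measure.pi fun b => Measure.pi fun _ : Fin (ns b) => D (cs b)).prod
    (Measure.pi fun b => Measure.pi fun _ : Fin (nm b) => D (cm b))

/-- The probability of an event if the data have law `μ` and the random choices of the algorithm
are uniform and independent of the data. -/
def jointProb {Ω S : Type} [MeasurableSpace Ω] [Fintype S] (μ : Measure Ω) (E : Ω → S → Prop) :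
    ℝ≥0∞ :=
  (Fintype.card S : ℝ≥0∞)⁻¹ * ∑ s, μ {ω | E ω s}

/- ## Sample sizes -/

/-- The logarithm whose powers are the logarithmic factors in the sample sizes. -/
def logFactor (d : ℕ) (αs αm σ M ε δ : ℝ) : ℝ :=
  Real.log (2 + d / (αs * αm * ε * δ) + M / σ)

/-- `min {√k, 1 / (ε √αs)}`. -/
def dimFactor (k : ℕ) (αs ε : ℝ) : ℝ := min (Real.sqrt k) (1 / (ε * Real.sqrt αs))

end BatchRegression

end

open BatchRegression

/-! One run aims at the component i of its distinguished batch. Write v for the current error and Σ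
for the second-moment matrix of that component. The gradient of the squared loss is Σ v, and since 1
≤ Σ ≤ C₁ a step of length 1/C₁ contracts v by 1 - 1/C₁ (`norm_sub_secondMoment_le`). An estimate of
the gradient with error at most ‖v‖/2 + εσ/4 therefore still shrinks the error by 1 - 1/(2C₁) up to
an additive εσ/(4C₁) (`norm_gradStep_sub_le`), and order C₁ log(2 + M/(εσ)) rounds suffice
(`pow_numRounds_le`).

Clipping at a level κ with κ² of order signal plus σ² keeps gradients bounded. Its bias is at most
‖v‖/4: by the symmetry of the noise the pointwise error carries a factor of the signal, and
hypercontractivity controls the resulting third power (`norm_gradMean_sub_le`). A median of average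
squared residuals finds such a κ (`measure_clipParam_le`).

The remaining task is to estimate the mean clipped gradient G of component i. The two halves of a
small batch are independent with the same mean, so the cross matrix has expectation Σ p_j G_j G_jᵀ,
and a matrix Bernstein inequality (Ahlswede–Winter, resting on Golden–Thompson) makes it close to
this mixture. After ℓ singular vectors the next singular value is small, either because the mixture
has rank at most k or because its trace is bounded; hence the ℓ top singular vectors nearly span
every G_j of substantial weight (`IsNearMixture.norm_sub_proj_le`).

Inside that ℓ-dimensional space a medium batch is compared with the distinguished one through the
inner product of two independent estimates of the same difference. Its fluctuation grows like √ℓ and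
not like ℓ (`IsSpread.measure_inner_inner_le`), which is what allows medium batches of size about
√ℓ/ε². All batches of component i pass, and every batch that passes has nearly the same projected
gradient; averaging the survivors, with a median in the metric space for confidence, gives the
projected gradient (`measure_keepSet_le`, `measure_partMean_le`).

Every stage depends on the outcome of the earlier ones but reads fresh samples. `measure_freeze`
turns this into a rule: an earlier outcome may be treated as a constant. It needs measurability of
everything computed, including the singular vectors, which are obtained as limits of normalized
matrix powers (`measurable_topUnitVec`).

The random orders are treated separately from the data. The number of batches of component i that
fall into a part concentrates, by a negative correlation argument for random permutations
(`sum_half_pow_hits_le`), and the independent runs pick a distinguished batch from each component of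
I with high probability (`freq_not_hit_le`). A union bound over runs, rounds and stages finishes the
probability estimate; the running time is a deterministic count. -/

noncomputable section

namespace BatchRegression

/- ## The Golden–Thompson inequality -/

section GoldenThompson

variable {n : Type*} [Fintype n]

/-- Cauchy–Schwarz for the Frobenius inner product. -/
theorem trace_mul_sq_le (A B : Matrix n n ℝ) :
    (A * B).trace ^ 2 ≤ (A * A.transpose).trace * (B * B.transpose).trace := by
  have h1 : (A * B).trace = ∑ p : n × n, A p.1 p.2 * B p.2 p.1 := by
    simp [Matrix.trace, Matrix.mul_apply, Fintype.sum_prod_type]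
  have h2 : (A * A.transpose).trace = ∑ p : n × n, A p.1 p.2 ^ 2 := by
    simp [Matrix.trace, Matrix.mul_apply, Fintype.sum_prod_type, sq]
  have h3 : (B * B.transpose).trace = ∑ p : n × n, B p.2 p.1 ^ 2 := by
    simp only [Matrix.trace, Matrix.mul_apply, Fintype.sum_prod_type, sq, Matrix.diag,
      Matrix.transpose_apply]
    exact Finset.sum_comm
  rw [h1, h2, h3]
  exact Finset.sum_mul_sq_le_sq_mul_sq _ _ _

variable [DecidableEq n]

theorem trace_mul_pow_comm (A B : Matrix n n ℝ) (m : ℕ) :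
    ((A * B) ^ m).trace = ((B * A) ^ m).trace := by
  cases m with
  | zero => simp
  | succ m =>
    have h : SemiconjBy A (B * A) (A * B) := by simp [SemiconjBy, mul_assoc]
    have h2 := (h.pow_right m).eq
    rw [pow_succ, pow_succ, ← mul_assoc, ← h2, mul_assoc, Matrix.trace_mul_comm, mul_assoc]

/-- The two inequalities feed each other in one induction. For the first at the next level, apply it
to Z², rotate the factors cyclically to reach ZᵀZ · ZZᵀ, separate these by the second, and finish
with Cauchy–Schwarz, since ZᵀZ and ZZᵀ have the same traces of powers. For the second, apply the
first to XY, rotate XY·YX into X²Y², and use the second for X² and Y². -/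
theorem trace_pow_two_pow_aux (m : ℕ) :
    (∀ Z : Matrix n n ℝ, |(Z ^ 2 ^ (m + 1)).trace| ≤ ((Z * Z.transpose) ^ 2 ^ m).trace) ∧
    (∀ X Y : Matrix n n ℝ, X.IsSymm → Y.IsSymm →
      ((X * Y) ^ 2 ^ m).trace ≤ (X ^ 2 ^ m * Y ^ 2 ^ m).trace) := by
  induction m with
  | zero =>
    refine ⟨fun Z => ?_, fun X Y _ _ => by simp⟩
    have h := trace_mul_sq_le Z Z
    have h0 : 0 ≤ (Z * Z.transpose).trace := by
      simp only [Matrix.trace, Matrix.mul_apply, Matrix.diag, Matrix.transpose_apply]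
      exact Finset.sum_nonneg fun i _ => Finset.sum_nonneg fun j _ => mul_self_nonneg _
    simp only [zero_add, pow_one, pow_zero]
    rw [sq Z]
    exact abs_le_of_sq_le_sq (by nlinarith) h0
  | succ m ih =>
    obtain ⟨ih1, ih2⟩ := ih
    constructor
    · intro Z
      have hs1 : (Z.transpose * Z).IsSymm := by simp [Matrix.IsSymm, Matrix.transpose_mul]
      have hs2 : (Z * Z.transpose).IsSymm := by simp [Matrix.IsSymm, Matrix.transpose_mul]
      have e1 : Z ^ 2 ^ (m + 1 + 1) = (Z ^ 2) ^ 2 ^ (m + 1) := by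
        rw [← pow_mul]; congr 1; ring
      have e2 : ((Z ^ 2 * (Z ^ 2).transpose) ^ 2 ^ m).trace
          = ((Z.transpose * Z * (Z * Z.transpose)) ^ 2 ^ m).trace := by
        have : Z ^ 2 * (Z ^ 2).transpose = (Z * (Z * Z.transpose)) * Z.transpose := by
          rw [sq, Matrix.transpose_mul]; simp only [mul_assoc]
        rw [this, trace_mul_pow_comm]; simp only [mul_assoc]
      have h1 := ih1 (Z ^ 2)
      rw [e2] at h1
      have h2 := ih2 _ _ hs1 hs2
      have h3 := trace_mul_sq_le ((Z.transpose * Z) ^ 2 ^ m) ((Z * Z.transpose) ^ 2 ^ m)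
      have e3 : ∀ W : Matrix n n ℝ, W.IsSymm →
          W ^ 2 ^ m * (W ^ 2 ^ m).transpose = W ^ 2 ^ (m + 1) := by
        intro W hW
        rw [Matrix.transpose_pow, hW.eq, ← pow_add]; congr 1; ring
      rw [e3 _ hs1, e3 _ hs2, trace_mul_pow_comm Z.transpose Z] at h3
      have h0 : 0 ≤ ((Z * Z.transpose) ^ 2 ^ (m + 1)).trace := by
        rw [← e3 _ hs2]
        simp only [Matrix.trace, Matrix.mul_apply, Matrix.diag, Matrix.transpose_apply]
        exact Finset.sum_nonneg fun i _ => Finset.sum_nonneg fun j _ => mul_self_nonneg _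
      rw [e1]
      refine h1.trans (h2.trans ?_)
      exact le_of_abs_le (abs_le_of_sq_le_sq (by nlinarith) h0)
    · intro X Y hX hY
      have h1 := ih1 (X * Y)
      have e : ((X * Y * (X * Y).transpose) ^ 2 ^ m).trace
          = ((X ^ 2 * Y ^ 2) ^ 2 ^ m).trace := by
        rw [Matrix.transpose_mul, hX.eq, hY.eq]
        have : X * Y * (Y * X) = (X * Y ^ 2) * X := by rw [sq]; simp only [mul_assoc]
        rw [this, trace_mul_pow_comm, sq X]; simp only [mul_assoc]
      rw [e] at h1
      have hX2 : (X ^ 2).IsSymm := by rw [Matrix.IsSymm, Matrix.transpose_pow, hX.eq]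
      have hY2 : (Y ^ 2).IsSymm := by rw [Matrix.IsSymm, Matrix.transpose_pow, hY.eq]
      have h2 := ih2 _ _ hX2 hY2
      rw [← pow_mul, ← pow_mul] at h2
      have e2 : 2 * 2 ^ m = 2 ^ (m + 1) := by ring
      rw [e2] at h2
      exact (le_abs_self _).trans (h1.trans h2)

end GoldenThompson

/-! ### The Lie product formula -/

section Lie

variable {𝔸 : Type*} [NormedRing 𝔸]

/-- Telescoping; `1 ≤ c` allows the convenient exponent `N` in place of `N - 1`. -/
theorem norm_pow_sub_pow_le (X Y : 𝔸) (c : ℝ) (hc : 1 ≤ c) (hX : ‖X‖ ≤ c) (hY : ‖Y‖ ≤ c) (N : ℕ) :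
    ‖X ^ N - Y ^ N‖ ≤ N * c ^ N * ‖X - Y‖ := by
  induction N with
  | zero => simp
  | succ N ih =>
    have e : X ^ (N + 1) - Y ^ (N + 1) = (X ^ N - Y ^ N) * X + Y ^ N * (X - Y) := by
      rw [pow_succ, pow_succ]; noncomm_ring
    rcases Nat.eq_zero_or_pos N with rfl | hN
    · simp; nlinarith [norm_nonneg (X - Y)]
    have hYN : ‖Y ^ N‖ ≤ c ^ (N + 1) := (norm_pow_le' Y hN).trans
      ((pow_le_pow_left₀ (norm_nonneg _) hY N).trans (pow_le_pow_right₀ hc (by omega)))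
    rw [e]
    calc _ ≤ ‖X ^ N - Y ^ N‖ * ‖X‖ + ‖Y ^ N‖ * ‖X - Y‖ :=
          (norm_add_le _ _).trans (add_le_add (norm_mul_le _ _) (norm_mul_le _ _))
      _ ≤ (N * c ^ N * ‖X - Y‖) * c + c ^ (N + 1) * ‖X - Y‖ := by gcongr
      _ = _ := by push_cast; ring

variable [NormedAlgebra ℝ 𝔸] [CompleteSpace 𝔸] [NormOneClass 𝔸]

open NormedSpace in
theorem norm_exp_le_exp_norm (Z : 𝔸) : ‖exp Z‖ ≤ Real.exp ‖Z‖ := by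
  refine (exp_series_hasSum_exp' (𝕂 := ℝ) Z).norm_le_of_bounded
    (g := fun n => (n.factorial : ℝ)⁻¹ • ‖Z‖ ^ n) ?_ fun n => ?_
  · rw [Real.exp_eq_exp_ℝ]
    exact exp_series_hasSum_exp' (𝕂 := ℝ) ‖Z‖
  · rw [norm_smul, smul_eq_mul, norm_inv, Real.norm_natCast]
    gcongr
    exact norm_pow_le _ _

-- The difference of exp(tA) exp(tB) and exp(t(A+B)) vanishes to first order at t = 0, so at t = 1/N
-- it is o(1/N). Taking N-th powers costs only a factor N times a constant, by `norm_pow_sub_pow_le`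
-- with c = exp((‖A‖ + ‖B‖)/N).
open NormedSpace Filter Topology in
theorem tendsto_exp_mul_exp_pow (A B : 𝔸) :
    Tendsto (fun N : ℕ => (exp ((N : ℝ)⁻¹ • A) * exp ((N : ℝ)⁻¹ • B)) ^ N) atTop
      (𝓝 (exp (A + B))) := by
  let _ : NormedAlgebra ℚ 𝔸 := NormedAlgebra.restrictScalars ℚ ℝ 𝔸
  have hd : HasDerivAt (fun t : ℝ => exp (t • A) * exp (t • B) - exp (t • (A + B))) 0 0 := by
    have hA := hasDerivAt_exp_smul_const (𝕂 := ℝ) A (0 : ℝ)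
    have hB := hasDerivAt_exp_smul_const (𝕂 := ℝ) B (0 : ℝ)
    have hAB := hasDerivAt_exp_smul_const (𝕂 := ℝ) (A + B) (0 : ℝ)
    have := (hA.mul hB).sub hAB
    exact this.congr_deriv (by simp [exp_zero])
  have ho := hd.isLittleO
  simp only [zero_smul, exp_zero, mul_one, sub_self, sub_zero, smul_zero] at ho
  have hlim : Tendsto (fun N : ℕ => ((N : ℝ)⁻¹)) atTop (𝓝 0) := tendsto_inv_atTop_nhds_zero_nat
  have ho2 := ho.comp_tendsto hlim
  have ho3 : Tendsto (fun N : ℕ => (N : ℝ) *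
      ‖exp ((N : ℝ)⁻¹ • A) * exp ((N : ℝ)⁻¹ • B) - exp ((N : ℝ)⁻¹ • (A + B))‖) atTop (𝓝 0) := by
    have := ho2.norm_norm.tendsto_div_nhds_zero
    refine this.congr fun N => ?_
    simp [Function.comp, div_eq_mul_inv, mul_comm]
  rw [tendsto_iff_norm_sub_tendsto_zero]
  have hub := ho3.const_mul (Real.exp (‖A‖ + ‖B‖))
  rw [mul_zero] at hub
  refine squeeze_zero' (Eventually.of_forall fun _ => norm_nonneg _) ?_ hub
  filter_upwards [eventually_gt_atTop 0] with N hN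
  have hN' : (0 : ℝ) < N := by exact_mod_cast hN
  have hpow : exp (A + B) = exp ((N : ℝ)⁻¹ • (A + B)) ^ N := by
    rw [← exp_nsmul, ← Nat.cast_smul_eq_nsmul ℝ, smul_smul, mul_inv_cancel₀ hN'.ne', one_smul]
  rw [hpow]
  set c := Real.exp ((‖A‖ + ‖B‖) / N) with hc
  have hc1 : 1 ≤ c := Real.one_le_exp (by positivity)
  have hcN : c ^ N = Real.exp (‖A‖ + ‖B‖) := by
    rw [hc, ← Real.exp_nat_mul]; congr 1; field_simp
  have hnorm : ∀ Z : 𝔸, ‖exp ((N : ℝ)⁻¹ • Z)‖ ≤ Real.exp (‖Z‖ / N) := by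
    intro Z
    refine (norm_exp_le_exp_norm _).trans (Real.exp_le_exp.2 ?_)
    rw [norm_smul, norm_inv, Real.norm_natCast, div_eq_inv_mul]
  refine (norm_pow_sub_pow_le _ _ c hc1 ?_ ?_ N).trans (le_of_eq ?_)
  · refine (norm_mul_le _ _).trans ?_
    rw [hc, add_div, Real.exp_add]
    exact mul_le_mul (hnorm A) (hnorm B) (norm_nonneg _) (Real.exp_nonneg _)
  · refine (hnorm _).trans (Real.exp_le_exp.2 ?_)
    gcongr; exact norm_add_le _ _
  · rw [hcN]; ring

end Lie

/-! ### Golden–Thompson as a limit of trace inequalities -/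

section GT2
variable {n : Type*} [Fintype n] [DecidableEq n]
open NormedSpace Filter Topology
open scoped Matrix.Norms.L2Operator

/-- The trace inequality for (XY)^N with N = 2^m, X = exp(A/N) and Y = exp(B/N) has the required
right side for every m, and its left side converges by the Lie product formula. -/
theorem golden_thompson (A B : Matrix n n ℝ) (hA : A.IsSymm) (hB : B.IsSymm) :
    (exp (A + B)).trace ≤ (exp A * exp B).trace := by
  cases isEmpty_or_nonempty n
  · simp [Matrix.trace]
  have ht := tendsto_exp_mul_exp_pow A B
  have h2 : Tendsto (fun m : ℕ => 2 ^ m) atTop (atTop : Filter ℕ) :=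
    tendsto_pow_atTop_atTop_of_one_lt (by norm_num)
  have htr : Continuous (fun M : Matrix n n ℝ => M.trace) := continuous_id.matrix_trace
  have ht2 := (htr.tendsto _).comp (ht.comp h2)
  refine le_of_tendsto ht2 (Eventually.of_forall fun m => ?_)
  simp only [Function.comp]
  set N := 2 ^ m with hN
  have hN' : (0 : ℝ) < (N : ℕ) := by rw [hN]; positivity
  have hpow : ∀ Z : Matrix n n ℝ, exp (((N : ℕ) : ℝ)⁻¹ • Z) ^ N = exp Z := by
    intro Z
    rw [← Matrix.exp_nsmul, ← Nat.cast_smul_eq_nsmul ℝ, smul_smul, mul_inv_cancel₀ hN'.ne',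
      one_smul]
  have := (trace_pow_two_pow_aux m).2 (exp (((N : ℕ) : ℝ)⁻¹ • A)) (exp (((N : ℕ) : ℝ)⁻¹ • B))
    (Matrix.IsSymm.exp (by simp [Matrix.IsSymm, hA.eq]))
    (Matrix.IsSymm.exp (by simp [Matrix.IsSymm, hB.eq]))
  rwa [← hN, hpow, hpow] at this

end GT2

/- ## Matrix exponentials of symmetric matrices -/

section SymExp
variable {n : Type*} [Fintype n] [DecidableEq n]
open NormedSpace Matrix

open scoped MatrixOrder Matrix.Norms.L2Operator in
theorem trace_mul_nonneg_of_posSemidef {A C : Matrix n n ℝ} (hA : A.PosSemidef)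
    (hC : C.PosSemidef) : 0 ≤ (A * C).trace := by
  obtain ⟨Y, rfl⟩ := CStarAlgebra.nonneg_iff_eq_star_mul_self.mp hA.nonneg
  rw [Matrix.star_eq_conjTranspose, mul_assoc, Matrix.trace_mul_comm]
  have := (hC.mul_mul_conjTranspose_same Y).trace_nonneg
  rwa [mul_assoc] at this ⊢

theorem trace_mul_le_of_posSemidef {A B : Matrix n n ℝ} {l : ℝ} (hA : A.PosSemidef)
    (hB : (l • (1 : Matrix n n ℝ) - B).PosSemidef) : (A * B).trace ≤ l * A.trace := by
  have := trace_mul_nonneg_of_posSemidef hA hB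
  rw [mul_sub, Matrix.trace_sub] at this
  simp at this
  linarith

/-- The matrix with the eigenvectors of `A` and the eigenvalues `f (l i)`. -/
def spectralFun {A : Matrix n n ℝ} (hA : A.IsHermitian) (f : ℝ → ℝ) : Matrix n n ℝ :=
  (hA.eigenvectorUnitary : Matrix n n ℝ) * Matrix.diagonal (fun i => f (hA.eigenvalues i)) *
    star (hA.eigenvectorUnitary : Matrix n n ℝ)

theorem spectralFun_id {A : Matrix n n ℝ} (hA : A.IsHermitian) : spectralFun hA id = A := by
  conv_rhs => rw [hA.spectral_theorem, Unitary.conjStarAlgAut_apply]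
  simp [spectralFun]

theorem spectralFun_exp {A : Matrix n n ℝ} (hA : A.IsHermitian) :
    spectralFun hA Real.exp = exp A := by
  have hU : star (hA.eigenvectorUnitary : Matrix n n ℝ)
      = (hA.eigenvectorUnitary : Matrix n n ℝ)⁻¹ :=
    (Matrix.inv_eq_right_inv (by simp)).symm
  have hunit : IsUnit (hA.eigenvectorUnitary : Matrix n n ℝ) :=
    (Unitary.toUnits hA.eigenvectorUnitary).isUnit
  conv_rhs => rw [← spectralFun_id hA]
  rw [spectralFun, spectralFun, hU, Matrix.exp_conj _ _ hunit, Matrix.exp_diagonal]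
  congr 3
  ext i
  rw [Pi.coe_exp, Real.exp_eq_exp_ℝ]; rfl

theorem spectralFun_add {A : Matrix n n ℝ} (hA : A.IsHermitian) (f g : ℝ → ℝ) :
    spectralFun hA (fun x => f x + g x) = spectralFun hA f + spectralFun hA g := by
  simp only [spectralFun, ← add_mul, ← mul_add, Matrix.diagonal_add]

theorem spectralFun_mul {A : Matrix n n ℝ} (hA : A.IsHermitian) (f g : ℝ → ℝ) :
    spectralFun hA (fun x => f x * g x) = spectralFun hA f * spectralFun hA g := by
  have : spectralFun hA f * spectralFun hA g = (hA.eigenvectorUnitary : Matrix n n ℝ) *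
      Matrix.diagonal (fun i => f (hA.eigenvalues i)) *
      (star (hA.eigenvectorUnitary : Matrix n n ℝ) * (hA.eigenvectorUnitary : Matrix n n ℝ)) *
      Matrix.diagonal (fun i => g (hA.eigenvalues i)) *
      star (hA.eigenvectorUnitary : Matrix n n ℝ) := by
    simp only [spectralFun, mul_assoc]
  rw [this]
  simp [spectralFun, mul_assoc]

theorem spectralFun_const {A : Matrix n n ℝ} (hA : A.IsHermitian) (c : ℝ) :
    spectralFun hA (fun _ => c) = c • (1 : Matrix n n ℝ) := by
  have : (Matrix.diagonal (fun _ : n => c)) = c • (1 : Matrix n n ℝ) := by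
    ext i j; simp [Matrix.diagonal_apply, Matrix.one_apply]
  simp [spectralFun, this]

theorem spectralFun_posSemidef {A : Matrix n n ℝ} (hA : A.IsHermitian) {f : ℝ → ℝ}
    (hf : ∀ i, 0 ≤ f (hA.eigenvalues i)) : (spectralFun hA f).PosSemidef := by
  have h : (Matrix.diagonal (fun i => f (hA.eigenvalues i))).PosSemidef :=
    Matrix.PosSemidef.diagonal hf
  exact h.mul_mul_conjTranspose_same (hA.eigenvectorUnitary : Matrix n n ℝ)

theorem trace_spectralFun {A : Matrix n n ℝ} (hA : A.IsHermitian) (f : ℝ → ℝ) :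
    (spectralFun hA f).trace = ∑ i, f (hA.eigenvalues i) := by
  rw [spectralFun, Matrix.trace_mul_comm, ← mul_assoc]
  simp

theorem exp_posSemidef {A : Matrix n n ℝ} (hA : A.IsHermitian) : (exp A).PosSemidef := by
  rw [← spectralFun_exp hA]
  exact spectralFun_posSemidef hA fun _ => Real.exp_nonneg _

theorem exists_unit_eigenvalue {A : Matrix n n ℝ} (hA : A.IsHermitian) (i : n) :
    ∃ x : n → ℝ, x ⬝ᵥ x = 1 ∧ x ⬝ᵥ (A *ᵥ x) = hA.eigenvalues i := by
  have h1 : (hA.eigenvectorBasis i).ofLp ⬝ᵥ (hA.eigenvectorBasis i).ofLp = 1 := by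
    have h := hA.eigenvectorBasis.orthonormal.1 i
    have h2 := EuclideanSpace.real_norm_sq_eq (hA.eigenvectorBasis i)
    rw [h] at h2
    simp only [dotProduct, ← sq]
    linarith
  refine ⟨_, h1, ?_⟩
  rw [hA.mulVec_eigenvectorBasis, dotProduct_smul, h1]; simp

/-- The scalar inequality eˣ ≤ 1 + x + x² for |x| ≤ 1, applied to the eigenvalues; the hypothesis on
the quadratic form places them in [-1, 1]. -/
theorem exp_le_one_add_sq {X : Matrix n n ℝ} (hX : X.IsHermitian)
    (h : ∀ x : n → ℝ, |x ⬝ᵥ (X *ᵥ x)| ≤ x ⬝ᵥ x) : (1 + X + X * X - exp X).PosSemidef := by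
  have e : 1 + X + X * X - exp X
      = spectralFun hX (fun x => (1 + id x + id x * id x) + (-1) * Real.exp x) := by
    rw [spectralFun_add, spectralFun_add, spectralFun_add, spectralFun_mul, spectralFun_mul,
      spectralFun_exp, spectralFun_id, spectralFun_const, spectralFun_const]
    simp [sub_eq_add_neg]
  rw [e]
  refine spectralFun_posSemidef hX fun i => ?_
  obtain ⟨x, hx1, hx2⟩ := exists_unit_eigenvalue hX i
  have h3 := h x
  rw [hx1, hx2] at h3
  have h4 := Real.abs_exp_sub_one_sub_id_le h3
  have h5 := (abs_le.1 h4).2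
  simp only [id]; nlinarith

/-- The trace is the sum of the exponentials of the eigenvalues. If it were below exp t, every
eigenvalue would be below t, and so would every Rayleigh quotient. -/
theorem exp_le_trace_exp {A : Matrix n n ℝ} (hA : A.IsHermitian) {t : ℝ} {x : n → ℝ}
    (hx : 0 < x ⬝ᵥ x) (h : t * (x ⬝ᵥ x) ≤ x ⬝ᵥ (A *ᵥ x)) : Real.exp t ≤ (exp A).trace := by
  by_contra! hlt
  rw [← spectralFun_exp hA, trace_spectralFun] at hlt
  have hlam : ∀ i, hA.eigenvalues i < t := by
    intro i
    have h1 : Real.exp (hA.eigenvalues i) ≤ ∑ i, Real.exp (hA.eigenvalues i) :=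
      Finset.single_le_sum (f := fun i => Real.exp (hA.eigenvalues i))
        (fun _ _ => Real.exp_nonneg _) (Finset.mem_univ i)
    exact Real.exp_lt_exp.1 (h1.trans_lt hlt)
  have hne : Nonempty n := by
    by_contra hne
    rw [not_nonempty_iff] at hne
    simp [dotProduct] at hx
  obtain ⟨i0, -, hi0⟩ := Finset.exists_max_image Finset.univ hA.eigenvalues Finset.univ_nonempty
  set l := hA.eigenvalues i0
  have hps : (spectralFun hA (fun x => l + (-1) * id x)).PosSemidef :=
    spectralFun_posSemidef hA fun i => by simpa using hi0 i (Finset.mem_univ i)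
  rw [spectralFun_add, spectralFun_mul, spectralFun_const, spectralFun_const, spectralFun_id]
    at hps
  have h2 := hps.dotProduct_mulVec_nonneg x
  simp [Matrix.add_mulVec, Matrix.neg_mulVec, Matrix.smul_mulVec] at h2
  have h3 := hlam i0
  nlinarith

end SymExp

/- ## Product measures: functions of disjoint sets of coordinates -/

section Product

variable {ι S : Type*} [Fintype ι] [MeasurableSpace S] (ν : ι → Measure S)
  [∀ i, IsProbabilityMeasure (ν i)]

open scoped Classical in
/-- The coordinates in `J` from `p.1` and the other ones from `p.2`. -/
def mix (J : Set ι) (p : (ι → S) × (ι → S)) : ι → S := fun i => if i ∈ J then p.1 i else p.2 i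

omit [Fintype ι] in
theorem measurable_mix (J : Set ι) : Measurable (mix (S := S) J) := by
  refine measurable_pi_lambda _ fun i => ?_
  by_cases h : i ∈ J
  · simp only [mix, h, if_true]; fun_prop
  · simp only [mix, h, if_false]; fun_prop

/-- Independence in the form used everywhere: taking the coordinates outside `J` from an independent
copy does not change the law. Functions of disjoint coordinate sets then read different factors of a
product measure. -/
theorem measurePreserving_mix (J : Set ι) :
    MeasurePreserving (mix (S := S) J) ((Measure.pi ν).prod (Measure.pi ν)) (Measure.pi ν) := by
  classical
  refine ⟨measurable_mix J, ?_⟩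
  symm
  refine Measure.pi_eq fun s hs => ?_
  rw [Measure.map_apply (measurable_mix J) (MeasurableSet.univ_pi hs)]
  have : mix J ⁻¹' (Set.univ.pi s) =
      (Set.univ.pi fun i => if i ∈ J then s i else Set.univ) ×ˢ
      (Set.univ.pi fun i => if i ∈ J then Set.univ else s i) := by
    ext p
    simp only [Set.mem_preimage, Set.mem_univ_pi, Set.mem_prod, mix, ← forall_and]
    refine forall_congr' fun i => ?_
    by_cases h : i ∈ J <;> simp [h]
  rw [this, Measure.prod_prod, Measure.pi_pi, Measure.pi_pi, ← Finset.prod_mul_distrib]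
  refine Finset.prod_congr rfl fun i _ => ?_
  by_cases h : i ∈ J <;> simp [h]

omit [Fintype ι] [MeasurableSpace S] in
theorem _root_.DependsOn.mix_fst {β : Type*} {f : (ι → S) → β} {J : Set ι} (hf : DependsOn f J)
    (p : (ι → S) × (ι → S)) : f (mix J p) = f p.1 :=
  hf fun i hi => by simp [mix, hi]

omit [Fintype ι] [MeasurableSpace S] in
theorem _root_.DependsOn.mix_snd {β : Type*} {f : (ι → S) → β} {J J' : Set ι} (hJ : Disjoint J J')
    (hf : DependsOn f J') (p : (ι → S) × (ι → S)) : f (mix J p) = f p.2 :=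
  hf fun i hi => by simp [mix, Set.disjoint_right.1 hJ hi]

/-- The value of a function of other coordinates can be regarded as a constant. -/
theorem lintegral_freeze {α : Type*} [MeasurableSpace α] {f : (ι → S) → α} (hf : Measurable f)
    {J J' : Set ι} (hd : Disjoint J J') (hJ : DependsOn f J) {F : α → (ι → S) → ℝ≥0∞}
    (hF : Measurable (Function.uncurry F)) (hJ' : ∀ a, DependsOn (F a) J') :
    ∫⁻ ω, F (f ω) ω ∂(Measure.pi ν) = ∫⁻ ω, ∫⁻ ω', F (f ω) ω' ∂(Measure.pi ν) ∂(Measure.pi ν) := by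
  have hm : Measurable fun ω => F (f ω) ω := hF.comp (hf.prodMk measurable_id)
  rw [← (measurePreserving_mix ν J).lintegral_comp hm]
  rw [lintegral_prod]
  · refine lintegral_congr fun ω => lintegral_congr fun ω' => ?_
    rw [hJ.mix_fst, (hJ' _).mix_snd hd]
  · exact (hm.comp (measurable_mix J)).aemeasurable

/-- This is how adaptivity is handled. The outcome `f` of earlier stages uses the coordinates in `J`
and the new event those in `J'`, so a bound for each fixed outcome is a bound for the random one. -/
theorem measure_freeze {α : Type*} [MeasurableSpace α] {f : (ι → S) → α} (hf : Measurable f)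
    {J J' : Set ι} (hd : Disjoint J J') (hJ : DependsOn f J) {bad : α → (ι → S) → Prop}
    (hbad : MeasurableSet {p : α × (ι → S) | bad p.1 p.2}) (hJ' : ∀ a, DependsOn (bad a) J')
    {δ : ℝ≥0∞} (h : ∀ ω, Measure.pi ν {ω' | bad (f ω) ω'} ≤ δ) :
    Measure.pi ν {ω | bad (f ω) ω} ≤ δ := by
  classical
  have hsec : ∀ a, MeasurableSet {ω | bad a ω} := fun a => measurable_prodMk_left hbad
  have hms : MeasurableSet {ω | bad (f ω) ω} := (hf.prodMk measurable_id) hbad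
  let F : α → (ι → S) → ℝ≥0∞ := fun a ω => {ω | bad a ω}.indicator 1 ω
  have hF : Measurable (Function.uncurry F) := by
    have : Function.uncurry F = {p : α × (ι → S) | bad p.1 p.2}.indicator 1 := by
      ext p; simp [F, Function.uncurry, Set.indicator]
    rw [this]
    exact measurable_one.indicator hbad
  have hFd : ∀ a, DependsOn (F a) J' := fun a x y hxy => by
    have := hJ' a hxy
    simp [F, Set.indicator, this]
  have e1 : Measure.pi ν {ω | bad (f ω) ω} = ∫⁻ ω, F (f ω) ω ∂(Measure.pi ν) := by
    rw [← lintegral_indicator_one hms]; rfl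
  rw [e1, lintegral_freeze ν hf hd hJ hF hFd]
  calc _ ≤ ∫⁻ _, δ ∂(Measure.pi ν) := lintegral_mono fun ω => by
        rw [lintegral_indicator_one (hsec _)]; exact h ω
    _ = δ := by simp

theorem indepFun_of_dependsOn {α β : Type*} [MeasurableSpace α] [MeasurableSpace β]
    {f : (ι → S) → α} {g : (ι → S) → β} (hf : Measurable f) (hg : Measurable g) {J J' : Set ι}
    (hd : Disjoint J J') (hJ : DependsOn f J) (hJ' : DependsOn g J') :
    IndepFun f g (Measure.pi ν) := by
  rw [indepFun_iff_measure_inter_preimage_eq_mul]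
  intro s t hs ht
  rw [← (measurePreserving_mix ν J).measure_preimage ((hf hs).inter (hg ht)).nullMeasurableSet]
  have : mix J ⁻¹' (f ⁻¹' s ∩ g ⁻¹' t) = (f ⁻¹' s) ×ˢ (g ⁻¹' t) := by
    ext p
    simp [hJ.mix_fst, hJ'.mix_snd hd]
  rw [this, Measure.prod_prod]

theorem measure_biInter_of_dependsOn {κ : Type*} {E : κ → Set (ι → S)}
    (hE : ∀ j, MeasurableSet (E j)) {J : κ → Set ι} (hd : Pairwise (Function.onFun Disjoint J))
    (hJ : ∀ j, DependsOn (fun ω => ω ∈ E j) (J j)) (s : Finset κ) :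
    Measure.pi ν (⋂ j ∈ s, E j) = ∏ j ∈ s, Measure.pi ν (E j) := by
  classical
  induction s using Finset.induction_on with
  | empty => simp
  | insert a s ha ih =>
    rw [Finset.prod_insert ha, Finset.set_biInter_insert, ← ih]
    set G := ⋂ j ∈ s, E j with hG
    have hGm : MeasurableSet G := Finset.measurableSet_biInter s fun j _ => hE j
    have hGd : DependsOn (fun ω => ω ∈ G) (⋃ j ∈ s, J j) := by
      intro x y hxy
      simp only [hG, Set.mem_iInter]
      refine forall_congr fun j => forall_congr fun hj => ?_
      exact hJ j fun i hi => hxy i (Set.mem_biUnion hj hi)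
    have hdis : Disjoint (J a) (⋃ j ∈ s, J j) := by
      rw [Set.disjoint_iUnion₂_right]
      intro j hj
      exact hd (by rintro rfl; exact ha hj)
    rw [← (measurePreserving_mix ν (J a)).measure_preimage ((hE a).inter hGm).nullMeasurableSet]
    have : mix (J a) ⁻¹' (E a ∩ G) = E a ×ˢ G := by
      ext p
      have h1 := (hJ a).mix_fst p
      have h2 := hGd.mix_snd hdis p
      simp only [eq_iff_iff] at h1 h2
      simp [h1, h2]
    rw [this, Measure.prod_prod]

open scoped Classical in
/-- A majority of unlikely independent events is very unlikely. -/
theorem measure_majority_le {T : ℕ} {E : Fin T → Set (ι → S)}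
    (hE : ∀ j, MeasurableSet (E j)) {J : Fin T → Set ι}
    (hd : Pairwise (Function.onFun Disjoint J))
    (hJ : ∀ j, DependsOn (fun ω => ω ∈ E j) (J j))
    (hq : ∀ j, Measure.pi ν (E j) ≤ ENNReal.ofReal (1 / 8)) {δ : ℝ} (hδ : 0 < δ) (hδ1 : δ ≤ 1)
    (hT : 3 * Real.log (1 / δ) ≤ T) :
    Measure.pi ν {ω | T ≤ 2 * (Finset.univ.filter fun j => ω ∈ E j).card} ≤ ENNReal.ofReal δ := by
  have hsub : {ω | T ≤ 2 * (Finset.univ.filter fun j => ω ∈ E j).card} ⊆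
      ⋃ s ∈ Finset.univ.filter (fun s : Finset (Fin T) => T ≤ 2 * s.card), ⋂ j ∈ s, E j := by
    intro ω hω
    simp only [Set.mem_iUnion]
    refine ⟨Finset.univ.filter fun j => ω ∈ E j, by simpa using hω, ?_⟩
    simp
  -- If a majority fails, then some set of at least T/2 indices fails simultaneously, which by
  -- independence has probability at most 8^(-T/2).
  have hone : ∀ s ∈ Finset.univ.filter (fun s : Finset (Fin T) => T ≤ 2 * s.card),
      Measure.pi ν (⋂ j ∈ s, E j) ≤ ENNReal.ofReal (Real.exp (-(3 * Real.log 2 * (T / 2)))) := by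
    intro s hs
    have hs' : (T : ℝ) ≤ 2 * s.card := by exact_mod_cast (Finset.mem_filter.1 hs).2
    rw [measure_biInter_of_dependsOn ν hE hd hJ]
    calc _ ≤ ∏ j ∈ s, ENNReal.ofReal (1 / 8) := Finset.prod_le_prod' fun j _ => hq j
      _ = ENNReal.ofReal ((1 / 8) ^ s.card) := by
        rw [Finset.prod_const, ENNReal.ofReal_pow (by norm_num)]
      _ ≤ _ := by
        refine ENNReal.ofReal_le_ofReal ?_
        have h8 : (1 / 8 : ℝ) = Real.exp (-(3 * Real.log 2)) := by
          rw [Real.exp_neg, show 3 * Real.log 2 = Real.log (2 ^ 3) by rw [Real.log_pow]; norm_num,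
            Real.exp_log (by norm_num)]
          norm_num
        rw [h8, ← Real.exp_nat_mul]
        refine Real.exp_le_exp.2 ?_
        have := Real.log_pos (show (1 : ℝ) < 2 by norm_num)
        nlinarith
  refine (measure_mono hsub).trans ((measure_biUnion_finset_le _ _).trans
    ((Finset.sum_le_sum hone).trans ?_))
  rw [Finset.sum_const, nsmul_eq_mul, ← ENNReal.ofReal_natCast,
    ← ENNReal.ofReal_mul (by positivity)]
  refine ENNReal.ofReal_le_ofReal ?_
  have hc : ((Finset.univ.filter (fun s : Finset (Fin T) => T ≤ 2 * s.card)).card : ℝ)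
      ≤ Real.exp (Real.log 2 * T) := by
    rw [mul_comm, Real.exp_nat_mul, Real.exp_log (by norm_num)]
    have : (Finset.univ.filter (fun s : Finset (Fin T) => T ≤ 2 * s.card)).card ≤ 2 ^ T :=
      (Finset.card_filter_le _ _).trans (by simp)
    exact_mod_cast this
  -- At most 2^T sets, each of probability at most 8^(-T/2), give 2^(-T/2) in total. Since (3/2) log
  -- 2 > 1, the bound on `T` makes this at most δ.
  calc _ ≤ Real.exp (Real.log 2 * T) * Real.exp (-(3 * Real.log 2 * (T / 2))) := by gcongr
    _ ≤ Real.exp (Real.log δ) := by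
      rw [← Real.exp_add]
      refine Real.exp_le_exp.2 ?_
      have h2 : (0.6931471803 : ℝ) < Real.log 2 := Real.log_two_gt_d9
      have h3 : 0 ≤ Real.log (1 / δ) := Real.log_nonneg (by rw [le_div_iff₀ hδ]; linarith)
      have h4 : Real.log (1 / δ) = -Real.log δ := by rw [one_div, Real.log_inv]
      nlinarith
    _ = δ := Real.exp_log hδ

end Product

/- ## A Bernstein inequality for the largest eigenvalue -/

section MatrixBernstein

open NormedSpace Matrix
open scoped Matrix.Norms.L2Operator

theorem abs_entry_le_norm {n : Type*} [Fintype n] [DecidableEq n] (A : Matrix n n ℝ) (i j : n) :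
    |A i j| ≤ ‖A‖ := by
  have h := Matrix.l2_opNorm_mulVec A (EuclideanSpace.single j (1 : ℝ))
  have h2 := EuclideanSpace.norm_eq (WithLp.toLp 2 (A *ᵥ (EuclideanSpace.single j (1 : ℝ)).ofLp))
  have h3 := PiLp.norm_apply_le (WithLp.toLp 2 (A *ᵥ (EuclideanSpace.single j (1 : ℝ)).ofLp)) i
  simp at h3 h
  exact h3.trans h

variable {n : Type*} [Fintype n]

theorem integral_dotProduct_mulVec {Ω : Type*} [MeasurableSpace Ω] (μ : Measure Ω)
    {X : Ω → Matrix n n ℝ} (hX : ∀ i j, Integrable (fun ω => X ω i j) μ) (x : n → ℝ) :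
    ∫ ω, x ⬝ᵥ (X ω *ᵥ x) ∂μ = x ⬝ᵥ ((Matrix.of fun i j => ∫ ω, X ω i j ∂μ) *ᵥ x) := by
  simp only [dotProduct, Matrix.mulVec, Matrix.of_apply]
  rw [integral_finsetSum _ fun i _ => (integrable_finsetSum _ fun j _ =>
    (hX i j).mul_const _).const_mul _]
  refine Finset.sum_congr rfl fun i _ => ?_
  rw [integral_const_mul, integral_finsetSum _ fun j _ => (hX i j).mul_const _]
  congr 1
  exact Finset.sum_congr rfl fun j _ => integral_mul_const _ _

theorem integrable_dotProduct_mulVec {Ω : Type*} [MeasurableSpace Ω] (μ : Measure Ω)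
    {X : Ω → Matrix n n ℝ} (hX : ∀ i j, Integrable (fun ω => X ω i j) μ) (x : n → ℝ) :
    Integrable (fun ω => x ⬝ᵥ (X ω *ᵥ x)) μ := by
  simp only [dotProduct, Matrix.mulVec]
  exact integrable_finsetSum _ fun i _ => (integrable_finsetSum _ fun j _ =>
    (hX i j).mul_const _).const_mul _

variable [DecidableEq n]

theorem continuous_exp_matrix : Continuous (fun A : Matrix n n ℝ => exp A) :=
  let _ : NormedAlgebra ℚ (Matrix n n ℝ) := NormedAlgebra.restrictScalars ℚ ℝ _
  exp_continuous

theorem measurable_exp_entry {Ω : Type*} [MeasurableSpace Ω] {X : Ω → Matrix n n ℝ}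
    (hX : ∀ i j, Measurable fun ω => X ω i j) (i j : n) :
    Measurable fun ω => exp (X ω) i j := by
  have h1 : Measurable (fun ω => (fun a b => X ω a b : n → n → ℝ)) :=
    measurable_pi_lambda _ fun a => measurable_pi_lambda _ fun b => hX a b
  have h2 : Continuous fun A : n → n → ℝ => exp (Matrix.of A) i j :=
    (continuous_exp_matrix.comp continuous_id).matrix_elem i j
  exact h2.measurable.comp h1

variable {ι S : Type*} [Fintype ι] [MeasurableSpace S] (ν : ι → Measure S)
  [∀ i, IsProbabilityMeasure (ν i)]

/-- The data of the matrix Bernstein inequality. -/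
structure BernsteinFamily {m : ℕ} (X : Fin m → (ι → S) → Matrix n n ℝ) (J : Fin m → Set ι)
    (L V : ℝ) : Prop where
  meas : ∀ b i j, Measurable fun ω => X b ω i j
  symm : ∀ b ω, (X b ω).IsSymm
  disj : Pairwise (Function.onFun Disjoint J)
  dep : ∀ b, DependsOn (X b) (J b)
  bdd : ∀ b, ∀ᵐ ω ∂(Measure.pi ν), ‖X b ω‖ ≤ L
  mean : ∀ b i j, ∫ ω, X b ω i j ∂(Measure.pi ν) = 0
  var : ∀ b (x : n → ℝ), ∫ ω, (X b ω *ᵥ x) ⬝ᵥ (X b ω *ᵥ x) ∂(Measure.pi ν) ≤ V * (x ⬝ᵥ x)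

variable {ν} {m : ℕ} {X : Fin m → (ι → S) → Matrix n n ℝ} {J : Fin m → Set ι} {L V : ℝ}

theorem BernsteinFamily.integrable_exp (h : BernsteinFamily ν X J L V) (θ : ℝ)
    (s : Finset (Fin m)) (i j : n) :
    Integrable (fun ω => exp (θ • ∑ b ∈ s, X b ω) i j) (Measure.pi ν) := by
  have hmeas := measurable_exp_entry (X := fun ω => θ • ∑ b ∈ s, X b ω) (fun i j => by
    simp only [Matrix.smul_apply, Matrix.sum_apply]
    exact (Finset.measurable_fun_sum s fun b _ => h.meas b i j).const_smul θ) i j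
  refine Integrable.of_bound hmeas.aestronglyMeasurable (Real.exp (|θ| * ∑ b ∈ s, L)) ?_
  filter_upwards [ae_all_iff.2 h.bdd] with ω hω
  have : Nonempty n := ⟨i⟩
  refine (abs_entry_le_norm _ i j).trans ((norm_exp_le_exp_norm _).trans (Real.exp_le_exp.2 ?_))
  rw [norm_smul, Real.norm_eq_abs]
  gcongr
  exact (norm_sum_le _ _).trans (Finset.sum_le_sum fun b _ => hω b)

/-- The estimate exp(θX) ≤ 1 + θX + (θX)² holds in the matrix order because ‖θX‖ ≤ 1. In expectation
the linear term disappears and the quadratic one is at most θ²V. -/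
theorem BernsteinFamily.mgf_le (h : BernsteinFamily ν X J L V) {θ : ℝ} (hθ : 0 ≤ θ)
    (hL : θ * L ≤ 1) (b : Fin m) :
    ((1 + θ ^ 2 * V) • (1 : Matrix n n ℝ) -
      Matrix.of fun i j => ∫ ω, exp (θ • X b ω) i j ∂(Measure.pi ν)).PosSemidef := by
  have hint : ∀ i j, Integrable (fun ω => exp (θ • X b ω) i j) (Measure.pi ν) := fun i j => by
    simpa using h.integrable_exp θ {b} i j
  have hXint : ∀ i j, Integrable (fun ω => X b ω i j) (Measure.pi ν) := fun i j => by
    refine Integrable.of_bound (h.meas b i j).aestronglyMeasurable L ?_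
    filter_upwards [h.bdd b] with ω hω using (abs_entry_le_norm _ i j).trans hω
  have hX2int : ∀ i j, Integrable (fun ω => (X b ω * X b ω) i j) (Measure.pi ν) := fun i j => by
    refine Integrable.of_bound ?_ (L * L) ?_
    · simp only [Matrix.mul_apply]
      exact (Finset.measurable_fun_sum _ fun c _ =>
        (h.meas b i c).mul (h.meas b c j)).aestronglyMeasurable
    · filter_upwards [h.bdd b] with ω hω
      refine (abs_entry_le_norm _ i j).trans ((norm_mul_le _ _).trans ?_)
      gcongr
      exact (norm_nonneg _).trans hω
  have hsym : (Matrix.of fun i j => ∫ ω, exp (θ • X b ω) i j ∂(Measure.pi ν)).IsHermitian := by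
    ext i j
    simp only [Matrix.conjTranspose_apply, Matrix.of_apply, star_trivial]
    refine integral_congr_ae (Filter.Eventually.of_forall fun ω => ?_)
    have : (exp (θ • X b ω)).IsSymm := Matrix.IsSymm.exp (by
      rw [Matrix.IsSymm, Matrix.transpose_smul, (h.symm b ω).eq])
    exact this.apply i j
  refine Matrix.PosSemidef.of_dotProduct_mulVec_nonneg ?_ fun x => ?_
  · refine Matrix.IsHermitian.sub ?_ hsym
    ext i j; simp [Matrix.one_apply, eq_comm]
  · rw [star_trivial, Matrix.sub_mulVec, dotProduct_sub, Matrix.smul_mulVec, Matrix.one_mulVec,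
      dotProduct_smul, ← integral_dotProduct_mulVec _ hint, smul_eq_mul]
    have key : ∫ ω, x ⬝ᵥ (exp (θ • X b ω) *ᵥ x) ∂(Measure.pi ν) ≤
        ∫ ω, (x ⬝ᵥ x + θ * (x ⬝ᵥ (X b ω *ᵥ x)) + θ ^ 2 * (x ⬝ᵥ ((X b ω * X b ω) *ᵥ x)))
          ∂(Measure.pi ν) := by
      refine integral_mono_ae (integrable_dotProduct_mulVec _ hint x)
        (((integrable_const _).add ((integrable_dotProduct_mulVec _ hXint x).const_mul _)).add
          ((integrable_dotProduct_mulVec _ hX2int x).const_mul _)) ?_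
      filter_upwards [h.bdd b] with ω hω
      have hherm : (θ • X b ω).IsHermitian := by
        rw [Matrix.IsHermitian, Matrix.conjTranspose_eq_transpose_of_trivial,
          Matrix.transpose_smul, (h.symm b ω).eq]
      have hps := exp_le_one_add_sq hherm fun y => by
        have h1 := abs_real_inner_le_norm (WithLp.toLp 2 y)
          (WithLp.toLp 2 ((θ • X b ω) *ᵥ y))
        have h2 := Matrix.l2_opNorm_mulVec (θ • X b ω) (WithLp.toLp 2 y)
        have h3 : ‖θ • X b ω‖ ≤ 1 := by
          rw [norm_smul, Real.norm_eq_abs, abs_of_nonneg hθ]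
          exact (mul_le_mul_of_nonneg_left hω hθ).trans hL
        have h4 : inner ℝ (WithLp.toLp 2 y) (WithLp.toLp 2 ((θ • X b ω) *ᵥ y))
            = y ⬝ᵥ ((θ • X b ω) *ᵥ y) := by
          simp [EuclideanSpace.inner_eq_star_dotProduct, dotProduct_comm]
        have h5 : y ⬝ᵥ y = ‖WithLp.toLp 2 y‖ ^ 2 := by
          rw [EuclideanSpace.real_norm_sq_eq]; simp [dotProduct, sq]
        rw [← h4, h5]
        refine h1.trans ?_
        have h6 : ‖WithLp.toLp 2 ((θ • X b ω) *ᵥ y)‖ ≤ 1 * ‖WithLp.toLp 2 y‖ :=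
          h2.trans (by gcongr)
        nlinarith [norm_nonneg (WithLp.toLp 2 y)]
      have := hps.dotProduct_mulVec_nonneg x
      simp only [Matrix.sub_mulVec, Matrix.add_mulVec, Matrix.one_mulVec, star_trivial,
        dotProduct_sub, dotProduct_add, Matrix.smul_mulVec, dotProduct_smul, smul_eq_mul,
        Matrix.smul_mul, Matrix.mul_smul] at this
      nlinarith
    have h0 : ∫ ω, x ⬝ᵥ (X b ω *ᵥ x) ∂(Measure.pi ν) = 0 := by
      rw [integral_dotProduct_mulVec _ hXint]
      simp [h.mean b, Matrix.mulVec, dotProduct]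
    have hv : ∫ ω, x ⬝ᵥ ((X b ω * X b ω) *ᵥ x) ∂(Measure.pi ν) ≤ V * (x ⬝ᵥ x) := by
      refine le_trans (le_of_eq ?_) (h.var b x)
      refine integral_congr_ae (Filter.Eventually.of_forall fun ω => ?_)
      simp only
      rw [← Matrix.mulVec_mulVec, Matrix.dotProduct_mulVec, ← Matrix.mulVec_transpose,
        (h.symm b ω).eq]
    have hI1 : Integrable (fun ω => θ * (x ⬝ᵥ (X b ω *ᵥ x))) (Measure.pi ν) :=
      (integrable_dotProduct_mulVec _ hXint x).const_mul _
    have hI2 : Integrable (fun ω => x ⬝ᵥ x + θ * (x ⬝ᵥ (X b ω *ᵥ x))) (Measure.pi ν) :=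
      (integrable_const _).add hI1
    rw [integral_add hI2 ((integrable_dotProduct_mulVec _ hX2int x).const_mul _),
      integral_add (integrable_const _) hI1, integral_const_mul, integral_const_mul, h0] at key
    simp at key
    nlinarith [sq_nonneg θ]

/-- Summands are split off one at a time. Golden–Thompson separates the exponential of the new
summand from that of the others; independence turns the expected trace of the product into the trace
of the product of the expectations; the second factor is at most (1 + θ²V) times the identity, and
the first is positive semidefinite, so the trace grows by at most this factor. -/
theorem BernsteinFamily.trace_mgf_le (h : BernsteinFamily ν X J L V) {θ : ℝ} (hθ : 0 ≤ θ)
    (hL : θ * L ≤ 1) (hV : 0 ≤ V) (s : Finset (Fin m)) :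
    ∫ ω, (exp (θ • ∑ b ∈ s, X b ω)).trace ∂(Measure.pi ν) ≤
      (1 + θ ^ 2 * V) ^ s.card * Fintype.card n := by
  classical
  induction s using Finset.induction_on with
  | empty => simp [exp_zero]
  | insert a s ha ih =>
    set F : (ι → S) → Matrix n n ℝ := fun ω => exp (θ • ∑ b ∈ s, X b ω) with hF
    set G : (ι → S) → Matrix n n ℝ := fun ω => exp (θ • X a ω) with hG
    have hFi := h.integrable_exp θ s
    have hGi : ∀ i j, Integrable (fun ω => G ω i j) (Measure.pi ν) := fun i j => by
      simpa using h.integrable_exp θ {a} i j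
    have hsymS : ∀ ω, (θ • ∑ b ∈ s, X b ω).IsSymm := fun ω => by
      rw [Matrix.IsSymm, Matrix.transpose_smul, Matrix.transpose_sum]
      simp only [(h.symm _ ω).eq]
    have hind : ∀ i j, IndepFun (fun ω => F ω i j) (fun ω => G ω j i) (Measure.pi ν) := by
      intro i j
      refine indepFun_of_dependsOn ν (J := ⋃ b ∈ s, J b) (J' := J a) ?_ ?_ ?_ ?_ ?_
      · exact measurable_exp_entry (fun i j => by
          simp only [Matrix.smul_apply, Matrix.sum_apply]
          exact (Finset.measurable_fun_sum s fun b _ => h.meas b i j).const_smul θ) i j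
      · exact measurable_exp_entry (fun i j => by
          simp only [Matrix.smul_apply]
          exact (h.meas a i j).const_smul θ) j i
      · rw [Set.disjoint_iUnion₂_left]
        intro b hb
        exact h.disj (by rintro rfl; exact ha hb)
      · intro x y hxy
        have : ∑ b ∈ s, X b x = ∑ b ∈ s, X b y := Finset.sum_congr rfl fun b hb =>
          h.dep b fun i hi => hxy i (Set.mem_biUnion hb hi)
        simp only [hF, this]
      · intro x y hxy
        simp only [hG]
        rw [h.dep a hxy]
    have hFGi : ∀ i j, Integrable (fun ω => F ω i j * G ω j i) (Measure.pi ν) := fun i j =>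
      (hind i j).integrable_mul (hFi i j) (hGi j i)
    set MF : Matrix n n ℝ := Matrix.of fun i j => ∫ ω, F ω i j ∂(Measure.pi ν) with hMF
    set MG : Matrix n n ℝ := Matrix.of fun i j => ∫ ω, G ω i j ∂(Measure.pi ν) with hMG
    have h1 : ∫ ω, (exp (θ • ∑ b ∈ insert a s, X b ω)).trace ∂(Measure.pi ν) ≤ (MF * MG).trace := by
      have : (MF * MG).trace = ∫ ω, (F ω * G ω).trace ∂(Measure.pi ν) := by
        simp only [Matrix.trace, Matrix.mul_apply, Matrix.diag]
        rw [integral_finsetSum _ fun i _ => integrable_finsetSum _ fun j _ => hFGi i j]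
        refine Finset.sum_congr rfl fun i _ => ?_
        rw [integral_finsetSum _ fun j _ => hFGi i j]
        refine Finset.sum_congr rfl fun j _ => ?_
        exact ((hind i j).integral_fun_mul_eq_mul_integral (hFi i j).aestronglyMeasurable
          (hGi j i).aestronglyMeasurable).symm
      rw [this]
      refine integral_mono_ae ?_ ?_ (Filter.Eventually.of_forall fun ω => ?_)
      · exact integrable_finsetSum _ fun i _ => h.integrable_exp θ (insert a s) i i
      · simp only [Matrix.trace, Matrix.mul_apply, Matrix.diag]
        exact integrable_finsetSum _ fun i _ => integrable_finsetSum _ fun j _ => hFGi i j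
      · simp only [Finset.sum_insert ha, smul_add]
        rw [add_comm]
        refine golden_thompson _ _ (hsymS ω) ?_
        rw [Matrix.IsSymm, Matrix.transpose_smul, (h.symm a ω).eq]
    have hMFps : MF.PosSemidef := by
      refine Matrix.PosSemidef.of_dotProduct_mulVec_nonneg ?_ fun x => ?_
      · ext i j
        simp only [hMF, Matrix.conjTranspose_apply, Matrix.of_apply, star_trivial]
        refine integral_congr_ae (Filter.Eventually.of_forall fun ω => ?_)
        exact (Matrix.IsSymm.exp (hsymS ω)).apply i j
      · rw [star_trivial, hMF, ← integral_dotProduct_mulVec _ hFi]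
        refine integral_nonneg fun ω => ?_
        have hps := exp_posSemidef (A := θ • ∑ b ∈ s, X b ω) (by
          rw [Matrix.IsHermitian, Matrix.conjTranspose_eq_transpose_of_trivial]; exact hsymS ω)
        simpa using hps.dotProduct_mulVec_nonneg x
    have hMFt : MF.trace = ∫ ω, (F ω).trace ∂(Measure.pi ν) := by
      simp only [Matrix.trace, Matrix.diag]
      rw [integral_finsetSum _ fun i _ => hFi i i]
      rfl
    refine h1.trans ((trace_mul_le_of_posSemidef hMFps (h.mgf_le hθ hL a)).trans ?_)
    rw [hMFt, Finset.card_insert_of_notMem ha, pow_succ' (1 + θ ^ 2 * V),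
      mul_assoc]
    exact mul_le_mul_of_nonneg_left ih (by positivity)

/-- The Ahlswede–Winter form of the matrix Bernstein inequality. -/
theorem BernsteinFamily.tail (h : BernsteinFamily ν X J L V) {θ : ℝ} (hθ : 0 ≤ θ)
    (hL : θ * L ≤ 1) (hV : 0 ≤ V) (t : ℝ) :
    Measure.pi ν {ω | ∃ x : n → ℝ, 0 < x ⬝ᵥ x ∧
      t * (x ⬝ᵥ x) ≤ x ⬝ᵥ ((∑ b, X b ω) *ᵥ x)} ≤
    ENNReal.ofReal (Fintype.card n * Real.exp (m * (θ ^ 2 * V) - θ * t)) := by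
  have hherm : ∀ ω, (θ • ∑ b, X b ω).IsHermitian := fun ω => by
    rw [Matrix.IsHermitian, Matrix.conjTranspose_eq_transpose_of_trivial, Matrix.transpose_smul,
      Matrix.transpose_sum]
    simp only [(h.symm _ ω).eq]
  set F : (ι → S) → ℝ := fun ω => (exp (θ • ∑ b, X b ω)).trace with hF
  have hFi : Integrable F (Measure.pi ν) :=
    integrable_finsetSum _ fun i _ => h.integrable_exp θ Finset.univ i i
  have hF0 : ∀ ω, 0 ≤ F ω := fun ω => (exp_posSemidef (hherm ω)).trace_nonneg
  -- A direction with large quadratic form forces the trace of the exponential above exp(θt), so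
  -- that Markov's inequality applies to this trace.
  have hsub : {ω | ∃ x : n → ℝ, 0 < x ⬝ᵥ x ∧ t * (x ⬝ᵥ x) ≤ x ⬝ᵥ ((∑ b, X b ω) *ᵥ x)} ⊆
      {ω | Real.exp (θ * t) ≤ F ω} := by
    rintro ω ⟨x, hx, hxt⟩
    refine exp_le_trace_exp (hherm ω) hx ?_
    rw [Matrix.smul_mulVec, dotProduct_smul, smul_eq_mul, mul_assoc]
    exact mul_le_mul_of_nonneg_left hxt hθ
  have hmk := mul_meas_ge_le_integral_of_nonneg (Filter.Eventually.of_forall hF0) hFi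
    (Real.exp (θ * t))
  have htr := h.trace_mgf_le hθ hL hV Finset.univ
  have hpow : (1 + θ ^ 2 * V) ^ m ≤ Real.exp (m * (θ ^ 2 * V)) := by
    rw [Real.exp_nat_mul]
    gcongr
    linarith [Real.add_one_le_exp (θ ^ 2 * V)]
  rw [Finset.card_univ, Fintype.card_fin] at htr
  have hreal : (Measure.pi ν).real {ω | Real.exp (θ * t) ≤ F ω} ≤
      Fintype.card n * Real.exp (m * (θ ^ 2 * V) - θ * t) := by
    rw [Real.exp_sub, mul_div_assoc', le_div_iff₀ (Real.exp_pos _), mul_comm]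
    refine hmk.trans (htr.trans ?_)
    rw [mul_comm]
    gcongr
  refine (measure_mono hsub).trans ?_
  rw [← ENNReal.ofReal_toReal (measure_ne_top (Measure.pi ν) _)]
  exact ENNReal.ofReal_le_ofReal hreal

end MatrixBernstein

/- ## Medians -/

/-- In a sorted list the entries up to `c` form an initial segment, so position `k` lies in it
exactly when it is longer than `k`. -/
theorem getElem_le_iff_lt_countP {l : List ℝ} (hl : l.Pairwise (· ≤ ·)) (c : ℝ) {k : ℕ}
    (hk : k < l.length) : l[k] ≤ c ↔ k < l.countP (fun x => decide (x ≤ c)) := by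
  induction l generalizing k with
  | nil => simp at hk
  | cons a t ih =>
    rw [List.pairwise_cons] at hl
    by_cases hac : a ≤ c
    · rw [List.countP_cons_of_pos (by simpa using hac)]
      cases k with
      | zero => simpa using hac
      | succ k =>
        have hk' : k < t.length := by simpa using hk
        rw [List.getElem_cons_succ, ih hl.2 hk']
        omega
    · have h0 : (a :: t).countP (fun x => decide (x ≤ c)) = 0 := by
        rw [List.countP_eq_zero]
        intro x hx
        rcases List.mem_cons.1 hx with rfl | hx
        · simpa using hac
        · have := hl.1 x hx
          simp only [decide_eq_true_eq, not_le] at hac ⊢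
          linarith
      rw [h0]
      simp only [Nat.not_lt_zero, iff_false]
      cases k with
      | zero => simpa using hac
      | succ k =>
        have hk' : k < t.length := by simpa using hk
        have := hl.1 _ (List.getElem_mem hk')
        rw [List.getElem_cons_succ]
        linarith [not_le.1 hac]

/-- Reduces every statement about medians, measurability included, to counting entries. The median
is the entry at position ⌊n/2⌋ counted from zero, whence the strict inequality. -/
theorem median_le_iff {n : ℕ} (hn : 0 < n) (x : Fin n → ℝ) (c : ℝ) :
    median x ≤ c ↔ n / 2 < (Finset.univ.filter fun i => x i ≤ c).card := by
  set l := (List.ofFn x).insertionSort (· ≤ ·) with hl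
  have hlen : l.length = n := by simp [hl]
  have hk : n / 2 < l.length := by rw [hlen]; omega
  have hmed : median x = l[n / 2] := by
    rw [median, ← hl, List.getD_eq_getElem _ _ hk]
  rw [hmed, getElem_le_iff_lt_countP (List.pairwise_insertionSort _ _)]
  have : l.countP (fun y => decide (y ≤ c)) = (Finset.univ.filter fun i => x i ≤ c).card := by
    rw [(List.perm_insertionSort (· ≤ ·) (List.ofFn x)).countP_eq, List.ofFn_eq_map,
      List.countP_map, List.countP_eq_length_filter]
    rfl
  rw [this]

theorem median_le_of_card {n : ℕ} (x : Fin n → ℝ) {c : ℝ}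
    (h : 2 * (Finset.univ.filter fun i => c < x i).card < n) : median x ≤ c := by
  rw [median_le_iff (by omega)]
  have := Finset.card_filter_add_card_filter_not (s := Finset.univ) (fun i => x i ≤ c)
  simp only [not_le, Finset.card_univ, Fintype.card_fin] at this
  omega

theorem le_median_of_card {n : ℕ} (x : Fin n → ℝ) {c : ℝ}
    (h : 2 * (Finset.univ.filter fun i => x i < c).card < n) : c ≤ median x := by
  by_contra! hlt
  have h1 := (median_le_iff (by omega) x (median x)).1 le_rfl
  have h2 : (Finset.univ.filter fun i => x i ≤ median x).card ≤
      (Finset.univ.filter fun i => x i < c).card :=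
    Finset.card_le_card fun i hi => by
      simp only [Finset.mem_filter, Finset.mem_univ, true_and] at hi ⊢
      exact hi.trans_lt hlt
  omega

theorem measurable_median {Ω : Type*} [MeasurableSpace Ω] {n : ℕ} {x : Ω → Fin n → ℝ}
    (hx : ∀ i, Measurable fun ω => x ω i) : Measurable fun ω => median (x ω) := by
  rcases Nat.eq_zero_or_pos n with rfl | hn
  · simp [median]
  refine measurable_of_Iic fun c => ?_
  have : (fun ω => median (x ω)) ⁻¹' Set.Iic c =
      {ω | n / 2 < ∑ i, if x ω i ≤ c then 1 else 0} := by
    ext ω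
    rw [Set.mem_preimage, Set.mem_Iic, median_le_iff hn, Finset.card_filter]
    rfl
  rw [this]
  refine measurableSet_lt measurable_const (Finset.measurable_fun_sum _ fun i _ => ?_)
  exact Measurable.ite (measurableSet_le (hx i) measurable_const) measurable_const measurable_const

/- ## Singular vectors -/

/-- An orthonormal basis of `W` that consists of eigenvectors of `T`. -/
structure Eigenframe {d : ℕ} (T : Vec d →ₗ[ℝ] Vec d) (W : Submodule ℝ (Vec d)) (m : ℕ) where
  vec : Fin m → Vec d
  val : Fin m → ℝ
  orthonormal : Orthonormal ℝ vec
  mem : ∀ i, vec i ∈ W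
  apply : ∀ i, T (vec i) = val i • vec i
  repr : ∀ u ∈ W, ∑ i, inner ℝ (vec i) u • vec i = u

theorem exists_eigenframe {d : ℕ} {T : Vec d →ₗ[ℝ] Vec d} (hT : T.IsSymmetric)
    {W : Submodule ℝ (Vec d)} (hW : ∀ v ∈ W, T v ∈ W) :
    Nonempty (Eigenframe T W (Module.finrank ℝ W)) := by
  have hs := hT.restrict_invariant hW
  let b := hs.eigenvectorBasis rfl
  refine ⟨⟨fun i => (b i : Vec d), hs.eigenvalues rfl, ?_, fun i => (b i).2, fun i => ?_,
    fun u hu => ?_⟩⟩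
  · exact b.orthonormal.comp_linearIsometry W.subtypeₗᵢ
  · have := congrArg (Subtype.val) (hs.apply_eigenvectorBasis rfl i)
    exact this
  · have := congrArg (Subtype.val) (b.sum_repr' ⟨u, hu⟩)
    simpa using this

theorem Eigenframe.inner_apply {d m : ℕ} {T : Vec d →ₗ[ℝ] Vec d} {W : Submodule ℝ (Vec d)}
    (e : Eigenframe T W m) (hT : T.IsSymmetric) (i : Fin m) (u : Vec d) :
    inner ℝ (e.vec i) (T u) = e.val i * inner ℝ (e.vec i) u := by
  rw [← hT, e.apply, inner_smul_left]; simp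

theorem Eigenframe.norm_sq {d m : ℕ} {T : Vec d →ₗ[ℝ] Vec d} {W : Submodule ℝ (Vec d)}
    (e : Eigenframe T W m) {u : Vec d} (hu : u ∈ W) :
    ‖u‖ ^ 2 = ∑ i, inner ℝ (e.vec i) u ^ 2 := by
  have h := e.repr u hu
  rw [← real_inner_self_eq_norm_sq]
  conv_lhs => rw [← h]
  rw [e.orthonormal.inner_sum]
  simp [sq]

theorem Eigenframe.inner_eq {d m : ℕ} {T : Vec d →ₗ[ℝ] Vec d} {W : Submodule ℝ (Vec d)}
    (e : Eigenframe T W m) (x : Vec d) {w : Vec d} (hw : w ∈ W) :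
    inner ℝ x w = ∑ i, inner ℝ (e.vec i) x * inner ℝ (e.vec i) w := by
  conv_lhs => rw [← e.repr w hw]
  rw [inner_sum]
  refine Finset.sum_congr rfl fun i _ => ?_
  rw [inner_smul_right, real_inner_comm (e.vec i) x, mul_comm]

/-! ### Singular vectors as successive maximizers -/

section Gram

variable {d : ℕ} (A : Matrix (Fin d) (Fin d) ℝ)

/-- The operator `AᵀA`. -/
abbrev gram : Vec d →ₗ[ℝ] Vec d := Matrix.toEuclideanLin (A.transpose * A)

theorem gram_symmetric : (gram A).IsSymmetric := by
  rw [Matrix.isSymmetric_toEuclideanLin_iff, Matrix.IsHermitian,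
    Matrix.conjTranspose_eq_transpose_of_trivial, Matrix.transpose_mul, Matrix.transpose_transpose]

theorem inner_gram (u v : Vec d) : inner ℝ u (gram A v) =
    inner ℝ (Matrix.toEuclideanLin A u) (Matrix.toEuclideanLin A v) := by
  simp only [gram, Matrix.toLpLin_apply, EuclideanSpace.inner_eq_star_dotProduct, star_trivial]
  rw [← Matrix.mulVec_mulVec, ← Matrix.vecMul_transpose, Matrix.transpose_transpose,
    ← Matrix.dotProduct_mulVec]

variable {A}

theorem Eigenframe.val_nonneg {m : ℕ} {W : Submodule ℝ (Vec d)} (e : Eigenframe (gram A) W m)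
    (i : Fin m) : 0 ≤ e.val i := by
  have h1 := inner_gram A (e.vec i) (e.vec i)
  rw [e.inner_apply (gram_symmetric A), real_inner_self_eq_norm_sq, real_inner_self_eq_norm_sq,
    e.orthonormal.1 i] at h1
  nlinarith [sq_nonneg ‖Matrix.toEuclideanLin A (e.vec i)‖]

/-- The supremum in `topEigenvalue` is attained: an eigenvector in `W` for an eigenvalue above all
those of the frame would be orthogonal to the whole frame and hence zero. The index `i₀` guarantees
that `W` is nontrivial. -/
theorem Eigenframe.isGreatest {m : ℕ} {W : Submodule ℝ (Vec d)} (e : Eigenframe (gram A) W m)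
    {i₀ : Fin m} (h0 : ∀ i, e.val i ≤ e.val i₀) : topEigenvalue A W = e.val i₀ := by
  refine IsGreatest.csSup_eq ⟨?_, ?_⟩
  · intro hbot
    have hmem : e.vec i₀ ∈ W ⊓ Module.End.eigenspace (gram A) (e.val i₀) :=
      ⟨e.mem i₀, Module.End.mem_eigenspace_iff.2 (e.apply i₀)⟩
    rw [hbot, Submodule.mem_bot] at hmem
    have := e.orthonormal.1 i₀
    rw [hmem] at this
    simp at this
  · intro l hl
    obtain ⟨u, hu, hu0⟩ := Submodule.exists_mem_ne_zero_of_ne_bot hl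
    have hT : gram A u = l • u := Module.End.mem_eigenspace_iff.1 hu.2
    by_contra! hlt
    apply hu0
    rw [← e.repr u hu.1]
    refine Finset.sum_eq_zero fun i _ => ?_
    have h1 := e.inner_apply (gram_symmetric A) i u
    rw [hT, inner_smul_right] at h1
    have h2 : (l - e.val i) * inner ℝ (e.vec i) u = 0 := by linarith
    rcases mul_eq_zero.1 h2 with h | h
    · linarith [h0 i]
    · rw [h, zero_smul]

theorem Eigenframe.inner_eq_zero_of_mem_topEigenspace {m : ℕ} {W : Submodule ℝ (Vec d)}
    (e : Eigenframe (gram A) W m) {u : Vec d} (hu : u ∈ topEigenspace A W) {i : Fin m}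
    (hi : e.val i ≠ topEigenvalue A W) : inner ℝ (e.vec i) u = 0 := by
  have hT : gram A u = topEigenvalue A W • u := Module.End.mem_eigenspace_iff.1 hu.2
  have h1 := e.inner_apply (gram_symmetric A) i u
  rw [hT, inner_smul_right] at h1
  have h2 : (topEigenvalue A W - e.val i) * inner ℝ (e.vec i) u = 0 := by linarith
  rcases mul_eq_zero.1 h2 with h | h
  · exact absurd (by linarith) hi
  · exact h

open scoped Classical in
theorem Eigenframe.starProjection_topEigenspace {m : ℕ} {W : Submodule ℝ (Vec d)}
    (e : Eigenframe (gram A) W m) (x : Vec d) :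
    (topEigenspace A W).starProjection x =
      ∑ i, if e.val i = topEigenvalue A W then inner ℝ (e.vec i) x • e.vec i else 0 := by
  refine Submodule.eq_starProjection_of_mem_of_inner_eq_zero ?_ fun w hw => ?_
  · refine Submodule.sum_mem _ fun i _ => ?_
    split_ifs with h
    · exact Submodule.smul_mem _ _ ⟨e.mem i, Module.End.mem_eigenspace_iff.2 (h ▸ e.apply i)⟩
    · exact Submodule.zero_mem _
  · rw [inner_sub_left, sum_inner, e.inner_eq x hw.1, ← Finset.sum_sub_distrib]
    refine Finset.sum_eq_zero fun i _ => ?_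
    split_ifs with h
    · rw [real_inner_smul_left, sub_self]
    · rw [e.inner_eq_zero_of_mem_topEigenspace hw h]; simp

theorem Eigenframe.starProjection {m : ℕ} {T : Vec d →ₗ[ℝ] Vec d} {W : Submodule ℝ (Vec d)}
    (e : Eigenframe T W m) (x : Vec d) :
    W.starProjection x = ∑ i, inner ℝ (e.vec i) x • e.vec i := by
  refine Submodule.eq_starProjection_of_mem_of_inner_eq_zero ?_ fun w hw => ?_
  · exact Submodule.sum_mem _ fun i _ => Submodule.smul_mem _ _ (e.mem i)
  · rw [inner_sub_left, sum_inner, e.inner_eq x hw, ← Finset.sum_sub_distrib]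
    refine Finset.sum_eq_zero fun i _ => ?_
    rw [real_inner_smul_left, sub_self]

/-- The singular vectors are chosen from the top eigenspace. -/
theorem topUnitVec_mem (W : Submodule ℝ (Vec d)) : topUnitVec A W ∈ topEigenspace A W := by
  classical
  rw [topUnitVec]
  refine Submodule.smul_mem _ _ ?_
  set L := ((List.finRange d).map fun a =>
    (topEigenspace A W).starProjection (EuclideanSpace.single a (1 : ℝ)))
  rcases h : L.find? (fun v => decide (v ≠ 0)) with _ | v
  · simp
  · have := List.mem_of_find?_eq_some h
    obtain ⟨a, -, rfl⟩ := List.mem_map.1 this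
    exact Submodule.starProjection_apply_mem _ _

theorem norm_topUnitVec (W : Submodule ℝ (Vec d)) :
    topUnitVec A W = 0 ∨ ‖topUnitVec A W‖ = 1 := by
  rw [topUnitVec]
  set v := (((List.finRange d).map fun a =>
    (topEigenspace A W).starProjection (EuclideanSpace.single a (1 : ℝ))).find?
      fun v => decide (v ≠ 0)).getD 0
  by_cases hv : v = 0
  · simp [hv]
  · right
    rw [norm_smul, norm_inv, norm_norm, inv_mul_cancel₀ (norm_ne_zero_iff.2 hv)]

/-- The standard basis spans the space, so it cannot project to zero in a nontrivial subspace, and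
the search in `topUnitVec` succeeds. -/
theorem norm_topUnitVec_of_ne_bot {W : Submodule ℝ (Vec d)} (hW : topEigenspace A W ≠ ⊥) :
    ‖topUnitVec A W‖ = 1 := by
  classical
  rcases norm_topUnitVec (A := A) W with h | h
  swap
  · exact h
  exfalso
  rw [topUnitVec] at h
  set L := ((List.finRange d).map fun a =>
    (topEigenspace A W).starProjection (EuclideanSpace.single a (1 : ℝ))) with hL
  have hzero : ∀ v ∈ L, v = 0 := by
    rcases hf : L.find? (fun v => decide (v ≠ 0)) with _ | v
    · intro v hv
      have := List.find?_eq_none.1 hf v hv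
      simpa using this
    · have hv := List.find?_some hf
      simp only [decide_eq_true_eq] at hv
      simp only [hf, Option.getD_some, smul_eq_zero, inv_eq_zero, norm_eq_zero, or_self] at h
      exact absurd h hv
  apply hW
  rw [Submodule.eq_bot_iff]
  intro x hx
  rw [← Submodule.starProjection_eq_self_iff.2 hx]
  have hx2 : x = ∑ a, x a • EuclideanSpace.single a (1 : ℝ) := by
    ext b; simp [Finset.sum_apply, Pi.single_apply]
  rw [hx2, map_sum]
  refine Finset.sum_eq_zero fun a _ => ?_
  rw [map_smul, hzero _ (List.mem_map.2 ⟨a, List.mem_finRange a, rfl⟩), smul_zero]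

theorem topEigenspace_le (W : Submodule ℝ (Vec d)) : topEigenspace A W ≤ W := inf_le_left

/-- A symmetric operator preserves the complement of its eigenvectors. Invariance is what provides
an eigenframe at every stage of the construction. -/
theorem singComplement_invariant (j : ℕ) :
    ∀ v ∈ singComplement A j, gram A v ∈ singComplement A j := by
  induction j with
  | zero => intro v _; trivial
  | succ j ih =>
    rintro v ⟨hv1, hv2⟩
    refine ⟨ih v hv1, ?_⟩
    rw [SetLike.mem_coe, Submodule.mem_orthogonal_singleton_iff_inner_right] at hv2 ⊢
    have hq := Module.End.mem_eigenspace_iff.1 (topUnitVec_mem (A := A) (singComplement A j)).2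
    rw [← gram_symmetric A, gram, hq, real_inner_smul_left, hv2, mul_zero]

theorem exists_singFrame (j : ℕ) : Nonempty (Eigenframe (gram A) (singComplement A j)
    (Module.finrank ℝ (singComplement A j))) :=
  exists_eigenframe (gram_symmetric A) (singComplement_invariant j)

theorem singComplement_antitone : Antitone (singComplement A) :=
  antitone_nat_of_succ_le fun _ => inf_le_left

theorem topEigenspace_ne_bot {j : ℕ} (h : singComplement A j ≠ ⊥) :
    topEigenspace A (singComplement A j) ≠ ⊥ := by
  obtain ⟨e⟩ := exists_singFrame (A := A) j
  have hpos : 0 < Module.finrank ℝ (singComplement A j) := Submodule.one_le_finrank_iff.2 h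
  have : Nonempty (Fin (Module.finrank ℝ (singComplement A j))) := ⟨⟨0, hpos⟩⟩
  obtain ⟨i0, h0⟩ := Finite.exists_max e.val
  intro hbot
  have hmem : e.vec i0 ∈ topEigenspace A (singComplement A j) :=
    ⟨e.mem i0, Module.End.mem_eigenspace_iff.2 (by rw [e.isGreatest h0]; exact e.apply i0)⟩
  rw [hbot, Submodule.mem_bot] at hmem
  have := e.orthonormal.1 i0
  rw [hmem] at this
  simp at this

/-- Each step loses at most one dimension, so the first `d` singular vectors are genuine unit
vectors. -/
theorem le_finrank_singComplement (j : ℕ) : d ≤ Module.finrank ℝ (singComplement A j) + j := by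
  induction j with
  | zero => rw [show singComplement A 0 = ⊤ from rfl, finrank_top]; simp
  | succ j ih =>
    have h1 := Submodule.finrank_add_finrank_orthogonal (ℝ ∙ topUnitVec A (singComplement A j))
    have h2 : Module.finrank ℝ (ℝ ∙ topUnitVec A (singComplement A j)) ≤ 1 :=
      (finrank_span_le_card ({topUnitVec A (singComplement A j)} : Set (Vec d))).trans (by simp)
    have h3 := Submodule.finrank_sup_add_finrank_inf_eq (singComplement A j)
      (ℝ ∙ topUnitVec A (singComplement A j))ᗮ
    have h4 := Submodule.finrank_le (singComplement A j ⊔ (ℝ ∙ topUnitVec A (singComplement A j))ᗮ)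
    have h5 : Module.finrank ℝ (Vec d) = d := by simp
    change d ≤ Module.finrank ℝ (singComplement A j ⊓ (ℝ ∙ topUnitVec A (singComplement A j))ᗮ :
      Submodule ℝ (Vec d)) + (j + 1)
    omega

theorem norm_singVec {j : ℕ} (hj : j < d) : ‖singVec A j‖ = 1 := by
  refine norm_topUnitVec_of_ne_bot (topEigenspace_ne_bot ?_)
  rw [← Submodule.one_le_finrank_iff]
  have := le_finrank_singComplement (A := A) j
  omega

theorem singVec_mem (j : ℕ) : singVec A j ∈ singComplement A j :=
  topEigenspace_le _ (topUnitVec_mem _)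

theorem inner_singVec_of_mem {i j : ℕ} (hij : i < j) {u : Vec d} (hu : u ∈ singComplement A j) :
    inner ℝ (singVec A i) u = 0 := by
  have h1 : u ∈ singComplement A (i + 1) := singComplement_antitone hij hu
  exact Submodule.mem_orthogonal_singleton_iff_inner_right.1 h1.2

theorem mem_singComplement {j : ℕ} {u : Vec d} (hu : ∀ i < j, inner ℝ (singVec A i) u = 0) :
    u ∈ singComplement A j := by
  induction j with
  | zero => trivial
  | succ j ih =>
    exact ⟨ih fun i hi => hu i (by omega),
      Submodule.mem_orthogonal_singleton_iff_inner_right.2 (hu j (by omega))⟩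

theorem orthonormal_singVec {l : ℕ} (hl : l ≤ d) :
    Orthonormal ℝ fun j : Fin l => singVec A j := by
  refine ⟨fun j => norm_singVec (by omega), ?_⟩
  intro i j hij
  rcases lt_or_gt_of_ne (fun h => hij (Fin.ext h)) with h | h
  · exact inner_singVec_of_mem h (singVec_mem _)
  · change inner ℝ (singVec A i) (singVec A j) = 0
    rw [real_inner_comm]
    exact inner_singVec_of_mem h (singVec_mem _)

/-- The square of the `j`-th singular value. -/
def singValSq (A : Matrix (Fin d) (Fin d) ℝ) (j : ℕ) : ℝ := topEigenvalue A (singComplement A j)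

theorem gram_singVec (j : ℕ) : gram A (singVec A j) = singValSq A j • singVec A j :=
  Module.End.mem_eigenspace_iff.1 (topUnitVec_mem (A := A) (singComplement A j)).2

/-- The variational property of singular values: beyond the first `j` singular vectors, `A`
stretches by at most the next singular value. -/
theorem norm_sq_apply_le {j : ℕ} {u : Vec d} (hu : u ∈ singComplement A j) :
    ‖Matrix.toEuclideanLin A u‖ ^ 2 ≤ singValSq A j * ‖u‖ ^ 2 := by
  obtain ⟨e⟩ := exists_singFrame (A := A) j
  by_cases hbot : singComplement A j = ⊥
  · rw [hbot, Submodule.mem_bot] at hu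
    simp [hu]
  have hpos : 0 < Module.finrank ℝ (singComplement A j) := Submodule.one_le_finrank_iff.2 hbot
  have : Nonempty (Fin (Module.finrank ℝ (singComplement A j))) := ⟨⟨0, hpos⟩⟩
  obtain ⟨i0, h0⟩ := Finite.exists_max e.val
  rw [← real_inner_self_eq_norm_sq, ← inner_gram, singValSq, e.isGreatest h0, e.norm_sq hu,
    real_inner_comm, e.inner_eq _ hu, Finset.mul_sum]
  refine Finset.sum_le_sum fun i _ => ?_
  rw [e.inner_apply (gram_symmetric A)]
  nlinarith [h0 i, sq_nonneg (inner ℝ (e.vec i) u)]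

theorem norm_sq_apply_singVec {j : ℕ} (hj : j < d) :
    ‖Matrix.toEuclideanLin A (singVec A j)‖ ^ 2 = singValSq A j := by
  rw [← real_inner_self_eq_norm_sq, ← inner_gram, gram_singVec, inner_smul_right,
    real_inner_self_eq_norm_sq, norm_singVec hj]
  simp

theorem singValSq_le {i j : ℕ} (hij : i ≤ j) (hj : j < d) : singValSq A j ≤ singValSq A i := by
  have h := norm_sq_apply_le (A := A) (singComplement_antitone hij (singVec_mem (A := A) j))
  rw [norm_sq_apply_singVec hj, norm_singVec hj] at h
  simpa using h

/- ### Approximation by the top singular vectors -/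

section Approximation

variable {k : ℕ} {p : Fin k → ℝ} {G : Fin k → Vec d} {η : ℝ}

/-- `A` is within `η` of `∑ j, p j • G j (G j)ᵀ` in the spectral norm. -/
def IsNearMixture (A : Matrix (Fin d) (Fin d) ℝ) (p : Fin k → ℝ) (G : Fin k → Vec d) (η : ℝ) :
    Prop :=
  ∀ u v : Vec d, |inner ℝ u (Matrix.toEuclideanLin A v) -
    ∑ j, p j * (inner ℝ (G j) u * inner ℝ (G j) v)| ≤ η * (‖u‖ * ‖v‖)

theorem inner_apply_apply_singVec {i j : ℕ} (hi : i < d) (hj : j < d) (hij : i ≠ j) :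
    inner ℝ (Matrix.toEuclideanLin A (singVec A i)) (Matrix.toEuclideanLin A (singVec A j)) = 0 := by
  rw [← inner_gram, gram_singVec, inner_smul_right]
  have := (orthonormal_singVec (A := A) le_rfl).2 (i := ⟨i, hi⟩) (j := ⟨j, hj⟩)
    (fun h => hij (by simpa using h))
  simp only at this
  rw [this, mul_zero]

/-- With right singular vectors q and left ones r, the singular values are ⟨r, Aq⟩. Replacing `A` by
the mixture costs η for each, and by AM–GM and Bessel the sum of the mixture terms over an
orthonormal family is at most the trace. The smallest of the l + 1 singular values is at most their
average. -/
theorem singVal_le_of_trace (hp : ∀ j, 0 ≤ p j) (hA : IsNearMixture A p G η) {l : ℕ} (hl : l < d) :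
    (l + 1) * Real.sqrt (singValSq A l) ≤ ∑ j, p j * ‖G j‖ ^ 2 + (l + 1) * η := by
  set s : ℕ → ℝ := fun j => Real.sqrt (singValSq A j) with hs
  have hη : 0 ≤ η := by
    have h1 := (abs_nonneg _).trans (hA (singVec A l) (singVec A l))
    rw [norm_singVec hl] at h1
    linarith
  have htr : 0 ≤ ∑ j, p j * ‖G j‖ ^ 2 :=
    Finset.sum_nonneg fun j _ => mul_nonneg (hp j) (sq_nonneg _)
  -- The left singular vectors are defined through division by the singular values, so a vanishing
  -- one is treated apart.
  rcases (Real.sqrt_nonneg (singValSq A l)).eq_or_lt with h0 | hpos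
  · rw [← h0, mul_zero]; exact add_nonneg htr (by positivity)
  have hsge : ∀ j : Fin (l + 1), s l ≤ s j := fun j =>
    Real.sqrt_le_sqrt (singValSq_le (by omega) hl)
  have hspos : ∀ j : Fin (l + 1), 0 < s j := fun j => hpos.trans_le (hsge j)
  have hnorm : ∀ j : Fin (l + 1), ‖Matrix.toEuclideanLin A (singVec A j)‖ = s j := fun j => by
    change _ = Real.sqrt (singValSq A j)
    rw [← norm_sq_apply_singVec (A := A) (j := j) (by omega), Real.sqrt_sq (norm_nonneg _)]
  set q : Fin (l + 1) → Vec d := fun j => singVec A j with hq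
  set r : Fin (l + 1) → Vec d := fun j => (s j)⁻¹ • Matrix.toEuclideanLin A (singVec A j) with hr
  have hqo : Orthonormal ℝ q := orthonormal_singVec (by omega)
  have hro : Orthonormal ℝ r := by
    refine ⟨fun j => ?_, fun i j hij => ?_⟩
    · rw [hr]
      simp only
      rw [norm_smul, norm_inv, Real.norm_eq_abs, abs_of_pos (hspos j), hnorm,
        inv_mul_cancel₀ (hspos j).ne']
    · simp only [hr]
      rw [real_inner_smul_left, real_inner_smul_right,
        inner_apply_apply_singVec (by omega) (by omega) (fun h => hij (Fin.ext h))]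
      simp
  have hterm : ∀ j : Fin (l + 1), s l ≤
      ∑ i, p i * ((inner ℝ (G i) (r j) ^ 2 + inner ℝ (G i) (q j) ^ 2) / 2) + η := by
    intro j
    have h1 := hA (r j) (q j)
    have h2 : inner ℝ (r j) (Matrix.toEuclideanLin A (q j)) = s j := by
      simp only [hr, hq]
      rw [real_inner_smul_left, real_inner_self_eq_norm_sq, hnorm]
      have := (hspos j).ne'
      field_simp
    rw [h2, hro.1, hqo.1] at h1
    have h3 : ∑ i, p i * (inner ℝ (G i) (r j) * inner ℝ (G i) (q j)) ≤
        ∑ i, p i * ((inner ℝ (G i) (r j) ^ 2 + inner ℝ (G i) (q j) ^ 2) / 2) :=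
      Finset.sum_le_sum fun i _ => mul_le_mul_of_nonneg_left
        (by nlinarith [sq_nonneg (inner ℝ (G i) (r j) - inner ℝ (G i) (q j))]) (hp i)
    have h4 := (abs_le.1 h1).2
    linarith [hsge j]
  have hbessel : ∀ (b : Fin (l + 1) → Vec d), Orthonormal ℝ b → ∀ i,
      ∑ j, inner ℝ (G i) (b j) ^ 2 ≤ ‖G i‖ ^ 2 := by
    intro b hb i
    have := hb.sum_inner_products_le (x := G i) (s := Finset.univ)
    refine le_trans (le_of_eq (Finset.sum_congr rfl fun j _ => ?_)) this
    rw [Real.norm_eq_abs, sq_abs, real_inner_comm]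
  have hsum := Finset.sum_le_sum fun (j : Fin (l + 1)) (_ : j ∈ Finset.univ) => hterm j
  rw [Finset.sum_add_distrib, Finset.sum_comm] at hsum
  simp only [Finset.sum_const, Finset.card_univ, Fintype.card_fin, nsmul_eq_mul, Nat.cast_add,
    Nat.cast_one] at hsum
  refine hsum.trans ?_
  gcongr with i
  rw [← Finset.mul_sum]
  refine mul_le_mul_of_nonneg_left ?_ (hp i)
  rw [← Finset.sum_div, Finset.sum_add_distrib]
  linarith [hbessel r hro i, hbessel q hqo i]

/-- The l + 1 > k top singular vectors have a nonzero combination v orthogonal to all `G j`. The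
mixture vanishes on v, so ‖Av‖ ≤ η‖v‖, while v lies in the span of singular vectors with values at
least the l-th. -/
theorem singVal_le_of_rank (hη : 0 ≤ η) (hA : IsNearMixture A p G η) {l : ℕ} (hl : l < d)
    (hk : k ≤ l) : Real.sqrt (singValSq A l) ≤ η := by
  let φ : (Fin (l + 1) → ℝ) →ₗ[ℝ] (Fin k → ℝ) :=
    Matrix.toLin' (Matrix.of fun j i => inner ℝ (G j) (singVec A (i : Fin (l + 1))))
  obtain ⟨c, hc, hc0⟩ := Submodule.exists_mem_ne_zero_of_ne_bot
    (LinearMap.ker_ne_bot_of_finrank_lt (f := φ) (by simp; omega))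
  set v : Vec d := ∑ i : Fin (l + 1), c i • singVec A i with hv
  have hqo : Orthonormal ℝ fun j : Fin (l + 1) => singVec A j := orthonormal_singVec (by omega)
  have hGv : ∀ j, inner ℝ (G j) v = 0 := by
    intro j
    have h1 := congrFun (LinearMap.mem_ker.1 hc) j
    simp only [φ, Matrix.toLin'_apply, Matrix.mulVec, dotProduct, Matrix.of_apply,
      Pi.zero_apply] at h1
    rw [hv, inner_sum, ← h1]
    refine Finset.sum_congr rfl fun i _ => ?_
    rw [inner_smul_right, mul_comm]
  have hvn : ‖v‖ ^ 2 = ∑ i, c i ^ 2 := by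
    rw [← real_inner_self_eq_norm_sq, hv, hqo.inner_sum]
    simp [sq]
  have hvpos : 0 < ‖v‖ := by
    obtain ⟨i, hi⟩ := Function.ne_iff.1 hc0
    have : 0 < ∑ i, c i ^ 2 := Finset.sum_pos' (fun i _ => sq_nonneg _)
      ⟨i, Finset.mem_univ i, by have : c i ≠ 0 := hi; positivity⟩
    rw [← hvn] at this
    exact (norm_nonneg v).lt_of_ne' (sq_pos_iff.1 this)
  have hAv : singValSq A l * ‖v‖ ^ 2 ≤ ‖Matrix.toEuclideanLin A v‖ ^ 2 := by
    have h1 : gram A v = ∑ i : Fin (l + 1), (singValSq A i * c i) • singVec A i := by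
      rw [hv, map_sum]
      refine Finset.sum_congr rfl fun i _ => ?_
      rw [map_smul, gram_singVec, smul_smul, mul_comm]
    rw [← real_inner_self_eq_norm_sq (Matrix.toEuclideanLin A v), ← inner_gram, h1, hv,
      hqo.inner_sum, ← hv, hvn, Finset.mul_sum]
    refine Finset.sum_le_sum fun i _ => ?_
    have := singValSq_le (A := A) (i := i) (j := l) (by omega) hl
    simp only [conj_trivial]
    nlinarith [sq_nonneg (c i)]
  -- Testing against u = Av yields a bound for ‖Av‖ itself.
  have h2 := hA (Matrix.toEuclideanLin A v) v
  simp only [hGv, mul_zero, Finset.sum_const_zero, sub_zero, real_inner_self_eq_norm_sq] at h2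
  rw [abs_of_nonneg (sq_nonneg _)] at h2
  have h3 : ‖Matrix.toEuclideanLin A v‖ ≤ η * ‖v‖ := by
    rcases (norm_nonneg (Matrix.toEuclideanLin A v)).eq_or_lt with h0 | h0
    · rw [← h0]; positivity
    · nlinarith
  rw [Real.sqrt_le_left hη]
  have h4 : singValSq A l * ‖v‖ ^ 2 ≤ η ^ 2 * ‖v‖ ^ 2 := by
    rw [← mul_pow]
    exact hAv.trans (pow_le_pow_left₀ (norm_nonneg _) h3 2)
  exact le_of_mul_le_mul_right h4 (by positivity)

/-- Here `r` is the part of `G i` missed by the singular vectors. The form of `A` at `r` is at most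
the next singular value times ‖r‖², whereas the mixture contributes at least p_i ⟨G_i, r⟩² = p_i
‖r‖⁴, because ⟨G_i, r⟩ = ‖r‖². -/
theorem residual_le (hp : ∀ j, 0 ≤ p j) (hA : IsNearMixture A p G η) {l : ℕ} {i : Fin k}
    {r x : Vec d} (hr : r ∈ singComplement A l) (hx : inner ℝ x r = 0) (hG : G i = x + r) :
    p i * ‖r‖ ^ 2 ≤ Real.sqrt (singValSq A l) + η ∨ r = 0 := by
  by_cases hr0 : r = 0
  · exact Or.inr hr0
  left
  have hrpos : 0 < ‖r‖ := norm_pos_iff.2 hr0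
  have h1 := norm_sq_apply_le hr
  have hs0 : 0 ≤ singValSq A l := by
    by_contra! hneg
    nlinarith [sq_nonneg ‖Matrix.toEuclideanLin A r‖, pow_pos hrpos 2]
  have h2 : ‖Matrix.toEuclideanLin A r‖ ≤ Real.sqrt (singValSq A l) * ‖r‖ := by
    refine abs_le_of_sq_le_sq' ?_ (by positivity) |>.2
    rw [mul_pow, Real.sq_sqrt hs0]; exact h1
  have h3 := (abs_le.1 (hA r r)).1
  have h4 : inner ℝ r (Matrix.toEuclideanLin A r) ≤ ‖r‖ * (Real.sqrt (singValSq A l) * ‖r‖) :=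
    (real_inner_le_norm _ _).trans (by gcongr)
  have h5 : p i * (‖r‖ ^ 2 * ‖r‖ ^ 2) ≤ ∑ j, p j * (inner ℝ (G j) r * inner ℝ (G j) r) := by
    have h6 : inner ℝ (G i) r = ‖r‖ ^ 2 := by
      rw [hG, inner_add_left, hx, zero_add, real_inner_self_eq_norm_sq]
    rw [← h6]
    exact Finset.single_le_sum (f := fun j => p j * (inner ℝ (G j) r * inner ℝ (G j) r))
      (fun j _ => mul_nonneg (hp j) (mul_self_nonneg _)) (Finset.mem_univ i)
  refine le_of_mul_le_mul_right ?_ (pow_pos hrpos 2)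
  nlinarith

theorem eq_zero_of_mem_singComplement_self {r : Vec d} (hr : r ∈ singComplement A d) : r = 0 := by
  have ho := orthonormal_singVec (A := A) le_rfl
  have hspan := ho.linearIndependent.span_eq_top_of_card_eq_finrank' (by simp)
  have : r ∈ (Submodule.span ℝ (Set.range fun j : Fin d => singVec A j))ᗮ := by
    rw [Submodule.mem_orthogonal]
    intro u hu
    induction hu using Submodule.span_induction with
    | mem u hu => obtain ⟨j, rfl⟩ := hu; exact inner_singVec_of_mem j.2 hr
    | zero => simp
    | add u v _ _ hu hv => rw [inner_add_left, hu, hv, add_zero]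
    | smul a u _ hu => rw [real_inner_smul_left, hu, mul_zero]
  rw [hspan, Submodule.top_orthogonal_eq_bot, Submodule.mem_bot] at this
  exact this

end Approximation

end Gram

/- ## Measurability of the singular vectors -/

section Measurability

variable {Ω : Type*} [MeasurableSpace Ω] {d : ℕ}

theorem measurable_vec_iff {f : Ω → Vec d} : Measurable f ↔ ∀ a, Measurable fun ω => f ω a := by
  constructor
  · intro h a
    exact (EuclideanSpace.proj (𝕜 := ℝ) a).continuous.measurable.comp h
  · intro h
    have : Measurable fun ω => WithLp.toLp 2 (fun a => f ω a) :=
      (MeasurableEquiv.toLp 2 (Fin d → ℝ)).measurable.comp (measurable_pi_lambda _ h)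
    exact this

theorem measurable_toEuclideanLin {A : Ω → Matrix (Fin d) (Fin d) ℝ}
    (hA : ∀ a b, Measurable fun ω => A ω a b) {x : Ω → Vec d} (hx : Measurable x) :
    Measurable fun ω => Matrix.toEuclideanLin (A ω) (x ω) := by
  rw [measurable_vec_iff] at hx ⊢
  intro a
  simp only [Matrix.toLpLin_apply, Matrix.mulVec, dotProduct]
  exact Finset.measurable_fun_sum _ fun b _ => (hA a b).mul (hx b)

theorem measurable_matrix_mul {A B : Ω → Matrix (Fin d) (Fin d) ℝ}
    (hA : ∀ a b, Measurable fun ω => A ω a b) (hB : ∀ a b, Measurable fun ω => B ω a b)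
    (a b : Fin d) : Measurable fun ω => (A ω * B ω) a b := by
  simp only [Matrix.mul_apply]
  exact Finset.measurable_fun_sum _ fun c _ => (hA a c).mul (hB c b)

theorem measurable_matrix_pow {A : Ω → Matrix (Fin d) (Fin d) ℝ}
    (hA : ∀ a b, Measurable fun ω => A ω a b) (n : ℕ) (a b : Fin d) :
    Measurable fun ω => (A ω ^ n) a b := by
  induction n generalizing a b with
  | zero => simp
  | succ n ih =>
    simp only [pow_succ]
    exact measurable_matrix_mul ih hA a b

open scoped Matrix.Norms.L2Operator in
theorem measurable_matrix_norm {A : Ω → Matrix (Fin d) (Fin d) ℝ}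
    (hA : ∀ a b, Measurable fun ω => A ω a b) : Measurable fun ω => ‖A ω‖ := by
  have h1 : Measurable (fun ω => (fun a b => A ω a b : Fin d → Fin d → ℝ)) :=
    measurable_pi_lambda _ fun a => measurable_pi_lambda _ fun b => hA a b
  have h2 : Continuous fun A : Fin d → Fin d → ℝ => ‖Matrix.of A‖ :=
    continuous_norm.comp continuous_id
  exact h2.measurable.comp h1

/-- The matrix of `(1 + AᵀA) P`, where `P` is the orthogonal projection to `W`. -/
def compressedGram (A : Matrix (Fin d) (Fin d) ℝ) (W : Submodule ℝ (Vec d)) :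
    Matrix (Fin d) (Fin d) ℝ :=
  Matrix.of fun a b => (W.starProjection (EuclideanSpace.single b 1) +
    gram A (W.starProjection (EuclideanSpace.single b 1))) a

theorem compressedGram_apply (A : Matrix (Fin d) (Fin d) ℝ) (W : Submodule ℝ (Vec d)) (x : Vec d) :
    Matrix.toEuclideanLin (compressedGram A W) x = W.starProjection x +
      gram A (W.starProjection x) := by
  have hx : x = ∑ a, x a • EuclideanSpace.single a (1 : ℝ) := by
    ext b; simp [Finset.sum_apply, Pi.single_apply]
  conv_rhs => rw [hx]
  simp only [map_sum, map_smul, ← Finset.sum_add_distrib, ← smul_add]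
  ext a
  simp only [Matrix.toLpLin_apply, Matrix.mulVec, dotProduct, compressedGram, Matrix.of_apply]
  rw [WithLp.ofLp_sum, Finset.sum_apply]
  exact Finset.sum_congr rfl fun b _ => mul_comm _ _

theorem compressedGram_pow_apply {A : Matrix (Fin d) (Fin d) ℝ} {W : Submodule ℝ (Vec d)} {m : ℕ}
    (e : Eigenframe (gram A) W m) (x : Vec d) (n : ℕ) :
    Matrix.toEuclideanLin (compressedGram A W ^ (n + 1)) x =
      ∑ i, ((1 + e.val i) ^ (n + 1) * inner ℝ (e.vec i) x) • e.vec i := by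
  induction n generalizing x with
  | zero =>
    rw [zero_add, pow_one, compressedGram_apply, e.starProjection, map_sum, ← Finset.sum_add_distrib]
    refine Finset.sum_congr rfl fun i _ => ?_
    rw [map_smul, e.apply, smul_smul, ← add_smul]
    congr 1; ring
  | succ n ih =>
    have h1 : Matrix.toEuclideanLin (compressedGram A W ^ (n + 1 + 1)) x =
        Matrix.toEuclideanLin (compressedGram A W ^ (n + 1))
          (Matrix.toEuclideanLin (compressedGram A W) x) := by
      simp only [Matrix.toLpLin_apply, pow_succ (compressedGram A W) (n + 1), Matrix.mulVec_mulVec]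
    rw [h1, ih]
    refine Finset.sum_congr rfl fun i _ => ?_
    congr 1
    have h2 : Matrix.toEuclideanLin (compressedGram A W) x =
        ∑ i, ((1 + e.val i) * inner ℝ (e.vec i) x) • e.vec i := by
      rw [compressedGram_apply, e.starProjection, map_sum, ← Finset.sum_add_distrib]
      refine Finset.sum_congr rfl fun i _ => ?_
      rw [map_smul, e.apply, smul_smul, ← add_smul]
      congr 1; ring
    rw [h2, e.orthonormal.inner_right_fintype]
    ring

-- The summand 1 in (1 + AᵀA)P keeps this norm positive even if AᵀA vanishes on `W`, and separates
-- `W` from its complement, where the matrix is zero. Normalized powers are therefore well defined.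
open scoped Matrix.Norms.L2Operator in
theorem norm_compressedGram {A : Matrix (Fin d) (Fin d) ℝ} {W : Submodule ℝ (Vec d)} {m : ℕ}
    (e : Eigenframe (gram A) W m) {i₀ : Fin m} (h0 : ∀ i, e.val i ≤ e.val i₀) :
    ‖compressedGram A W‖ = 1 + e.val i₀ := by
  have happ : ∀ x, Matrix.toEuclideanLin (compressedGram A W) x =
      ∑ i, ((1 + e.val i) * inner ℝ (e.vec i) x) • e.vec i := fun x => by
    simpa using compressedGram_pow_apply e x 0
  have hpos : 0 ≤ 1 + e.val i₀ := by linarith [e.val_nonneg i₀]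
  rw [Matrix.cstar_norm_def]
  refine le_antisymm (ContinuousLinearMap.opNorm_le_bound _ hpos fun x => ?_) ?_
  · change ‖Matrix.toEuclideanLin (compressedGram A W) x‖ ≤ _
    refine abs_le_of_sq_le_sq' ?_ (by positivity) |>.2
    rw [happ, ← real_inner_self_eq_norm_sq, e.orthonormal.inner_sum, mul_pow]
    have hb := e.orthonormal.sum_inner_products_le (x := x) (s := Finset.univ)
    refine le_trans ?_ (mul_le_mul_of_nonneg_left hb (sq_nonneg _))
    rw [Finset.mul_sum]
    refine Finset.sum_le_sum fun i _ => ?_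
    rw [Real.norm_eq_abs, sq_abs, conj_trivial]
    have h1 : (1 + e.val i) ^ 2 ≤ (1 + e.val i₀) ^ 2 :=
      pow_le_pow_left₀ (by linarith [e.val_nonneg i]) (by linarith [h0 i]) 2
    nlinarith [sq_nonneg (inner ℝ (e.vec i) x)]
  · have h1 := (Matrix.toEuclideanCLM (n := Fin d) (𝕜 := ℝ) (compressedGram A W)).le_opNorm
      (e.vec i₀)
    have h2 : Matrix.toEuclideanCLM (n := Fin d) (𝕜 := ℝ) (compressedGram A W) (e.vec i₀) =
        (1 + e.val i₀) • e.vec i₀ := by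
      change Matrix.toEuclideanLin (compressedGram A W) (e.vec i₀) = _
      rw [compressedGram_apply, Submodule.starProjection_eq_self_iff.2 (e.mem i₀), e.apply,
        add_smul, one_smul]
    rw [h2, norm_smul, e.orthonormal.1 i₀, mul_one, mul_one, Real.norm_eq_abs,
      abs_of_nonneg hpos] at h1
    exact h1

open scoped Matrix.Norms.L2Operator in
open Filter Topology in
/-- Power iteration converges to the top eigenspace. -/
theorem tendsto_starProjection_topEigenspace {A : Matrix (Fin d) (Fin d) ℝ}
    {W : Submodule ℝ (Vec d)} (hW : ∀ v ∈ W, gram A v ∈ W) (x : Vec d) :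
    Tendsto (fun n : ℕ => (‖compressedGram A W‖ ^ (n + 1))⁻¹ •
      Matrix.toEuclideanLin (compressedGram A W ^ (n + 1)) x) atTop
      (𝓝 ((topEigenspace A W).starProjection x)) := by
  classical
  obtain ⟨e⟩ := exists_eigenframe (gram_symmetric A) hW
  rw [e.starProjection_topEigenspace]
  simp only [compressedGram_pow_apply e, Finset.smul_sum]
  refine tendsto_finsetSum _ fun i _ => ?_
  have : Nonempty (Fin (Module.finrank ℝ W)) := ⟨i⟩
  obtain ⟨i0, h0⟩ := Finite.exists_max e.val
  rw [norm_compressedGram e h0, e.isGreatest h0]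
  have hpos : 0 < 1 + e.val i0 := by linarith [e.val_nonneg i0]
  have heq : ∀ n : ℕ, ((1 + e.val i0) ^ (n + 1))⁻¹ •
      ((1 + e.val i) ^ (n + 1) * inner ℝ (e.vec i) x) • e.vec i =
      (((1 + e.val i) / (1 + e.val i0)) ^ (n + 1)) • (inner ℝ (e.vec i) x • e.vec i) := by
    intro n
    rw [smul_smul, smul_smul, div_pow]
    congr 1
    field_simp
  simp only [heq]
  split_ifs with h
  · rw [h, div_self hpos.ne']
    simp
  · have hlt : (1 + e.val i) / (1 + e.val i0) < 1 := by
      rw [div_lt_one hpos]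
      linarith [lt_of_le_of_ne (h0 i) h]
    have hnn : 0 ≤ (1 + e.val i) / (1 + e.val i0) :=
      div_nonneg (by linarith [e.val_nonneg i]) hpos.le
    have := ((tendsto_pow_atTop_nhds_zero_of_lt_one hnn hlt).comp (tendsto_add_atTop_nat 1)).smul_const
      (inner ℝ (e.vec i) x • e.vec i)
    simpa using this

variable {A : Ω → Matrix (Fin d) (Fin d) ℝ} (hA : ∀ a b, Measurable fun ω => A ω a b)
include hA

/-- Eigenvectors do not depend continuously on the matrix, but the projection to the top eigenspace
is a pointwise limit of normalized matrix powers and thus measurable. The choice of the first basis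
vector with nonzero projection is a finite case distinction. -/
theorem measurable_topUnitVec {W : Ω → Submodule ℝ (Vec d)}
    (hW : ∀ ω, ∀ v ∈ W ω, gram (A ω) v ∈ W ω)
    (hm : ∀ x, Measurable fun ω => (W ω).starProjection x) :
    Measurable fun ω => topUnitVec (A ω) (W ω) := by
  classical
  have hT : ∀ a b, Measurable fun ω => ((A ω).transpose * A ω) a b :=
    measurable_matrix_mul (fun a b => hA b a) hA
  have hC : ∀ a b, Measurable fun ω => compressedGram (A ω) (W ω) a b := fun a b => by
    simp only [compressedGram, Matrix.of_apply]
    exact measurable_vec_iff.1 ((hm _).add (measurable_toEuclideanLin hT (hm _))) a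
  have hE : ∀ x, Measurable fun ω => (topEigenspace (A ω) (W ω)).starProjection x := fun x => by
    refine measurable_of_tendsto_metrizable (fun n => ?_)
      (tendsto_pi_nhds.2 fun ω => tendsto_starProjection_topEigenspace (hW ω) x)
    exact ((measurable_matrix_norm hC).pow_const _).inv.smul
      (measurable_toEuclideanLin (measurable_matrix_pow hC _) measurable_const)
  have hfind : ∀ L : List (Fin d), Measurable fun ω =>
      ((L.map fun a => (topEigenspace (A ω) (W ω)).starProjection
        (EuclideanSpace.single a (1 : ℝ))).find? fun v => decide (v ≠ 0)).getD 0 := by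
    intro L
    induction L with
    | nil => simp
    | cons a L ih =>
      have : (fun ω => (((a :: L).map fun a => (topEigenspace (A ω) (W ω)).starProjection
          (EuclideanSpace.single a (1 : ℝ))).find? fun v => decide (v ≠ 0)).getD 0) =
          fun ω => if (topEigenspace (A ω) (W ω)).starProjection
            (EuclideanSpace.single a (1 : ℝ)) = 0 then
            ((L.map fun a => (topEigenspace (A ω) (W ω)).starProjection
              (EuclideanSpace.single a (1 : ℝ))).find? fun v => decide (v ≠ 0)).getD 0
            else (topEigenspace (A ω) (W ω)).starProjection (EuclideanSpace.single a (1 : ℝ)) := by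
        ext1 ω
        rw [List.map_cons, List.find?_cons]
        split_ifs with h <;> simp [h]
      rw [this]
      exact Measurable.ite ((hE _) (measurableSet_singleton 0)) ih (hE _)
  have := hfind (List.finRange d)
  exact this.norm.inv.smul this

/-- The next projection is the present one minus the component along the next singular vector, so
projections and singular vectors are measurable by one induction. -/
theorem measurable_starProjection_singComplement (j : ℕ) :
    ∀ x, Measurable fun ω => (singComplement (A ω) j).starProjection x := by
  induction j with
  | zero =>
    intro x
    have : ∀ ω, (singComplement (A ω) 0).starProjection x = x := fun ω =>
      Submodule.starProjection_eq_self_iff.2 (Submodule.mem_top)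
    simp only [this, measurable_const]
  | succ j ih =>
    intro x
    have hq := measurable_topUnitVec hA (fun ω => singComplement_invariant (A := A ω) j) ih
    have : ∀ ω, (singComplement (A ω) (j + 1)).starProjection x =
        (singComplement (A ω) j).starProjection x -
        inner ℝ (singVec (A ω) j) x • singVec (A ω) j := by
      intro ω
      refine Submodule.eq_starProjection_of_mem_of_inner_eq_zero ⟨?_, ?_⟩ fun w hw => ?_
      · exact Submodule.sub_mem _ (Submodule.starProjection_apply_mem _ _)
          (Submodule.smul_mem _ _ (singVec_mem j))
      · rw [SetLike.mem_coe, Submodule.mem_orthogonal_singleton_iff_inner_right, inner_sub_right,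
          real_inner_smul_right]
        have h1 : inner ℝ (singVec (A ω) j) ((singComplement (A ω) j).starProjection x) =
            inner ℝ (singVec (A ω) j) x := by
          have := Submodule.starProjection_inner_eq_zero (K := singComplement (A ω) j) x _
            (singVec_mem j)
          rw [inner_sub_left] at this
          rw [real_inner_comm, real_inner_comm x]
          linarith
        change inner ℝ (singVec (A ω) j) _ - _ * inner ℝ (singVec (A ω) j) (singVec (A ω) j) = 0
        rw [h1]
        -- The singular vector is either a unit vector or zero once the complement is exhausted; the
        -- formula is right in both cases.
        rcases norm_topUnitVec (A := A ω) (singComplement (A ω) j) with h | h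
        · rw [show singVec (A ω) j = 0 from h]; simp
        · rw [real_inner_self_eq_norm_sq, show ‖singVec (A ω) j‖ = 1 from h]; ring
      · have h1 := Submodule.starProjection_inner_eq_zero (K := singComplement (A ω) j) x w hw.1
        have h2 := inner_singVec_of_mem (Nat.lt_succ_self j) hw
        rw [inner_sub_left] at h1
        rw [inner_sub_left, inner_sub_left, real_inner_smul_left, h2]
        linarith
    simp only [this]
    have hs : Measurable fun ω => singVec (A ω) j := hq
    have hi : Measurable fun ω => inner ℝ (singVec (A ω) j) x := hs.inner measurable_const
    exact (ih x).sub (hi.smul hs)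

theorem measurable_singVec (j : ℕ) : Measurable fun ω => singVec (A ω) j :=
  measurable_topUnitVec hA (fun ω => singComplement_invariant (A := A ω) j)
    (measurable_starProjection_singComplement hA j)

end Measurability

/- ## The values computed by the algorithm -/

@[simp] theorem Timed.val_bind {α β : Type} (x : Timed α) (f : α → Timed β) :
    (x >>= f).val = (f x.val).val := rfl
@[simp] theorem Timed.val_pure {α : Type} (a : α) : (pure a : Timed α).val = a := rfl
@[simp] theorem val_charge {α : Type} (n : ℕ) (a : α) : (charge n a).val = a := rfl
@[simp] theorem val_tab {α : Type} {n : ℕ} (f : Fin n → Timed α) :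
    (tab f).val = fun i => (f i).val := rfl
@[simp] theorem cost_tab {α : Type} {n : ℕ} (f : Fin n → Timed α) :
    (tab f).cost = ∑ i, ((f i).cost + 1) := rfl

/-- The residual, clipped at `κ`. -/
def clipFun (κ t : ℝ) : ℝ := t / max |t| κ * κ

variable {d : ℕ}

def clipGrad (z : Sample d) (w : Vec d) (κ : ℝ) : Vec d := clipFun κ (inner ℝ z.1 w - z.2) • z.1

def avgClipGrad (S : Batch d) (w : Vec d) (κ : ℝ) : Vec d :=
  (1 / (S.size : ℝ)) • ∑ t, clipGrad (S.get t) w κ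

def avgSqResidual (S : Batch d) (w : Vec d) : ℝ :=
  (∑ t, (inner ℝ (S.get t).1 w - (S.get t).2) ^ 2) / S.size

theorem val_dotT (x y : Vec d) : (dotT x y).val = inner ℝ x y := by
  simp [dotT, sumT, mulT, PiLp.inner_apply, mul_comm]

theorem val_scaleT (c : ℝ) (x : Vec d) : (scaleT c x).val = c • x := by
  ext a; simp [scaleT, vecT, mulT]

theorem val_vsubT (x y : Vec d) : (vsubT x y).val = x - y := by
  ext a; simp [vsubT, vecT, subT]

theorem val_vsumT {n : ℕ} (g : Fin n → Vec d) : (vsumT g).val = ∑ t, g t := by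
  ext a; simp [vsumT, vecT, sumT]

theorem val_distT (x y : Vec d) : (distT x y).val = ‖x - y‖ := by
  simp only [distT, Timed.val_bind, val_vsubT, val_dotT, sqrtT, val_charge]
  rw [real_inner_self_eq_norm_sq, Real.sqrt_sq (norm_nonneg _)]

theorem val_mulVecT (P : Matrix (Fin d) (Fin d) ℝ) (x : Vec d) :
    (mulVecT P x).val = Matrix.toEuclideanLin P x := by
  ext a; simp [mulVecT, vecT, mulT, sumT, Matrix.toLpLin_apply, Matrix.mulVec, dotProduct]

theorem val_clipGradT (z : Sample d) (w : Vec d) (κ : ℝ) :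
    (clipGradT z w κ).val = clipGrad z w κ := by
  simp [clipGradT, val_scaleT, val_dotT, subT, absT, maxT, divT, mulT, clipGrad, clipFun]

theorem val_avgClipGradT (S : Batch d) (w : Vec d) (κ : ℝ) :
    (avgClipGradT S w κ).val = avgClipGrad S w κ := by
  simp [avgClipGradT, val_scaleT, val_vsumT, val_clipGradT, divT, avgClipGrad]

theorem val_avgSqResidualT (S : Batch d) (w : Vec d) :
    (avgSqResidualT S w).val = avgSqResidual S w := by
  simp [avgSqResidualT, sumT, val_dotT, subT, mulT, divT, avgSqResidual, sq]

/-- The clipping parameter. -/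
def clipParam (T : ℕ) (S : Batch d) (w : Vec d) (ε σ C C₁ : ℝ) : ℝ :=
  Real.sqrt (32 * (C + 1) * C₁ *
    (median (fun j : Fin T => avgSqResidual (S.part T j) w) + 17 * σ ^ 2) / ε)

theorem val_clipEst (τ : Tuning) (S : Batch d) (w : Vec d) (ε δ' σ C C₁ : ℝ) :
    (clipEst τ S w ε δ' σ C C₁).val = clipParam ⌈τ.cClip * Real.log (1 / δ')⌉₊ S w ε σ C C₁ := by
  simp only [clipEst, Timed.val_bind, val_charge, val_tab, val_avgSqResidualT, medianT, clipParam]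

/-- The matrix `A` of the subspace estimation. -/
def crossMatrix (B : Arr (Batch d)) (κ : ℝ) (w : Vec d) : Matrix (Fin d) (Fin d) ℝ :=
  Matrix.of fun a c => (∑ b, (avgClipGrad ((B.get b).part 2 0) w κ a *
      avgClipGrad ((B.get b).part 2 1) w κ c + avgClipGrad ((B.get b).part 2 1) w κ a *
      avgClipGrad ((B.get b).part 2 0) w κ c)) / (2 * B.size)

/-- The matrix of the orthogonal projection to the span of the top `l` singular vectors. -/
def singProj (A : Matrix (Fin d) (Fin d) ℝ) (l : ℕ) : Matrix (Fin d) (Fin d) ℝ :=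
  Matrix.of fun a c => ∑ j : Fin l, singVec A j a * singVec A j c

theorem val_gradSubEst (B : Arr (Batch d)) (κ : ℝ) (w : Vec d) (l : ℕ) :
    (gradSubEst B κ w l).val = singProj (crossMatrix B κ w) l := by
  simp only [gradSubEst, Timed.val_bind, val_tab, val_avgClipGradT, matT, mulT, addT, sumT, divT,
    val_charge, Timed.val_pure, svdT, singProj, crossMatrix]

def testStat (T₁ : ℕ) (b S : Batch d) (κ : ℝ) (w : Vec d) (P : Matrix (Fin d) (Fin d) ℝ)
    (j : Fin T₁) : ℝ :=
  let j₁ : Fin (2 * T₁) := ⟨j.val, by have := j.isLt; omega⟩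
  let j₂ : Fin (2 * T₁) := ⟨T₁ + j.val, by have := j.isLt; omega⟩
  inner ℝ (Matrix.toEuclideanLin P (avgClipGrad ((b.part 2 0).part (2 * T₁) j₁) w κ -
      avgClipGrad (S.part (2 * T₁) j₁) w κ))
    (Matrix.toEuclideanLin P (avgClipGrad ((b.part 2 0).part (2 * T₁) j₂) w κ -
      avgClipGrad (S.part (2 * T₁) j₂) w κ))

def keepSet (T₁ : ℕ) (thr : ℝ) (B : Arr (Batch d)) (S : Batch d) (κ : ℝ) (w : Vec d)
    (P : Matrix (Fin d) (Fin d) ℝ) (b : Fin B.size) : Bool :=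
  decide (median (testStat T₁ (B.get b) S κ w P) ≤ thr)

def partMean (T₂ : ℕ) (B : Arr (Batch d)) (keep : Fin B.size → Bool) (κ : ℝ) (w : Vec d)
    (P : Matrix (Fin d) (Fin d) ℝ) (i : Fin T₂) : Vec d :=
  (1 / ((Finset.univ.filter fun b => keep b = true).card : ℝ)) • ∑ b, if keep b = true then
    Matrix.toEuclideanLin P (avgClipGrad (((B.get b).part 2 1).part T₂ i) w κ) else 0

/-- The point with the smallest median distance to the other ones. -/
def medianPoint {T : ℕ} (Δ : Fin T → Vec d) : Vec d :=
  ((List.finRange T).argmin fun i => median fun j => ‖Δ i - Δ j‖).elim 0 Δ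

theorem val_gradEst (τ : Tuning) (B : Arr (Batch d)) (S : Batch d) (κ : ℝ) (w : Vec d)
    (P : Matrix (Fin d) (Fin d) ℝ) (ε δ' C₁ : ℝ) :
    (gradEst τ B S κ w P ε δ' C₁).val =
      medianPoint (partMean ⌈τ.cEst * Real.log (1 / δ')⌉₊ B
        (keepSet ⌈τ.cTest * Real.log (B.size / δ')⌉₊ (ε ^ 2 * κ ^ 2 * C₁) B S κ w P) κ w P) := by
  simp only [gradEst, Timed.val_bind, val_charge, val_tab, val_avgClipGradT, val_vsubT,
    val_mulVecT, val_dotT, medianT, leT, argminT, val_scaleT, val_vsumT, divT, val_distT]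
  have hite : ∀ (c : Prop) [Decidable c] (x y : Timed (Vec d)),
      (if c then x else y).val = if c then x.val else y.val := fun c _ x y => by
    split_ifs <;> rfl
  simp only [hite, Timed.val_bind, val_avgClipGradT, val_mulVecT, Timed.val_pure]
  unfold medianPoint
  have hmatch : ∀ {n : ℕ} (o : Option (Fin n)) (Δ : Fin n → Vec d),
      (match o with | some i => pure (Δ i) | none => pure 0 : Timed (Vec d)).val = o.elim 0 Δ := by
    intro n o Δ
    cases o <;> rfl
  exact hmatch _ _

/- ## Arrays of indices -/

/-- The algorithm runs on arrays of indices whose entries are then read off from a sample point. The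
set of coordinates entering an intermediate quantity is thereby visible, independently of the data.
-/
def Arr.map {α β : Type} (f : α → β) (a : Arr α) : Arr β := ⟨a.size, fun t => f (a.get t)⟩

/-- The items of an array. -/
def Arr.idx {α : Type} (a : Arr α) : Set α := Set.range a.get

theorem Arr.map_congr {α β : Type} {f g : α → β} {a : Arr α} (h : ∀ i ∈ a.idx, f i = g i) :
    a.map f = a.map g := by
  simp only [Arr.map]
  congr 1
  funext t
  exact h _ ⟨t, rfl⟩

theorem Arr.idx_part_subset {α : Type} (a : Arr α) (p : ℕ) (j : Fin p) :
    (a.part p j).idx ⊆ a.idx := by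
  rintro _ ⟨t, rfl⟩; exact ⟨_, rfl⟩

theorem Arr.part_injective {α : Type} {a : Arr α} (h : Function.Injective a.get) (p : ℕ)
    (j : Fin p) : Function.Injective (a.part p j).get := by
  intro s t hst
  have := h hst
  simp only [Fin.mk.injEq, Nat.add_left_cancel_iff] at this
  exact Fin.ext this

/-- Uniqueness of division with remainder; it makes different parts disjoint. -/
theorem part_index_inj {s p : ℕ} {i j : Fin p} {t u : Fin (s / p)}
    (h : i.val * (s / p) + t.val = j.val * (s / p) + u.val) : i = j := by
  have ht := t.isLt
  have hu := u.isLt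
  by_contra hne
  rcases lt_or_gt_of_ne (fun h => hne (Fin.ext h) : i.val ≠ j.val) with hlt | hlt
  · have : (i.val + 1) * (s / p) ≤ j.val * (s / p) := Nat.mul_le_mul_right _ hlt
    rw [add_mul, one_mul] at this
    omega
  · have : (j.val + 1) * (s / p) ≤ i.val * (s / p) := Nat.mul_le_mul_right _ hlt
    rw [add_mul, one_mul] at this
    omega

theorem Arr.disjoint_part {α : Type} {a : Arr α} (h : Function.Injective a.get) (p : ℕ)
    {i j : Fin p} (hij : i ≠ j) : Disjoint (a.part p i).idx (a.part p j).idx := by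
  rw [Set.disjoint_left]
  rintro _ ⟨t, rfl⟩ ⟨u, hu⟩
  have := h hu
  simp only [Fin.mk.injEq] at this
  exact hij (part_index_inj this).symm

/-- The samples in a collection of batches. -/
def Arr.idx₂ {α : Type} (B : Arr (Arr α)) : Set α := ⋃ b, (B.get b).idx

/-! ### Measurability of the quantities computed in a round -/

section Measurability

variable {ι : Type} {Ω : Type*} [MeasurableSpace Ω]

theorem measurable_clipFun {κ t : Ω → ℝ} (hκ : Measurable κ) (ht : Measurable t) :
    Measurable fun ω => clipFun (κ ω) (t ω) := by
  unfold clipFun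
  exact (ht.div ((continuous_abs.measurable.comp ht).max hκ)).mul hκ

variable {F : Ω → ι → Sample d} (hF : ∀ i, Measurable fun ω => F ω i)
  {w : Ω → Vec d} (hw : Measurable w) {κ : Ω → ℝ} (hκ : Measurable κ)
  {P : Ω → Matrix (Fin d) (Fin d) ℝ} (hP : ∀ a b, Measurable fun ω => P ω a b)

include hF hw in
theorem measurable_residual (i : ι) : Measurable fun ω => inner ℝ (F ω i).1 (w ω) - (F ω i).2 :=
  ((measurable_fst.comp (hF i)).inner hw).sub (measurable_snd.comp (hF i))

include hF hw in
theorem measurable_avgSqResidual (S : Arr ι) :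
    Measurable fun ω => avgSqResidual (S.map (F ω)) (w ω) := by
  change Measurable fun ω => (∑ t : Fin S.size, (inner ℝ (F ω (S.get t)).1 (w ω) -
    (F ω (S.get t)).2) ^ 2) / (S.size : ℝ)
  exact (Finset.measurable_fun_sum _ fun t _ =>
    (measurable_residual hF hw (S.get t)).pow_const 2).div_const _

include hF hw in
theorem measurable_clipParam (T : ℕ) (S : Arr ι) (ε σ C C₁ : ℝ) :
    Measurable fun ω => clipParam T (S.map (F ω)) (w ω) ε σ C C₁ := by
  unfold clipParam
  exact ((((measurable_median fun j => measurable_avgSqResidual hF hw (S.part T j)).add_const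
    _).const_mul _).div_const _).sqrt

include hF hw hκ in
theorem measurable_clipGrad (i : ι) : Measurable fun ω => clipGrad (F ω i) (w ω) (κ ω) :=
  (measurable_clipFun hκ (measurable_residual hF hw i)).smul (measurable_fst.comp (hF i))

include hF hw hκ in
theorem measurable_avgClipGrad (S : Arr ι) :
    Measurable fun ω => avgClipGrad (S.map (F ω)) (w ω) (κ ω) := by
  change Measurable fun ω => (1 / (S.size : ℝ)) • ∑ t : Fin S.size,
    clipGrad (F ω (S.get t)) (w ω) (κ ω)
  have h : Measurable fun ω => ∑ t : Fin S.size, clipGrad (F ω (S.get t)) (w ω) (κ ω) :=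
    Finset.measurable_fun_sum _ fun t _ => measurable_clipGrad hF hw hκ (S.get t)
  exact h.const_smul (1 / (S.size : ℝ))

include hF hw hκ in
theorem measurable_singProj (B : Arr (Arr ι)) (l : ℕ) (a c : Fin d) :
    Measurable fun ω => singProj (crossMatrix (B.map (Arr.map (F ω))) (κ ω) (w ω)) l a c := by
  have hg : ∀ (S : Arr ι) a, Measurable fun ω => avgClipGrad (S.map (F ω)) (w ω) (κ ω) a :=
    fun S => measurable_vec_iff.1 (measurable_avgClipGrad hF hw hκ S)
  have hA : ∀ a c, Measurable fun ω => crossMatrix (B.map (Arr.map (F ω))) (κ ω) (w ω) a c := by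
    intro a c
    change Measurable fun ω => (∑ b : Fin B.size,
      (avgClipGrad (((B.get b).part 2 0).map (F ω)) (w ω) (κ ω) a *
        avgClipGrad (((B.get b).part 2 1).map (F ω)) (w ω) (κ ω) c +
        avgClipGrad (((B.get b).part 2 1).map (F ω)) (w ω) (κ ω) a *
        avgClipGrad (((B.get b).part 2 0).map (F ω)) (w ω) (κ ω) c)) / (2 * (B.size : ℝ))
    refine Measurable.div_const (Finset.measurable_fun_sum _ fun b _ => ?_) _
    exact ((hg ((B.get b).part 2 0) a).mul (hg ((B.get b).part 2 1) c)).add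
      ((hg ((B.get b).part 2 1) a).mul (hg ((B.get b).part 2 0) c))
  simp only [singProj, Matrix.of_apply]
  refine Finset.measurable_fun_sum _ fun j _ => ?_
  have hs := measurable_vec_iff.1 (measurable_singVec hA (j : ℕ))
  exact (hs a).mul (hs c)

include hF hw hκ hP in
theorem measurable_testStat (T₁ : ℕ) (b S : Arr ι) (j : Fin T₁) :
    Measurable fun ω => testStat T₁ (b.map (F ω)) (S.map (F ω)) (κ ω) (w ω) (P ω) j := by
  unfold testStat
  have hg := measurable_avgClipGrad hF hw hκ
  exact (measurable_toEuclideanLin hP ((hg ((b.part 2 0).part (2 * T₁) _)).sub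
    (hg (S.part (2 * T₁) _)))).inner (measurable_toEuclideanLin hP
      ((hg ((b.part 2 0).part (2 * T₁) _)).sub (hg (S.part (2 * T₁) _))))

include hF hw hκ hP in
theorem measurable_keepSet (T₁ : ℕ) {thr : Ω → ℝ} (hthr : Measurable thr) (B : Arr (Arr ι))
    (S : Arr ι) : Measurable fun ω => fun b : Fin B.size => keepSet T₁ (thr ω) (B.map (Arr.map (F ω)))
      (S.map (F ω)) (κ ω) (w ω) (P ω) b := by
  refine measurable_pi_lambda _ fun b => measurable_to_bool ?_
  have : (fun ω => keepSet T₁ (thr ω) (B.map (Arr.map (F ω))) (S.map (F ω)) (κ ω) (w ω) (P ω) b)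
      ⁻¹' {true} = {ω | median (testStat T₁ ((B.get b).map (F ω)) (S.map (F ω)) (κ ω) (w ω)
        (P ω)) ≤ thr ω} := by
    ext ω
    exact decide_eq_true_iff
  rw [this]
  exact measurableSet_le (measurable_median fun j => measurable_testStat hF hw hκ hP T₁ _ S j) hthr

include hF hw hκ hP in
theorem measurable_partMean (T₂ : ℕ) (B : Arr (Arr ι)) {keep : Ω → Fin B.size → Bool}
    (hk : Measurable keep) (i : Fin T₂) :
    Measurable fun ω => partMean T₂ (B.map (Arr.map (F ω))) (keep ω) (κ ω) (w ω) (P ω) i := by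
  have hkb : ∀ b, MeasurableSet {ω | keep ω b = true} := fun b =>
    ((measurable_pi_apply b).comp hk) (measurableSet_singleton true)
  unfold partMean
  have h1 : Measurable fun ω => ((Finset.univ.filter fun b => keep ω b = true).card : ℝ) := by
    simp only [Finset.card_filter, Nat.cast_sum]
    refine Finset.measurable_fun_sum _ fun b _ => ?_
    have : (fun ω => ((if keep ω b = true then 1 else 0 : ℕ) : ℝ)) =
        fun ω => if keep ω b = true then (1 : ℝ) else 0 := by
      ext ω; split_ifs <;> simp
    rw [this]
    exact Measurable.ite (hkb b) measurable_const measurable_const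
  refine (h1.const_div 1).smul (f := fun ω => 1 / _) ?_
  change Measurable fun ω => ∑ b : Fin B.size, if keep ω b = true then Matrix.toEuclideanLin (P ω)
    (avgClipGrad ((((B.get b).part 2 1).part T₂ i).map (F ω)) (w ω) (κ ω)) else 0
  refine Finset.measurable_fun_sum _ fun b _ => ?_
  exact Measurable.ite (hkb b) (measurable_toEuclideanLin hP
    (measurable_avgClipGrad hF hw hκ (((B.get b).part 2 1).part T₂ i))) measurable_const

/-- Follows the recursion of `List.argmin`: the first element replaces the minimizer of the rest
unless the latter is strictly smaller. -/
theorem measurableSet_argmin {T : ℕ} {f : Ω → Fin T → ℝ} (hf : ∀ i, Measurable fun ω => f ω i)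
    (L : List (Fin T)) (i : Fin T) : MeasurableSet {ω | L.argmin (f ω) = some i} := by
  induction L generalizing i with
  | nil => simp
  | cons a L ih =>
    rcases L.eq_nil_or_concat with rfl | hL
    · simp
    have hne : L ≠ [] := by obtain ⟨l, x, rfl⟩ := hL; simp
    have : {ω | (a :: L).argmin (f ω) = some i} = ⋃ c, ({ω | L.argmin (f ω) = some c} ∩
        (({ω | f ω c < f ω a} ∩ {_ω | c = i}) ∪ ({ω | f ω c < f ω a}ᶜ ∩ {_ω | a = i}))) := by
      ext ω
      simp only [Set.mem_iUnion, Set.mem_inter_iff, Set.mem_union, Set.mem_compl_iff]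
      change (a :: L).argmin (f ω) = some i ↔ ∃ c, L.argmin (f ω) = some c ∧
        ((f ω c < f ω a ∧ c = i) ∨ (¬ f ω c < f ω a ∧ a = i))
      rw [List.argmin_cons]
      rcases h : L.argmin (f ω) with _ | c
      · exact absurd (List.argmin_eq_none.1 h) hne
      · simp only [Option.some.injEq, exists_eq_left']
        split_ifs with hlt <;> simp [hlt]
    rw [this]
    refine MeasurableSet.iUnion fun c => (ih c).inter (((measurableSet_lt (hf c) (hf a)).inter
      (MeasurableSet.const _)).union ((measurableSet_lt (hf c) (hf a)).compl.inter
      (MeasurableSet.const _)))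

theorem measurable_medianPoint {T : ℕ} {Δ : Ω → Fin T → Vec d}
    (hΔ : ∀ i, Measurable fun ω => Δ ω i) : Measurable fun ω => medianPoint (Δ ω) := by
  classical
  have hm : ∀ i, Measurable fun ω => median fun j => ‖Δ ω i - Δ ω j‖ := fun i =>
    measurable_median fun j => ((hΔ i).sub (hΔ j)).norm
  have : (fun ω => medianPoint (Δ ω)) = fun ω => ∑ i, if (List.finRange T).argmin
      (fun i => median fun j => ‖Δ ω i - Δ ω j‖) = some i then Δ ω i else 0 := by
    ext1 ω
    rw [medianPoint]
    rcases (List.finRange T).argmin (fun i => median fun j => ‖Δ ω i - Δ ω j‖) with _ | c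
    · simp
    · simp
  rw [this]
  exact Finset.measurable_fun_sum _ fun i _ => Measurable.ite
    (measurableSet_argmin hm _ i) (hΔ i) measurable_const

end Measurability

/- ## Averages of independent samples -/

section Markov

variable {Ω : Type*} [MeasurableSpace Ω] {μ : Measure Ω} [IsProbabilityMeasure μ]

theorem measure_ge_le_of_integral_le {X : Ω → ℝ} (hX : Integrable X μ) (h0 : 0 ≤ᵐ[μ] X)
    {v t : ℝ} (ht : 0 < t) (hv : ∫ ω, X ω ∂μ ≤ v) : μ {ω | t ≤ X ω} ≤ ENNReal.ofReal (v / t) := by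
  have h := mul_meas_ge_le_integral_of_nonneg h0 hX t
  rw [← ENNReal.ofReal_toReal (measure_ne_top μ _)]
  refine ENNReal.ofReal_le_ofReal ?_
  rw [le_div_iff₀ ht, mul_comm]
  exact h.trans hv

theorem measure_abs_ge_le_of_integral_sq_le {X : Ω → ℝ} (hX : Integrable (fun ω => X ω ^ 2) μ)
    {v t : ℝ} (ht : 0 < t) (hv : ∫ ω, X ω ^ 2 ∂μ ≤ v) :
    μ {ω | t ≤ |X ω|} ≤ ENNReal.ofReal (v / t ^ 2) := by
  have h := measure_ge_le_of_integral_le hX (Filter.Eventually.of_forall fun ω => sq_nonneg (X ω))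
    (pow_pos ht 2) hv
  refine (measure_mono fun ω hω => ?_).trans h
  have h1 : t ≤ |X ω| := hω
  change t ^ 2 ≤ X ω ^ 2
  rw [← sq_abs (X ω)]
  gcongr

end Markov

section Averages

variable {ι S : Type} [Fintype ι] [MeasurableSpace S] (ν : ι → Measure S)
  [∀ i, IsProbabilityMeasure (ν i)]

theorem integral_comp_eval {i : ι} {E : Type*} [NormedAddCommGroup E] [NormedSpace ℝ E]
    {h : S → E} (hh : AEStronglyMeasurable h (ν i)) :
    ∫ ω, h (ω i) ∂(Measure.pi ν) = ∫ z, h z ∂(ν i) := by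
  have hmp := measurePreserving_eval ν i
  conv_rhs => rw [← hmp.map_eq]
  rw [integral_map hmp.measurable.aemeasurable (by rwa [hmp.map_eq])]

theorem integrable_comp_eval {i : ι} {E : Type*} [NormedAddCommGroup E] {h : S → E}
    (hh : Integrable h (ν i)) : Integrable (fun ω => h (ω i)) (Measure.pi ν) :=
  (measurePreserving_eval ν i).integrable_comp_of_integrable hh

theorem memLp_comp_eval {i : ι} {h : S → ℝ} (hh : MemLp h 2 (ν i)) :
    MemLp (fun ω : ι → S => h (ω i)) 2 (Measure.pi ν) :=
  hh.comp_measurePreserving (measurePreserving_eval ν i)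

theorem ae_comp_eval {p : S → Prop} {i : ι} (hp : ∀ᵐ z ∂(ν i), p z) :
    ∀ᵐ ω ∂(Measure.pi ν), p (ω i) :=
  (measurePreserving_eval ν i).quasiMeasurePreserving.ae hp

variable {ν} {D : Measure S} {a : Arr ι} (hD : ∀ t, ν (a.get t) = D)
include hD

theorem memLp_average {h : S → ℝ} (hh : MemLp h 2 D) :
    MemLp (fun ω : ι → S => (∑ t, h (ω (a.get t))) / a.size) 2 (Measure.pi ν) := by
  simp only [div_eq_mul_inv]
  exact (memLp_finsetSum _ fun t _ => memLp_comp_eval ν (by rw [hD]; exact hh)).mul_const _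

theorem integral_average {h : S → ℝ} (hh : Integrable h D) (ha : 0 < a.size) :
    ∫ ω, (∑ t, h (ω (a.get t))) / a.size ∂(Measure.pi ν) = ∫ z, h z ∂D := by
  have ha' : (a.size : ℝ) ≠ 0 := by positivity
  rw [integral_div, integral_finsetSum _ fun t _ =>
    integrable_comp_eval ν (i := a.get t) (by rw [hD]; exact hh)]
  have : ∀ t, ∫ ω, h (ω (a.get t)) ∂(Measure.pi ν) = ∫ z, h z ∂D := fun t => by
    rw [integral_comp_eval ν (by rw [hD]; exact hh.aestronglyMeasurable), hD]
  simp only [this, Finset.sum_const, Finset.card_univ, Fintype.card_fin, nsmul_eq_mul]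
  field_simp

theorem integrable_average {h : S → ℝ} (hh : Integrable h D) :
    Integrable (fun ω : ι → S => (∑ t, h (ω (a.get t))) / a.size) (Measure.pi ν) :=
  (integrable_finsetSum _ fun t _ =>
    integrable_comp_eval ν (i := a.get t) (by rw [hD]; exact hh)).div_const _

/-- Variances of independent samples add, and each variance is at most the second moment.
Injectivity says that no sample is counted twice. -/
theorem integral_average_sub_sq_le (hinj : Function.Injective a.get) {h : S → ℝ}
    (hh : MemLp h 2 D) (ha : 0 < a.size) :
    ∫ ω, ((∑ t, h (ω (a.get t))) / a.size - ∫ z, h z ∂D) ^ 2 ∂(Measure.pi ν) ≤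
      (∫ z, h z ^ 2 ∂D) / a.size := by
  have hp : IsProbabilityMeasure D := by rw [← hD ⟨0, ha⟩]; infer_instance
  have ha' : (0 : ℝ) < a.size := by positivity
  have hint : Integrable h D := hh.integrable (by norm_num)
  set X : Fin a.size → (ι → S) → ℝ := fun t ω => h (ω (a.get t)) with hX
  have hXL : ∀ t, MemLp (X t) 2 (Measure.pi ν) := fun t =>
    memLp_comp_eval ν (by rw [hD]; exact hh)
  have hmean : ∀ t, ∫ ω, X t ω ∂(Measure.pi ν) = ∫ z, h z ∂D := fun t => by
    rw [hX]; simp only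
    rw [integral_comp_eval ν (by rw [hD]; exact hint.aestronglyMeasurable), hD]
  have hvar1 : ∀ t, Var[X t; Measure.pi ν] ≤ ∫ z, h z ^ 2 ∂D := fun t => by
    refine (variance_le_expectation_sq (hXL t).aestronglyMeasurable).trans (le_of_eq ?_)
    have := integral_comp_eval ν (i := a.get t) (h := fun z => h z ^ 2)
      (by rw [hD]; exact hh.aestronglyMeasurable.pow 2)
    rw [hD] at this
    exact this
  have hindep : Pairwise fun s t => IndepFun (X s) (X t) (Measure.pi ν) := by
    intro s t hst
    have h1 : iIndepFun (fun i (ω : ι → S) => ω i) (Measure.pi ν) :=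
      iIndepFun_pi (X := fun _ => id) fun i => aemeasurable_id
    have h2 := h1.indepFun (fun h => hst (hinj h))
    refine h2.comp₀ (measurable_pi_apply _).aemeasurable (measurable_pi_apply _).aemeasurable
      (φ := h) (ψ := h) ?_ ?_
    · rw [(measurePreserving_eval ν _).map_eq, hD]; exact hh.aestronglyMeasurable.aemeasurable
    · rw [(measurePreserving_eval ν _).map_eq, hD]; exact hh.aestronglyMeasurable.aemeasurable
  have hvar := IndepFun.variance_sum (s := Finset.univ) (fun t _ => hXL t)
    fun s _ t _ hst => hindep hst
  have hsum : Var[fun ω => (∑ t, X t ω) / a.size; Measure.pi ν] ≤ (∫ z, h z ^ 2 ∂D) / a.size := by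
    have h1 : (fun ω => (∑ t, X t ω) / a.size) = fun ω => (a.size : ℝ)⁻¹ * (∑ t, X t) ω := by
      ext ω; simp [div_eq_inv_mul]
    rw [h1, variance_const_mul, hvar]
    calc _ ≤ ((a.size : ℝ)⁻¹) ^ 2 * ∑ _t : Fin a.size, ∫ z, h z ^ 2 ∂D := by
          gcongr with t; exact hvar1 t
      _ = _ := by
          simp only [Finset.sum_const, Finset.card_univ, Fintype.card_fin, nsmul_eq_mul]
          field_simp
  rw [variance_eq_integral] at hsum
  · rw [integral_average hD hint ha] at hsum
    exact hsum
  · exact (memLp_average hD hh).aestronglyMeasurable.aemeasurable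

/-- Jensen's inequality for the square; repeated indices would do no harm. -/
theorem integral_average_sq_le {h : S → ℝ} (hh : MemLp h 2 D) (ha : 0 < a.size) :
    ∫ ω, ((∑ t, h (ω (a.get t))) / a.size) ^ 2 ∂(Measure.pi ν) ≤ ∫ z, h z ^ 2 ∂D := by
  have ha' : (0 : ℝ) < a.size := by positivity
  rw [← integral_average hD hh.integrable_sq ha]
  refine integral_mono (memLp_average hD hh).integrable_sq
    (integrable_average hD hh.integrable_sq) fun ω => ?_
  have hcs := sq_sum_le_card_mul_sum_sq (s := Finset.univ) (f := fun t => h (ω (a.get t)))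
  simp only [Finset.card_univ, Fintype.card_fin] at hcs
  simp only [div_pow]
  rw [div_le_div_iff₀ (by positivity) ha']
  nlinarith

end Averages

/- ## Moments of the clipped gradient -/

section Moments

variable {d : ℕ}

theorem abs_clipFun_le {κ : ℝ} (hκ : 0 < κ) (t : ℝ) : |clipFun κ t| ≤ κ := by
  have hm : 0 < max |t| κ := lt_max_of_lt_right hκ
  rw [clipFun, abs_mul, abs_div, abs_of_pos hm, abs_of_pos hκ]
  have : |t| / max |t| κ ≤ 1 := (div_le_one hm).2 (le_max_left _ _)
  nlinarith

theorem clipFun_of_le {κ t : ℝ} (hκ : 0 < κ) (ht : |t| ≤ κ) : clipFun κ t = t := by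
  rw [clipFun, max_eq_right ht]; field_simp

theorem clipFun_of_ge {κ t : ℝ} (hκ : 0 < κ) (ht : κ ≤ t) : clipFun κ t = κ := by
  have h1 : |t| = t := abs_of_pos (hκ.trans_le ht)
  have h2 : t ≠ 0 := (hκ.trans_le ht).ne'
  rw [clipFun, h1, max_eq_left ht]; field_simp

theorem clipFun_neg (κ t : ℝ) : clipFun κ (-t) = -clipFun κ t := by
  simp only [clipFun, abs_neg]; ring

theorem clipFun_of_le_neg {κ t : ℝ} (hκ : 0 < κ) (ht : t ≤ -κ) : clipFun κ t = -κ := by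
  rw [← neg_neg t, clipFun_neg, clipFun_of_ge hκ (by linarith)]

/-- A distribution of the input with bounded support and bounded covariance. -/
structure IsBounded (D : Measure (Sample d)) (C₁ b : ℝ) : Prop where
  prob : IsProbabilityMeasure D
  secondMoment_le : specNorm (secondMoment D) ≤ C₁
  norm_le : ∀ᵐ z ∂D, ‖z.1‖ ≤ b

variable {D : Measure (Sample d)} {C₁ b : ℝ} (hD : IsBounded D C₁ b)

theorem measurable_inner_fst (u : Vec d) : Measurable fun z : Sample d => inner ℝ z.1 u :=
  measurable_fst.inner measurable_const

theorem measurable_fst_apply (a : Fin d) : Measurable fun z : Sample d => z.1 a :=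
  measurable_vec_iff.1 measurable_fst a

include hD

theorem IsBounded.memLp_inner (u : Vec d) (p : ℝ≥0∞) :
    MemLp (fun z : Sample d => inner ℝ z.1 u) p D := by
  have := hD.prob
  refine MemLp.of_bound (measurable_inner_fst u).aestronglyMeasurable (b * ‖u‖) ?_
  filter_upwards [hD.norm_le] with z hz
  exact (norm_inner_le_norm _ _).trans (by gcongr)

theorem IsBounded.integrable_coord (a c : Fin d) : Integrable (fun z : Sample d => z.1 a * z.1 c) D := by
  have := hD.prob
  refine Integrable.of_bound ((measurable_fst_apply a).mul
    (measurable_fst_apply c)).aestronglyMeasurable (b * b) ?_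
  filter_upwards [hD.norm_le] with z hz
  rw [norm_mul]
  have h0 := (norm_nonneg _).trans hz
  exact mul_le_mul ((PiLp.norm_apply_le _ _).trans hz) ((PiLp.norm_apply_le _ _).trans hz)
    (norm_nonneg _) h0

theorem IsBounded.inner_secondMoment (u v : Vec d) :
    inner ℝ u (Matrix.toEuclideanLin (secondMoment D) v) =
      ∫ z, inner ℝ z.1 u * inner ℝ z.1 v ∂D := by
  have h1 : ∀ z : Sample d, inner ℝ z.1 u * inner ℝ z.1 v =
      ∑ a, ∑ c, u a * v c * (z.1 a * z.1 c) := by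
    intro z
    simp only [PiLp.inner_apply, Finset.sum_mul_sum]
    refine Finset.sum_congr rfl fun a _ => Finset.sum_congr rfl fun c _ => ?_
    simp; ring
  simp only [h1]
  rw [integral_finsetSum _ fun a _ => integrable_finsetSum _ fun c _ =>
    (hD.integrable_coord a c).const_mul _]
  simp only [PiLp.inner_apply, Matrix.toLpLin_apply, Matrix.mulVec, dotProduct, secondMoment,
    Matrix.of_apply]
  refine Finset.sum_congr rfl fun a _ => ?_
  rw [integral_finsetSum _ fun c _ => (hD.integrable_coord a c).const_mul _]
  simp only [RCLike.inner_apply, conj_trivial, Finset.sum_mul, integral_const_mul]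
  exact Finset.sum_congr rfl fun c _ => by ring

theorem IsBounded.integral_inner_sq_le (u : Vec d) :
    ∫ z, inner ℝ z.1 u ^ 2 ∂D ≤ C₁ * ‖u‖ ^ 2 := by
  have h1 := hD.inner_secondMoment u u
  simp only [← sq] at h1
  rw [← h1]
  refine (real_inner_le_norm _ _).trans ?_
  have h2 := (Matrix.toEuclideanCLM (n := Fin d) (𝕜 := ℝ) (secondMoment D)).le_opNorm u
  have h3 : ‖Matrix.toEuclideanLin (secondMoment D) u‖ ≤ C₁ * ‖u‖ :=
    h2.trans (mul_le_mul_of_nonneg_right hD.secondMoment_le (norm_nonneg _))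
  nlinarith [norm_nonneg u]

omit hD in
theorem measurable_clipGrad_const (w : Vec d) (κ : ℝ) :
    Measurable fun z : Sample d => clipGrad z w κ :=
  measurable_clipGrad (ι := Unit) (F := fun z _ => z) (fun _ => measurable_id) measurable_const
    measurable_const ()

theorem IsBounded.norm_clipGrad_le {κ : ℝ} (hκ : 0 < κ) (w : Vec d) :
    ∀ᵐ z ∂D, ‖clipGrad z w κ‖ ≤ κ * b := by
  filter_upwards [hD.norm_le] with z hz
  rw [clipGrad, norm_smul]
  exact mul_le_mul (abs_clipFun_le hκ _) hz (norm_nonneg _) hκ.le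

omit hD in
/-- The expected clipped gradient. -/
def gradMean (D : Measure (Sample d)) (w : Vec d) (κ : ℝ) : Vec d := ∫ z, clipGrad z w κ ∂D

theorem IsBounded.integrable_clipGrad {κ : ℝ} (hκ : 0 < κ) (w : Vec d) :
    Integrable (fun z => clipGrad z w κ) D := by
  have := hD.prob
  exact Integrable.of_bound (measurable_clipGrad_const w κ).aestronglyMeasurable (κ * b)
    (hD.norm_clipGrad_le hκ w)

theorem IsBounded.memLp_inner_clipGrad {κ : ℝ} (hκ : 0 < κ) (w u : Vec d) :
    MemLp (fun z => inner ℝ (clipGrad z w κ) u) 2 D := by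
  have := hD.prob
  refine MemLp.of_bound ((measurable_clipGrad_const w κ).inner
    measurable_const).aestronglyMeasurable (κ * b * ‖u‖) ?_
  filter_upwards [hD.norm_clipGrad_le hκ w] with z hz
  exact (norm_inner_le_norm _ _).trans (by gcongr)

theorem IsBounded.integral_inner_clipGrad {κ : ℝ} (hκ : 0 < κ) (w u : Vec d) :
    ∫ z, inner ℝ (clipGrad z w κ) u ∂D = inner ℝ (gradMean D w κ) u := by
  have := integral_inner (𝕜 := ℝ) (hD.integrable_clipGrad hκ w) u
  rw [gradMean, real_inner_comm, ← this]
  exact integral_congr_ae (Filter.Eventually.of_forall fun z => real_inner_comm _ _)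

theorem IsBounded.integral_inner_clipGrad_sq_le {κ : ℝ} (hκ : 0 < κ) (w u : Vec d) :
    ∫ z, inner ℝ (clipGrad z w κ) u ^ 2 ∂D ≤ κ ^ 2 * C₁ * ‖u‖ ^ 2 := by
  have h1 := hD.integral_inner_sq_le u
  calc _ ≤ ∫ z, κ ^ 2 * inner ℝ z.1 u ^ 2 ∂D := by
        refine integral_mono (hD.memLp_inner_clipGrad hκ w u).integrable_sq
          ((hD.memLp_inner u 2).integrable_sq.const_mul _) fun z => ?_
        simp only [clipGrad, real_inner_smul_left, mul_pow]
        have h2 := abs_clipFun_le hκ (inner ℝ z.1 w - z.2)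
        have h3 : clipFun κ (inner ℝ z.1 w - z.2) ^ 2 ≤ κ ^ 2 := by
          rw [← sq_abs]; gcongr
        gcongr
    _ ≤ _ := by rw [integral_const_mul]; nlinarith [sq_nonneg κ]

/-- Testing in the direction of the mean G itself, ‖G‖⁴ is the square of an expectation and hence at
most the second moment κ²C₁‖G‖². In contrast to the almost sure bound κb, this does not grow with
the dimension. -/
theorem IsBounded.norm_gradMean_sq_le {κ : ℝ} (hκ : 0 < κ) (w : Vec d) :
    ‖gradMean D w κ‖ ^ 2 ≤ κ ^ 2 * C₁ := by
  have := hD.prob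
  set G := gradMean D w κ with hG
  have h1 := hD.integral_inner_clipGrad hκ w G
  have h2 := hD.integral_inner_clipGrad_sq_le hκ w G
  rw [← hG, real_inner_self_eq_norm_sq] at h1
  have h3 : (∫ z, inner ℝ (clipGrad z w κ) G ∂D) ^ 2 ≤ ∫ z, inner ℝ (clipGrad z w κ) G ^ 2 ∂D := by
    have := variance_nonneg (fun z => inner ℝ (clipGrad z w κ) G) D
    rw [variance_eq_sub (hD.memLp_inner_clipGrad hκ w G)] at this
    simpa using this
  rw [h1] at h3
  rcases (sq_nonneg ‖G‖).eq_or_lt with h0 | h0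
  · rw [← h0]
    have hC : 0 ≤ C₁ := (norm_nonneg _).trans hD.secondMoment_le
    positivity
  · refine le_of_mul_le_mul_right ?_ h0
    nlinarith

theorem IsBounded.norm_gradMean_le {κ : ℝ} (hκ : 0 < κ) (w : Vec d) :
    ‖gradMean D w κ‖ ≤ κ * b := by
  have := hD.prob
  have := norm_integral_le_of_norm_le_const (hD.norm_clipGrad_le hκ w)
  rw [gradMean]
  simpa using this

-- The expected gradient is needed at iterates and clipping levels that are themselves random, so it
-- must be measurable in both before `measure_freeze` applies.
omit hD in
theorem measurable_gradMean [SFinite D] {α : Type*} [MeasurableSpace α] {w : α → Vec d}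
    (hw : Measurable w) {κ : α → ℝ} (hκ : Measurable κ) :
    Measurable fun p => gradMean D (w p) (κ p) := by
  have h : StronglyMeasurable fun q : α × Sample d => clipGrad q.2 (w q.1) (κ q.1) :=
    (measurable_clipGrad (ι := Unit) (F := fun (q : α × Sample d) _ => q.2)
      (fun _ => measurable_snd) (hw.comp measurable_fst) (hκ.comp measurable_fst)
      ()).stronglyMeasurable
  exact h.integral_prod_right'.measurable

end Moments

/- ## The bias of the clipped gradient -/

/-- In this form monotonicity and the Lipschitz constant 1 are evident. -/
theorem clipFun_eq_max_min {κ : ℝ} (hκ : 0 < κ) (t : ℝ) :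
    clipFun κ t = max (-κ) (min κ t) := by
  rcases le_total κ t with h | h
  · rw [clipFun_of_ge hκ h, min_eq_left h, max_eq_right (by linarith)]
  rcases le_total t (-κ) with h' | h'
  · rw [clipFun_of_le_neg hκ h', min_eq_right h, max_eq_left h']
  · rw [clipFun_of_le hκ (abs_le.2 ⟨h', h⟩), min_eq_right h, max_eq_right h']

theorem clipFun_mono {κ : ℝ} (hκ : 0 < κ) : Monotone (clipFun κ) := by
  intro s t hst
  rw [clipFun_eq_max_min hκ, clipFun_eq_max_min hκ]
  exact max_le_max le_rfl (min_le_min le_rfl hst)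

theorem clipFun_sub_le {κ : ℝ} (hκ : 0 < κ) {s t : ℝ} (hst : s ≤ t) :
    clipFun κ t - clipFun κ s ≤ t - s := by
  rw [clipFun_eq_max_min hκ, clipFun_eq_max_min hκ]
  rcases le_total κ t with h | h <;> rcases le_total κ s with h' | h' <;>
  rcases le_total (-κ) t with h1 | h1 <;> rcases le_total (-κ) s with h2 | h2 <;>
  simp [h, h', h1, h2] <;> grind

/-- Averaging over the sign of the noise is the point. If |a| and |η| are at most κ/2, nothing is
clipped and the error is zero. Otherwise 1 ≤ 4(a² + η²)/κ², and the error is at most |a| because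
clipping is monotone and 1-Lipschitz. The factor |a| makes the bias proportional to the signal,
however large the noise. -/
theorem abs_symm_clip_sub_le {κ : ℝ} (hκ : 0 < κ) (a η : ℝ) :
    |(clipFun κ (a - η) + clipFun κ (a + η)) / 2 - a| ≤ 4 / κ ^ 2 * (|a| * (a ^ 2 + η ^ 2)) := by
  by_cases h : |a| ≤ κ / 2 ∧ |η| ≤ κ / 2
  · obtain ⟨ha, hη⟩ := h
    rw [abs_le] at ha hη
    rw [clipFun_of_le hκ (abs_le.2 ⟨by linarith, by linarith⟩),
      clipFun_of_le hκ (abs_le.2 ⟨by linarith, by linarith⟩)]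
    have : (a - η + (a + η)) / 2 - a = 0 := by ring
    rw [this, abs_zero]
    positivity
  · have h1 : κ ^ 2 ≤ 4 * (a ^ 2 + η ^ 2) := by
      rcases not_and_or.1 h with h | h
      · nlinarith [not_le.1 h, sq_abs a, abs_nonneg a, sq_nonneg η]
      · nlinarith [not_le.1 h, sq_abs η, abs_nonneg η, sq_nonneg a]
    have h2 : |(clipFun κ (a - η) + clipFun κ (a + η)) / 2 - a| ≤ |a| := by
      have e : clipFun κ (a - η) = -clipFun κ (η - a) := by
        rw [← clipFun_neg]; congr 1; ring
      rw [e, add_comm a η]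
      rcases le_total 0 a with ha | ha
      · have m1 := clipFun_mono hκ (show η - a ≤ η + a by linarith)
        have m2 := clipFun_sub_le hκ (show η - a ≤ η + a by linarith)
        rw [abs_of_nonneg ha, abs_le]; constructor <;> linarith
      · have m1 := clipFun_mono hκ (show η + a ≤ η - a by linarith)
        have m2 := clipFun_sub_le hκ (show η + a ≤ η - a by linarith)
        rw [abs_of_nonpos ha, abs_le]; constructor <;> linarith
    refine h2.trans ?_
    have h3 : 1 ≤ 4 / κ ^ 2 * (a ^ 2 + η ^ 2) := by
      rw [div_mul_eq_mul_div, le_div_iff₀ (by positivity)]; linarith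
    calc |a| = |a| * 1 := (mul_one _).symm
      _ ≤ |a| * (4 / κ ^ 2 * (a ^ 2 + η ^ 2)) := by gcongr
      _ = _ := by ring

/-- Young's inequality with exponents 4/3 and 4 and a free weight `t`. -/
theorem cube_mul_le {t a b : ℝ} (ht : 0 < t) :
    |a| ^ 3 * |b| ≤ (3 * t * a ^ 4 + (t ^ 3)⁻¹ * b ^ 4) / 4 := by
  set B := |b| / t with hB
  have hb : |b| = t * B := by rw [hB]; field_simp
  have hb4 : b ^ 4 = t ^ 4 * B ^ 4 := by
    rw [show b ^ 4 = |b| ^ 4 by rw [show (4 : ℕ) = 2 * 2 by rfl, pow_mul, pow_mul, sq_abs], hb]; ring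
  have ha4 : a ^ 4 = |a| ^ 4 := by rw [show (4 : ℕ) = 2 * 2 by rfl, pow_mul, pow_mul, sq_abs]
  rw [hb4, hb, ha4]
  have hB0 : 0 ≤ B := by positivity
  have key : |a| ^ 3 * B ≤ (3 * |a| ^ 4 + B ^ 4) / 4 := by
    -- With x = |a|, 3x⁴ + B⁴ - 4x³B = (x - B)²(3x² + 2xB + B²).
    nlinarith [mul_nonneg (sq_nonneg (|a| - B))
      (show 0 ≤ 3 * |a| ^ 2 + 2 * |a| * B + B ^ 2 by positivity)]
  calc |a| ^ 3 * (t * B) = t * (|a| ^ 3 * B) := by ring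
    _ ≤ t * ((3 * |a| ^ 4 + B ^ 4) / 4) := by gcongr
    _ = _ := by field_simp

section Bias

variable {d : ℕ} {C C₁ σ b : ℝ} {D : Measure (Sample d)} {w₀ : Vec d}
  (hB : IsBounded D C₁ b) (hM : IsRegressionModel C C₁ σ D w₀)

/-- The mean squared signal. -/
def signal (D : Measure (Sample d)) (v : Vec d) : ℝ := ∫ z, inner ℝ z.1 v ^ 2 ∂D

theorem signal_nonneg (v : Vec d) : 0 ≤ signal D v := integral_nonneg fun _ => sq_nonneg _

include hB in
theorem IsBounded.signal_le (v : Vec d) : signal D v ≤ C₁ * ‖v‖ ^ 2 := hB.integral_inner_sq_le v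

include hB hM in
theorem norm_sq_le_signal (v : Vec d) : ‖v‖ ^ 2 ≤ signal D v := by
  by_cases hv : v = 0
  · rw [hv, norm_zero]; simpa using signal_nonneg 0
  have hvn : ‖v‖ ≠ 0 := norm_ne_zero_iff.2 hv
  have h1 := hM.one_le_secondMoment (‖v‖⁻¹ • v) (by
    rw [norm_smul, norm_inv, norm_norm, inv_mul_cancel₀ hvn])
  have h2 := hB.inner_secondMoment (‖v‖⁻¹ • v) (‖v‖⁻¹ • v)
  have h3 : inner ℝ (‖v‖⁻¹ • v) (Matrix.toEuclideanLin (secondMoment D) (‖v‖⁻¹ • v)) =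
      ∑ a, ∑ c, (‖v‖⁻¹ • v) a * secondMoment D a c * (‖v‖⁻¹ • v) c := by
    simp only [PiLp.inner_apply, Matrix.toLpLin_apply, Matrix.mulVec, dotProduct,
      RCLike.inner_apply, conj_trivial, Finset.sum_mul]
    exact Finset.sum_congr rfl fun a _ => Finset.sum_congr rfl fun c _ => by ring
  rw [← h3, h2] at h1
  simp only [real_inner_smul_right] at h1
  have h4 : ∫ z : Sample d, ‖v‖⁻¹ * inner ℝ z.1 v * (‖v‖⁻¹ * inner ℝ z.1 v) ∂D =
      (‖v‖ ^ 2)⁻¹ * signal D v := by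
    rw [signal, ← integral_const_mul]
    refine integral_congr_ae (Filter.Eventually.of_forall fun z => ?_)
    simp only
    rw [← inv_pow]; ring
  rw [h4, inv_mul_eq_div, le_div_iff₀ (by positivity)] at h1
  linarith

theorem measurable_noise (w₀ : Vec d) : Measurable (noise (d := d) w₀) :=
  measurable_snd.sub (measurable_const.inner measurable_fst)

theorem residual_eq (w w₀ : Vec d) (z : Sample d) :
    inner ℝ z.1 w - z.2 = inner ℝ z.1 (w - w₀) - noise w₀ z := by
  rw [noise, inner_sub_right, real_inner_comm z.1 w₀]; ring

include hM in
/-- The noise may be replaced by its negative. -/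
theorem integral_noise_symm [IsProbabilityMeasure D] {F : ℝ × Vec d → ℝ} (hF : Measurable F) :
    ∫ z, F (noise w₀ z, z.1) ∂D = ∫ z, F (-noise w₀ z, z.1) ∂D := by
  have hm := measurable_noise w₀
  have h1 := (indepFun_iff_map_prod_eq_prod_map_map hm.aemeasurable
    measurable_fst.aemeasurable).1 hM.noise_indep
  have h2 := (indepFun_iff_map_prod_eq_prod_map_map hm.neg.aemeasurable
    measurable_fst.aemeasurable).1 (hM.noise_indep.comp measurable_neg measurable_id)
  have h3 : D.map (fun z => (noise w₀ z, z.1)) = D.map (fun z => (-noise w₀ z, z.1)) := by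
    rw [h1, hM.noise_symm]; exact h2.symm
  have e1 := integral_map (μ := D) (hm.prodMk measurable_fst).aemeasurable
    (f := F) hF.aestronglyMeasurable
  have e2 := integral_map (μ := D) (hm.neg.prodMk measurable_fst).aemeasurable
    (f := F) hF.aestronglyMeasurable
  rw [← e1, h3]
  exact e2

-- A Hölder inequality followed by hypercontractivity: fourth moments are at most C times squared
-- second moments, which are bounded by C₁. Young's inequality with an optimized weight takes the
-- place of Hölder.
include hB hM in
theorem integral_cube_mul_le (hC : 0 ≤ C) (u v : Vec d) :
    ∫ z : Sample d, |inner ℝ z.1 v| ^ 3 * |inner ℝ z.1 u| ∂D ≤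
      C * signal D v * (C₁ * ‖v‖ * ‖u‖) := by
  have hC₁ : 0 ≤ C₁ := (norm_nonneg _).trans hB.secondMoment_le
  by_cases hv : v = 0
  · simp [hv]
  by_cases hu : u = 0
  · simp [hu]
  have hQ : 0 < signal D v := lt_of_lt_of_le (by positivity) (norm_sq_le_signal hB hM v)
  have hR : 0 < signal D u := lt_of_lt_of_le (by positivity) (norm_sq_le_signal hB hM u)
  set s := Real.sqrt (signal D v) with hs
  set r := Real.sqrt (signal D u) with hr
  have hs0 : 0 < s := Real.sqrt_pos.2 hQ
  have hr0 : 0 < r := Real.sqrt_pos.2 hR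
  have hs2 : s ^ 2 = signal D v := Real.sq_sqrt hQ.le
  have hr2 : r ^ 2 = signal D u := Real.sq_sqrt hR.le
  have hsr : s * r ≤ C₁ * ‖v‖ * ‖u‖ := by
    refine abs_le_of_sq_le_sq' ?_ (by positivity) |>.2
    rw [mul_pow, hs2, hr2]
    calc _ ≤ (C₁ * ‖v‖ ^ 2) * (C₁ * ‖u‖ ^ 2) :=
          mul_le_mul (hB.signal_le v) (hB.signal_le u) hR.le (by positivity)
      _ = _ := by ring
  -- The weight r/s makes both terms of Young's inequality of order s³r.
  have ht : 0 < r / s := by positivity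
  have hi4 : ∀ x : Vec d, Integrable (fun z : Sample d => inner ℝ z.1 x ^ 4) D := fun x => by
    have := (hB.memLp_inner x 4).integrable_norm_pow (by norm_num)
    refine this.congr (Filter.Eventually.of_forall fun z => ?_)
    simp only [Real.norm_eq_abs]
    exact Even.pow_abs (by decide) _
  have h1 : ∫ z : Sample d, |inner ℝ z.1 v| ^ 3 * |inner ℝ z.1 u| ∂D ≤
      ∫ z : Sample d, (3 * (r / s) * inner ℝ z.1 v ^ 4 +
        ((r / s) ^ 3)⁻¹ * inner ℝ z.1 u ^ 4) / 4 ∂D := by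
    refine integral_mono_of_nonneg (Filter.Eventually.of_forall fun z => by positivity)
      ((((hi4 v).const_mul _).add ((hi4 u).const_mul _)).div_const _)
      (Filter.Eventually.of_forall fun z => cube_mul_le ht)
  rw [integral_div, integral_add ((hi4 v).const_mul _) ((hi4 u).const_mul _), integral_const_mul,
    integral_const_mul] at h1
  have hv4 : ∫ z : Sample d, inner ℝ z.1 v ^ 4 ∂D ≤ C * (s ^ 2) ^ 2 := by
    rw [hs2]; exact hM.hypercontractive v
  have hu4 : ∫ z : Sample d, inner ℝ z.1 u ^ 4 ∂D ≤ C * (r ^ 2) ^ 2 := by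
    rw [hr2]; exact hM.hypercontractive u
  refine h1.trans ?_
  calc _ ≤ (3 * (r / s) * (C * (s ^ 2) ^ 2) + ((r / s) ^ 3)⁻¹ * (C * (r ^ 2) ^ 2)) / 4 := by gcongr
    _ = C * s ^ 2 * (s * r) := by field_simp; ring
    _ ≤ _ := by rw [hs2]; gcongr

-- Independence separates the noise from the input. The remaining product is bounded by AM–GM with
-- weights that balance ‖u‖ and ‖v‖.
include hB hM in
theorem integral_noise_sq_mul_le (u v : Vec d) :
    ∫ z : Sample d, noise w₀ z ^ 2 * (|inner ℝ z.1 v| * |inner ℝ z.1 u|) ∂D ≤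
      σ ^ 2 * (C₁ * ‖v‖ * ‖u‖) := by
  have hC₁ : 0 ≤ C₁ := (norm_nonneg _).trans hB.secondMoment_le
  have hi : IndepFun (fun z => noise w₀ z ^ 2)
      (fun z : Sample d => |inner ℝ z.1 v| * |inner ℝ z.1 u|) D :=
    hM.noise_indep.comp (φ := fun t => t ^ 2) (ψ := fun x => |inner ℝ x v| * |inner ℝ x u|)
      (by fun_prop) (by fun_prop)
  rw [hi.integral_fun_mul_eq_mul_integral
    ((measurable_noise w₀).pow_const 2).aestronglyMeasurable (by fun_prop)]
  have h2 : ∫ z : Sample d, |inner ℝ z.1 v| * |inner ℝ z.1 u| ∂D ≤ C₁ * ‖v‖ * ‖u‖ := by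
    by_cases hv : v = 0
    · simp [hv]
    by_cases hu : u = 0
    · simp [hu]
    have hvp := norm_pos_iff.2 hv
    have hup := norm_pos_iff.2 hu
    have h3 : ∫ z : Sample d, |inner ℝ z.1 v| * |inner ℝ z.1 u| ∂D ≤
        ∫ z : Sample d, (‖u‖ / ‖v‖ * inner ℝ z.1 v ^ 2 + ‖v‖ / ‖u‖ * inner ℝ z.1 u ^ 2) / 2 ∂D := by
      refine integral_mono_of_nonneg (Filter.Eventually.of_forall fun z => by positivity)
        ((((hB.memLp_inner v 2).integrable_sq.const_mul _).add
          ((hB.memLp_inner u 2).integrable_sq.const_mul _)).div_const _)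
        (Filter.Eventually.of_forall fun z => ?_)
      simp only
      rw [← sq_abs (inner ℝ z.1 v), ← sq_abs (inner ℝ z.1 u)]
      rw [le_div_iff₀ (by norm_num), div_mul_eq_mul_div, div_mul_eq_mul_div,
        div_add_div _ _ hvp.ne' hup.ne', le_div_iff₀ (by positivity)]
      nlinarith [sq_nonneg (‖u‖ * |inner ℝ z.1 v| - ‖v‖ * |inner ℝ z.1 u|)]
    rw [integral_div, integral_add ((hB.memLp_inner v 2).integrable_sq.const_mul _)
      ((hB.memLp_inner u 2).integrable_sq.const_mul _), integral_const_mul,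
      integral_const_mul] at h3
    refine h3.trans ?_
    calc _ ≤ (‖u‖ / ‖v‖ * (C₁ * ‖v‖ ^ 2) + ‖v‖ / ‖u‖ * (C₁ * ‖u‖ ^ 2)) / 2 := by
          gcongr
          · exact hB.integral_inner_sq_le v
          · exact hB.integral_inner_sq_le u
      _ = _ := by field_simp; ring
  refine mul_le_mul hM.noise_var h2 (integral_nonneg fun _ => by positivity) (sq_nonneg _)

-- The bias g is tested in its own direction. Symmetry of the noise replaces the clipped residual by
-- the average over both signs, whose distance from the signal is bounded pointwise by
-- `abs_symm_clip_sub_le`. The signal part of that bound is a third power, controlled by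
-- hypercontractivity; the noise part factors by independence.
include hB hM in
theorem norm_gradMean_sub_le (hC : 0 ≤ C) {κ : ℝ} (hκ : 0 < κ) (w : Vec d) :
    ‖gradMean D w κ - Matrix.toEuclideanLin (secondMoment D) (w - w₀)‖ ≤
      4 / κ ^ 2 * ((C * signal D (w - w₀) + σ ^ 2) * (C₁ * ‖w - w₀‖)) := by
  have := hB.prob
  set v := w - w₀ with hv
  set g := gradMean D w κ - Matrix.toEuclideanLin (secondMoment D) v with hg
  have hmn := measurable_noise w₀
  have hbd : ∀ s : ℝ, ∀ u : Vec d, Integrable (fun z : Sample d =>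
      clipFun κ (inner ℝ z.1 v + s * noise w₀ z) * inner ℝ z.1 u) D := by
    intro s u
    refine Integrable.of_bound (((measurable_clipFun measurable_const
      ((measurable_inner_fst v).add (hmn.const_mul s))).mul
      (measurable_inner_fst u)).aestronglyMeasurable) (κ * (b * ‖u‖)) ?_
    filter_upwards [hB.norm_le] with z hz
    rw [norm_mul]
    exact mul_le_mul (abs_clipFun_le hκ _) ((norm_inner_le_norm _ _).trans (by gcongr))
      (norm_nonneg _) hκ.le
  have hab : Integrable (fun z : Sample d => inner ℝ z.1 v * inner ℝ z.1 g) D :=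
    (hB.memLp_inner v 2).integrable_mul (hB.memLp_inner g 2)
  have e1 : inner ℝ g g = ∫ z : Sample d,
      ((clipFun κ (inner ℝ z.1 v - noise w₀ z) + clipFun κ (inner ℝ z.1 v + noise w₀ z)) / 2 -
        inner ℝ z.1 v) * inner ℝ z.1 g ∂D := by
    have h1 : inner ℝ g g = inner ℝ (gradMean D w κ) g -
        inner ℝ (Matrix.toEuclideanLin (secondMoment D) v) g := by
      conv_lhs => rw [hg, inner_sub_left]
    have h2 : inner ℝ (gradMean D w κ) g =
        ∫ z : Sample d, clipFun κ (inner ℝ z.1 v - noise w₀ z) * inner ℝ z.1 g ∂D := by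
      rw [← hB.integral_inner_clipGrad hκ]
      refine integral_congr_ae (Filter.Eventually.of_forall fun z => ?_)
      simp only [clipGrad, real_inner_smul_left]
      rw [residual_eq w w₀]
    have h3 : ∫ z : Sample d, clipFun κ (inner ℝ z.1 v - noise w₀ z) * inner ℝ z.1 g ∂D =
        ∫ z : Sample d, clipFun κ (inner ℝ z.1 v + noise w₀ z) * inner ℝ z.1 g ∂D := by
      have := integral_noise_symm hM
        (F := fun p => clipFun κ (inner ℝ p.2 v - p.1) * inner ℝ p.2 g) (by
          refine (measurable_clipFun measurable_const ?_).mul ?_ <;> fun_prop)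
      simpa using this
    have h4 : inner ℝ (Matrix.toEuclideanLin (secondMoment D) v) g =
        ∫ z : Sample d, inner ℝ z.1 v * inner ℝ z.1 g ∂D := by
      rw [real_inner_comm, hB.inner_secondMoment]
      exact integral_congr_ae (Filter.Eventually.of_forall fun z => mul_comm _ _)
    have i1 := hbd (-1) g
    have i2 := hbd 1 g
    simp only [neg_one_mul, ← sub_eq_add_neg, one_mul] at i1 i2
    have h5 : ∫ z : Sample d,
      ((clipFun κ (inner ℝ z.1 v - noise w₀ z) + clipFun κ (inner ℝ z.1 v + noise w₀ z)) / 2 -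
        inner ℝ z.1 v) * inner ℝ z.1 g ∂D =
      ∫ z : Sample d, ((clipFun κ (inner ℝ z.1 v - noise w₀ z) * inner ℝ z.1 g +
        clipFun κ (inner ℝ z.1 v + noise w₀ z) * inner ℝ z.1 g) / 2 -
        inner ℝ z.1 v * inner ℝ z.1 g) ∂D :=
      integral_congr_ae (Filter.Eventually.of_forall fun z => by simp only; ring)
    have i12 : Integrable (fun z : Sample d => clipFun κ (inner ℝ z.1 v - noise w₀ z) * inner ℝ z.1 g +
        clipFun κ (inner ℝ z.1 v + noise w₀ z) * inner ℝ z.1 g) D := i1.add i2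
    rw [h5, integral_sub (i12.div_const 2) hab, integral_div, integral_add i1 i2, ← h3,
      ← h2, h1, h4]
    ring
  have i3 : Integrable (fun z : Sample d => |inner ℝ z.1 v| ^ 3 * |inner ℝ z.1 g|) D := by
    refine Integrable.of_bound (by fun_prop) ((b * ‖v‖) ^ 3 * (b * ‖g‖)) ?_
    filter_upwards [hB.norm_le] with z hz
    rw [norm_mul, norm_pow, Real.norm_eq_abs, Real.norm_eq_abs, abs_abs, abs_abs]
    have hb0 := (norm_nonneg _).trans hz
    have k1 : |inner ℝ z.1 v| ≤ b * ‖v‖ := (abs_real_inner_le_norm _ _).trans (by gcongr)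
    have k2 : |inner ℝ z.1 g| ≤ b * ‖g‖ := (abs_real_inner_le_norm _ _).trans (by gcongr)
    gcongr
  have i4 : Integrable (fun z : Sample d => noise w₀ z ^ 2 * (|inner ℝ z.1 v| * |inner ℝ z.1 g|)) D := by
    refine hM.noise_memLp.integrable_sq.mul_bdd (c := (b * ‖v‖) * (b * ‖g‖)) (by fun_prop) ?_
    filter_upwards [hB.norm_le] with z hz
    rw [norm_mul, Real.norm_eq_abs, Real.norm_eq_abs, abs_abs, abs_abs]
    have hb0 := (norm_nonneg _).trans hz
    have k1 : |inner ℝ z.1 v| ≤ b * ‖v‖ := (abs_real_inner_le_norm _ _).trans (by gcongr)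
    have k2 : |inner ℝ z.1 g| ≤ b * ‖g‖ := (abs_real_inner_le_norm _ _).trans (by gcongr)
    gcongr
  have e2 : inner ℝ g g ≤ 4 / κ ^ 2 * ((C * signal D v + σ ^ 2) * (C₁ * ‖v‖)) * ‖g‖ := by
    rw [e1]
    calc _ ≤ ∫ z : Sample d, 4 / κ ^ 2 * (|inner ℝ z.1 v| ^ 3 * |inner ℝ z.1 g| +
            noise w₀ z ^ 2 * (|inner ℝ z.1 v| * |inner ℝ z.1 g|)) ∂D := by
          refine (le_abs_self _).trans (abs_integral_le_integral_abs.trans ?_)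
          refine integral_mono_of_nonneg (Filter.Eventually.of_forall fun z => abs_nonneg _)
            ((i3.add i4).const_mul _) (Filter.Eventually.of_forall fun z => ?_)
          simp only [abs_mul]
          have := abs_symm_clip_sub_le hκ (inner ℝ z.1 v) (noise w₀ z)
          calc _ ≤ 4 / κ ^ 2 * (|inner ℝ z.1 v| * (inner ℝ z.1 v ^ 2 + noise w₀ z ^ 2)) *
                |inner ℝ z.1 g| := by gcongr
            _ = _ := by rw [← sq_abs (inner ℝ z.1 v)]; ring
      _ ≤ 4 / κ ^ 2 * (C * signal D v * (C₁ * ‖v‖ * ‖g‖) + σ ^ 2 * (C₁ * ‖v‖ * ‖g‖)) := by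
          rw [integral_const_mul, integral_add i3 i4]
          gcongr
          · exact integral_cube_mul_le hB hM hC g v
          · exact integral_noise_sq_mul_le hB hM g v
      _ = _ := by ring
  rw [real_inner_self_eq_norm_sq] at e2
  rcases (norm_nonneg g).eq_or_lt with h0 | h0
  · rw [← h0]
    have hC₁ : 0 ≤ C₁ := (norm_nonneg _).trans hB.secondMoment_le
    have := signal_nonneg (D := D) v
    positivity
  · exact le_of_mul_le_mul_right (by nlinarith) h0

-- All eigenvalues of Σ lie in [1, C₁], so those of 1 - Σ/C₁ lie in [0, 1 - 1/C₁].
include hB hM in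
theorem norm_sub_secondMoment_le (hC₁ : 0 < C₁) (v : Vec d) :
    ‖v - (1 / C₁) • Matrix.toEuclideanLin (secondMoment D) v‖ ≤ (1 - 1 / C₁) * ‖v‖ := by
  set T := Matrix.toEuclideanLin (𝕜 := ℝ) (secondMoment D) with hTdef
  have hT : T.IsSymmetric := by
    rw [hTdef, Matrix.isSymmetric_toEuclideanLin_iff]
    ext a c
    simp only [Matrix.conjTranspose_apply, secondMoment, Matrix.of_apply, star_trivial]
    exact integral_congr_ae (Filter.Eventually.of_forall fun z => mul_comm _ _)
  obtain ⟨e⟩ := exists_eigenframe hT (W := ⊤) (fun _ _ => Submodule.mem_top)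
  have hval : ∀ i, e.val i = signal D (e.vec i) := by
    intro i
    have h1 := hB.inner_secondMoment (e.vec i) (e.vec i)
    have h2 : Matrix.toEuclideanLin (secondMoment D) (e.vec i) = e.val i • e.vec i := e.apply i
    rw [h2, inner_smul_right, real_inner_self_eq_norm_sq, e.orthonormal.1 i] at h1
    simp only [← sq] at h1
    simpa [signal] using h1
  have hlo : ∀ i, 1 ≤ e.val i := fun i => by
    rw [hval]
    have := norm_sq_le_signal hB hM (e.vec i)
    rwa [e.orthonormal.1 i, one_pow] at this
  have hhi : ∀ i, e.val i ≤ C₁ := fun i => by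
    rw [hval]
    have := hB.signal_le (e.vec i)
    rwa [e.orthonormal.1 i, one_pow, mul_one] at this
  by_cases hv : v = 0
  · simp [hv]
  have hne : Nonempty (Fin (Module.finrank ℝ (⊤ : Submodule ℝ (Vec d)))) := by
    by_contra hne
    rw [not_nonempty_iff] at hne
    have := e.repr v Submodule.mem_top
    simp at this
    exact hv this.symm
  have h0 : 0 ≤ 1 - 1 / C₁ := by
    obtain ⟨i⟩ := hne
    rw [sub_nonneg, div_le_one hC₁]
    exact (hlo i).trans (hhi i)
  refine abs_le_of_sq_le_sq' ?_ (by positivity) |>.2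
  rw [mul_pow, e.norm_sq (u := v - (1 / C₁) • T v) Submodule.mem_top,
    e.norm_sq (u := v) Submodule.mem_top, Finset.mul_sum]
  refine Finset.sum_le_sum fun i _ => ?_
  rw [inner_sub_right, inner_smul_right, e.inner_apply hT]
  have h1 : inner ℝ (e.vec i) v - 1 / C₁ * (e.val i * inner ℝ (e.vec i) v) =
      (1 - e.val i / C₁) * inner ℝ (e.vec i) v := by ring
  rw [h1, mul_pow]
  have h2 : 0 ≤ 1 - e.val i / C₁ := by
    rw [sub_nonneg, div_le_one hC₁]; exact hhi i
  have h3 : 1 - e.val i / C₁ ≤ 1 - 1 / C₁ := by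
    have : 1 / C₁ ≤ e.val i / C₁ := by gcongr; exact hlo i
    linarith
  gcongr

end Bias

/- ## The clipping parameter -/

section Clip

/-- Almost every claim about which samples a quantity uses is an instance of this. -/
theorem dependsOn_map {α β γ : Type} (a : Arr α) (f : Arr β → γ) :
    DependsOn (fun ω : α → β => f (a.map ω)) a.idx := by
  intro x y h
  change f (a.map x) = f (a.map y)
  rw [Arr.map_congr h]

variable {ι : Type} [Fintype ι] {d : ℕ} {ν : ι → Measure (Sample d)}
  [∀ i, IsProbabilityMeasure (ν i)] {C C₁ σ b : ℝ} {D : Measure (Sample d)} {w₀ : Vec d}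
  (hB : IsBounded D C₁ b) (hM : IsRegressionModel C C₁ σ D w₀)

include hB hM in
/-- The average squared residual of sufficiently many samples is correct up to constant factors
with constant probability. -/
theorem measure_avgSqResidual_le (hC : 0 < C) (hσ : 0 < σ) {a : Arr ι}
    (hD : ∀ t, ν (a.get t) = D) (hinj : Function.Injective a.get)
    (ha : 128 * C ≤ a.size) (w : Vec d) :
    Measure.pi ν {ω | ¬ (signal D (w - w₀) / 4 - 16 * σ ^ 2 ≤ avgSqResidual (a.map ω) w ∧
      avgSqResidual (a.map ω) w ≤ 64 * (signal D (w - w₀) + σ ^ 2))} ≤ ENNReal.ofReal (1 / 8) := by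
  have ha0 : 0 < a.size := by
    by_contra! h
    have h1 : a.size = 0 := by omega
    rw [h1] at ha
    simp at ha
    linarith
  have ha0' : (0 : ℝ) < a.size := by exact_mod_cast ha0
  have hp : IsProbabilityMeasure D := hB.prob
  set v := w - w₀ with hv
  set Q := signal D v with hQ
  have hQ0 : 0 ≤ Q := signal_nonneg v
  let s : Sample d → ℝ := fun z => inner ℝ z.1 v ^ 2
  let e : Sample d → ℝ := fun z => noise w₀ z ^ 2
  have hs2 : MemLp s 2 D := by
    have h1 := hB.memLp_inner v 4
    have h2 := h1.norm_rpow_div 2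
    refine (h2.congr_norm ?_ ?_ : MemLp s (4 / 2) D).mono_exponent ?_
    · exact ((measurable_inner_fst v).pow_const 2).aestronglyMeasurable
    · exact Filter.Eventually.of_forall fun z => by simp [s]
    · rw [ENNReal.le_div_iff_mul_le (by simp) (by simp)]; norm_num
  have hs1 : Integrable s D := hs2.integrable (by norm_num)
  have he1 : Integrable e D := hM.noise_memLp.integrable_sq
  let A : (Sample d → ℝ) → (ι → Sample d) → ℝ := fun h ω => (∑ t, h (ω (a.get t))) / a.size
  -- The failure probability 1/8 is 1/16 + 1/32 + 1/32. Large noise and a large residual are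
  -- excluded by Markov's inequality; a small average signal by Chebyshev's, where
  -- hypercontractivity bounds the variance of the squared signal and the size 128 C is used.
  have b1 : Measure.pi ν {ω | 16 * σ ^ 2 ≤ A e ω} ≤ ENNReal.ofReal (1 / 16) := by
    have h := measure_ge_le_of_integral_le (μ := Measure.pi ν) (X := A e) (v := σ ^ 2)
      (t := 16 * σ ^ 2) (integrable_average hD he1)
      (Filter.Eventually.of_forall fun ω =>
        div_nonneg (Finset.sum_nonneg fun t _ => sq_nonneg _) ha0'.le) (by positivity)
      (by rw [integral_average hD he1 ha0]; exact hM.noise_var)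
    refine h.trans (ENNReal.ofReal_le_ofReal (le_of_eq ?_))
    field_simp
  have b2 : Measure.pi ν {ω | A s ω < Q / 2} ≤ ENNReal.ofReal (1 / 32) := by
    rcases hQ0.eq_or_lt with h0 | hQpos
    · have : {ω : ι → Sample d | A s ω < Q / 2} = ∅ := by
        rw [← h0]
        refine Set.eq_empty_of_forall_notMem fun ω hω => ?_
        have h1 : A s ω < 0 / 2 := hω
        have h2 : 0 ≤ A s ω := div_nonneg (Finset.sum_nonneg fun t _ => sq_nonneg _) ha0'.le
        linarith
      rw [this]; simp
    have h := measure_abs_ge_le_of_integral_sq_le (μ := Measure.pi ν) (X := fun ω => A s ω - Q)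
      (v := C * Q ^ 2 / a.size) (t := Q / 2)
      (((memLp_average hD hs2).sub (memLp_const Q)).integrable_sq) (by positivity) (by
        refine (integral_average_sub_sq_le hD hinj hs2 ha0).trans ?_
        refine div_le_div_of_nonneg_right ?_ ha0'.le
        refine le_trans (le_of_eq ?_) (hM.hypercontractive v)
        exact integral_congr_ae (Filter.Eventually.of_forall fun z => by simp only [s]; ring))
    refine (measure_mono fun ω hω => ?_).trans (h.trans (ENNReal.ofReal_le_ofReal ?_))
    · have h1 : A s ω < Q / 2 := hω
      change Q / 2 ≤ |A s ω - Q|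
      rw [abs_of_nonpos (by linarith)]
      linarith
    · rw [div_div, div_le_div_iff₀ (by positivity) (by norm_num)]
      nlinarith [sq_nonneg Q]
  have b3 : Measure.pi ν {ω | 64 * (Q + σ ^ 2) ≤ A (fun z => 2 * s z + 2 * e z) ω} ≤
      ENNReal.ofReal (1 / 32) := by
    have hi : Integrable (fun z => 2 * s z + 2 * e z) D := (hs1.const_mul 2).add (he1.const_mul 2)
    have h := measure_ge_le_of_integral_le (μ := Measure.pi ν) (X := A fun z => 2 * s z + 2 * e z)
      (v := 2 * (Q + σ ^ 2)) (t := 64 * (Q + σ ^ 2)) (integrable_average hD hi)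
      (Filter.Eventually.of_forall fun ω =>
        div_nonneg (Finset.sum_nonneg fun t _ => by positivity) ha0'.le) (by positivity)
      (by
        rw [integral_average hD hi ha0, integral_add (hs1.const_mul 2) (he1.const_mul 2),
          integral_const_mul, integral_const_mul]
        have h1 : ∫ z, s z ∂D = Q := rfl
        have h2 : ∫ z, e z ∂D ≤ σ ^ 2 := hM.noise_var
        linarith)
    refine h.trans (ENNReal.ofReal_le_ofReal (le_of_eq ?_))
    have : Q + σ ^ 2 ≠ 0 := by positivity
    field_simp
    norm_num
  have hR : ∀ ω : ι → Sample d, avgSqResidual (a.map ω) w =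
      A (fun z => (inner ℝ z.1 v - noise w₀ z) ^ 2) ω := by
    intro ω
    change (∑ t : Fin a.size, (inner ℝ (ω (a.get t)).1 w - (ω (a.get t)).2) ^ 2) /
      (a.size : ℝ) = _
    simp only [residual_eq w w₀, A, ← hv]
  have hmono : ∀ (h h' : Sample d → ℝ), (∀ z, h z ≤ h' z) → ∀ ω, A h ω ≤ A h' ω :=
    fun h h' hh ω => div_le_div_of_nonneg_right (Finset.sum_le_sum fun t _ => hh _) ha0'.le
  have hsub : {ω | ¬ (Q / 4 - 16 * σ ^ 2 ≤ avgSqResidual (a.map ω) w ∧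
      avgSqResidual (a.map ω) w ≤ 64 * (Q + σ ^ 2))} ⊆
      ({ω | 16 * σ ^ 2 ≤ A e ω} ∪ {ω | A s ω < Q / 2}) ∪
        {ω | 64 * (Q + σ ^ 2) ≤ A (fun z => 2 * s z + 2 * e z) ω} := by
    intro ω hω
    by_contra hc
    simp only [Set.mem_union, not_or] at hc
    obtain ⟨⟨h1, h2⟩, h3⟩ := hc
    have h1 : A e ω < 16 * σ ^ 2 := not_le.1 h1
    have h2 : Q / 2 ≤ A s ω := not_lt.1 h2
    have h3 : A (fun z => 2 * s z + 2 * e z) ω < 64 * (Q + σ ^ 2) := not_le.1 h3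
    refine hω ?_
    rw [hR]
    constructor
    · have h4 : A (fun z => s z / 2 - e z) ω = A s ω / 2 - A e ω := by
        simp only [A, Finset.sum_sub_distrib, ← Finset.sum_div]; ring
      have h5 := hmono (fun z => s z / 2 - e z) (fun z => (inner ℝ z.1 v - noise w₀ z) ^ 2)
        (fun z => by simp only [s, e]; nlinarith [sq_nonneg (inner ℝ z.1 v - 2 * noise w₀ z)]) ω
      linarith
    · have h5 := hmono (fun z => (inner ℝ z.1 v - noise w₀ z) ^ 2) (fun z => 2 * s z + 2 * e z)
        (fun z => by simp only [s, e]; nlinarith [sq_nonneg (inner ℝ z.1 v + noise w₀ z)]) ω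
      linarith
  refine (measure_mono hsub).trans ((measure_union_le _ _).trans ?_)
  refine (add_le_add ((measure_union_le _ _).trans (add_le_add b1 b2)) b3).trans ?_
  rw [← ENNReal.ofReal_add (by norm_num) (by norm_num),
    ← ENNReal.ofReal_add (by norm_num) (by norm_num)]
  exact ENNReal.ofReal_le_ofReal (by norm_num)

-- A median of independent averages raises constant confidence to 1 - δ. The residual overestimates
-- the signal by noise only up to a constant factor, so κ² is of order signal plus σ², as the bias
-- bound and the accuracy bound both require.
include hB hM in
theorem measure_clipParam_le (hC : 0 < C) (hC₁ : 0 < C₁) (hσ : 0 < σ) {T : ℕ}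
    {δ : ℝ} (hδ : 0 < δ) (hδ1 : δ ≤ 1) (hT : 3 * Real.log (1 / δ) ≤ T) {a : Arr ι}
    (hD : ∀ t, ν (a.get t) = D) (hinj : Function.Injective a.get)
    (ha : 128 * C ≤ (a.size / T : ℕ)) {ε : ℝ} (hε : 0 < ε) (w : Vec d) :
    Measure.pi ν {ω | ¬ (8 * (C + 1) * C₁ * (signal D (w - w₀) + σ ^ 2) / ε ≤
        clipParam T (a.map ω) w ε σ C C₁ ^ 2 ∧
      clipParam T (a.map ω) w ε σ C C₁ ^ 2 ≤
        2592 * (C + 1) * C₁ * (signal D (w - w₀) + σ ^ 2) / ε)} ≤ ENNReal.ofReal δ := by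
  classical
  set Q := signal D (w - w₀) with hQ
  have hQ0 : 0 ≤ Q := signal_nonneg _
  let good : ℝ → Prop := fun x => Q / 4 - 16 * σ ^ 2 ≤ x ∧ x ≤ 64 * (Q + σ ^ 2)
  let E : Fin T → Set (ι → Sample d) := fun j =>
    {ω | ¬ good (avgSqResidual ((a.part T j).map ω) w)}
  have hm := measure_majority_le ν (E := E) (J := fun j => (a.part T j).idx) (fun j => by
      have h1 : Measurable fun ω : ι → Sample d => avgSqResidual ((a.part T j).map ω) w :=
        measurable_avgSqResidual (F := fun ω => ω) (fun i => measurable_pi_apply i)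
          measurable_const _
      exact ((measurableSet_le measurable_const h1).inter
        (measurableSet_le h1 measurable_const)).compl)
    (fun i j hij => Arr.disjoint_part hinj T hij)
    (fun j => dependsOn_map (a.part T j) fun A : Batch d => ¬ good (avgSqResidual A w))
    (fun j => measure_avgSqResidual_le hB hM hC hσ (a := a.part T j) (fun t => hD _)
      (Arr.part_injective hinj T j) ha w) hδ hδ1 hT
  refine (measure_mono fun ω hω => ?_).trans hm
  by_contra hlt
  replace hlt : 2 * (Finset.univ.filter fun j => ω ∈ E j).card < T := by
    have h1 : ¬ (T ≤ _) := hlt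
    convert Nat.lt_of_not_le h1
  refine hω ?_
  set x : Fin T → ℝ := fun j => avgSqResidual ((a.map ω).part T j) w with hx
  have hE : ∀ j, ω ∈ E j ↔ ¬ good (x j) := fun j => Iff.rfl
  have h1 : Q / 4 - 16 * σ ^ 2 ≤ median x := by
    refine le_median_of_card x (lt_of_le_of_lt (Nat.mul_le_mul_left 2 (Finset.card_le_card ?_)) hlt)
    intro j hj
    simp only [Finset.mem_filter, Finset.mem_univ, true_and, hE] at hj ⊢
    exact fun h => absurd h.1 (not_le.2 hj)
  have h2 : median x ≤ 64 * (Q + σ ^ 2) := by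
    refine median_le_of_card x (lt_of_le_of_lt (Nat.mul_le_mul_left 2 (Finset.card_le_card ?_)) hlt)
    intro j hj
    simp only [Finset.mem_filter, Finset.mem_univ, true_and, hE] at hj ⊢
    exact fun h => absurd h.2 (not_le.2 hj)
  have h3 : 0 ≤ 32 * (C + 1) * C₁ * (median x + 17 * σ ^ 2) / ε := by
    have : 0 ≤ median x + 17 * σ ^ 2 := by nlinarith [sq_nonneg σ]
    positivity
  have h4 : clipParam T (a.map ω) w ε σ C C₁ ^ 2 =
      32 * (C + 1) * C₁ * (median x + 17 * σ ^ 2) / ε := Real.sq_sqrt h3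
  rw [h4]
  have h5 : 0 < (C + 1) * C₁ := by positivity
  -- The shift 17σ² compensates for the loss 16σ² in the lower bound of the median. In the upper
  -- bound 32(64 + 17) = 2592.
  constructor
  · gcongr ?_ / _
    nlinarith [sq_nonneg σ]
  · gcongr ?_ / _
    nlinarith [sq_nonneg σ]

end Clip

/- ## Averages of clipped gradients -/

section AvgClipGrad

variable {ι : Type} {d : ℕ}

theorem measurable_avgClipGrad_const (a : Arr ι) (w : Vec d) (κ : ℝ) :
    Measurable fun ω : ι → Sample d => avgClipGrad (a.map ω) w κ :=
  measurable_avgClipGrad (F := fun ω => ω) (fun i => measurable_pi_apply i) measurable_const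
    measurable_const a

theorem avgClipGrad_map (a : Arr ι) (ω : ι → Sample d) (w : Vec d) (κ : ℝ) :
    avgClipGrad (a.map ω) w κ = (1 / (a.size : ℝ)) • ∑ t, clipGrad (ω (a.get t)) w κ := rfl

theorem inner_avgClipGrad (a : Arr ι) (ω : ι → Sample d) (w u : Vec d) (κ : ℝ) :
    inner ℝ (avgClipGrad (a.map ω) w κ) u =
      (∑ t, inner ℝ (clipGrad (ω (a.get t)) w κ) u) / a.size := by
  rw [avgClipGrad_map, real_inner_smul_left, sum_inner]; ring

variable [Fintype ι] {ν : ι → Measure (Sample d)} [∀ i, IsProbabilityMeasure (ν i)]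
  {C₁ b : ℝ} {D : Measure (Sample d)} (hB : IsBounded D C₁ b) {κ : ℝ} (hκ : 0 < κ)
  {a : Arr ι} (hD : ∀ t, ν (a.get t) = D) (w : Vec d)

include hB hκ hD

theorem norm_avgClipGrad_le :
    ∀ᵐ ω ∂(Measure.pi ν), ‖avgClipGrad (a.map ω) w κ‖ ≤ κ * b := by
  have h0 : 0 ≤ κ * b := (norm_nonneg _).trans (hB.norm_gradMean_le hκ w)
  have h1 : ∀ᵐ ω ∂(Measure.pi ν), ∀ t, ‖clipGrad (ω (a.get t)) w κ‖ ≤ κ * b :=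
    ae_all_iff.2 fun t => ae_comp_eval ν (p := fun z => ‖clipGrad z w κ‖ ≤ κ * b)
      (by rw [hD]; exact hB.norm_clipGrad_le hκ w)
  filter_upwards [h1] with ω hω
  rw [avgClipGrad_map, norm_smul, Real.norm_of_nonneg (by positivity)]
  have h2 : ‖∑ t, clipGrad (ω (a.get t)) w κ‖ ≤ a.size * (κ * b) := by
    refine (norm_sum_le _ _).trans ((Finset.sum_le_sum fun t _ => hω t).trans ?_)
    simp
  rcases Nat.eq_zero_or_pos a.size with hs | hs
  · have hs' : (a.size : ℝ) = 0 := by exact_mod_cast hs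
    rw [hs']; simpa using h0
  · have hs' : (0 : ℝ) < a.size := by exact_mod_cast hs
    rw [one_div, inv_mul_le_iff₀ hs']
    exact h2

theorem memLp_inner_avgClipGrad (u : Vec d) :
    MemLp (fun ω : ι → Sample d => inner ℝ (avgClipGrad (a.map ω) w κ) u) 2 (Measure.pi ν) := by
  simp only [inner_avgClipGrad]
  exact memLp_average hD (hB.memLp_inner_clipGrad hκ w u)

theorem integral_inner_avgClipGrad (ha : 0 < a.size) (u : Vec d) :
    ∫ ω, inner ℝ (avgClipGrad (a.map ω) w κ) u ∂(Measure.pi ν) =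
      inner ℝ (gradMean D w κ) u := by
  have := hB.prob
  simp only [inner_avgClipGrad]
  rw [integral_average (h := fun z => inner ℝ (clipGrad z w κ) u) hD
    ((hB.memLp_inner_clipGrad hκ w u).integrable (by norm_num)) ha,
    hB.integral_inner_clipGrad hκ w u]

theorem integral_inner_avgClipGrad_sq_le (ha : 0 < a.size) (u : Vec d) :
    ∫ ω, inner ℝ (avgClipGrad (a.map ω) w κ) u ^ 2 ∂(Measure.pi ν) ≤ κ ^ 2 * C₁ * ‖u‖ ^ 2 := by
  simp only [inner_avgClipGrad]
  exact (integral_average_sq_le hD (hB.memLp_inner_clipGrad hκ w u) ha).trans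
    (hB.integral_inner_clipGrad_sq_le hκ w u)

theorem integral_inner_avgClipGrad_sub_sq_le (hinj : Function.Injective a.get) (ha : 0 < a.size)
    (u : Vec d) :
    ∫ ω, inner ℝ (avgClipGrad (a.map ω) w κ - gradMean D w κ) u ^ 2 ∂(Measure.pi ν) ≤
      κ ^ 2 * C₁ / a.size * ‖u‖ ^ 2 := by
  simp only [inner_sub_left, inner_avgClipGrad, ← hB.integral_inner_clipGrad hκ w u]
  refine (integral_average_sub_sq_le hD hinj (hB.memLp_inner_clipGrad hκ w u) ha).trans ?_
  have ha' : (0 : ℝ) < a.size := by exact_mod_cast ha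
  rw [div_mul_eq_mul_div]
  exact div_le_div_of_nonneg_right (hB.integral_inner_clipGrad_sq_le hκ w u) ha'.le

end AvgClipGrad

/- ## Concentration of the cross matrix -/

section CrossMatrix

open scoped Matrix Matrix.Norms.L2Operator

variable {d : ℕ}

/-- The deviation of the symmetrized outer product of `u` and `v` from `G Gᵀ`. -/
def outerDev (u v G : Vec d) : Matrix (Fin d) (Fin d) ℝ :=
  Matrix.of fun a c => (u a * v c + v a * u c) / 2 - G a * G c

theorem toEuclideanLin_outerDev (u v G x : Vec d) :
    Matrix.toEuclideanLin (outerDev u v G) x =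
      (inner ℝ v x / 2) • u + (inner ℝ u x / 2) • v - inner ℝ G x • G := by
  ext a
  simp only [Matrix.toLpLin_apply, Matrix.mulVec, dotProduct, outerDev, Matrix.of_apply,
    PiLp.inner_apply, PiLp.sub_apply, PiLp.add_apply, PiLp.smul_apply, smul_eq_mul,
    Finset.sum_div, Finset.sum_mul, RCLike.inner_apply, conj_trivial]
  rw [← Finset.sum_add_distrib, ← Finset.sum_sub_distrib]
  exact Finset.sum_congr rfl fun c _ => by ring

theorem norm_outerDev_apply_le {u v G : Vec d} {c : ℝ} (hu : ‖u‖ ≤ c) (hv : ‖v‖ ≤ c)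
    (hG : ‖G‖ ≤ c) (x : Vec d) :
    ‖Matrix.toEuclideanLin (outerDev u v G) x‖ ≤
      c * (|inner ℝ v x| / 2 + |inner ℝ u x| / 2 + |inner ℝ G x|) := by
  rw [toEuclideanLin_outerDev]
  refine (norm_sub_le _ _).trans ?_
  refine (add_le_add_left (norm_add_le _ _) _).trans ?_
  simp only [norm_smul, Real.norm_eq_abs, abs_div, abs_two]
  calc _ ≤ |inner ℝ v x| / 2 * c + |inner ℝ u x| / 2 * c + |inner ℝ G x| * c := by gcongr
    _ = _ := by ring

theorem norm_outerDev_le {u v G : Vec d} {c : ℝ} (hu : ‖u‖ ≤ c) (hv : ‖v‖ ≤ c) (hG : ‖G‖ ≤ c) :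
    ‖outerDev u v G‖ ≤ 2 * c ^ 2 := by
  have hc : 0 ≤ c := (norm_nonneg u).trans hu
  rw [Matrix.l2_opNorm_def]
  refine ContinuousLinearMap.opNorm_le_bound _ (by positivity) fun x => ?_
  refine (norm_outerDev_apply_le hu hv hG x).trans ?_
  have h1 : |inner ℝ v x| ≤ c * ‖x‖ := (abs_real_inner_le_norm _ _).trans (by gcongr)
  have h2 : |inner ℝ u x| ≤ c * ‖x‖ := (abs_real_inner_le_norm _ _).trans (by gcongr)
  have h3 : |inner ℝ G x| ≤ c * ‖x‖ := (abs_real_inner_le_norm _ _).trans (by gcongr)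
  nlinarith

/-- One factor of each product is bounded by its norm, while the inner products with `x` are kept:
only those have a second moment free of the dimension. -/
theorem sq_norm_outerDev_apply_le {u v G : Vec d} {c : ℝ} (hu : ‖u‖ ≤ c) (hv : ‖v‖ ≤ c)
    (hG : ‖G‖ ≤ c) (x : Vec d) :
    ‖Matrix.toEuclideanLin (outerDev u v G) x‖ ^ 2 ≤
      c ^ 2 * (inner ℝ v x ^ 2 + inner ℝ u x ^ 2 + 2 * inner ℝ G x ^ 2) := by
  have hc : 0 ≤ c := (norm_nonneg u).trans hu
  calc _ ≤ (c * (|inner ℝ v x| / 2 + |inner ℝ u x| / 2 + |inner ℝ G x|)) ^ 2 := by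
        gcongr; exact norm_outerDev_apply_le hu hv hG x
    _ ≤ _ := by
        rw [mul_pow, ← sq_abs (inner ℝ v x), ← sq_abs (inner ℝ u x), ← sq_abs (inner ℝ G x)]
        gcongr
        set p := |inner ℝ v x|
        set q := |inner ℝ u x|
        set r := |inner ℝ G x|
        nlinarith [sq_nonneg (p - q), sq_nonneg ((p + q) / 2 - r)]

variable {ι : Type} [Fintype ι] {ν : ι → Measure (Sample d)} [∀ i, IsProbabilityMeasure (ν i)]
  {C₁ b : ℝ} {k : ℕ} {D : Fin k → Measure (Sample d)} (hB : ∀ j, IsBounded (D j) C₁ b)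
  {κ : ℝ} (hκ : 0 < κ) (w : Vec d) {B : Arr (Arr ι)} {c : Fin B.size → Fin k}
  (hD : ∀ b t, ν ((B.get b).get t) = D (c b)) (hinj : ∀ b, Function.Injective (B.get b).get)
  (hdisj : Pairwise (Function.onFun Disjoint fun b => (B.get b).idx))
  (hsize : ∀ b, 2 ≤ (B.get b).size)

/-- Supplies the lower tail. -/
theorem BernsteinFamily.neg {n : Type*} [Fintype n] [DecidableEq n] {S : Type*}
    [MeasurableSpace S] {ν : ι → Measure S} [∀ i, IsProbabilityMeasure (ν i)]
    {m : ℕ} {X : Fin m → (ι → S) → Matrix n n ℝ} {J : Fin m → Set ι} {L V : ℝ}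
    (h : BernsteinFamily ν X J L V) : BernsteinFamily ν (fun b ω => -X b ω) J L V where
  meas b i j := (h.meas b i j).neg
  symm b ω := by rw [Matrix.IsSymm, Matrix.transpose_neg, (h.symm b ω).eq]
  disj := h.disj
  dep b x y hxy := by simp only [h.dep b hxy]
  bdd b := by simpa only [norm_neg] using h.bdd b
  mean b i j := by
    simp only [Matrix.neg_apply]
    rw [integral_neg, h.mean, neg_zero]
  var b x := by simpa only [Matrix.neg_mulVec, neg_dotProduct_neg] using h.var b x

-- The halves of a batch are independent with the same mean G, so the symmetrized outer product is
-- an unbiased estimate of G Gᵀ even when each half is a single sample. In the variance, one factor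
-- contributes the almost sure bound (κb)² and the other a directional second moment κ²C₁; with b of
-- order √d the variance grows like d and not like d².
include hB hκ hD hinj hdisj hsize in
theorem bernsteinFamily_outerDev :
    BernsteinFamily ν (fun b ω => outerDev (avgClipGrad (((B.get b).part 2 0).map ω) w κ)
      (avgClipGrad (((B.get b).part 2 1).map ω) w κ) (gradMean (D (c b)) w κ))
      (fun b => (B.get b).idx) (2 * (κ * b) ^ 2) (4 * (κ * b) ^ 2 * (κ ^ 2 * C₁)) where
  meas b i j := by
    have h1 := measurable_vec_iff.1 (measurable_avgClipGrad_const (d := d)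
      ((B.get b).part 2 0) w κ)
    have h2 := measurable_vec_iff.1 (measurable_avgClipGrad_const (d := d)
      ((B.get b).part 2 1) w κ)
    exact ((((h1 i).mul (h2 j)).add ((h2 i).mul (h1 j))).div_const _).sub_const _
  symm b ω := by
    ext i j
    simp only [Matrix.transpose_apply, outerDev, Matrix.of_apply]; ring
  disj := hdisj
  dep b := dependsOn_map (B.get b) fun A : Batch d =>
    outerDev (avgClipGrad (A.part 2 0) w κ) (avgClipGrad (A.part 2 1) w κ)
      (gradMean (D (c b)) w κ)
  bdd b' := by
    filter_upwards [norm_avgClipGrad_le (hB (c b')) hκ (a := (B.get b').part 2 0)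
      (fun t => hD b' _) w, norm_avgClipGrad_le (hB (c b')) hκ (a := (B.get b').part 2 1)
      (fun t => hD b' _) w] with ω h1 h2
    exact norm_outerDev_le h1 h2 ((hB _).norm_gradMean_le hκ w)
  mean b i j := by
    have hs : 0 < (B.get b).size / 2 := Nat.div_pos (hsize b) (by norm_num)
    set u : (ι → Sample d) → Vec d := fun ω => avgClipGrad (((B.get b).part 2 0).map ω) w κ
    set v : (ι → Sample d) → Vec d := fun ω => avgClipGrad (((B.get b).part 2 1).map ω) w κ
    set G := gradMean (D (c b)) w κ with hG
    have hc : ∀ (x : Vec d) i, inner ℝ x (EuclideanSpace.single i (1 : ℝ)) = x i := fun x i => by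
      rw [EuclideanSpace.inner_single_right]; simp
    have hu : ∀ i, MemLp (fun ω => u ω i) 2 (Measure.pi ν) := fun i => by
      simpa only [hc] using memLp_inner_avgClipGrad (hB (c b)) hκ (a := (B.get b).part 2 0)
        (fun t => hD b _) w (EuclideanSpace.single i (1 : ℝ))
    have hv : ∀ i, MemLp (fun ω => v ω i) 2 (Measure.pi ν) := fun i => by
      simpa only [hc] using memLp_inner_avgClipGrad (hB (c b)) hκ (a := (B.get b).part 2 1)
        (fun t => hD b _) w (EuclideanSpace.single i (1 : ℝ))
    have eu : ∀ i, ∫ ω, u ω i ∂(Measure.pi ν) = G i := fun i => by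
      simpa only [hc] using integral_inner_avgClipGrad (hB (c b)) hκ (a := (B.get b).part 2 0)
        (fun t => hD b _) w hs (EuclideanSpace.single i (1 : ℝ))
    have ev : ∀ i, ∫ ω, v ω i ∂(Measure.pi ν) = G i := fun i => by
      simpa only [hc] using integral_inner_avgClipGrad (hB (c b)) hκ (a := (B.get b).part 2 1)
        (fun t => hD b _) w hs (EuclideanSpace.single i (1 : ℝ))
    have hind : ∀ i j, IndepFun (fun ω => u ω i) (fun ω => v ω j) (Measure.pi ν) := fun i j => by
      have hd := Arr.disjoint_part (hinj b) 2 (i := 0) (j := 1) (by decide)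
      exact indepFun_of_dependsOn ν
        (measurable_vec_iff.1 (measurable_avgClipGrad_const (d := d) ((B.get b).part 2 0) w κ) i)
        (measurable_vec_iff.1 (measurable_avgClipGrad_const (d := d) ((B.get b).part 2 1) w κ) j)
        hd (dependsOn_map _ fun A : Batch d => avgClipGrad A w κ i)
        (dependsOn_map _ fun A : Batch d => avgClipGrad A w κ j)
    have e1 : ∀ i j, ∫ ω, u ω i * v ω j ∂(Measure.pi ν) = G i * G j := fun i j => by
      rw [(hind i j).integral_fun_mul_eq_mul_integral (hu i).aestronglyMeasurable
        (hv j).aestronglyMeasurable, eu, ev]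
    have e2 : ∀ i j, ∫ ω, v ω i * u ω j ∂(Measure.pi ν) = G i * G j := fun i j => by
      rw [mul_comm (G i), ← e1 j i]
      exact integral_congr_ae (Filter.Eventually.of_forall fun ω => mul_comm _ _)
    have i1 : Integrable (fun ω => u ω i * v ω j) (Measure.pi ν) := (hu i).integrable_mul (hv j)
    have i2 : Integrable (fun ω => v ω i * u ω j) (Measure.pi ν) := (hv i).integrable_mul (hu j)
    have i12 : Integrable (fun ω => u ω i * v ω j + v ω i * u ω j) (Measure.pi ν) := i1.add i2
    change ∫ ω, ((u ω i * v ω j + v ω i * u ω j) / 2 - G i * G j) ∂(Measure.pi ν) = 0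
    rw [integral_sub (i12.div_const 2) (integrable_const _), integral_div, integral_add i1 i2, e1,
      e2]
    simp
  var b' x := by
    have hs : 0 < (B.get b').size / 2 := Nat.div_pos (hsize b') (by norm_num)
    set G := gradMean (D (c b')) w κ with hG
    set y : Vec d := WithLp.toLp 2 x with hy
    have hx : x ⬝ᵥ x = ‖y‖ ^ 2 := by
      rw [EuclideanSpace.real_norm_sq_eq]; simp [dotProduct, hy, sq]
    have hM : ∀ M : Matrix (Fin d) (Fin d) ℝ, (M *ᵥ x) ⬝ᵥ (M *ᵥ x) =
        ‖Matrix.toEuclideanLin M y‖ ^ 2 := fun M => by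
      rw [EuclideanSpace.real_norm_sq_eq]; simp [dotProduct, hy, sq, Matrix.toLpLin_apply]
    simp only [hM, hx]
    have i1 := (memLp_inner_avgClipGrad (hB (c b')) hκ (a := (B.get b').part 2 0)
      (fun t => hD b' _) w y).integrable_sq
    have i2 := (memLp_inner_avgClipGrad (hB (c b')) hκ (a := (B.get b').part 2 1)
      (fun t => hD b' _) w y).integrable_sq
    have e1 := integral_inner_avgClipGrad_sq_le (hB (c b')) hκ (a := (B.get b').part 2 0)
      (fun t => hD b' _) w hs y
    have e2 := integral_inner_avgClipGrad_sq_le (hB (c b')) hκ (a := (B.get b').part 2 1)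
      (fun t => hD b' _) w hs y
    have e3 : inner ℝ G y ^ 2 ≤ κ ^ 2 * C₁ * ‖y‖ ^ 2 := by
      have h1 := (hB (c b')).norm_gradMean_sq_le hκ w
      have h2 := abs_real_inner_le_norm G y
      calc inner ℝ G y ^ 2 = |inner ℝ G y| ^ 2 := (sq_abs _).symm
        _ ≤ (‖G‖ * ‖y‖) ^ 2 := by gcongr
        _ = ‖G‖ ^ 2 * ‖y‖ ^ 2 := by ring
        _ ≤ _ := by gcongr
    have i12 : Integrable (fun ω => inner ℝ (avgClipGrad (((B.get b').part 2 1).map ω) w κ) y ^ 2 +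
        inner ℝ (avgClipGrad (((B.get b').part 2 0).map ω) w κ) y ^ 2) (Measure.pi ν) := i2.add i1
    have i123 : Integrable (fun ω =>
        inner ℝ (avgClipGrad (((B.get b').part 2 1).map ω) w κ) y ^ 2 +
        inner ℝ (avgClipGrad (((B.get b').part 2 0).map ω) w κ) y ^ 2 + 2 * inner ℝ G y ^ 2)
        (Measure.pi ν) := i12.add (integrable_const _)
    calc _ ≤ ∫ ω, (κ * b) ^ 2 * (inner ℝ (avgClipGrad (((B.get b').part 2 1).map ω) w κ) y ^ 2 +
          inner ℝ (avgClipGrad (((B.get b').part 2 0).map ω) w κ) y ^ 2 + 2 * inner ℝ G y ^ 2)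
          ∂(Measure.pi ν) := by
          refine integral_mono_of_nonneg (Filter.Eventually.of_forall fun ω => sq_nonneg _)
            (i123.const_mul _) ?_
          filter_upwards [norm_avgClipGrad_le (hB (c b')) hκ (a := (B.get b').part 2 0)
            (fun t => hD b' _) w, norm_avgClipGrad_le (hB (c b')) hκ (a := (B.get b').part 2 1)
            (fun t => hD b' _) w] with ω h1 h2
          exact sq_norm_outerDev_apply_le h1 h2 ((hB _).norm_gradMean_le hκ w) y
      _ ≤ (κ * b) ^ 2 * (4 * (κ ^ 2 * C₁ * ‖y‖ ^ 2)) := by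
          rw [integral_const_mul, integral_add i12 (integrable_const _), integral_add i2 i1]
          simp only [integral_const, probReal_univ, one_smul]
          gcongr
          linarith
      _ = _ := by ring

end CrossMatrix

/- ## The subspace of the expected clipped gradients -/

section Projection

variable {d : ℕ}

/-- `P` is an orthogonal projection to a space of dimension at most `l`. -/
structure IsProjOfRank (P : Matrix (Fin d) (Fin d) ℝ) (l : ℕ) : Prop where
  symm : ∀ x y, inner ℝ (Matrix.toEuclideanLin P x) y = inner ℝ x (Matrix.toEuclideanLin P y)
  idem : ∀ x, Matrix.toEuclideanLin P (Matrix.toEuclideanLin P x) = Matrix.toEuclideanLin P x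
  trace_le : ∑ a, ‖Matrix.toEuclideanLin P (EuclideanSpace.single a (1 : ℝ))‖ ^ 2 ≤ l

theorem toEuclideanLin_singProj (A : Matrix (Fin d) (Fin d) ℝ) (l : ℕ) (x : Vec d) :
    Matrix.toEuclideanLin (singProj A l) x =
      ∑ j : Fin l, inner ℝ (singVec A j) x • singVec A j := by
  ext a
  simp only [Matrix.toLpLin_apply, Matrix.mulVec, dotProduct, singProj, Matrix.of_apply,
    PiLp.inner_apply, WithLp.ofLp_sum, Finset.sum_apply, PiLp.smul_apply, smul_eq_mul,
    Finset.sum_mul, RCLike.inner_apply, conj_trivial]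
  rw [Finset.sum_comm]
  exact Finset.sum_congr rfl fun j _ => Finset.sum_congr rfl fun c _ => by ring

theorem inner_singVec_singProj {A : Matrix (Fin d) (Fin d) ℝ} {l : ℕ} (hl : l ≤ d) (j : Fin l)
    (x : Vec d) : inner ℝ (singVec A j) (Matrix.toEuclideanLin (singProj A l) x) =
      inner ℝ (singVec A j) x := by
  rw [toEuclideanLin_singProj, (orthonormal_singVec (A := A) hl).inner_right_fintype]

theorem isProjOfRank_singProj (A : Matrix (Fin d) (Fin d) ℝ) {l : ℕ} (hl : l ≤ d) :
    IsProjOfRank (singProj A l) l where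
  symm x y := by
    rw [toEuclideanLin_singProj, toEuclideanLin_singProj, sum_inner, inner_sum]
    refine Finset.sum_congr rfl fun j _ => ?_
    rw [real_inner_smul_left, real_inner_smul_right, real_inner_comm x]; ring
  idem x := by
    rw [toEuclideanLin_singProj A l (Matrix.toEuclideanLin (singProj A l) x)]
    simp only [inner_singVec_singProj hl]
    rw [← toEuclideanLin_singProj]
  trace_le := by
    have h1 : ∀ a, ‖Matrix.toEuclideanLin (singProj A l) (EuclideanSpace.single a (1 : ℝ))‖ ^ 2 =
        ∑ j : Fin l, singVec A j a ^ 2 := fun a => by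
      rw [toEuclideanLin_singProj, ← real_inner_self_eq_norm_sq,
        (orthonormal_singVec (A := A) hl).inner_sum]
      refine Finset.sum_congr rfl fun j _ => ?_
      rw [EuclideanSpace.inner_single_right]
      simp [sq]
    simp only [h1]
    rw [Finset.sum_comm]
    have h2 : ∀ j : Fin l, ∑ a, singVec A j a ^ 2 = 1 := fun j => by
      rw [← EuclideanSpace.real_norm_sq_eq, (orthonormal_singVec (A := A) hl).1 j]; norm_num
    simp [h2]

end Projection

/-- Polarization after rescaling both vectors to equal length; the parallelogram law then gives the
product of the norms without loss of a constant. -/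
theorem abs_inner_apply_le_of_quadratic {E : Type*} [NormedAddCommGroup E] [InnerProductSpace ℝ E]
    {T : E →ₗ[ℝ] E} (hT : T.IsSymmetric) {η : ℝ}
    (h : ∀ x, |inner ℝ x (T x)| ≤ η * ‖x‖ ^ 2) (u v : E) :
    |inner ℝ u (T v)| ≤ η * (‖u‖ * ‖v‖) := by
  by_cases hu : u = 0
  · simp [hu]
  by_cases hv : v = 0
  · simp [hv]
  have hu' : 0 < ‖u‖ := norm_pos_iff.2 hu
  have hv' : 0 < ‖v‖ := norm_pos_iff.2 hv
  set x := ‖v‖ • u with hx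
  set y := ‖u‖ • v with hy
  have h1 := h (x + y)
  have h2 := h (x - y)
  have h3 : inner ℝ (x + y) (T (x + y)) - inner ℝ (x - y) (T (x - y)) = 4 * inner ℝ x (T y) := by
    have : inner ℝ y (T x) = inner ℝ x (T y) := by
      rw [← hT y x, real_inner_comm]
    simp only [map_add, map_sub, inner_add_left, inner_add_right, inner_sub_left, inner_sub_right,
      this]
    ring
  have h4 := parallelogram_law_with_norm ℝ x y
  have nx : ‖x‖ = ‖v‖ * ‖u‖ := by rw [hx, norm_smul, norm_norm]
  have ny : ‖y‖ = ‖u‖ * ‖v‖ := by rw [hy, norm_smul, norm_norm]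
  have h5 : inner ℝ x (T y) = ‖v‖ * ‖u‖ * inner ℝ u (T v) := by
    rw [hx, hy, map_smul, real_inner_smul_left, real_inner_smul_right]; ring
  have h6 : |4 * inner ℝ x (T y)| ≤ η * (4 * (‖u‖ * ‖v‖) ^ 2) := by
    rw [← h3]
    refine (abs_sub _ _).trans ?_
    rw [nx, ny] at h4
    calc _ ≤ η * ‖x + y‖ ^ 2 + η * ‖x - y‖ ^ 2 := add_le_add h1 h2
      _ = η * (‖x + y‖ ^ 2 + ‖x - y‖ ^ 2) := by ring
      _ = _ := by rw [h4]; ring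
  rw [h5, abs_mul, abs_mul, abs_of_pos (by positivity : 0 < ‖v‖ * ‖u‖)] at h6
  norm_num at h6
  have hp : 0 < ‖u‖ * ‖v‖ := by positivity
  refine le_of_mul_le_mul_left ?_ hp
  nlinarith

/-! ### The cross matrix is close to the mixture of the expected gradients -/

section Subspace

open scoped Matrix

variable {d k : ℕ}

theorem crossMatrix_eq (B : Arr (Batch d)) (κ : ℝ) (w : Vec d) :
    crossMatrix B κ w = (1 / (B.size : ℝ)) • ∑ b, outerDev (avgClipGrad ((B.get b).part 2 0) w κ)
      (avgClipGrad ((B.get b).part 2 1) w κ) 0 := by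
  ext a c
  simp only [crossMatrix, Matrix.of_apply, Matrix.smul_apply, Matrix.sum_apply, outerDev,
    PiLp.zero_apply, mul_zero, sub_zero, smul_eq_mul]
  rw [← Finset.sum_div]
  ring

/-- Grouping the batches by component turns the expected cross matrix into a mixture whose weights
are the empirical fractions. -/
theorem inner_crossMatrix_sub (B : Arr (Batch d)) (κ : ℝ) (w : Vec d)
    (c : Fin B.size → Fin k) (G : Fin k → Vec d) (u v : Vec d) :
    inner ℝ u (Matrix.toEuclideanLin (crossMatrix B κ w) v) -
      ∑ j, ((Finset.univ.filter fun b => c b = j).card / B.size : ℝ) *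
        (inner ℝ (G j) u * inner ℝ (G j) v) =
    (1 / (B.size : ℝ)) * inner ℝ u (Matrix.toEuclideanLin
      (∑ b, outerDev (avgClipGrad ((B.get b).part 2 0) w κ)
        (avgClipGrad ((B.get b).part 2 1) w κ) (G (c b))) v) := by
  have h1 : ∀ g x y : Vec d, inner ℝ u (Matrix.toEuclideanLin (outerDev x y g) v) =
      inner ℝ u (Matrix.toEuclideanLin (outerDev x y 0) v) - inner ℝ g u * inner ℝ g v := by
    intro g x y
    simp only [toEuclideanLin_outerDev, inner_sub_right, inner_smul_right, inner_zero_left,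
      zero_mul, sub_zero]
    rw [real_inner_comm g u, mul_comm (inner ℝ g v), real_inner_comm u g]
  have h2 : ∑ j, ((Finset.univ.filter fun b => c b = j).card / B.size : ℝ) *
        (inner ℝ (G j) u * inner ℝ (G j) v) =
      (1 / (B.size : ℝ)) * ∑ b, inner ℝ (G (c b)) u * inner ℝ (G (c b)) v := by
    rw [← Finset.sum_fiberwise (s := Finset.univ) (g := c), Finset.mul_sum]
    refine Finset.sum_congr rfl fun j _ => ?_
    rw [Finset.sum_congr rfl (g := fun _ => inner ℝ (G j) u * inner ℝ (G j) v) fun b hb => by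
      rw [(Finset.mem_filter.1 hb).2], Finset.sum_const, nsmul_eq_mul]
    ring
  rw [h2, crossMatrix_eq]
  simp only [map_smul, map_sum, LinearMap.smul_apply, LinearMap.sum_apply, inner_smul_right,
    inner_sum]
  have h3 : ∀ b, inner ℝ u (Matrix.toEuclideanLin (outerDev
      (avgClipGrad ((B.get b).part 2 0) w κ) (avgClipGrad ((B.get b).part 2 1) w κ) (G (c b))) v) =
      inner ℝ u (Matrix.toEuclideanLin (outerDev (avgClipGrad ((B.get b).part 2 0) w κ)
        (avgClipGrad ((B.get b).part 2 1) w κ) 0) v) -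
      inner ℝ (G (c b)) u * inner ℝ (G (c b)) v := fun b => h1 _ _ _
  rw [Finset.sum_congr rfl fun b _ => h3 b, Finset.sum_sub_distrib]
  ring

variable {ι : Type} [Fintype ι] {ν : ι → Measure (Sample d)} [∀ i, IsProbabilityMeasure (ν i)]
  {C₁ b : ℝ} {D : Fin k → Measure (Sample d)} (hB : ∀ j, IsBounded (D j) C₁ b)
  {κ : ℝ} (hκ : 0 < κ) (w : Vec d) {B : Arr (Arr ι)} {c : Fin B.size → Fin k}
  (hD : ∀ b t, ν ((B.get b).get t) = D (c b)) (hinj : ∀ b, Function.Injective (B.get b).get)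
  (hdisj : Pairwise (Function.onFun Disjoint fun b => (B.get b).idx))
  (hsize : ∀ b, 2 ≤ (B.get b).size)

include hB hκ hD hinj hdisj hsize in
theorem measure_not_isNearMixture_le (hC₁ : 0 < C₁) (hb : 0 < b) (hn : 0 < B.size) {η δ : ℝ}
    (hη : 0 < η) (hη1 : η ≤ 4 * (κ ^ 2 * C₁)) (hδ : 0 < δ) (hd : 0 < d)
    (hlog : Real.log (2 * d / δ) ≤ B.size * (η ^ 2 / (16 * (κ * b) ^ 2 * (κ ^ 2 * C₁)))) :
    Measure.pi ν {ω | ¬ IsNearMixture (crossMatrix (B.map (Arr.map ω)) κ w)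
      (fun j => ((Finset.univ.filter fun b => c b = j).card / B.size : ℝ))
      (fun j => gradMean (D j) w κ) η} ≤ ENNReal.ofReal δ := by
  have hF := bernsteinFamily_outerDev hB hκ w hD hinj hdisj hsize
  set V : ℝ := 4 * (κ * b) ^ 2 * (κ ^ 2 * C₁) with hV
  have hVpos : 0 < V := by positivity
  set n : ℝ := (B.size : ℝ) with hndef
  have hnpos : 0 < n := by rw [hndef]; exact_mod_cast hn
  -- The minimizer of nθ²V - θnη; the exponent becomes -nη²/(4V). The hypothesis η ≤ 4κ²C₁ is
  -- exactly what `θ L ≤ 1` requires.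
  set θ : ℝ := η / (2 * V) with hθ
  have hθ0 : 0 ≤ θ := by positivity
  have hθL : θ * (2 * (κ * b) ^ 2) ≤ 1 := by
    rw [hθ, div_mul_eq_mul_div, div_le_one (by positivity), hV]
    have : 0 < (κ * b) ^ 2 := by positivity
    nlinarith
  have hexp : (d : ℝ) * Real.exp (n * (θ ^ 2 * V) - θ * (n * η)) ≤ δ / 2 := by
    have h1 : n * (θ ^ 2 * V) - θ * (n * η) =
        -(n * (η ^ 2 / (16 * (κ * b) ^ 2 * (κ ^ 2 * C₁)))) := by
      rw [hθ, hV]; field_simp; ring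
    rw [h1]
    have h2 : Real.exp (-(n * (η ^ 2 / (16 * (κ * b) ^ 2 * (κ ^ 2 * C₁))))) ≤
        Real.exp (-Real.log (2 * d / δ)) := Real.exp_le_exp.2 (by linarith)
    have hd' : (0 : ℝ) < d := by exact_mod_cast hd
    rw [Real.exp_neg (Real.log _), Real.exp_log (by positivity)] at h2
    calc _ ≤ (d : ℝ) * (2 * d / δ)⁻¹ := by gcongr
      _ = δ / 2 := by field_simp
  have t1 := (hF.tail hθ0 hθL hVpos.le (n * η)).trans (ENNReal.ofReal_le_ofReal (q := δ / 2) (by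
    rw [Fintype.card_fin]; exact hexp))
  have t2 := (hF.neg.tail hθ0 hθL hVpos.le (n * η)).trans (ENNReal.ofReal_le_ofReal (q := δ / 2) (by
    rw [Fintype.card_fin]; exact hexp))
  refine (measure_mono fun ω hω => ?_).trans ((measure_union_le _ _).trans
    ((add_le_add t1 t2).trans ?_))
  · by_contra hc
    simp only [Set.mem_union, not_or] at hc
    obtain ⟨h1, h2⟩ := hc
    refine hω ?_
    set X : Matrix (Fin d) (Fin d) ℝ := ∑ b, outerDev
      (avgClipGrad (((B.get b).part 2 0).map ω) w κ)
      (avgClipGrad (((B.get b).part 2 1).map ω) w κ) (gradMean (D (c b)) w κ) with hX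
    have hsymm : (Matrix.toEuclideanLin X).IsSymmetric := by
      rw [Matrix.isSymmetric_toEuclideanLin_iff, Matrix.IsHermitian,
        Matrix.conjTranspose_eq_transpose_of_trivial, hX, Matrix.transpose_sum]
      exact Finset.sum_congr rfl fun b _ => hF.symm b ω
    have hq : ∀ x : Vec d, |inner ℝ x (Matrix.toEuclideanLin X x)| ≤ n * η * ‖x‖ ^ 2 := by
      intro x
      have hxx : x.ofLp ⬝ᵥ x.ofLp = ‖x‖ ^ 2 := by
        rw [EuclideanSpace.real_norm_sq_eq]; simp [dotProduct, sq]
      have hxX : ∀ Y : Matrix (Fin d) (Fin d) ℝ,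
          x.ofLp ⬝ᵥ (Y *ᵥ x.ofLp) = inner ℝ x (Matrix.toEuclideanLin Y x) := fun Y => by
        simp [dotProduct, PiLp.inner_apply, Matrix.toLpLin_apply, mul_comm]
      by_cases hx : x = 0
      · simp [hx]
      have hpos : 0 < x.ofLp ⬝ᵥ x.ofLp := by
        rw [hxx]; have := norm_pos_iff.2 hx; positivity
      have k1 : ¬ (n * η * (x.ofLp ⬝ᵥ x.ofLp) ≤ x.ofLp ⬝ᵥ (X *ᵥ x.ofLp)) :=
        fun hh => h1 ⟨x.ofLp, hpos, hh⟩
      have k2 : ¬ (n * η * (x.ofLp ⬝ᵥ x.ofLp) ≤ x.ofLp ⬝ᵥ ((-X) *ᵥ x.ofLp)) := fun hh =>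
        h2 ⟨x.ofLp, hpos, by rw [Finset.sum_neg_distrib]; exact hh⟩
      rw [Matrix.neg_mulVec, dotProduct_neg] at k2
      rw [hxx, hxX] at k1 k2
      rw [abs_le]
      constructor <;> linarith
    intro u v
    have h3 := inner_crossMatrix_sub (B.map (Arr.map ω)) κ w c (fun j => gradMean (D j) w κ) u v
    have h4 := abs_inner_apply_le_of_quadratic hsymm hq u v
    refine (congrArg abs h3).trans_le ?_
    rw [abs_mul, abs_of_pos (show (0 : ℝ) < 1 / ((B.map (Arr.map ω)).size : ℝ) from
      one_div_pos.2 hnpos)]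
    change 1 / n * |inner ℝ u (Matrix.toEuclideanLin X v)| ≤ _
    rw [one_div, inv_mul_le_iff₀ hnpos]
    linarith
  · rw [← ENNReal.ofReal_add (by positivity) (by positivity)]
    exact ENNReal.ofReal_le_ofReal (by linarith)

/-- The top singular vectors of an approximate mixture span the components of large weight. -/
theorem IsNearMixture.norm_sub_proj_le {A : Matrix (Fin d) (Fin d) ℝ} {p : Fin k → ℝ}
    {G : Fin k → Vec d} {α ε s : ℝ} (hα : 0 < α) (hε : 0 < ε) (hs : 0 ≤ s)
    (hA : IsNearMixture A p G (α * ε ^ 2 * s)) (hp : ∀ j, 0 ≤ p j) (hp1 : ∑ j, p j = 1)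
    (hG : ∀ j, ‖G j‖ ^ 2 ≤ s) {i : Fin k} (hi : α / 2 ≤ p i) {l : ℕ}
    (hl : l = min (min k ⌈1 / (2 * α * ε ^ 2)⌉₊) d) :
    ‖G i - Matrix.toEuclideanLin (singProj A l) (G i)‖ ^ 2 ≤ 8 * (ε ^ 2 * s) := by
  have hld : l ≤ d := hl ▸ min_le_right _ _
  set x := Matrix.toEuclideanLin (singProj A l) (G i) with hx
  set r := G i - x with hr
  have hmem : r ∈ singComplement A l := mem_singComplement fun j hj => by
    have := inner_singVec_singProj (A := A) hld ⟨j, hj⟩ (G i)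
    rw [hr, inner_sub_right, hx, this, sub_self]
  have hxr : inner ℝ x r = 0 := by
    have hP := isProjOfRank_singProj A hld
    rw [hr, hx, hP.symm, map_sub, hP.idem, sub_self, inner_zero_right]
  have h0 : 0 ≤ 8 * (ε ^ 2 * s) := by positivity
  rcases residual_le hp hA hmem hxr (i := i) (by rw [hr]; abel) with h | h
  swap
  · rw [h]; simpa using h0
  rcases hld.eq_or_lt with hd | hd
  · have hr0 : r = 0 := eq_zero_of_mem_singComplement_self (A := A) (by rwa [hd] at hmem)
    rw [hr0]; simpa using h0
  have hη : 0 ≤ α * ε ^ 2 * s := by positivity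
  -- If ℓ ≥ k, the rank bound gives η. Otherwise, as ℓ < d, the dimension is ⌈1/(2αε²)⌉, and the
  -- trace bound s gives at most 2αε²s + η. Here η = αε²s.
  have hsl : Real.sqrt (singValSq A l) ≤ 3 * (α * ε ^ 2 * s) := by
    by_cases hk : k ≤ l
    · have := singVal_le_of_rank hη hA hd hk
      linarith
    · have hl2 : l = ⌈1 / (2 * α * ε ^ 2)⌉₊ := by
        rcases min_choice (min k ⌈1 / (2 * α * ε ^ 2)⌉₊) d with hm | hm
        · rcases min_choice k ⌈1 / (2 * α * ε ^ 2)⌉₊ with hm2 | hm2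
          · omega
          · omega
        · omega
      have hl3 : 1 / (2 * α * ε ^ 2) ≤ l := by rw [hl2]; exact Nat.le_ceil _
      have htr := singVal_le_of_trace hp hA hd
      have hsum : ∑ j, p j * ‖G j‖ ^ 2 ≤ s := by
        calc _ ≤ ∑ j, p j * s := Finset.sum_le_sum fun j _ => by gcongr; exacts [hp j, hG j]
          _ = s := by rw [← Finset.sum_mul, hp1, one_mul]
      have h1 : s ≤ (l + 1) * (2 * (α * ε ^ 2 * s)) := by
        rw [div_le_iff₀ (by positivity)] at hl3
        nlinarith
      have hl0 : (0 : ℝ) < l + 1 := by positivity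
      refine le_of_mul_le_mul_left ?_ hl0
      linarith
  -- The weight of component i is at least α/2, and 3αε²s + αε²s = (α/2) · 8ε²s.
  have h1 : α / 2 * ‖r‖ ^ 2 ≤ α / 2 * (8 * (ε ^ 2 * s)) := by
    have : α / 2 * ‖r‖ ^ 2 ≤ p i * ‖r‖ ^ 2 := by gcongr
    linarith
  exact le_of_mul_le_mul_left h1 (by positivity)

-- Both the tolerance αε²κ²C₁ and the range of the summands scale with κ², so κ cancels from the
-- required number of batches, which therefore suffices for every value of the random clipping
-- level. The factor 3 dominates √8.
include hB hκ hD hinj hdisj hsize in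
theorem measure_singProj_le (hC₁ : 0 < C₁) (hb : 0 < b) (hd : 0 < d) {α ε δ : ℝ} (hα : 0 < α)
    (hα1 : α ≤ 1) (hε : 0 < ε) (hε1 : ε ≤ 1) (hδ : 0 < δ) (hn : 0 < B.size)
    (hlog : Real.log (2 * d / δ) ≤ B.size * (α ^ 2 * ε ^ 4 * C₁ / (16 * b ^ 2))) {i : Fin k}
    (hi : α / 2 * B.size ≤ (Finset.univ.filter fun b => c b = i).card) {l : ℕ}
    (hl : l = min (min k ⌈1 / (2 * α * ε ^ 2)⌉₊) d) :
    Measure.pi ν {ω | ¬ ‖gradMean (D i) w κ - Matrix.toEuclideanLin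
      (singProj (crossMatrix (B.map (Arr.map ω)) κ w) l) (gradMean (D i) w κ)‖ ≤
        3 * (ε * κ * Real.sqrt C₁)} ≤ ENNReal.ofReal δ := by
  have hn' : (0 : ℝ) < B.size := by exact_mod_cast hn
  have hαε : α * ε ^ 2 ≤ 1 := by
    have : ε ^ 2 ≤ 1 := pow_le_one₀ hε.le hε1
    nlinarith
  refine (measure_mono fun ω hω => ?_).trans (measure_not_isNearMixture_le hB hκ w hD hinj hdisj
    hsize hC₁ hb hn (η := α * ε ^ 2 * (κ ^ 2 * C₁)) (by positivity) ?_ hδ hd ?_)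
  · intro hA
    refine hω ?_
    have h1 := IsNearMixture.norm_sub_proj_le (s := κ ^ 2 * C₁) hα hε (by positivity) hA
      (fun j => by positivity) ?_ (fun j => (hB j).norm_gradMean_sq_le hκ w) (i := i) ?_ hl
    · change ‖_‖ ≤ _
      refine abs_le_of_sq_le_sq' (h1.trans ?_) (by positivity) |>.2
      rw [mul_pow, mul_pow, mul_pow, Real.sq_sqrt hC₁.le]
      nlinarith [mul_pos (mul_pos (pow_pos hε 2) (pow_pos hκ 2)) hC₁]
    · rw [← Finset.sum_div, ← Nat.cast_sum,
        ← Finset.card_eq_sum_card_fiberwise (fun b _ => Finset.mem_univ (c b)), Finset.card_univ,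
        Fintype.card_fin, div_self hn'.ne']
    · rw [le_div_iff₀ hn']; exact hi
  · have : 0 < κ ^ 2 * C₁ := by positivity
    nlinarith
  · refine hlog.trans (le_of_eq ?_)
    congr 1
    field_simp

end Subspace

/- ## Random vectors with bounded covariance -/

section Spread

variable {Ω : Type*} [MeasurableSpace Ω] {μ : Measure Ω} {d : ℕ}

/-- Every linear functional `u` of `X - g` has second moment at most `s * ‖u‖ ^ 2`. -/
structure IsSpread (μ : Measure Ω) (X : Ω → Vec d) (g : Vec d) (s : ℝ) : Prop where
  meas : Measurable X
  integrable : ∀ u, Integrable (fun ω => inner ℝ (X ω - g) u ^ 2) μ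
  integral_le : ∀ u, ∫ ω, inner ℝ (X ω - g) u ^ 2 ∂μ ≤ s * ‖u‖ ^ 2

theorem IsSpread.mono {X : Ω → Vec d} {g : Vec d} {s t : ℝ} (h : IsSpread μ X g s) (hst : s ≤ t) :
    IsSpread μ X g t :=
  ⟨h.meas, h.integrable, fun u => (h.integral_le u).trans (by gcongr)⟩

theorem IsSpread.sub {X Y : Ω → Vec d} {g h : Vec d} {s t : ℝ} (hX : IsSpread μ X g s)
    (hY : IsSpread μ Y h t) : IsSpread μ (fun ω => X ω - Y ω) (g - h) (2 * (s + t)) := by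
  have hm : Measurable fun ω => X ω - Y ω := hX.meas.sub hY.meas
  have hle : ∀ u ω, inner ℝ (X ω - Y ω - (g - h)) u ^ 2 ≤
      2 * (inner ℝ (X ω - g) u ^ 2 + inner ℝ (Y ω - h) u ^ 2) := fun u ω => by
    have : X ω - Y ω - (g - h) = (X ω - g) - (Y ω - h) := by abel
    rw [this, inner_sub_left]
    nlinarith [sq_nonneg (inner ℝ (X ω - g) u + inner ℝ (Y ω - h) u)]
  have hi : ∀ u, Integrable (fun ω => 2 * (inner ℝ (X ω - g) u ^ 2 + inner ℝ (Y ω - h) u ^ 2)) μ :=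
    fun u => ((hX.integrable u).add (hY.integrable u)).const_mul 2
  have hint : ∀ u, Integrable (fun ω => inner ℝ (X ω - Y ω - (g - h)) u ^ 2) μ := fun u => by
    refine (hi u).mono' (((hm.sub_const _).inner measurable_const).pow_const 2).aestronglyMeasurable
      (Filter.Eventually.of_forall fun ω => ?_)
    rw [Real.norm_of_nonneg (sq_nonneg _)]
    exact hle u ω
  refine ⟨hm, hint, fun u => ?_⟩
  refine (integral_mono (hint u) (hi u) (hle u)).trans ?_
  rw [integral_const_mul, integral_add (hX.integrable u) (hY.integrable u)]
  linarith [hX.integral_le u, hY.integral_le u]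

variable {P : Matrix (Fin d) (Fin d) ℝ} {l : ℕ} (hP : IsProjOfRank P l)

-- The squared length of the projection is a sum of squared functionals in the directions of the
-- projected basis vectors, and their squared lengths add up to the rank.
include hP in
theorem IsSpread.integral_norm_sq_le {X : Ω → Vec d} {g : Vec d} {s : ℝ} (hX : IsSpread μ X g s)
    (hs : 0 ≤ s) : Integrable (fun ω => ‖Matrix.toEuclideanLin P (X ω - g)‖ ^ 2) μ ∧
      ∫ ω, ‖Matrix.toEuclideanLin P (X ω - g)‖ ^ 2 ∂μ ≤ s * l := by
  have h1 : ∀ x, ‖Matrix.toEuclideanLin P x‖ ^ 2 =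
      ∑ a, inner ℝ x (Matrix.toEuclideanLin P (EuclideanSpace.single a (1 : ℝ))) ^ 2 := fun x => by
    rw [EuclideanSpace.real_norm_sq_eq]
    refine Finset.sum_congr rfl fun a _ => ?_
    rw [← hP.symm, EuclideanSpace.inner_single_right]
    simp
  simp only [h1]
  refine ⟨integrable_finsetSum _ fun a _ => hX.integrable _, ?_⟩
  rw [integral_finsetSum _ fun a _ => hX.integrable _]
  refine (Finset.sum_le_sum fun a _ => hX.integral_le _).trans ?_
  rw [← Finset.mul_sum]
  exact mul_le_mul_of_nonneg_left hP.trace_le hs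

theorem measure_lt_le_of_integral_sq_le [IsProbabilityMeasure μ] {X : Ω → ℝ}
    (hX : Integrable (fun ω => X ω ^ 2) μ)
    {v t : ℝ} (ht : 0 < t) (hv : ∫ ω, X ω ^ 2 ∂μ ≤ v) :
    μ {ω | t < |X ω|} ≤ ENNReal.ofReal (v / t ^ 2) := by
  refine (measure_mono fun ω hω => ?_).trans (measure_abs_ge_le_of_integral_sq_le hX ht hv)
  have h1 : t < |X ω| := hω
  exact h1.le

variable [IsProbabilityMeasure μ]

include hP in
theorem IsSpread.measure_norm_le {X : Ω → Vec d} {g : Vec d} {s t : ℝ} (hX : IsSpread μ X g s)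
    (hs : 0 ≤ s) (ht : 0 < t) :
    μ {ω | t < ‖Matrix.toEuclideanLin P (X ω - g)‖} ≤ ENNReal.ofReal (s * l / t ^ 2) := by
  have h := hX.integral_norm_sq_le hP hs
  simpa only [abs_norm] using measure_lt_le_of_integral_sq_le h.1 ht h.2

theorem IsSpread.measure_inner_le {X : Ω → Vec d} {g u : Vec d} {s r q : ℝ} (hX : IsSpread μ X g s)
    (hr : 0 < r) (hq : s / r ^ 2 ≤ q) :
    μ {ω | ‖u‖ * r < |inner ℝ (X ω - g) u|} ≤ ENNReal.ofReal q := by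
  by_cases hu : u = 0
  · simp [hu]
  have hu' : 0 < ‖u‖ := norm_pos_iff.2 hu
  refine (measure_lt_le_of_integral_sq_le (hX.integrable u) (by positivity)
    (hX.integral_le u)).trans (ENNReal.ofReal_le_ofReal ?_)
  refine le_trans (le_of_eq ?_) hq
  field_simp

variable {ι S : Type*} [Fintype ι] [MeasurableSpace S] {ν : ι → Measure S}
  [∀ i, IsProbabilityMeasure (ν i)]

-- The source of the √ℓ in the batch size. With X frozen, the inner product is a linear functional
-- of Y, so its second moment is at most s‖P(X - g)‖²; averaging over X gives s² ℓ. The inner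
-- product of independent deviations is thus of size s√ℓ, whereas the squared length of one
-- deviation is only bounded by sℓ.
include hP in
theorem IsSpread.measure_inner_inner_le {X Y : (ι → S) → Vec d} {g h : Vec d} {s t : ℝ}
    (hX : IsSpread (Measure.pi ν) X g s) (hY : IsSpread (Measure.pi ν) Y h s) (hs : 0 ≤ s)
    {J J' : Set ι} (hd : Disjoint J J') (hXd : DependsOn X J) (hYd : DependsOn Y J') (ht : 0 < t) :
    Measure.pi ν {ω | t < |inner ℝ (Matrix.toEuclideanLin P (X ω - g))
      (Matrix.toEuclideanLin P (Y ω - h))|} ≤ ENNReal.ofReal (s ^ 2 * l / t ^ 2) := by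
  set Z : (ι → S) → ℝ := fun ω => inner ℝ (Matrix.toEuclideanLin P (X ω - g))
      (Matrix.toEuclideanLin P (Y ω - h)) with hZ
  -- Symmetry and idempotence put the whole projection on the side of X.
  have hZ' : ∀ ω, Z ω = inner ℝ (Y ω - h) (Matrix.toEuclideanLin P (X ω - g)) := fun ω => by
    change inner ℝ (Matrix.toEuclideanLin P (X ω - g)) (Matrix.toEuclideanLin P (Y ω - h)) = _
    rw [← hP.symm, hP.idem, real_inner_comm]
  have hPm : Measurable fun x : Vec d => Matrix.toEuclideanLin P (x - g) :=
    measurable_toEuclideanLin (A := fun _ => P) (x := fun x => x - g) (fun _ _ => measurable_const)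
      (measurable_id.sub_const g)
  have key : ∫⁻ ω, ENNReal.ofReal (Z ω ^ 2) ∂(Measure.pi ν) ≤ ENNReal.ofReal (s ^ 2 * l) := by
    rw [lintegral_congr fun ω => congrArg (fun x => ENNReal.ofReal (x ^ 2)) (hZ' ω)]
    have hfr := lintegral_freeze ν hX.meas hd hXd
      (F := fun a ω => ENNReal.ofReal (inner ℝ (Y ω - h) (Matrix.toEuclideanLin P (a - g)) ^ 2))
      (by
        refine ENNReal.measurable_ofReal.comp (Measurable.pow_const ?_ 2)
        exact ((hY.meas.comp measurable_snd).sub_const h).inner (hPm.comp measurable_fst))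
      (fun a x y hxy => by simp only [hYd hxy])
    rw [hfr]
    calc _ ≤ ∫⁻ ω, ENNReal.ofReal (s * ‖Matrix.toEuclideanLin P (X ω - g)‖ ^ 2)
            ∂(Measure.pi ν) := by
          refine lintegral_mono fun ω => ?_
          rw [← ofReal_integral_eq_lintegral_ofReal (hY.integrable _)
            (Filter.Eventually.of_forall fun _ => sq_nonneg _)]
          exact ENNReal.ofReal_le_ofReal (hY.integral_le _)
      _ ≤ _ := by
          have h1 := hX.integral_norm_sq_le hP hs
          rw [← ofReal_integral_eq_lintegral_ofReal (h1.1.const_mul s)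
            (Filter.Eventually.of_forall fun _ => by positivity), integral_const_mul]
          refine ENNReal.ofReal_le_ofReal ?_
          nlinarith [h1.2]
  have hm : Measurable Z := (hPm.comp hX.meas).inner (measurable_toEuclideanLin
    (A := fun _ => P) (x := fun ω => Y ω - h) (fun _ _ => measurable_const) (hY.meas.sub_const h))
  have hmk := mul_meas_ge_le_lintegral (μ := Measure.pi ν)
    (ENNReal.measurable_ofReal.comp (hm.pow_const 2)) (ENNReal.ofReal (t ^ 2))
  have ht2 : 0 < t ^ 2 := by positivity
  rw [ENNReal.ofReal_div_of_pos ht2, ENNReal.le_div_iff_mul_le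
    (Or.inl (by simpa using ht.ne')) (Or.inl ENNReal.ofReal_ne_top), mul_comm]
  refine le_trans (mul_le_mul_right (measure_mono fun ω hω => ?_) _) (hmk.trans key)
  have h1 : t < |Z ω| := hω
  change ENNReal.ofReal (t ^ 2) ≤ ENNReal.ofReal (Z ω ^ 2)
  refine ENNReal.ofReal_le_ofReal ?_
  rw [← sq_abs (Z ω)]
  gcongr

end Spread

/-! ### Averages with bounded covariance -/

section SpreadAverages

variable {ι : Type} [Fintype ι] {d : ℕ} {ν : ι → Measure (Sample d)}
  [∀ i, IsProbabilityMeasure (ν i)] {C₁ b : ℝ} {κ : ℝ} (hκ : 0 < κ) (w : Vec d)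

include hκ in
theorem isSpread_avgClipGrad {D : Measure (Sample d)} (hB : IsBounded D C₁ b) {a : Arr ι}
    (hD : ∀ t, ν (a.get t) = D) (hinj : Function.Injective a.get) (ha : 0 < a.size) :
    IsSpread (Measure.pi ν) (fun ω => avgClipGrad (a.map ω) w κ) (gradMean D w κ)
      (κ ^ 2 * C₁ / a.size) where
  meas := measurable_avgClipGrad_const a w κ
  integrable u := by
    simp only [inner_sub_left]
    exact ((memLp_inner_avgClipGrad hB hκ hD w u).sub (memLp_const _)).integrable_sq
  integral_le u := integral_inner_avgClipGrad_sub_sq_le hB hκ hD w hinj ha u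

/-- Averages of independent random vectors. -/
theorem IsSpread.average {β : Type*} [DecidableEq β] {K : Finset β} (hK : K.Nonempty)
    {X : β → (ι → Sample d) → Vec d} {g : β → Vec d} {s : ℝ}
    (hX : ∀ b, IsSpread (Measure.pi ν) (X b) (g b) s)
    (hmean : ∀ b u, ∫ ω, inner ℝ (X b ω) u ∂(Measure.pi ν) = inner ℝ (g b) u)
    {J : β → Set ι} (hd : Pairwise (Function.onFun Disjoint J)) (hJ : ∀ b, DependsOn (X b) (J b)) :
    IsSpread (Measure.pi ν) (fun ω => (1 / (K.card : ℝ)) • ∑ b ∈ K, X b ω)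
      ((1 / (K.card : ℝ)) • ∑ b ∈ K, g b) (s / K.card) := by
  have hKpos : (0 : ℝ) < K.card := by exact_mod_cast hK.card_pos
  have hdiff : ∀ u ω, inner ℝ ((1 / (K.card : ℝ)) • ∑ b ∈ K, X b ω -
      (1 / (K.card : ℝ)) • ∑ b ∈ K, g b) u = (1 / (K.card : ℝ)) *
        (∑ b ∈ K, fun ω => inner ℝ (X b ω - g b) u) ω := fun u ω => by
    rw [← smul_sub, ← Finset.sum_sub_distrib, real_inner_smul_left, sum_inner, Finset.sum_apply]
  have hL : ∀ b u, MemLp (fun ω => inner ℝ (X b ω - g b) u) 2 (Measure.pi ν) := fun b u => by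
    rw [memLp_two_iff_integrable_sq]
    · exact (hX b).integrable u
    · exact (((hX b).meas.sub_const _).inner measurable_const).aestronglyMeasurable
  have hmean0 : ∀ b u, ∫ ω, inner ℝ (X b ω - g b) u ∂(Measure.pi ν) = 0 := fun b u => by
    have h1 : Integrable (fun ω => inner ℝ (X b ω - g b) u) (Measure.pi ν) :=
      (hL b u).integrable (by norm_num)
    have h2 : (fun ω => inner ℝ (X b ω) u) = fun ω => inner ℝ (X b ω - g b) u + inner ℝ (g b) u := by
      ext ω; rw [inner_sub_left]; ring
    have h3 := hmean b u
    rw [h2, integral_add h1 (integrable_const _)] at h3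
    simpa using h3
  have hvar : ∀ b u, Var[fun ω => inner ℝ (X b ω - g b) u; Measure.pi ν] ≤ s * ‖u‖ ^ 2 :=
    fun b u => (variance_le_expectation_sq (hL b u).aestronglyMeasurable).trans
      ((hX b).integral_le u)
  have hsumL : ∀ u, MemLp (∑ b ∈ K, fun ω => inner ℝ (X b ω - g b) u) 2 (Measure.pi ν) :=
    fun u => memLp_finsetSum' _ fun b _ => hL b u
  refine ⟨?_, fun u => ?_, fun u => ?_⟩
  · exact (Finset.measurable_fun_sum _ fun b _ => (hX b).meas).const_smul (1 / (K.card : ℝ))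
  · simp only [hdiff]
    exact ((hsumL u).const_mul _).integrable_sq
  · simp only [hdiff, mul_pow]
    rw [integral_const_mul]
    have hs := IndepFun.variance_sum (s := K) (X := fun b ω => inner ℝ (X b ω - g b) u)
      (fun b _ => hL b u) fun b _ b' _ hbb' =>
        indepFun_of_dependsOn ν (((hX b).meas.sub_const _).inner measurable_const)
          (((hX b').meas.sub_const _).inner measurable_const) (hd hbb')
          (fun x y hxy => by simp only [hJ b hxy]) (fun x y hxy => by simp only [hJ b' hxy])
    rw [variance_eq_integral (hsumL u).aestronglyMeasurable.aemeasurable] at hs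
    have h0 : ∫ ω, (∑ b ∈ K, fun ω => inner ℝ (X b ω - g b) u) ω ∂(Measure.pi ν) = 0 := by
      simp only [Finset.sum_apply]
      rw [integral_finsetSum _ fun b _ => (hL b u).integrable (by norm_num)]
      simp [hmean0]
    rw [h0] at hs
    simp only [sub_zero] at hs
    rw [hs]
    calc _ ≤ (1 / (K.card : ℝ)) ^ 2 * ∑ _b ∈ K, s * ‖u‖ ^ 2 := by
          gcongr with b; exact hvar b u
      _ = _ := by rw [Finset.sum_const, nsmul_eq_mul]; field_simp

end SpreadAverages

/- ## The batches that look alike, and the robust average -/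

/-- Call a point good if it is within ρ of `g`; the good ones are a majority. A good point has
median distance at most 2ρ from the others, so the selected point does too. More than half of the
points lie within 2ρ of it, and one of those is good. -/
theorem norm_medianPoint_sub_le {d T : ℕ} {Δ : Fin T → Vec d} {g : Vec d} {ρ : ℝ}
    (h : 2 * (Finset.univ.filter fun i => ρ < ‖Δ i - g‖).card < T) :
    ‖medianPoint Δ - g‖ ≤ 3 * ρ := by
  have hT : 0 < T := by omega
  set bad := Finset.univ.filter fun i => ρ < ‖Δ i - g‖ with hbad
  have hgood : ∀ i, i ∉ bad → ‖Δ i - g‖ ≤ ρ := fun i hi => by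
    rw [hbad, Finset.mem_filter, not_and] at hi
    exact not_lt.1 (hi (Finset.mem_univ i))
  obtain ⟨i₀, hi₀⟩ : ∃ i, i ∉ bad := by
    by_contra! hall
    have : bad = Finset.univ := Finset.eq_univ_of_forall hall
    rw [this, Finset.card_univ, Fintype.card_fin] at h
    omega
  have hm₀ : median (fun j => ‖Δ i₀ - Δ j‖) ≤ 2 * ρ := by
    refine median_le_of_card _ (lt_of_le_of_lt (Nat.mul_le_mul_left 2 (Finset.card_le_card ?_)) h)
    intro j hj
    by_contra hjb
    rw [Finset.mem_filter] at hj
    have h1 := hgood i₀ hi₀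
    have h2 := hgood j hjb
    have h3 : ‖Δ i₀ - Δ j‖ ≤ ‖Δ i₀ - g‖ + ‖Δ j - g‖ := by
      rw [norm_sub_rev (Δ j) g]
      exact norm_sub_le_norm_sub_add_norm_sub _ _ _
    linarith [hj.2]
  rcases hc : (List.finRange T).argmin (fun i => median fun j => ‖Δ i - Δ j‖) with _ | i
  · rw [List.argmin_eq_none, List.finRange_eq_nil_iff] at hc
    omega
  have hmi : median (fun j => ‖Δ i - Δ j‖) ≤ 2 * ρ :=
    (List.le_of_mem_argmin (List.mem_finRange i₀) hc).trans hm₀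
  have hpt : medianPoint Δ = Δ i := by rw [medianPoint, hc]; rfl
  rw [hpt]
  have hA := (median_le_iff hT _ _).1 hmi
  set A := Finset.univ.filter fun j => ‖Δ i - Δ j‖ ≤ 2 * ρ with hAdef
  obtain ⟨j, hjA, hjb⟩ : ∃ j ∈ A, j ∉ bad := by
    by_contra! hall
    have := Finset.card_le_card hall
    omega
  have h1 : ‖Δ i - Δ j‖ ≤ 2 * ρ := (Finset.mem_filter.1 hjA).2
  have h2 := hgood j hjb
  have h3 := norm_sub_le_norm_sub_add_norm_sub (Δ i) (Δ j) g
  linarith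

section Stages

variable {ι : Type} [Fintype ι] {d : ℕ} {ν : ι → Measure (Sample d)}
  [∀ i, IsProbabilityMeasure (ν i)] {C₁ B₀ : ℝ} {κ : ℝ} (hκ : 0 < κ) (w : Vec d) (hC₁ : 0 < C₁)
  {P : Matrix (Fin d) (Fin d) ℝ} {l : ℕ} (hP : IsProjOfRank P l) (hl : 1 ≤ l)
  {ε : ℝ} (hε : 0 < ε)

/-- The samples that enter the `q`-th pair of gradients of the test. -/
def testIdx (b S : Arr ι) (n : ℕ) (q : Fin n) : Set ι :=
  ((b.part 2 0).part n q).idx ∪ (S.part n q).idx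

omit [Fintype ι] in
theorem disjoint_testIdx {b S : Arr ι} (hbi : Function.Injective b.get)
    (hSi : Function.Injective S.get) (hbS : Disjoint b.idx S.idx) {n : ℕ} {q q' : Fin n}
    (hq : q ≠ q') : Disjoint (testIdx b S n q) (testIdx b S n q') := by
  have hb' : ∀ q, ((b.part 2 0).part n q).idx ⊆ b.idx := fun q =>
    (Arr.idx_part_subset _ _ _).trans (Arr.idx_part_subset _ _ _)
  have hS' : ∀ q, (S.part n q).idx ⊆ S.idx := fun q => Arr.idx_part_subset _ _ _
  exact Set.disjoint_union_left.2 ⟨Set.disjoint_union_right.2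
    ⟨Arr.disjoint_part (Arr.part_injective hbi _ _) _ hq, hbS.mono (hb' _) (hS' _)⟩,
    Set.disjoint_union_right.2 ⟨hbS.symm.mono (hS' _) (hb' _), Arr.disjoint_part hSi _ hq⟩⟩

/-! ### Comparing one batch with the distinguished batch -/

section Test

variable {Db Ds : Measure (Sample d)} (hDb : IsBounded Db C₁ B₀) (hDs : IsBounded Ds C₁ B₀)
  {b S : Arr ι} (hb : ∀ t, ν (b.get t) = Db) (hS : ∀ t, ν (S.get t) = Ds)
  (hbi : Function.Injective b.get) (hSi : Function.Injective S.get)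
  (hbS : Disjoint b.idx S.idx) {T₁ : ℕ} {m : ℝ} (hm : 6144 * Real.sqrt l ≤ ε ^ 2 * m)
  (hmb : m ≤ (b.size / 2 / (2 * T₁) : ℕ)) (hmS : m ≤ (S.size / (2 * T₁) : ℕ))

-- The statistic is an inner product of two independent estimates of the same difference g of
-- expected gradients, hence unbiased for ‖Pg‖². Expanding around g leaves a product of two
-- deviations, of size s√ℓ, and two linear terms of size ‖Pg‖√s.
include hκ hC₁ hP hl hε hDb hDs hb hS hbi hSi hbS hm hmb hmS in
theorem measure_testStat_le (j : Fin T₁) :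
    Measure.pi ν {ω | ¬ |testStat T₁ (b.map ω) (S.map ω) κ w P j -
      ‖Matrix.toEuclideanLin P (gradMean Db w κ - gradMean Ds w κ)‖ ^ 2| ≤
      (ε * κ * Real.sqrt C₁) ^ 2 / 8 +
      ‖Matrix.toEuclideanLin P (gradMean Db w κ - gradMean Ds w κ)‖ *
        ((ε * κ * Real.sqrt C₁) / 4)} ≤ ENNReal.ofReal (1 / 8) := by
  set ρ := ε * κ * Real.sqrt C₁ with hρ
  have hρ0 : 0 < ρ := by have := Real.sqrt_pos.2 hC₁; positivity
  have hρ2 : ρ ^ 2 = ε ^ 2 * (κ ^ 2 * C₁) := by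
    rw [hρ, mul_pow, mul_pow, Real.sq_sqrt hC₁.le]; ring
  set g := gradMean Db w κ - gradMean Ds w κ with hg
  have hl' : (1 : ℝ) ≤ Real.sqrt l := by
    rw [Real.one_le_sqrt]; exact_mod_cast hl
  have hmpos : 0 < m := by
    have h1 : 0 < ε ^ 2 * m := lt_of_lt_of_le (by positivity) hm
    exact pos_of_mul_pos_right h1 (by positivity)
  have hK : 0 < κ ^ 2 * C₁ := by positivity
  -- A difference of two averages, each with spread at most κ²C₁/m, has spread at most 2(1/m +
  -- 1/m)κ²C₁.
  set s := 4 * (κ ^ 2 * C₁) / m with hs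
  have hs0 : 0 ≤ s := by positivity
  have hsρ : s * Real.sqrt l ≤ ρ ^ 2 / 1536 := by
    rw [hs, hρ2, div_mul_eq_mul_div, div_le_div_iff₀ hmpos (by norm_num)]
    nlinarith
  let q₁ : Fin (2 * T₁) := ⟨j.val, by have := j.isLt; omega⟩
  let q₂ : Fin (2 * T₁) := ⟨T₁ + j.val, by have := j.isLt; omega⟩
  have hq : q₁ ≠ q₂ := by
    intro h
    have := congrArg Fin.val h
    have h2 := j.isLt
    simp only [q₁, q₂] at this
    omega
  let X : Fin (2 * T₁) → (ι → Sample d) → Vec d := fun q ω =>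
    avgClipGrad (((b.part 2 0).part (2 * T₁) q).map ω) w κ -
      avgClipGrad ((S.part (2 * T₁) q).map ω) w κ
  let I : Fin (2 * T₁) → Set ι := testIdx b S (2 * T₁)
  have hspread : ∀ q, IsSpread (Measure.pi ν) (X q) g s := fun q => by
    have hb0 : 0 < (b.size / 2 / (2 * T₁) : ℕ) := by exact_mod_cast hmpos.trans_le hmb
    have hS0 : 0 < (S.size / (2 * T₁) : ℕ) := by exact_mod_cast hmpos.trans_le hmS
    have h1 := isSpread_avgClipGrad hκ w hDb (a := (b.part 2 0).part (2 * T₁) q) (fun t => hb _)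
      (Arr.part_injective (Arr.part_injective hbi _ _) _ _) hb0
    have h2 := isSpread_avgClipGrad hκ w hDs (a := S.part (2 * T₁) q) (fun t => hS _)
      (Arr.part_injective hSi _ _) hS0
    refine (h1.sub h2).mono ?_
    have e1 : κ ^ 2 * C₁ / ((b.size / 2 / (2 * T₁) : ℕ) : ℝ) ≤ κ ^ 2 * C₁ / m := by gcongr
    have e2 : κ ^ 2 * C₁ / ((S.size / (2 * T₁) : ℕ) : ℝ) ≤ κ ^ 2 * C₁ / m := by gcongr
    change 2 * (κ ^ 2 * C₁ / ((b.size / 2 / (2 * T₁) : ℕ) : ℝ) +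
      κ ^ 2 * C₁ / ((S.size / (2 * T₁) : ℕ) : ℝ)) ≤ s
    calc _ ≤ 2 * (κ ^ 2 * C₁ / m + κ ^ 2 * C₁ / m) := by gcongr
      _ = s := by rw [hs]; ring
  have hdep : ∀ q, DependsOn (X q) (I q) := fun q x y hxy => by
    simp only [X]
    rw [Arr.map_congr fun i hi => hxy i (Set.mem_union_left _ hi),
      Arr.map_congr (a := S.part (2 * T₁) q) fun i hi => hxy i (Set.mem_union_right _ hi)]
  have hdis : Disjoint (I q₁) (I q₂) := disjoint_testIdx hbi hSi hbS hq
  have p1 := IsSpread.measure_inner_inner_le hP (hspread q₁) (hspread q₂) hs0 hdis (hdep q₁)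
    (hdep q₂) (t := ρ ^ 2 / 8) (by positivity)
  have hsq : s ≤ ρ ^ 2 / 1536 := le_trans (by nlinarith) hsρ
  -- Each of the three exceptional events gets probability 1/24. For the linear terms 64/1536 =
  -- 1/24; the product term has room to spare.
  have p2 := fun q => (hspread q).measure_inner_le (u := Matrix.toEuclideanLin P g) (r := ρ / 8)
    (q := 1 / 24) (by positivity) (by
      rw [div_pow, div_le_iff₀ (by positivity)]; linarith)
  have p1' : s ^ 2 * l / (ρ ^ 2 / 8) ^ 2 ≤ 1 / 24 := by
    rw [div_le_iff₀ (by positivity)]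
    have h1 : s ^ 2 * l = (s * Real.sqrt l) ^ 2 := by
      rw [mul_pow, Real.sq_sqrt (by positivity)]
    rw [h1]
    have h2 : (s * Real.sqrt l) ^ 2 ≤ (ρ ^ 2 / 1536) ^ 2 := by gcongr
    nlinarith [sq_nonneg (ρ ^ 2)]
  refine (measure_mono (t := ({ω | ρ ^ 2 / 8 < |inner ℝ (Matrix.toEuclideanLin P (X q₁ ω - g))
    (Matrix.toEuclideanLin P (X q₂ ω - g))|} ∪
    {ω | ‖Matrix.toEuclideanLin P g‖ * (ρ / 8) <
      |inner ℝ (X q₁ ω - g) (Matrix.toEuclideanLin P g)|}) ∪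
    {ω | ‖Matrix.toEuclideanLin P g‖ * (ρ / 8) <
      |inner ℝ (X q₂ ω - g) (Matrix.toEuclideanLin P g)|}) fun ω hω => ?_).trans
    (((measure_union_le _ _).trans (add_le_add ((measure_union_le _ _).trans
      (add_le_add (p1.trans (ENNReal.ofReal_le_ofReal p1')) (p2 q₁))) (p2 q₂))).trans ?_)
  · by_contra hc
    simp only [Set.mem_union, not_or] at hc
    obtain ⟨⟨h1, h2⟩, h3⟩ := hc
    have h1 : |inner ℝ (Matrix.toEuclideanLin P (X q₁ ω - g))
      (Matrix.toEuclideanLin P (X q₂ ω - g))| ≤ ρ ^ 2 / 8 := not_lt.1 h1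
    have h2 : |inner ℝ (X q₁ ω - g) (Matrix.toEuclideanLin P g)| ≤
      ‖Matrix.toEuclideanLin P g‖ * (ρ / 8) := not_lt.1 h2
    have h3 : |inner ℝ (X q₂ ω - g) (Matrix.toEuclideanLin P g)| ≤
      ‖Matrix.toEuclideanLin P g‖ * (ρ / 8) := not_lt.1 h3
    refine hω ?_
    have hts : testStat T₁ (b.map ω) (S.map ω) κ w P j = inner ℝ (Matrix.toEuclideanLin P (X q₁ ω))
        (Matrix.toEuclideanLin P (X q₂ ω)) := rfl
    rw [hts]
    have hdec : inner ℝ (Matrix.toEuclideanLin P (X q₁ ω)) (Matrix.toEuclideanLin P (X q₂ ω)) -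
        ‖Matrix.toEuclideanLin P g‖ ^ 2 =
        inner ℝ (Matrix.toEuclideanLin P (X q₁ ω - g)) (Matrix.toEuclideanLin P (X q₂ ω - g)) +
        inner ℝ (X q₁ ω - g) (Matrix.toEuclideanLin P g) +
        inner ℝ (X q₂ ω - g) (Matrix.toEuclideanLin P g) := by
      have k : ∀ x, inner ℝ (x - g) (Matrix.toEuclideanLin P g) =
          inner ℝ (Matrix.toEuclideanLin P x) (Matrix.toEuclideanLin P g) -
            ‖Matrix.toEuclideanLin P g‖ ^ 2 := fun x => by
        rw [← hP.idem, ← hP.symm, map_sub, inner_sub_left, real_inner_self_eq_norm_sq, hP.idem]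
      rw [k, k]
      simp only [map_sub, inner_sub_left, inner_sub_right, real_inner_self_eq_norm_sq]
      rw [real_inner_comm (Matrix.toEuclideanLin P g) (Matrix.toEuclideanLin P (X q₂ ω))]
      ring
    rw [hdec]
    refine (abs_add_three _ _ _).trans ?_
    linarith
  · rw [← ENNReal.ofReal_add (by norm_num) (by norm_num),
      ← ENNReal.ofReal_add (by norm_num) (by norm_num)]
    exact ENNReal.ofReal_le_ofReal (by norm_num)

-- The threshold ρ² separates the two cases: for equal distributions the statistic is typically at
-- most ρ²/8, and for a projected difference above 2ρ it is typically above 2ρ². Different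
-- repetitions use disjoint parts, so a majority vote applies to the median.
include hκ hC₁ hP hl hε hDb hDs hb hS hbi hSi hbS hm hmb hmS in
theorem measure_median_testStat_le {δ : ℝ} (hδ : 0 < δ) (hδ1 : δ ≤ 1)
    (hT : 3 * Real.log (1 / δ) ≤ T₁) :
    Measure.pi ν {ω | ¬ ((Db = Ds → median (testStat T₁ (b.map ω) (S.map ω) κ w P) ≤
        (ε * κ * Real.sqrt C₁) ^ 2) ∧
      (median (testStat T₁ (b.map ω) (S.map ω) κ w P) ≤ (ε * κ * Real.sqrt C₁) ^ 2 →
        ‖Matrix.toEuclideanLin P (gradMean Db w κ - gradMean Ds w κ)‖ ≤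
          2 * (ε * κ * Real.sqrt C₁)))} ≤ ENNReal.ofReal δ := by
  classical
  have h0 := measure_testStat_le hκ w hC₁ hP hl hε hDb hDs hb hS hbi hSi hbS hm hmb hmS
  set ρ := ε * κ * Real.sqrt C₁ with hρ
  have hρ0 : 0 < ρ := by have := Real.sqrt_pos.2 hC₁; positivity
  set x := ‖Matrix.toEuclideanLin P (gradMean Db w κ - gradMean Ds w κ)‖ with hx
  let good : ℝ → Prop := fun z => |z - x ^ 2| ≤ ρ ^ 2 / 8 + x * (ρ / 4)
  let E : Fin T₁ → Set (ι → Sample d) := fun j =>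
    {ω | ¬ good (testStat T₁ (b.map ω) (S.map ω) κ w P j)}
  let I : Fin (2 * T₁) → Set ι := testIdx b S (2 * T₁)
  let q₁ : Fin T₁ → Fin (2 * T₁) := fun j => ⟨j.val, by have := j.isLt; omega⟩
  let q₂ : Fin T₁ → Fin (2 * T₁) := fun j => ⟨T₁ + j.val, by have := j.isLt; omega⟩
  have hI : ∀ q q', q ≠ q' → Disjoint (I q) (I q') := fun q q' hq =>
    disjoint_testIdx hbi hSi hbS hq
  have hmaj := measure_majority_le ν (E := E) (J := fun j => I (q₁ j) ∪ I (q₂ j)) (fun j => by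
      have h1 : Measurable fun ω : ι → Sample d => testStat T₁ (b.map ω) (S.map ω) κ w P j :=
        measurable_testStat (F := fun ω => ω) (P := fun _ => P) (fun i => measurable_pi_apply i)
          measurable_const measurable_const (fun _ _ => measurable_const) T₁ b S j
      exact (measurableSet_le (h1.sub_const _).abs measurable_const).compl)
    (fun i j hij => by
      have hv : i.val ≠ j.val := fun h => hij (Fin.ext h)
      have hi := i.isLt
      have hj := j.isLt
      simp only [Function.onFun, Set.disjoint_union_left, Set.disjoint_union_right]
      refine ⟨⟨hI _ _ ?_, hI _ _ ?_⟩, hI _ _ ?_, hI _ _ ?_⟩ <;>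
        · intro h
          have := congrArg Fin.val h
          simp only [q₁, q₂] at this
          omega)
    (fun j x y hxy => by
      have k : ∀ q : Fin (2 * T₁), I q ⊆ I (q₁ j) ∪ I (q₂ j) →
          ((b.part 2 0).part (2 * T₁) q).map x = ((b.part 2 0).part (2 * T₁) q).map y ∧
          (S.part (2 * T₁) q).map x = (S.part (2 * T₁) q).map y := fun q hq =>
        ⟨Arr.map_congr fun i hi => hxy i (hq (Set.mem_union_left _ hi)),
          Arr.map_congr fun i hi => hxy i (hq (Set.mem_union_right _ hi))⟩
      have k1 := k (q₁ j) Set.subset_union_left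
      have k2 := k (q₂ j) Set.subset_union_right
      have hts : testStat T₁ (b.map x) (S.map x) κ w P j =
          testStat T₁ (b.map y) (S.map y) κ w P j := by
        change inner ℝ (Matrix.toEuclideanLin P
          (avgClipGrad (((b.part 2 0).part (2 * T₁) (q₁ j)).map x) w κ -
            avgClipGrad ((S.part (2 * T₁) (q₁ j)).map x) w κ)) (Matrix.toEuclideanLin P
          (avgClipGrad (((b.part 2 0).part (2 * T₁) (q₂ j)).map x) w κ -
            avgClipGrad ((S.part (2 * T₁) (q₂ j)).map x) w κ)) = _
        rw [k1.1, k1.2, k2.1, k2.2]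
        rfl
      change (¬ good _) = (¬ good _)
      rw [hts])
    h0 hδ hδ1 hT
  refine (measure_mono fun ω hω => ?_).trans hmaj
  by_contra hlt
  replace hlt : 2 * (Finset.univ.filter fun j => ω ∈ E j).card < T₁ := by
    have h1 : ¬ (T₁ ≤ _) := hlt
    convert Nat.lt_of_not_le h1
  refine hω ?_
  have hE : ∀ j, ω ∈ E j ↔ ¬ good (testStat T₁ (b.map ω) (S.map ω) κ w P j) := fun j => Iff.rfl
  have hx0 : 0 ≤ x := norm_nonneg _
  constructor
  · intro hDD
    have hx' : x = 0 := by rw [hx, hDD, sub_self, map_zero, norm_zero]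
    refine median_le_of_card _ (lt_of_le_of_lt (Nat.mul_le_mul_left 2 (Finset.card_le_card ?_)) hlt)
    intro j hj
    simp only [Finset.mem_filter, Finset.mem_univ, true_and, hE] at hj ⊢
    intro hgd
    have h1 := (abs_le.1 hgd).2
    rw [hx'] at h1
    nlinarith
  · intro hmed
    by_contra! hxl
    -- For x > 2ρ the value x² - xρ/4 - ρ²/8 exceeds (4 - 1/2 - 1/8)ρ².
    have : ρ ^ 2 * 2 ≤ median (testStat T₁ (b.map ω) (S.map ω) κ w P) := by
      refine le_median_of_card _
        (lt_of_le_of_lt (Nat.mul_le_mul_left 2 (Finset.card_le_card ?_)) hlt)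
      intro j hj
      simp only [Finset.mem_filter, Finset.mem_univ, true_and, hE] at hj ⊢
      intro hgd
      have h1 := (abs_le.1 hgd).1
      nlinarith
    nlinarith

end Test

/-! ### The kept batches and the average of their gradients -/

variable {k : ℕ} {D : Fin k → Measure (Sample d)} (hB : ∀ j, IsBounded (D j) C₁ B₀)
  {B : Arr (Arr ι)} {c : Fin B.size → Fin k} (hD : ∀ b t, ν ((B.get b).get t) = D (c b))
  (hinj : ∀ b, Function.Injective (B.get b).get)

-- A union bound over the batches, each tested at confidence δ/|B|; this is why the number of
-- repetitions contains the logarithm of the number of batches.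
include hκ hC₁ hP hl hε hB hD hinj in
theorem measure_keepSet_le {S : Arr ι} {i : Fin k} (hS : ∀ t, ν (S.get t) = D i)
    (hSi : Function.Injective S.get) (hBS : ∀ b, Disjoint (B.get b).idx S.idx) {T₁ : ℕ} {m : ℝ}
    (hm : 6144 * Real.sqrt l ≤ ε ^ 2 * m) (hmb : ∀ b, m ≤ ((B.get b).size / 2 / (2 * T₁) : ℕ))
    (hmS : m ≤ (S.size / (2 * T₁) : ℕ)) {δ : ℝ} (hδ : 0 < δ) (hδ1 : δ ≤ 1)
    (hT : 3 * Real.log (B.size / δ) ≤ T₁) :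
    Measure.pi ν {ω | ¬ ∀ b : Fin B.size,
      (c b = i → keepSet T₁ (ε ^ 2 * κ ^ 2 * C₁) (B.map (Arr.map ω)) (S.map ω) κ w P b = true) ∧
      (keepSet T₁ (ε ^ 2 * κ ^ 2 * C₁) (B.map (Arr.map ω)) (S.map ω) κ w P b = true →
        ‖Matrix.toEuclideanLin P (gradMean (D (c b)) w κ - gradMean (D i) w κ)‖ ≤
          2 * (ε * κ * Real.sqrt C₁))} ≤ ENNReal.ofReal δ := by
  rcases Nat.eq_zero_or_pos B.size with h0 | hpos
  · have : IsEmpty (Fin B.size) := by rw [h0]; infer_instance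
    simp
  have hn : (0 : ℝ) < B.size := by exact_mod_cast hpos
  have hn1 : (1 : ℝ) ≤ B.size := by exact_mod_cast hpos
  have hρ2 : (ε * κ * Real.sqrt C₁) ^ 2 = ε ^ 2 * κ ^ 2 * C₁ := by
    rw [mul_pow, mul_pow, Real.sq_sqrt hC₁.le]
  have h1 : ∀ b : Fin B.size, Measure.pi ν {ω | ¬ (
      (c b = i → keepSet T₁ (ε ^ 2 * κ ^ 2 * C₁) (B.map (Arr.map ω)) (S.map ω) κ w P b = true) ∧
      (keepSet T₁ (ε ^ 2 * κ ^ 2 * C₁) (B.map (Arr.map ω)) (S.map ω) κ w P b = true →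
        ‖Matrix.toEuclideanLin P (gradMean (D (c b)) w κ - gradMean (D i) w κ)‖ ≤
          2 * (ε * κ * Real.sqrt C₁)))} ≤ ENNReal.ofReal (δ / B.size) := by
    intro b
    have h := measure_median_testStat_le hκ w hC₁ hP hl hε (hB (c b)) (hB i) (hD b) hS (hinj b) hSi
      (hBS b) hm (hmb b) hmS (δ := δ / B.size) (by positivity)
      ((div_le_one hn).2 (hδ1.trans hn1)) (by rwa [one_div_div])
    refine (measure_mono fun ω hω => ?_).trans h
    intro hc
    refine hω ?_
    rw [hρ2] at hc
    have hk : keepSet T₁ (ε ^ 2 * κ ^ 2 * C₁) (B.map (Arr.map ω)) (S.map ω) κ w P b = true ↔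
        median (testStat T₁ ((B.get b).map ω) (S.map ω) κ w P) ≤ ε ^ 2 * κ ^ 2 * C₁ :=
      decide_eq_true_iff
    rw [hk]
    exact ⟨fun hci => hc.1 (by rw [hci]), hc.2⟩
  refine (measure_mono (t := ⋃ b : Fin B.size, {ω | ¬ (
      (c b = i → keepSet T₁ (ε ^ 2 * κ ^ 2 * C₁) (B.map (Arr.map ω)) (S.map ω) κ w P b = true) ∧
      (keepSet T₁ (ε ^ 2 * κ ^ 2 * C₁) (B.map (Arr.map ω)) (S.map ω) κ w P b = true →
        ‖Matrix.toEuclideanLin P (gradMean (D (c b)) w κ - gradMean (D i) w κ)‖ ≤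
          2 * (ε * κ * Real.sqrt C₁)))}) fun ω hω => ?_).trans
    ((measure_iUnion_fintype_le _ _).trans ((Finset.sum_le_sum fun b _ => h1 b).trans ?_))
  · obtain ⟨b, hb⟩ := not_forall.1 hω
    exact Set.mem_iUnion.2 ⟨b, hb⟩
  · rw [Finset.sum_const, Finset.card_univ, Fintype.card_fin, nsmul_eq_mul,
      ← ENNReal.ofReal_natCast, ← ENNReal.ofReal_mul (by positivity)]
    refine ENNReal.ofReal_le_ofReal (le_of_eq ?_)
    field_simp

-- The set of kept batches is a constant here, since it is decided from other samples. Pooling them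
-- gives mN samples per repetition, enough for ℓ dimensions, although a single batch is not. The
-- kept batches of other components shift the mean by at most 2ρ, as it is a convex combination;
-- together with the 3ρ of the median point this makes 5ρ.
include hκ hC₁ hP hε hB hD hinj in
theorem measure_partMean_le (hdisj : Pairwise (Function.onFun Disjoint fun b => (B.get b).idx))
    {i : Fin k} {keep : Fin B.size → Bool}
    (hkeep : ∀ b, keep b = true →
      ‖Matrix.toEuclideanLin P (gradMean (D (c b)) w κ - gradMean (D i) w κ)‖ ≤
        2 * (ε * κ * Real.sqrt C₁)) {T₂ : ℕ} {m N : ℝ} (hm0 : 0 < m)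
    (hN : N ≤ (Finset.univ.filter fun b => keep b = true).card) (hN0 : 0 < N)
    (hmN : 8 * l ≤ ε ^ 2 * (m * N)) (hmb : ∀ b, m ≤ ((B.get b).size / 2 / T₂ : ℕ))
    {δ : ℝ} (hδ : 0 < δ) (hδ1 : δ ≤ 1) (hT : 3 * Real.log (1 / δ) ≤ T₂) :
    Measure.pi ν {ω | ¬ ‖medianPoint (partMean T₂ (B.map (Arr.map ω)) keep κ w P) -
      Matrix.toEuclideanLin P (gradMean (D i) w κ)‖ ≤ 5 * (ε * κ * Real.sqrt C₁)} ≤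
        ENNReal.ofReal δ := by
  classical
  set ρ := ε * κ * Real.sqrt C₁ with hρ
  have hρ0 : 0 < ρ := by have := Real.sqrt_pos.2 hC₁; positivity
  have hρ2 : ρ ^ 2 = ε ^ 2 * (κ ^ 2 * C₁) := by
    rw [hρ, mul_pow, mul_pow, Real.sq_sqrt hC₁.le]; ring
  set K := Finset.univ.filter fun b => keep b = true with hK
  have hKpos : (0 : ℝ) < K.card := hN0.trans_le hN
  have hKne : K.Nonempty := Finset.card_pos.1 (by exact_mod_cast hKpos)
  let A : Fin T₂ → Fin B.size → Arr ι := fun i b => ((B.get b).part 2 1).part T₂ i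
  let X : Fin T₂ → (ι → Sample d) → Vec d := fun i ω =>
    (1 / (K.card : ℝ)) • ∑ b ∈ K, avgClipGrad ((A i b).map ω) w κ
  set g : Vec d := (1 / (K.card : ℝ)) • ∑ b ∈ K, gradMean (D (c b)) w κ with hg
  have hAsub : ∀ i b, (A i b).idx ⊆ (B.get b).idx := fun i b =>
    (Arr.idx_part_subset _ _ _).trans (Arr.idx_part_subset _ _ _)
  have hspread : ∀ i, IsSpread (Measure.pi ν) (X i) g (κ ^ 2 * C₁ / m / K.card) := fun i => by
    refine IsSpread.average hKne (X := fun b ω => avgClipGrad ((A i b).map ω) w κ)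
      (g := fun b => gradMean (D (c b)) w κ) (fun b => ?_) (fun b u => ?_)
      (J := fun b => (A i b).idx) (fun b b' hbb' => (hdisj hbb').mono (hAsub i b) (hAsub i b'))
      (fun b => dependsOn_map (A i b) fun S : Batch d => avgClipGrad S w κ)
    · have hs : 0 < ((B.get b).size / 2 / T₂ : ℕ) := by exact_mod_cast hm0.trans_le (hmb b)
      refine (isSpread_avgClipGrad hκ w (hB (c b)) (a := A i b) (fun t => hD b _)
        (Arr.part_injective (Arr.part_injective (hinj b) _ _) _ _) hs).mono ?_
      change κ ^ 2 * C₁ / (((B.get b).size / 2 / T₂ : ℕ) : ℝ) ≤ _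
      gcongr
      exact hmb b
    · have hs : 0 < ((B.get b).size / 2 / T₂ : ℕ) := by exact_mod_cast hm0.trans_le (hmb b)
      exact integral_inner_avgClipGrad (hB (c b)) hκ (a := A i b) (fun t => hD b _) w hs u
  have hpm : ∀ ω, partMean T₂ (B.map (Arr.map ω)) keep κ w P =
      fun i => Matrix.toEuclideanLin P (X i ω) := fun ω => by
    funext i
    have : partMean T₂ (B.map (Arr.map ω)) keep κ w P i = (1 / (K.card : ℝ)) •
        ∑ b, if keep b = true then
          Matrix.toEuclideanLin P (avgClipGrad ((A i b).map ω) w κ) else 0 := rfl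
    rw [this, ← Finset.sum_filter, ← hK]
    simp only [X, map_smul, map_sum]
  let E : Fin T₂ → Set (ι → Sample d) := fun i =>
    {ω | ρ < ‖Matrix.toEuclideanLin P (X i ω - g)‖}
  have hmaj := measure_majority_le ν (E := E) (J := fun i => ⋃ b, (A i b).idx) (fun i => by
      exact measurableSet_lt measurable_const (measurable_toEuclideanLin (A := fun _ => P)
        (x := fun ω => X i ω - g) (fun _ _ => measurable_const)
        ((hspread i).meas.sub_const g)).norm)
    (fun i j hij => by
      simp only [Function.onFun, Set.disjoint_iUnion_left, Set.disjoint_iUnion_right]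
      intro b b'
      by_cases hbb : b' = b
      · subst hbb
        exact Arr.disjoint_part (Arr.part_injective (hinj b') _ _) _ hij
      · exact (hdisj hbb).mono (hAsub i b') (hAsub j b))
    (fun i x y hxy => by
      have hX : X i x = X i y := by
        simp only [X]
        congr 1
        refine Finset.sum_congr rfl fun b _ => ?_
        rw [Arr.map_congr fun t ht => hxy t (Set.mem_iUnion.2 ⟨b, ht⟩)]
      change (ρ < ‖_‖) = (ρ < ‖_‖)
      rw [hX])
    (fun i => by
      refine ((hspread i).measure_norm_le hP (by positivity) hρ0).trans
        (ENNReal.ofReal_le_ofReal ?_)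
      rw [hρ2, div_div, div_le_iff₀ (by positivity), div_mul_eq_mul_div,
        div_le_iff₀ (by positivity)]
      have h1 : 8 * (l : ℝ) ≤ ε ^ 2 * (m * K.card) := hmN.trans (by gcongr)
      have h2 : 0 < κ ^ 2 * C₁ := by positivity
      nlinarith) hδ hδ1 hT
  refine (measure_mono fun ω hω => ?_).trans hmaj
  by_contra hlt
  replace hlt : 2 * (Finset.univ.filter fun j => ω ∈ E j).card < T₂ := by
    have h1 : ¬ (T₂ ≤ _) := hlt
    convert Nat.lt_of_not_le h1
  refine hω ?_
  rw [hpm]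
  have h1 : ‖medianPoint (fun i => Matrix.toEuclideanLin P (X i ω)) - Matrix.toEuclideanLin P g‖ ≤
      3 * ρ := by
    refine norm_medianPoint_sub_le (lt_of_le_of_lt ?_ hlt)
    refine Nat.mul_le_mul_left 2 (Finset.card_le_card fun j hj => ?_)
    rw [Finset.mem_filter] at hj ⊢
    refine ⟨hj.1, ?_⟩
    change ρ < _
    rw [map_sub]
    exact hj.2
  have h2 : ‖Matrix.toEuclideanLin P g - Matrix.toEuclideanLin P (gradMean (D i) w κ)‖ ≤ 2 * ρ := by
    have e : Matrix.toEuclideanLin P g - Matrix.toEuclideanLin P (gradMean (D i) w κ) =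
        (1 / (K.card : ℝ)) • ∑ b ∈ K,
          Matrix.toEuclideanLin P (gradMean (D (c b)) w κ - gradMean (D i) w κ) := by
      rw [← map_sum, Finset.sum_sub_distrib, Finset.sum_const, ← map_smul, smul_sub, ← hg,
        ← map_sub, ← Nat.cast_smul_eq_nsmul ℝ, smul_smul, one_div, inv_mul_cancel₀ hKpos.ne',
        one_smul]
    rw [e, norm_smul, Real.norm_of_nonneg (by positivity), one_div, inv_mul_le_iff₀ hKpos]
    refine (norm_sum_le _ _).trans ((Finset.sum_le_sum fun b hb =>
      hkeep b (Finset.mem_filter.1 hb).2).trans (le_of_eq ?_))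
    rw [Finset.sum_const, nsmul_eq_mul]
  have h3 := norm_sub_le_norm_sub_add_norm_sub
    (medianPoint fun i => Matrix.toEuclideanLin P (X i ω)) (Matrix.toEuclideanLin P g)
    (Matrix.toEuclideanLin P (gradMean (D i) w κ))
  linarith

end Stages

/- ## One round of gradient descent -/

section Round

variable {d k : ℕ}

/-- The iterate after one round. -/
def gradStep (T T₁ l : ℕ) (ε₁ ε₂ σ C C₁ : ℝ) (Bs Bm : Arr (Batch d)) (S₁ S₂ : Batch d)
    (w : Vec d) : Vec d :=
  let κ := clipParam T S₁ w ε₁ σ C C₁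
  let P := singProj (crossMatrix Bs κ w) l
  w - (1 / C₁) • medianPoint (partMean T Bm
    (keepSet T₁ (ε₂ ^ 2 * κ ^ 2 * C₁) Bm S₂ κ w P) κ w P)

variable {ι : Type}

theorem measurable_gradStep {Ω : Type*} [MeasurableSpace Ω] {F : Ω → ι → Sample d}
    (hF : ∀ i, Measurable fun ω => F ω i) {w : Ω → Vec d} (hw : Measurable w) (T T₁ l : ℕ)
    (ε₁ ε₂ σ C C₁ : ℝ) (Bs Bm : Arr (Arr ι)) (S₁ S₂ : Arr ι) :
    Measurable fun ω => gradStep T T₁ l ε₁ ε₂ σ C C₁ (Bs.map (Arr.map (F ω)))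
      (Bm.map (Arr.map (F ω))) (S₁.map (F ω)) (S₂.map (F ω)) (w ω) := by
  have hκ := measurable_clipParam hF hw T S₁ ε₁ σ C C₁
  have hP := measurable_singProj hF hw hκ Bs l
  have hk := measurable_keepSet hF hw hκ hP T₁ (((hκ.pow_const 2).const_mul (ε₂ ^ 2)).mul_const C₁)
    Bm S₂
  have hm := measurable_medianPoint fun i => measurable_partMean hF hw hκ hP T Bm hk i
  exact hw.sub (hm.const_smul (1 / C₁))

theorem Arr.map₂_congr {α β : Type} {f g : α → β} {B : Arr (Arr α)} (h : ∀ i ∈ B.idx₂, f i = g i) :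
    B.map (Arr.map f) = B.map (Arr.map g) := by
  refine Arr.map_congr fun a ha => Arr.map_congr fun i hi => h i ?_
  obtain ⟨b, rfl⟩ := ha
  exact Set.mem_iUnion.2 ⟨b, hi⟩

/-- The assumptions on the (indices of the) samples that enter one round. -/
structure RoundSetup (ν : ι → Measure (Sample d)) (D : Fin k → Measure (Sample d)) (i : Fin k)
    (Bs Bm : Arr (Arr ι)) (S₁ S₂ : Arr ι) (T T₁ l : ℕ) (α ε₂ C C₁ b δ : ℝ) where
  cs : Fin Bs.size → Fin k
  cm : Fin Bm.size → Fin k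
  m : ℝ
  law_small : ∀ b t, ν ((Bs.get b).get t) = D (cs b)
  law_medium : ∀ b t, ν ((Bm.get b).get t) = D (cm b)
  law₁ : ∀ t, ν (S₁.get t) = D i
  law₂ : ∀ t, ν (S₂.get t) = D i
  inj_small : ∀ b, Function.Injective (Bs.get b).get
  inj_medium : ∀ b, Function.Injective (Bm.get b).get
  inj₁ : Function.Injective S₁.get
  inj₂ : Function.Injective S₂.get
  disj_small : Pairwise (Function.onFun Disjoint fun b => (Bs.get b).idx)
  disj_medium : Pairwise (Function.onFun Disjoint fun b => (Bm.get b).idx)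
  disj₁_small : Disjoint S₁.idx Bs.idx₂
  disj₁_medium : Disjoint S₁.idx Bm.idx₂
  disj₁₂ : Disjoint S₁.idx S₂.idx
  disj₂_small : Disjoint Bs.idx₂ S₂.idx
  disj₂_medium : Disjoint Bm.idx₂ S₂.idx
  disj_small_medium : Disjoint Bs.idx₂ Bm.idx₂
  two_le : ∀ b, 2 ≤ (Bs.get b).size
  clip_size : 128 * C ≤ (S₁.size / T : ℕ)
  small_pos : 0 < Bs.size
  small_size : Real.log (2 * d / δ) ≤ Bs.size * (α ^ 2 * ε₂ ^ 4 * C₁ / (16 * b ^ 2))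
  small_count : α / 2 * Bs.size ≤ (Finset.univ.filter fun b => cs b = i).card
  test_size : 6144 * Real.sqrt l ≤ ε₂ ^ 2 * m
  le_test : ∀ b, m ≤ ((Bm.get b).size / 2 / (2 * T₁) : ℕ)
  le_star : m ≤ (S₂.size / (2 * T₁) : ℕ)
  le_est : ∀ b, m ≤ ((Bm.get b).size / 2 / T : ℕ)
  medium_count : Real.sqrt l ≤ (Finset.univ.filter fun b => cm b = i).card
  T_ge : 3 * Real.log (1 / δ) ≤ T
  T₁_ge : 3 * Real.log (Bm.size / δ) ≤ T₁
  rank_eq : l = min (min k ⌈1 / (2 * α * ε₂ ^ 2)⌉₊) d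

/-- The lower and the upper bound on Σ, compared on one unit vector. -/
theorem one_le_of_isRegressionModel {C C₁ σ b : ℝ} {D : Measure (Sample d)} {w₀ : Vec d}
    (hB : IsBounded D C₁ b) (hM : IsRegressionModel C C₁ σ D w₀) (hd : 0 < d) : 1 ≤ C₁ := by
  have h1 := norm_sq_le_signal hB hM (EuclideanSpace.single ⟨0, hd⟩ (1 : ℝ))
  have h2 := hB.signal_le (EuclideanSpace.single ⟨0, hd⟩ (1 : ℝ))
  simp only [PiLp.norm_single, norm_one, one_pow, mul_one] at h1 h2
  linarith

variable [Fintype ι] {ν : ι → Measure (Sample d)} [∀ i, IsProbabilityMeasure (ν i)]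
  {C C₁ b σ : ℝ} {D : Fin k → Measure (Sample d)} (hB : ∀ j, IsBounded (D j) C₁ b)
  {i : Fin k} {w₀ : Vec d} (hM : IsRegressionModel C C₁ σ (D i) w₀)

/-- The accuracy parameter `ε₂` makes the error of the projected gradient small. -/
theorem error_le {ε κ Q v : ℝ} (hC : 0 < C) (hC₁ : 0 < C₁) (hσ : 0 < σ) (hε : 0 < ε)
    (hv : 0 ≤ v) (hQ : Q ≤ C₁ * v ^ 2)
    (h : κ ^ 2 ≤ 2592 * (C + 1) * C₁ * (Q + σ ^ 2) / (1 / 2)) :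
    8 * ((1 / 4096) / (C₁ * Real.sqrt (C + 1)) * min ε (1 / Real.sqrt C₁) * κ * Real.sqrt C₁) ≤
      (v + ε * σ) / 4 := by
  set s := Real.sqrt (C + 1) with hs
  set t := Real.sqrt C₁ with ht
  set e := min ε (1 / t) with he
  have hs0 : 0 < s := Real.sqrt_pos.2 (by linarith)
  have ht0 : 0 < t := Real.sqrt_pos.2 hC₁
  have hs2 : s ^ 2 = C + 1 := Real.sq_sqrt (by linarith)
  have ht2 : t ^ 2 = C₁ := Real.sq_sqrt hC₁.le
  have he0 : 0 < e := lt_min hε (by positivity)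
  have het : e * t ≤ 1 := by
    have : e ≤ 1 / t := min_le_right _ _
    rwa [le_div_iff₀ ht0] at this
  have heε : e ≤ ε := min_le_left _ _
  have hκ2 : κ ≤ 72 * s * t * (t * v + σ) := by
    refine abs_le_of_sq_le_sq' ?_ (by positivity) |>.2
    calc κ ^ 2 ≤ 5184 * (s ^ 2 * t ^ 2) * (Q + σ ^ 2) := by
          rw [hs2, ht2]; refine h.trans (le_of_eq ?_); ring
      _ ≤ 5184 * (s ^ 2 * t ^ 2) * (t * v + σ) ^ 2 := by
          gcongr
          rw [← ht2] at hQ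
          nlinarith [mul_nonneg (mul_nonneg ht0.le hv) hσ.le]
      _ = _ := by ring
  have h1 : e * (t * v + σ) ≤ v + ε * σ := by nlinarith
  have h2 : (1 / 4096) / (C₁ * s) * e * κ * t ≤ 72 / 4096 * (e * (t * v + σ)) := by
    calc _ ≤ (1 / 4096) / (C₁ * s) * e * (72 * s * t * (t * v + σ)) * t := by gcongr
      _ = _ := by rw [← ht2]; field_simp
  have h3 : 0 ≤ v + ε * σ := by positivity
  linarith

-- The new error is (1 - Σ/C₁)v minus 1/C₁ times the sum of the estimation error and the bias. The
-- lower bound on κ² makes the bias at most ‖v‖/4; the upper bound makes the estimation error 3ρ +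
-- 5ρ at most (‖v‖ + εσ)/4. Half of the contraction survives.
include hB hM in
theorem norm_gradStep_sub_le (hC : 0 < C) (hC₁ : 0 < C₁) (hσ : 0 < σ) {ε κ : ℝ} (hε : 0 < ε)
    (hκ : 0 < κ) (w Δ : Vec d) (P : Matrix (Fin d) (Fin d) ℝ)
    (h₁ : 8 * (C + 1) * C₁ * (signal (D i) (w - w₀) + σ ^ 2) / (1 / 2) ≤ κ ^ 2)
    (h₂ : κ ^ 2 ≤ 2592 * (C + 1) * C₁ * (signal (D i) (w - w₀) + σ ^ 2) / (1 / 2))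
    {ρ : ℝ} (hρ : ρ = (1 / 4096) / (C₁ * Real.sqrt (C + 1)) * min ε (1 / Real.sqrt C₁) * κ *
      Real.sqrt C₁)
    (h₃ : ‖gradMean (D i) w κ - Matrix.toEuclideanLin P (gradMean (D i) w κ)‖ ≤ 3 * ρ)
    (h₄ : ‖Δ - Matrix.toEuclideanLin P (gradMean (D i) w κ)‖ ≤ 5 * ρ) :
    ‖w - (1 / C₁) • Δ - w₀‖ ≤ (1 - 1 / (2 * C₁)) * ‖w - w₀‖ + ε * σ / (4 * C₁) := by
  have hp := (hB i).prob
  set v := w - w₀ with hv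
  set Q := signal (D i) v with hQ
  have hQ0 : 0 ≤ Q := signal_nonneg v
  set G := gradMean (D i) w κ with hG
  set Sv := Matrix.toEuclideanLin (secondMoment (D i)) v with hSv
  have hbias : ‖G - Sv‖ ≤ ‖v‖ / 4 := by
    refine (norm_gradMean_sub_le (hB i) hM hC.le hκ w).trans ?_
    rw [← hv, ← hQ]
    rw [div_mul_eq_mul_div, div_le_iff₀ (by positivity)]
    have h5 : C * Q + σ ^ 2 ≤ (C + 1) * (Q + σ ^ 2) := by nlinarith [sq_nonneg σ]
    calc _ ≤ 4 * ((C + 1) * (Q + σ ^ 2) * (C₁ * ‖v‖)) := by gcongr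
      _ = ‖v‖ / 4 * (8 * (C + 1) * C₁ * (Q + σ ^ 2) / (1 / 2)) := by ring
      _ ≤ _ := by gcongr
  have hρ' : 8 * ρ ≤ (‖v‖ + ε * σ) / 4 := by
    rw [hρ]
    exact error_le hC hC₁ hσ hε (norm_nonneg v) ((hB i).signal_le v) h₂
  have hΔ : ‖Δ - G‖ ≤ 8 * ρ := by
    have h6 := norm_sub_le_norm_sub_add_norm_sub Δ (Matrix.toEuclideanLin P G) G
    rw [norm_sub_rev (Matrix.toEuclideanLin P G) G] at h6
    linarith
  have hcontr := norm_sub_secondMoment_le (hB i) hM hC₁ v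
  have hdec : w - (1 / C₁) • Δ - w₀ = (v - (1 / C₁) • Sv) - (1 / C₁) • ((Δ - G) + (G - Sv)) := by
    rw [hv]; module
  rw [hdec]
  refine (norm_sub_le _ _).trans ?_
  rw [norm_smul, Real.norm_of_nonneg (by positivity : 0 ≤ 1 / C₁)]
  have h7 : ‖(Δ - G) + (G - Sv)‖ ≤ ‖v‖ / 2 + ε * σ / 4 := by
    refine (norm_add_le _ _).trans ?_
    linarith
  calc _ ≤ (1 - 1 / C₁) * ‖v‖ + 1 / C₁ * (‖v‖ / 2 + ε * σ / 4) := by gcongr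
    _ = _ := by field_simp; ring

-- Four stages, each failing with probability at most δ: clipping level, subspace, selection of
-- batches, average. Each is bounded conditionally on the outcome of the earlier ones, which use
-- other samples.
include hB hM in
theorem measure_gradStep_le (hd : 0 < d) (hC : 0 < C) (hσ : 0 < σ) (hb : 0 < b) {α ε ε₂ δ : ℝ}
    (hα : 0 < α) (hα1 : α ≤ 1) (hε : 0 < ε) (hε1 : ε ≤ 1) (hδ : 0 < δ) (hδ1 : δ ≤ 1)
    (hε₂ : ε₂ = (1 / 4096) / (C₁ * Real.sqrt (C + 1)) * min ε (1 / Real.sqrt C₁))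
    {Bs Bm : Arr (Arr ι)} {S₁ S₂ : Arr ι} {T T₁ l : ℕ}
    (h : RoundSetup ν D i Bs Bm S₁ S₂ T T₁ l α ε₂ C C₁ b δ) (w : Vec d) :
    Measure.pi ν {ω | ¬ ‖gradStep T T₁ l (1 / 2) ε₂ σ C C₁ (Bs.map (Arr.map ω))
        (Bm.map (Arr.map ω)) (S₁.map ω) (S₂.map ω) w - w₀‖ ≤
      (1 - 1 / (2 * C₁)) * ‖w - w₀‖ + ε * σ / (4 * C₁)} ≤ ENNReal.ofReal (4 * δ) := by
  have hp := fun j => (hB j).prob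
  have hC₁1 : 1 ≤ C₁ := one_le_of_isRegressionModel (hB i) hM hd
  have hC₁ : 0 < C₁ := by linarith
  have hε₂0 : 0 < ε₂ := by
    have h1 := Real.sqrt_pos.2 hC₁
    have h2 : 0 < Real.sqrt (C + 1) := Real.sqrt_pos.2 (by linarith)
    have h3 : 0 < min ε (1 / Real.sqrt C₁) := lt_min hε (by positivity)
    rw [hε₂]; positivity
  have hε₂1 : ε₂ ≤ 1 := by
    have h2 : 1 ≤ Real.sqrt (C + 1) := by rw [Real.one_le_sqrt]; linarith
    have h3 : min ε (1 / Real.sqrt C₁) ≤ 1 := (min_le_left _ _).trans hε1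
    have h4 : 1 ≤ C₁ * Real.sqrt (C + 1) := by nlinarith
    have h5 : (1 / 4096) / (C₁ * Real.sqrt (C + 1)) ≤ 1 := by
      rw [div_le_one (by linarith)]; linarith
    have h6 : 0 ≤ min ε (1 / Real.sqrt C₁) := le_min hε.le (by positivity)
    rw [hε₂]
    exact mul_le_one₀ h5 h6 h3
  have hl1 : 1 ≤ l := by
    rw [h.rank_eq]
    have hk : 0 < k := i.pos
    have : 0 < ⌈1 / (2 * α * ε₂ ^ 2)⌉₊ := Nat.ceil_pos.2 (by positivity)
    simp only [le_min_iff]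
    omega
  have hld : l ≤ d := h.rank_eq ▸ min_le_right _ _
  have hsl : 1 ≤ Real.sqrt l := by rw [Real.one_le_sqrt]; exact_mod_cast hl1
  have hm0 : 0 < h.m := by
    have h1 : 0 < ε₂ ^ 2 * h.m := lt_of_lt_of_le (by positivity) h.test_size
    exact pos_of_mul_pos_right h1 (by positivity)
  have hμ : ∀ t : ι, Measurable fun ω : ι → Sample d => ω t := fun t => measurable_pi_apply t
  -- the quantities computed in this round
  let κ : (ι → Sample d) → ℝ := fun ω => clipParam T (S₁.map ω) w (1 / 2) σ C C₁
  let P : (ι → Sample d) → Matrix (Fin d) (Fin d) ℝ := fun ω =>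
    singProj (crossMatrix (Bs.map (Arr.map ω)) (κ ω) w) l
  let keepOf : ℝ → Matrix (Fin d) (Fin d) ℝ → (ι → Sample d) → Fin Bm.size → Bool :=
    fun κ P ω => keepSet T₁ (ε₂ ^ 2 * κ ^ 2 * C₁) (Bm.map (Arr.map ω)) (S₂.map ω) κ w P
  let keep : (ι → Sample d) → Fin Bm.size → Bool := fun ω => keepOf (κ ω) (P ω) ω
  have hκm : Measurable κ := measurable_clipParam hμ measurable_const T S₁ _ _ _ _
  have hPm : ∀ a c, Measurable fun ω => P ω a c := fun a c =>
    measurable_singProj hμ measurable_const hκm Bs l a c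
  have hkm : Measurable keep := measurable_keepSet hμ measurable_const hκm hPm T₁
    (((hκm.pow_const 2).const_mul (ε₂ ^ 2)).mul_const C₁) Bm S₂
  have hPproj : ∀ ω, IsProjOfRank (P ω) l := fun ω => isProjOfRank_singProj _ hld
  have hκd : DependsOn κ S₁.idx := dependsOn_map S₁ fun S : Batch d =>
    clipParam T S w (1 / 2) σ C C₁
  have hPd : DependsOn P (S₁.idx ∪ Bs.idx₂) := fun x y hxy => by
    have e1 : κ x = κ y := hκd fun i hi => hxy i (Or.inl hi)
    have e2 : Bs.map (Arr.map x) = Bs.map (Arr.map y) :=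
      Arr.map₂_congr fun i hi => hxy i (Or.inr hi)
    simp only [P, e1, e2]
  -- The selection reads only the first halves of the medium batches; the averages read the second
  -- halves. The kept set is therefore independent of what is averaged over it.
  have hkeepd : ∀ κ P, DependsOn (keepOf κ P)
      (S₂.idx ∪ ⋃ b, ((Bm.get b).part 2 0).idx) := fun κ P x y hxy => by
    funext b
    have e1 : S₂.map x = S₂.map y := Arr.map_congr fun i hi => hxy i (Or.inl hi)
    have e2 : ((Bm.get b).part 2 0).map x = ((Bm.get b).part 2 0).map y :=
      Arr.map_congr fun i hi => hxy i (Or.inr (Set.mem_iUnion.2 ⟨b, hi⟩))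
    have e3 : ∀ ω : ι → Sample d, keepOf κ P ω b = decide (median (fun j : Fin T₁ =>
        let j₁ : Fin (2 * T₁) := ⟨j.val, by have := j.isLt; omega⟩
        let j₂ : Fin (2 * T₁) := ⟨T₁ + j.val, by have := j.isLt; omega⟩
        inner ℝ (Matrix.toEuclideanLin P
          (avgClipGrad ((((Bm.get b).part 2 0).map ω).part (2 * T₁) j₁) w κ -
            avgClipGrad ((S₂.map ω).part (2 * T₁) j₁) w κ))
          (Matrix.toEuclideanLin P
          (avgClipGrad ((((Bm.get b).part 2 0).map ω).part (2 * T₁) j₂) w κ -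
            avgClipGrad ((S₂.map ω).part (2 * T₁) j₂) w κ))) ≤ ε₂ ^ 2 * κ ^ 2 * C₁) :=
      fun ω => rfl
    rw [e3, e3, e1, e2]
  let ρ : ℝ → ℝ := fun κ => ε₂ * κ * Real.sqrt C₁
  have hρm : Measurable ρ := (measurable_id.const_mul ε₂).mul_const _
  -- the four stages
  let bad₁ : (ι → Sample d) → Prop := fun ω =>
    ¬ (8 * (C + 1) * C₁ * (signal (D i) (w - w₀) + σ ^ 2) / (1 / 2) ≤ κ ω ^ 2 ∧
      κ ω ^ 2 ≤ 2592 * (C + 1) * C₁ * (signal (D i) (w - w₀) + σ ^ 2) / (1 / 2))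
  -- From here on the bad events include what the earlier stages are to guarantee: a positive
  -- clipping level, and for the last stage also a correct selection. For a frozen outcome without
  -- these properties the event is empty, so the bound holds for all outcomes.
  let bad₂ : ℝ → (ι → Sample d) → Prop := fun κ ω => 0 < κ ∧
    ¬ ‖gradMean (D i) w κ - Matrix.toEuclideanLin (singProj (crossMatrix (Bs.map (Arr.map ω)) κ w) l)
      (gradMean (D i) w κ)‖ ≤ 3 * ρ κ
  let close : ℝ → Matrix (Fin d) (Fin d) ℝ → Fin Bm.size → Prop := fun κ P b =>
    ‖Matrix.toEuclideanLin P (gradMean (D (h.cm b)) w κ - gradMean (D i) w κ)‖ ≤ 2 * ρ κ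
  let bad₃ : ℝ × (Fin d → Fin d → ℝ) → (ι → Sample d) → Prop := fun q ω => 0 < q.1 ∧
    ¬ ∀ b : Fin Bm.size, (h.cm b = i → keepOf q.1 (Matrix.of q.2) ω b = true) ∧
      (keepOf q.1 (Matrix.of q.2) ω b = true → close q.1 (Matrix.of q.2) b)
  let bad₄ : (ℝ × (Fin d → Fin d → ℝ)) × (Fin Bm.size → Bool) → (ι → Sample d) → Prop := fun q ω =>
    (0 < q.1.1 ∧ (∀ b, q.2 b = true → close q.1.1 (Matrix.of q.1.2) b) ∧
      ∀ b, h.cm b = i → q.2 b = true) ∧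
    ¬ ‖medianPoint (partMean T (Bm.map (Arr.map ω)) q.2 q.1.1 w (Matrix.of q.1.2)) -
      Matrix.toEuclideanLin (Matrix.of q.1.2) (gradMean (D i) w q.1.1)‖ ≤ 5 * ρ q.1.1
  have P₁ : Measure.pi ν {ω | bad₁ ω} ≤ ENNReal.ofReal δ :=
    measure_clipParam_le (hB i) hM hC hC₁ hσ hδ hδ1 h.T_ge h.law₁ h.inj₁ h.clip_size
      (by norm_num) w
  have P₂ : Measure.pi ν {ω | bad₂ (κ ω) ω} ≤ ENNReal.ofReal δ := by
    refine measure_freeze ν hκm h.disj₁_small hκd (bad := bad₂) ?_ (fun a x y hxy => ?_)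
      fun ω => ?_
    · have hF : ∀ t : ι, Measurable fun p : ℝ × (ι → Sample d) => p.2 t := fun t =>
        (measurable_pi_apply t).comp measurable_snd
      have hG : Measurable fun p : ℝ × (ι → Sample d) => gradMean (D i) w p.1 :=
        measurable_gradMean measurable_const measurable_fst
      refine (measurableSet_lt measurable_const measurable_fst).inter
        (measurableSet_le (hG.sub (measurable_toEuclideanLin
          (fun a c => measurable_singProj hF measurable_const measurable_fst Bs l a c) hG)).norm
          ((hρm.comp measurable_fst).const_mul 3)).compl
    · have e2 : Bs.map (Arr.map x) = Bs.map (Arr.map y) := Arr.map₂_congr hxy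
      simp only [bad₂, e2]
    · by_cases h0 : 0 < κ ω
      · refine (measure_mono fun ω' hω' => ?_).trans (measure_singProj_le hB h0 w h.law_small
          h.inj_small h.disj_small h.two_le hC₁ hb hd hα hα1 hε₂0 hε₂1 hδ h.small_pos h.small_size
          h.small_count h.rank_eq)
        exact hω'.2
      · refine le_trans (le_of_eq ?_) zero_le
        refine (congrArg _ (Set.eq_empty_of_forall_notMem fun ω' hω' => h0 hω'.1)).trans
          measure_empty
  have hcl : ∀ {Ω : Type} [MeasurableSpace Ω] {f : Ω → ℝ} {q : Ω → Matrix (Fin d) (Fin d) ℝ},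
      Measurable f → (∀ a c, Measurable fun ω => q ω a c) → ∀ b,
      MeasurableSet {ω | close (f ω) (q ω) b} := fun hf hq b =>
    measurableSet_le (measurable_toEuclideanLin hq ((measurable_gradMean measurable_const hf).sub
      (measurable_gradMean measurable_const hf))).norm ((hρm.comp hf).const_mul 2)
  have hsub : ∀ b q, ((Bm.get b).part 2 q).idx ⊆ Bm.idx₂ := fun b q =>
    (Arr.idx_part_subset _ _ _).trans (Set.subset_iUnion (fun b => (Bm.get b).idx) b)
  have hf₃ : Measurable fun ω => (κ ω, fun a c => P ω a c) :=
    hκm.prodMk (measurable_pi_lambda _ fun a => measurable_pi_lambda _ fun c => hPm a c)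
  have hd₃ : DependsOn (fun ω => (κ ω, fun a c => P ω a c)) (S₁.idx ∪ Bs.idx₂) :=
    fun x y hxy => by
      have e1 : κ x = κ y := hκd fun i hi => hxy i (Or.inl hi)
      have e2 : P x = P y := hPd hxy
      simp only [e1, e2]
  have P₃ : Measure.pi ν {ω | bad₃ (κ ω, fun a c => P ω a c) ω} ≤ ENNReal.ofReal δ := by
    refine measure_freeze ν hf₃ (J' := S₂.idx ∪ ⋃ b, ((Bm.get b).part 2 0).idx) ?_ hd₃
      (bad := bad₃) ?_ (fun a x y hxy => ?_) fun ω => ?_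
    · refine Set.disjoint_union_left.2 ⟨Set.disjoint_union_right.2 ⟨h.disj₁₂, ?_⟩,
        Set.disjoint_union_right.2 ⟨h.disj₂_small, ?_⟩⟩
      · exact Set.disjoint_iUnion_right.2 fun b => h.disj₁_medium.mono_right (hsub b 0)
      · exact Set.disjoint_iUnion_right.2 fun b => h.disj_small_medium.mono_right (hsub b 0)
    · have hF : ∀ t : ι, Measurable fun p : (ℝ × (Fin d → Fin d → ℝ)) × (ι → Sample d) => p.2 t :=
        fun t => (measurable_pi_apply t).comp measurable_snd
      have hκ' : Measurable fun p : (ℝ × (Fin d → Fin d → ℝ)) × (ι → Sample d) => p.1.1 := by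
        fun_prop
      have hP' : ∀ a c, Measurable fun p : (ℝ × (Fin d → Fin d → ℝ)) × (ι → Sample d) =>
          (Matrix.of p.1.2) a c := fun a c => by
        change Measurable fun p : (ℝ × (Fin d → Fin d → ℝ)) × (ι → Sample d) => p.1.2 a c
        fun_prop
      have hk' := measurable_keepSet hF (measurable_const (a := w)) hκ' hP' T₁
        (((hκ'.pow_const 2).const_mul (ε₂ ^ 2)).mul_const C₁) Bm S₂
      have hkb : ∀ b, MeasurableSet {p : (ℝ × (Fin d → Fin d → ℝ)) × (ι → Sample d) |
          keepOf p.1.1 (Matrix.of p.1.2) p.2 b = true} := fun b =>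
        ((measurable_pi_apply b).comp hk') (measurableSet_singleton true)
      refine (measurableSet_lt measurable_const hκ').inter (MeasurableSet.compl ?_)
      have : {p : (ℝ × (Fin d → Fin d → ℝ)) × (ι → Sample d) | ∀ b : Fin Bm.size,
          (h.cm b = i → keepOf p.1.1 (Matrix.of p.1.2) p.2 b = true) ∧
          (keepOf p.1.1 (Matrix.of p.1.2) p.2 b = true → close p.1.1 (Matrix.of p.1.2) b)} =
          ⋂ b, (({_p | h.cm b = i}ᶜ ∪ {p | keepOf p.1.1 (Matrix.of p.1.2) p.2 b = true}) ∩
            ({p | keepOf p.1.1 (Matrix.of p.1.2) p.2 b = true}ᶜ ∪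
              {p | close p.1.1 (Matrix.of p.1.2) b})) := by
        ext p
        simp only [Set.mem_iInter]
        exact forall_congr' fun b => and_congr imp_iff_not_or imp_iff_not_or
      refine (congrArg MeasurableSet this).mpr (MeasurableSet.iInter fun b => ?_)
      exact ((MeasurableSet.const _).compl.union (hkb b)).inter
        ((hkb b).compl.union (hcl hκ' hP' b))
    · simp only [bad₃, hkeepd _ _ hxy]
    · by_cases h0 : 0 < κ ω
      · refine (measure_mono fun ω' hω' => ?_).trans (measure_keepSet_le h0 w hC₁ (hPproj ω) hl1
          hε₂0 hB h.law_medium h.inj_medium h.law₂ h.inj₂ (fun b => h.disj₂_medium.mono_left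
            (Set.subset_iUnion (fun b => (Bm.get b).idx) b)) h.test_size h.le_test h.le_star hδ hδ1
            h.T₁_ge)
        exact hω'.2
      · refine le_trans (le_of_eq ?_) zero_le
        refine (congrArg _ (Set.eq_empty_of_forall_notMem fun ω' hω' => h0 hω'.1)).trans
          measure_empty
  have P₄ : Measure.pi ν {ω | bad₄ ((κ ω, fun a c => P ω a c), keep ω) ω} ≤ ENNReal.ofReal δ := by
    refine measure_freeze ν (hf₃.prodMk hkm)
      (J := (S₁.idx ∪ Bs.idx₂) ∪ (S₂.idx ∪ ⋃ b, ((Bm.get b).part 2 0).idx))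
      (J' := ⋃ b, ((Bm.get b).part 2 1).idx) ?_ (fun x y hxy => ?_)
      (bad := bad₄) ?_ (fun a x y hxy => ?_) fun ω => ?_
    · refine Set.disjoint_iUnion_right.2 fun b => ?_
      refine Set.disjoint_union_left.2 ⟨Set.disjoint_union_left.2
        ⟨h.disj₁_medium.mono_right (hsub b 1), h.disj_small_medium.mono_right (hsub b 1)⟩,
        Set.disjoint_union_left.2 ⟨h.disj₂_medium.symm.mono_right (hsub b 1),
          Set.disjoint_iUnion_left.2 fun b' => ?_⟩⟩
      by_cases hbb : b' = b
      · subst hbb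
        exact Arr.disjoint_part (h.inj_medium b') 2 (by decide)
      · exact (h.disj_medium hbb).mono (Arr.idx_part_subset _ _ _) (Arr.idx_part_subset _ _ _)
    · have e1 : κ x = κ y := hκd fun i hi => hxy i (Or.inl (Or.inl hi))
      have e2 : P x = P y := hPd fun i hi => hxy i (Or.inl hi)
      have e3 : keepOf (κ x) (P x) x = keepOf (κ x) (P x) y :=
        hkeepd _ _ fun i hi => hxy i (Or.inr hi)
      have e4 : keep x = keep y := by simp only [keep, e3]; rw [e1, e2]
      simp only [e1, e2, e4]
    · have hF : ∀ t : ι, Measurable fun p : ((ℝ × (Fin d → Fin d → ℝ)) × (Fin Bm.size → Bool)) ×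
          (ι → Sample d) => p.2 t := fun t => (measurable_pi_apply t).comp measurable_snd
      have hκ' : Measurable fun p : ((ℝ × (Fin d → Fin d → ℝ)) × (Fin Bm.size → Bool)) ×
          (ι → Sample d) => p.1.1.1 := by fun_prop
      have hP' : ∀ a c, Measurable fun p : ((ℝ × (Fin d → Fin d → ℝ)) × (Fin Bm.size → Bool)) ×
          (ι → Sample d) => (Matrix.of p.1.1.2) a c := fun a c => by
        change Measurable fun p : ((ℝ × (Fin d → Fin d → ℝ)) × (Fin Bm.size → Bool)) ×
          (ι → Sample d) => p.1.1.2 a c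
        fun_prop
      have hk' : Measurable fun p : ((ℝ × (Fin d → Fin d → ℝ)) × (Fin Bm.size → Bool)) ×
          (ι → Sample d) => p.1.2 := by fun_prop
      have hkb : ∀ b, MeasurableSet {p : ((ℝ × (Fin d → Fin d → ℝ)) × (Fin Bm.size → Bool)) ×
          (ι → Sample d) | p.1.2 b = true} := fun b =>
        ((measurable_pi_apply b).comp hk') (measurableSet_singleton true)
      refine MeasurableSet.inter ((measurableSet_lt measurable_const hκ').inter
        (MeasurableSet.inter ?_ ?_)) (measurableSet_le ((measurable_medianPoint fun i =>
          measurable_partMean hF measurable_const hκ' hP' T Bm hk' i).sub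
          (measurable_toEuclideanLin hP' (measurable_gradMean measurable_const hκ'))).norm
          ((hρm.comp hκ').const_mul 5)).compl
      · have : {p : ((ℝ × (Fin d → Fin d → ℝ)) × (Fin Bm.size → Bool)) × (ι → Sample d) |
            ∀ b, p.1.2 b = true → close p.1.1.1 (Matrix.of p.1.1.2) b} =
            ⋂ b, ({p | p.1.2 b = true}ᶜ ∪ {p | close p.1.1.1 (Matrix.of p.1.1.2) b}) := by
          ext p
          simp only [Set.mem_iInter]
          exact forall_congr' fun b => imp_iff_not_or
        refine (congrArg MeasurableSet this).mpr (MeasurableSet.iInter fun b => ?_)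
        exact (hkb b).compl.union (hcl hκ' hP' b)
      · have : {p : ((ℝ × (Fin d → Fin d → ℝ)) × (Fin Bm.size → Bool)) × (ι → Sample d) |
            ∀ b, h.cm b = i → p.1.2 b = true} =
            ⋂ b, ({_p | h.cm b = i}ᶜ ∪ {p | p.1.2 b = true}) := by
          ext p
          simp only [Set.mem_iInter]
          exact forall_congr' fun b => imp_iff_not_or
        refine (congrArg MeasurableSet this).mpr (MeasurableSet.iInter fun b => ?_)
        exact (MeasurableSet.const _).compl.union (hkb b)
    · have e : partMean T (Bm.map (Arr.map x)) a.2 a.1.1 w (Matrix.of a.1.2) =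
          partMean T (Bm.map (Arr.map y)) a.2 a.1.1 w (Matrix.of a.1.2) := by
        funext j
        unfold partMean
        congr 1
        refine Finset.sum_congr rfl fun b _ => ?_
        change (if a.2 b = true then Matrix.toEuclideanLin (Matrix.of a.1.2)
          (avgClipGrad ((((Bm.get b).part 2 1).map x).part T j) w a.1.1) else 0) =
          if a.2 b = true then Matrix.toEuclideanLin (Matrix.of a.1.2)
          (avgClipGrad ((((Bm.get b).part 2 1).map y).part T j) w a.1.1) else 0
        rw [Arr.map_congr (a := (Bm.get b).part 2 1) fun t ht => hxy t (Set.mem_iUnion.2 ⟨b, ht⟩)]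
      simp only [bad₄, e]
    · by_cases h0 : 0 < κ ω ∧ (∀ b, keep ω b = true → close (κ ω) (P ω) b) ∧
          ∀ b, h.cm b = i → keep ω b = true
      · refine (measure_mono fun ω' hω' => ?_).trans (measure_partMean_le h0.1 w hC₁ (hPproj ω)
          hε₂0 hB h.law_medium h.inj_medium h.disj_medium (i := i) (keep := keep ω) h0.2.1
          (T₂ := T) hm0 (N := Real.sqrt l) ?_ (by positivity) ?_ h.le_est hδ hδ1 h.T_ge)
        · exact hω'.2
        · refine h.medium_count.trans ?_
          exact_mod_cast Finset.card_le_card fun b hb => by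
            rw [Finset.mem_filter] at hb ⊢
            exact ⟨hb.1, h0.2.2 b hb.2⟩
        -- At least √ℓ batches of component i are kept, and each part has at least 6144√ℓ/ε₂²
        -- samples; the product exceeds the 8ℓ/ε₂² required.
        · have h1 := h.test_size
          have h2 : Real.sqrt l * Real.sqrt l = l := Real.mul_self_sqrt (by positivity)
          nlinarith
      · refine le_trans (le_of_eq ?_) zero_le
        refine (congrArg _ (Set.eq_empty_of_forall_notMem fun ω' hω' => h0 hω'.1)).trans
          measure_empty
  refine (measure_mono (t := (({ω | bad₁ ω} ∪ {ω | bad₂ (κ ω) ω}) ∪ {ω | bad₃ (κ ω, fun a c => P ω a c) ω}) ∪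
    {ω | bad₄ ((κ ω, fun a c => P ω a c), keep ω) ω}) fun ω hω => ?_).trans
    ((measure_union_le _ _).trans ((add_le_add ((measure_union_le _ _).trans (add_le_add
      ((measure_union_le _ _).trans (add_le_add P₁ P₂)) P₃)) P₄).trans (le_of_eq ?_)))
  · by_contra hc
    simp only [Set.mem_union, not_or] at hc
    obtain ⟨⟨⟨h1, h2⟩, h3⟩, h4⟩ := hc
    refine hω ?_
    have h1 := not_not.1 h1
    have hκ0 : 0 < κ ω := by
      have hQ : 0 ≤ signal (D i) (w - w₀) := signal_nonneg _
      have h5 : 0 < κ ω ^ 2 := lt_of_lt_of_le (by positivity) h1.1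
      have h6 : 0 ≤ κ ω := Real.sqrt_nonneg _
      exact lt_of_le_of_ne h6 fun h7 => by rw [← h7] at h5; norm_num at h5
    have h2 := not_not.1 fun hn => h2 ⟨hκ0, hn⟩
    have h3 := not_not.1 fun hn => h3 ⟨hκ0, hn⟩
    have h4 := not_not.1 fun hn => h4 ⟨⟨hκ0, fun b => (h3 b).2, fun b => (h3 b).1⟩, hn⟩
    exact norm_gradStep_sub_le hB hM hC hC₁ hσ hε hκ0 w _ (P ω) h1.1 h1.2 (ρ := ρ (κ ω))
      (by simp only [ρ, hε₂]) h2 h4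
  · rw [← ENNReal.ofReal_add hδ.le hδ.le, ← ENNReal.ofReal_add (by positivity) hδ.le,
      ← ENNReal.ofReal_add (by positivity) hδ.le]
    congr 1
    ring

end Round

/- ## One run of the main algorithm -/

/-- The iterate after `r` out of `R` rounds. -/
def iterVal {α : Type} {R : ℕ} (step : Fin R → α → α) (a : α) : (r : ℕ) → r ≤ R → α
  | 0, _ => a
  | r + 1, h => step ⟨r, h⟩ (iterVal step a r (Nat.le_of_succ_le h))

theorem val_iterT {α : Type} {R : ℕ} (step : Fin R → α → Timed α) (a : α) (r : ℕ) (h : r ≤ R) :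
    (iterT step a r h).val = iterVal (fun r x => (step r x).val) a r h := by
  induction r with
  | zero => rfl
  | succ r ih => simp only [iterT, iterVal, Timed.val_bind, ih]

/-- The constants of the algorithm. -/
def tuning : Tuning where
  cRuns := 2
  cRounds := 4
  c₁ := 1 / 2
  c₂ := 1 / 4096
  cClip := 3
  cTest := 3
  cEst := 3
  cRuns_pos := by norm_num
  cRounds_pos := by norm_num
  c₁_pos := by norm_num
  c₂_pos := by norm_num
  cClip_pos := by norm_num
  cTest_pos := by norm_num
  cEst_pos := by norm_num

def numRounds (C₁ M ε σ : ℝ) : ℕ := ⌈4 * C₁ * Real.log (2 + M / (ε * σ))⌉₊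

/-- The relative accuracy of the projected gradients. -/
def accuracy (C C₁ ε : ℝ) : ℝ :=
  (1 / 4096) / (C₁ * Real.sqrt (C + 1)) * min ε (1 / Real.sqrt C₁)

def subspaceDim (d k : ℕ) (α ε₂ : ℝ) : ℕ := min (min k ⌈1 / (2 * α * ε₂ ^ 2)⌉₊) d

/-- The part of the samples of the distinguished batch that is used in the test of round `r`. -/
def testPart {R : ℕ} (r : Fin R) : Fin (2 * R) := ⟨R + r.val, by have := r.isLt; omega⟩

/-- The part of the samples of the distinguished batch that is used for clipping in round `r`. -/
def clipPart {R : ℕ} (r : Fin R) : Fin (2 * R) := ⟨r.val, by have := r.isLt; omega⟩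

theorem val_mainAlgorithm {d : ℕ} (q : Params) (δ δ' ε₂ : ℝ) (R l : ℕ) (Bs Bm : Arr (Batch d))
    (S : Batch d) (hR : R = numRounds q.C₁ q.M q.ε q.σ) (hε₂ : ε₂ = accuracy q.C q.C₁ q.ε)
    (hl : l = subspaceDim d q.k q.αs ε₂) (hδ' : δ' = δ / (5 * R)) :
    (mainAlgorithm tuning q δ Bs Bm S).val = iterVal (fun (r : Fin R) w =>
      gradStep ⌈3 * Real.log (1 / δ')⌉₊ ⌈3 * Real.log ((Bm.size / R : ℕ) / δ')⌉₊ l (1 / 2) ε₂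
        q.σ q.C q.C₁ (Bs.part R r) (Bm.part R r) (S.part (2 * R) (clipPart r))
        (S.part (2 * R) (testPart r)) w) 0 R le_rfl := by
  subst hR hδ' hl hε₂
  simp only [mainAlgorithm, Timed.val_bind, val_charge, val_iterT, val_clipEst, val_gradSubEst,
    val_gradEst, val_scaleT, val_vsubT]
  rfl

section Run

variable {ι : Type} {d k : ℕ}

/-- The assumptions on the (indices of the) samples that enter one run. -/
structure RunSetup (ν : ι → Measure (Sample d)) (D : Fin k → Measure (Sample d)) (i : Fin k)
    (Bs Bm : Arr (Arr ι)) (S : Arr ι) (R T T₁ l : ℕ) (α ε₂ C C₁ b δ : ℝ) where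
  cs : Fin Bs.size → Fin k
  cm : Fin Bm.size → Fin k
  m : ℝ
  law_small : ∀ b t, ν ((Bs.get b).get t) = D (cs b)
  law_medium : ∀ b t, ν ((Bm.get b).get t) = D (cm b)
  law_star : ∀ t, ν (S.get t) = D i
  inj_small : ∀ b, Function.Injective (Bs.get b).get
  inj_medium : ∀ b, Function.Injective (Bm.get b).get
  inj_star : Function.Injective S.get
  disj_small : Pairwise (Function.onFun Disjoint fun b => (Bs.get b).idx)
  disj_medium : Pairwise (Function.onFun Disjoint fun b => (Bm.get b).idx)
  disj_small_star : Disjoint Bs.idx₂ S.idx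
  disj_medium_star : Disjoint Bm.idx₂ S.idx
  disj_small_medium : Disjoint Bs.idx₂ Bm.idx₂
  two_le : ∀ b, 2 ≤ (Bs.get b).size
  clip_size : 128 * C ≤ (S.size / (2 * R) / T : ℕ)
  small_pos : 0 < Bs.size / R
  small_size : Real.log (2 * d / δ) ≤
    (Bs.size / R : ℕ) * (α ^ 2 * ε₂ ^ 4 * C₁ / (16 * b ^ 2))
  small_count : ∀ r, α / 2 * (Bs.size / R : ℕ) ≤
    (Finset.univ.filter fun t => ((⟨Bs.size, cs⟩ : Arr (Fin k)).part R r).get t = i).card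
  test_size : 6144 * Real.sqrt l ≤ ε₂ ^ 2 * m
  le_test : ∀ b, m ≤ ((Bm.get b).size / 2 / (2 * T₁) : ℕ)
  le_star : m ≤ (S.size / (2 * R) / (2 * T₁) : ℕ)
  le_est : ∀ b, m ≤ ((Bm.get b).size / 2 / T : ℕ)
  medium_count : ∀ r, Real.sqrt l ≤
    (Finset.univ.filter fun t => ((⟨Bm.size, cm⟩ : Arr (Fin k)).part R r).get t = i).card
  T_ge : 3 * Real.log (1 / δ) ≤ T
  T₁_ge : 3 * Real.log ((Bm.size / R : ℕ) / δ) ≤ T₁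
  rank_eq : l = subspaceDim d k α ε₂

theorem Arr.idx₂_part_subset {α : Type} (B : Arr (Arr α)) (p : ℕ) (j : Fin p) :
    (B.part p j).idx₂ ⊆ B.idx₂ :=
  Set.iUnion_subset fun _ => Set.subset_iUnion (fun b => (B.get b).idx) _

theorem Arr.pairwise_disjoint_part {α : Type} {B : Arr (Arr α)}
    (h : Pairwise (Function.onFun Disjoint fun b => (B.get b).idx)) (p : ℕ) (j : Fin p) :
    Pairwise (Function.onFun Disjoint fun b => ((B.part p j).get b).idx) := by
  intro s t hst
  refine h fun he => hst ?_
  simp only [Fin.mk.injEq, Nat.add_left_cancel_iff] at he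
  exact Fin.ext he

theorem Arr.disjoint_idx₂_part {α : Type} {B : Arr (Arr α)}
    (h : Pairwise (Function.onFun Disjoint fun b => (B.get b).idx)) (p : ℕ) {i j : Fin p}
    (hij : i ≠ j) : Disjoint (B.part p i).idx₂ (B.part p j).idx₂ := by
  refine Set.disjoint_iUnion_left.2 fun s => Set.disjoint_iUnion_right.2 fun t => h fun he => hij ?_
  simp only [Fin.mk.injEq] at he
  exact part_index_inj he

variable {ν : ι → Measure (Sample d)} {D : Fin k → Measure (Sample d)} {i : Fin k}
  {Bs Bm : Arr (Arr ι)} {S : Arr ι} {R T T₁ l : ℕ} {α ε₂ C C₁ b δ : ℝ}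

def RunSetup.round (h : RunSetup ν D i Bs Bm S R T T₁ l α ε₂ C C₁ b δ) (r : Fin R) :
    RoundSetup ν D i (Bs.part R r) (Bm.part R r) (S.part (2 * R) (clipPart r))
      (S.part (2 * R) (testPart r)) T T₁ l α ε₂ C C₁ b δ where
  cs := ((⟨Bs.size, h.cs⟩ : Arr (Fin k)).part R r).get
  cm := ((⟨Bm.size, h.cm⟩ : Arr (Fin k)).part R r).get
  m := h.m
  law_small b t := h.law_small _ _
  law_medium b t := h.law_medium _ _
  law₁ t := h.law_star _
  law₂ t := h.law_star _
  inj_small b := h.inj_small _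
  inj_medium b := h.inj_medium _
  inj₁ := Arr.part_injective h.inj_star _ _
  inj₂ := Arr.part_injective h.inj_star _ _
  disj_small := Arr.pairwise_disjoint_part h.disj_small _ _
  disj_medium := Arr.pairwise_disjoint_part h.disj_medium _ _
  disj₁_small := h.disj_small_star.symm.mono (Arr.idx_part_subset _ _ _)
    (Arr.idx₂_part_subset _ _ _)
  disj₁_medium := h.disj_medium_star.symm.mono (Arr.idx_part_subset _ _ _)
    (Arr.idx₂_part_subset _ _ _)
  disj₁₂ := Arr.disjoint_part h.inj_star _ fun he => by
    have := r.isLt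
    simp only [clipPart, testPart, Fin.mk.injEq] at he
    omega
  disj₂_small := h.disj_small_star.mono (Arr.idx₂_part_subset _ _ _) (Arr.idx_part_subset _ _ _)
  disj₂_medium := h.disj_medium_star.mono (Arr.idx₂_part_subset _ _ _) (Arr.idx_part_subset _ _ _)
  disj_small_medium := h.disj_small_medium.mono (Arr.idx₂_part_subset _ _ _)
    (Arr.idx₂_part_subset _ _ _)
  two_le b := h.two_le _
  clip_size := h.clip_size
  small_pos := h.small_pos
  small_size := h.small_size
  small_count := h.small_count r
  test_size := h.test_size
  le_test b := h.le_test _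
  le_star := h.le_star
  le_est b := h.le_est _
  medium_count := h.medium_count r
  T_ge := h.T_ge
  T₁_ge := h.T₁_ge
  rank_eq := h.rank_eq

/-- The samples that are used in round `r`. -/
def roundIdx (Bs Bm : Arr (Arr ι)) (S : Arr ι) (R : ℕ) (r : Fin R) : Set ι :=
  ((Bs.part R r).idx₂ ∪ (Bm.part R r).idx₂) ∪
    ((S.part (2 * R) (clipPart r)).idx ∪ (S.part (2 * R) (testPart r)).idx)

theorem RunSetup.disjoint_roundIdx (h : RunSetup ν D i Bs Bm S R T T₁ l α ε₂ C C₁ b δ)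
    {r r' : Fin R} (hr : r ≠ r') : Disjoint (roundIdx Bs Bm S R r) (roundIdx Bs Bm S R r') := by
  have hrv : r.val ≠ r'.val := fun he => hr (Fin.ext he)
  have h1 := r.isLt
  have h2 := r'.isLt
  have hS : ∀ q q' : Fin (2 * R), q.val ≠ q'.val →
      Disjoint (S.part (2 * R) q).idx (S.part (2 * R) q').idx := fun q q' hq =>
    Arr.disjoint_part h.inj_star _ fun he => hq (congrArg Fin.val he)
  have hsm : ∀ r r' : Fin R, Disjoint (Bs.part R r).idx₂ (Bm.part R r').idx₂ := fun r r' =>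
    h.disj_small_medium.mono (Arr.idx₂_part_subset _ _ _) (Arr.idx₂_part_subset _ _ _)
  have hsS : ∀ (r : Fin R) q, Disjoint (Bs.part R r).idx₂ (S.part (2 * R) q).idx := fun r q =>
    h.disj_small_star.mono (Arr.idx₂_part_subset _ _ _) (Arr.idx_part_subset _ _ _)
  have hmS : ∀ (r : Fin R) q, Disjoint (Bm.part R r).idx₂ (S.part (2 * R) q).idx := fun r q =>
    h.disj_medium_star.mono (Arr.idx₂_part_subset _ _ _) (Arr.idx_part_subset _ _ _)
  simp only [roundIdx, Set.disjoint_union_left, Set.disjoint_union_right]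
  have hss := Arr.disjoint_idx₂_part h.disj_small R hr
  have hmm := Arr.disjoint_idx₂_part h.disj_medium R hr
  refine ⟨⟨⟨⟨hss, ?_⟩, ⟨?_, ?_⟩⟩, ⟨⟨?_, hmm⟩, ⟨?_, ?_⟩⟩⟩, ⟨⟨⟨?_, ?_⟩, ⟨?_, ?_⟩⟩,
    ⟨⟨?_, ?_⟩, ⟨?_, ?_⟩⟩⟩⟩ <;>
  first
    | exact hsm _ _ | exact (hsm _ _).symm | exact hsS _ _ | exact (hsS _ _).symm
    | exact hmS _ _ | exact (hmS _ _).symm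
    | exact hS _ _ (by simp only [clipPart, testPart]; omega)

variable [Fintype ι]

/-- If every step preserves the invariant with high probability and uses fresh samples, then the
invariant holds after all steps with high probability. -/
theorem measure_iterVal_le {β X : Type} [MeasurableSpace β] [MeasurableSpace X]
    (ν : ι → Measure X) [∀ i, IsProbabilityMeasure (ν i)] {R : ℕ}
    {step : (ι → X) → Fin R → β → β} {a : β} {U : Fin R → Set ι}
    (hU : Pairwise (Function.onFun Disjoint U))
    (hm : ∀ r, Measurable fun p : β × (ι → X) => step p.2 r p.1)
    (hdep : ∀ r w, DependsOn (fun ω => step ω r w) (U r)) {good : ℕ → β → Prop}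
    (hgood : ∀ r, MeasurableSet {w | good r w}) (h0 : good 0 a) {δ : ℝ} (hδ : 0 ≤ δ)
    (hstep : ∀ (r : Fin R) w, good r w →
      Measure.pi ν {ω | ¬ good (r + 1) (step ω r w)} ≤ ENNReal.ofReal δ) (r : ℕ) (hr : r ≤ R) :
    Measure.pi ν {ω | ¬ good r (iterVal (step ω) a r hr)} ≤ ENNReal.ofReal (r * δ) := by
  have hmeas : ∀ r hr, Measurable fun ω => iterVal (step ω) a r hr := by
    intro r
    induction r with
    | zero => exact fun _ => measurable_const
    | succ r ih => exact fun hr => (hm ⟨r, hr⟩).comp ((ih _).prodMk measurable_id)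
  have hiter : ∀ r hr, DependsOn (fun ω => iterVal (step ω) a r hr)
      (⋃ r' : {r' : Fin R // r'.val < r}, U r') := by
    intro r
    induction r with
    | zero => exact fun _ _ _ _ => rfl
    | succ r ih =>
      intro hr x y hxy
      have e1 : iterVal (step x) a r (Nat.le_of_succ_le hr) =
          iterVal (step y) a r (Nat.le_of_succ_le hr) := by
        refine ih _ fun t ht => hxy t ?_
        obtain ⟨r', hr'⟩ := Set.mem_iUnion.1 ht
        exact Set.mem_iUnion.2 ⟨⟨r'.1, r'.2.trans (Nat.lt_succ_self r)⟩, hr'⟩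
      have e2 := hdep ⟨r, hr⟩ (iterVal (step x) a r (Nat.le_of_succ_le hr)) (x := x) (y := y)
        fun t ht => hxy t (Set.mem_iUnion.2 ⟨⟨⟨r, hr⟩, Nat.lt_succ_self r⟩, ht⟩)
      simp only [iterVal]
      rw [← e1]
      exact e2
  induction r with
  | zero =>
    have he : {ω | ¬ good 0 (iterVal (step ω) a 0 hr)} = ∅ :=
      Set.eq_empty_of_forall_notMem fun ω hω => hω h0
    rw [he, measure_empty]
    exact zero_le
  | succ r ih =>
    -- The invariant before the step is part of the event, so a frozen iterate matters only when it
    -- is good.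
    let bad : β → (ι → X) → Prop := fun w ω => good r w ∧ ¬ good (r + 1) (step ω ⟨r, hr⟩ w)
    have hbad : Measure.pi ν {ω | bad (iterVal (step ω) a r (Nat.le_of_succ_le hr)) ω} ≤
        ENNReal.ofReal δ := by
      refine measure_freeze ν (hmeas r _) (J' := U ⟨r, hr⟩) ?_ (hiter r _)
        (bad := bad) ?_ (fun w x y hxy => ?_) fun ω => ?_
      · refine Set.disjoint_iUnion_left.2 fun r' => hU fun he => ?_
        have h1 := r'.2
        rw [he] at h1
        exact lt_irrefl _ h1
      · exact (measurable_fst (hgood r)).inter ((hm ⟨r, hr⟩) (hgood (r + 1))).compl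
      · have e : step x ⟨r, hr⟩ w = step y ⟨r, hr⟩ w := hdep _ _ hxy
        simp only [bad, e]
      · by_cases hg : good r (iterVal (step ω) a r (Nat.le_of_succ_le hr))
        · exact (measure_mono fun ω' hω' => hω'.2).trans (hstep ⟨r, hr⟩ _ hg)
        · refine le_trans (le_of_eq ?_) zero_le
          exact (congrArg _ (Set.eq_empty_of_forall_notMem fun ω' hω' => hg hω'.1)).trans
            measure_empty
    refine (measure_mono (t := {ω | ¬ good r (iterVal (step ω) a r (Nat.le_of_succ_le hr))} ∪
      {ω | bad (iterVal (step ω) a r (Nat.le_of_succ_le hr)) ω}) fun ω hω => ?_).trans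
      ((measure_union_le _ _).trans ((add_le_add (ih _) hbad).trans (le_of_eq ?_)))
    · by_cases hg : good r (iterVal (step ω) a r (Nat.le_of_succ_le hr))
      · exact Or.inr ⟨hg, hω⟩
      · exact Or.inl hg
    · rw [← ENNReal.ofReal_add (by positivity) hδ]
      congr 1
      push_cast
      ring

variable [∀ i, IsProbabilityMeasure (ν i)] {σ : ℝ} (hB : ∀ j, IsBounded (D j) C₁ b)
  {w₀ : Vec d} (hM : IsRegressionModel C C₁ σ (D i) w₀)

-- The invariant solves the recursion of one round: εσ/2 is the fixed point of x ↦ (1 - 1/(2C₁))x +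
-- εσ/(4C₁), and the initial error, at most M as the start is 0, decays geometrically.
include hB hM in
theorem RunSetup.measure_le (hd : 0 < d) (hC : 0 < C) (hσ : 0 < σ) (hb : 0 < b) {ε M : ℝ}
    (hα : 0 < α) (hα1 : α ≤ 1) (hε : 0 < ε) (hε1 : ε ≤ 1) (hδ : 0 < δ) (hδ1 : δ ≤ 1)
    (hε₂ : ε₂ = accuracy C C₁ ε) (hw : ‖w₀‖ ≤ M)
    (h : RunSetup ν D i Bs Bm S R T T₁ l α ε₂ C C₁ b δ) :
    Measure.pi ν {ω | ¬ ‖iterVal (fun (r : Fin R) w =>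
      gradStep T T₁ l (1 / 2) ε₂ σ C C₁ ((Bs.map (Arr.map ω)).part R r)
        ((Bm.map (Arr.map ω)).part R r) ((S.map ω).part (2 * R) (clipPart r))
        ((S.map ω).part (2 * R) (testPart r)) w) 0 R le_rfl - w₀‖ ≤
      (1 - 1 / (2 * C₁)) ^ R * M + ε * σ / 2} ≤ ENNReal.ofReal (R * (4 * δ)) := by
  have hC₁1 : 1 ≤ C₁ := one_le_of_isRegressionModel (hB i) hM hd
  have hC₁ : 0 < C₁ := by linarith
  have hεσ : 0 < ε * σ := by positivity
  have hq : 0 ≤ 1 - 1 / (2 * C₁) := by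
    rw [sub_nonneg, div_le_one (by positivity)]; linarith
  refine measure_iterVal_le ν (U := roundIdx Bs Bm S R)
    (step := fun ω (r : Fin R) w => gradStep T T₁ l (1 / 2) ε₂ σ C C₁
      ((Bs.part R r).map (Arr.map ω)) ((Bm.part R r).map (Arr.map ω))
      ((S.part (2 * R) (clipPart r)).map ω) ((S.part (2 * R) (testPart r)).map ω) w)
    (good := fun r w => ‖w - w₀‖ ≤ (1 - 1 / (2 * C₁)) ^ r * M + ε * σ / 2)
    (fun r r' hr => h.disjoint_roundIdx hr) (fun r => ?_) (fun r w x y hxy => ?_) (fun r => ?_)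
    ?_ (by positivity) (fun r w hg => ?_) R le_rfl
  · exact measurable_gradStep (F := fun p : Vec d × (ι → Sample d) => p.2)
      (fun t => (measurable_pi_apply t).comp measurable_snd) measurable_fst T T₁ l (1 / 2) ε₂ σ C C₁
      (Bs.part R r) (Bm.part R r) (S.part (2 * R) (clipPart r)) (S.part (2 * R) (testPart r))
  · have e1 : (Bs.part R r).map (Arr.map x) = (Bs.part R r).map (Arr.map y) :=
      Arr.map₂_congr fun i hi => hxy i (Or.inl (Or.inl hi))
    have e2 : (Bm.part R r).map (Arr.map x) = (Bm.part R r).map (Arr.map y) :=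
      Arr.map₂_congr fun i hi => hxy i (Or.inl (Or.inr hi))
    have e3 : (S.part (2 * R) (clipPart r)).map x = (S.part (2 * R) (clipPart r)).map y :=
      Arr.map_congr fun i hi => hxy i (Or.inr (Or.inl hi))
    have e4 : (S.part (2 * R) (testPart r)).map x = (S.part (2 * R) (testPart r)).map y :=
      Arr.map_congr fun i hi => hxy i (Or.inr (Or.inr hi))
    simp only [e1, e2, e3, e4]
  · exact measurableSet_le (measurable_id.sub_const w₀).norm measurable_const
  · simp only [zero_sub, norm_neg, pow_zero, one_mul]
    linarith
  · refine (measure_mono fun ω hω => ?_).trans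
      (measure_gradStep_le hB hM hd hC hσ hb hα hα1 hε hε1 hδ hδ1 hε₂ (h.round r) w)
    intro hc
    refine hω ?_
    refine le_trans hc ?_
    calc _ ≤ (1 - 1 / (2 * C₁)) * ((1 - 1 / (2 * C₁)) ^ (r : ℕ) * M + ε * σ / 2) +
            ε * σ / (4 * C₁) := by gcongr
      _ = _ := by
        have e : ε * σ / (4 * C₁) = 1 / (2 * C₁) * (ε * σ / 2) := by field_simp; ring
        rw [e, pow_succ]; ring

/-- With x = M/(εσ) the number of rounds makes the power at most (2 + x)⁻², and x/(2 + x)² ≤ 1/2.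
The 2 inside the logarithm takes care of small M. -/
theorem pow_numRounds_le {C₁ M ε σ : ℝ} (hC₁ : 1 ≤ C₁) (hM : 0 ≤ M) (hε : 0 < ε) (hσ : 0 < σ) :
    (1 - 1 / (2 * C₁)) ^ numRounds C₁ M ε σ * M ≤ ε * σ / 2 := by
  have hεσ : 0 < ε * σ := by positivity
  set x := M / (ε * σ) with hx
  have hx0 : 0 ≤ x := by positivity
  have hMx : M = ε * σ * x := by rw [hx]; field_simp
  have hq : 0 ≤ 1 - 1 / (2 * C₁) := by
    rw [sub_nonneg, div_le_one (by positivity)]; linarith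
  have h1 : 1 - 1 / (2 * C₁) ≤ Real.exp (-(1 / (2 * C₁))) := by
    have := Real.add_one_le_exp (-(1 / (2 * C₁))); linarith
  have h2 : 4 * C₁ * Real.log (2 + x) ≤ numRounds C₁ M ε σ := Nat.le_ceil _
  have h3 : (1 - 1 / (2 * C₁)) ^ numRounds C₁ M ε σ ≤ 1 / (2 + x) ^ 2 := by
    calc _ ≤ Real.exp (-(1 / (2 * C₁))) ^ numRounds C₁ M ε σ := by gcongr
      _ = Real.exp (-((numRounds C₁ M ε σ : ℝ) / (2 * C₁))) := by
          rw [← Real.exp_nat_mul]; congr 1; ring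
      _ ≤ Real.exp (-(2 * Real.log (2 + x))) := by
          rw [Real.exp_le_exp, neg_le_neg_iff, le_div_iff₀ (by positivity)]
          linarith
      _ = _ := by
          rw [Real.exp_neg, show 2 * Real.log (2 + x) = Real.log ((2 + x) ^ 2) by
            rw [Real.log_pow]; norm_num, Real.exp_log (by positivity), one_div]
  calc _ ≤ 1 / (2 + x) ^ 2 * M := by gcongr
    _ ≤ ε * σ / 2 := by
        rw [hMx, one_div_mul_eq_div, div_le_div_iff₀ (by positivity) (by norm_num)]
        nlinarith [mul_nonneg hεσ.le hx0, mul_nonneg hεσ.le (sq_nonneg x)]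

end Run

/- ## Running time -/

section Cost

variable {α β : Type} {d n Y : ℕ}

/-- The continuation is bounded for every intermediate value, because costs depend only on sizes;
hence the time bounds hold for all data and random choices. -/
theorem cost_bind_le {x : Timed α} {f : α → Timed β} {a b : ℕ} (hx : x.cost ≤ a)
    (hf : ∀ y, (f y).cost ≤ b) : (x >>= f).cost ≤ a + b :=
  add_le_add hx (hf _)

/-- In contrast to `cost_bind_le`, the continuation is considered only at the actual value. This is
needed where that value is the length of a later loop. -/
theorem cost_charge_bind_le {a : α} {f : α → Timed β} {c b : ℕ} (hf : (f a).cost ≤ b) :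
    (charge c a >>= f).cost ≤ c + b :=
  Nat.add_le_add_left hf c

theorem cost_tab_le {f : Fin n → Timed α} {c : ℕ} (hn : n ≤ Y) (hf : ∀ i, (f i).cost ≤ c) :
    (tab f).cost ≤ Y * (c + 1) := by
  rw [cost_tab]
  refine (Finset.sum_le_card_nsmul _ _ (c + 1) fun i _ => Nat.succ_le_succ (hf i)).trans ?_
  rw [Finset.card_univ, Fintype.card_fin, smul_eq_mul]
  exact Nat.mul_le_mul_right _ hn

variable (hd : d ≤ Y)
include hd

theorem cost_dotT_le (x y : Vec d) : (dotT x y).cost ≤ 3 * Y := by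
  have : (dotT x y).cost ≤ Y * (1 + 1) + Y :=
    cost_bind_le (cost_tab_le hd fun _ => le_rfl) fun _ => hd
  omega

theorem cost_vecT_le {f : Fin d → Timed ℝ} {c : ℕ} (hf : ∀ i, (f i).cost ≤ c) :
    (vecT f).cost ≤ Y * (c + 1) :=
  cost_bind_le (b := 0) (cost_tab_le hd hf) fun _ => le_rfl

theorem cost_matT_le {f : Fin d → Fin d → Timed ℝ} {c : ℕ} (hf : ∀ i j, (f i j).cost ≤ c) :
    (matT f).cost ≤ Y * (Y * (c + 1) + 1) :=
  cost_bind_le (b := 0) (cost_tab_le hd fun i => cost_tab_le hd (hf i)) fun _ => le_rfl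

theorem cost_scaleT_le (c : ℝ) (x : Vec d) : (scaleT c x).cost ≤ 2 * Y :=
  (cost_vecT_le hd (c := 1) fun _ => le_rfl).trans (by omega)

theorem cost_vsubT_le (x y : Vec d) : (vsubT x y).cost ≤ 2 * Y :=
  (cost_vecT_le hd (c := 1) fun _ => le_rfl).trans (by omega)

theorem cost_vsumT_le (hn : n ≤ Y) (g : Fin n → Vec d) : (vsumT g).cost ≤ Y * (Y + 1) :=
  cost_vecT_le hd fun _ => hn

theorem cost_distT_le (x y : Vec d) : (distT x y).cost ≤ 2 * Y + (3 * Y + 1) :=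
  cost_bind_le (cost_vsubT_le hd x y) fun z => cost_bind_le (cost_dotT_le hd z z) fun _ => le_rfl

theorem cost_mulVecT_le (P : Matrix (Fin d) (Fin d) ℝ) (x : Vec d) :
    (mulVecT P x).cost ≤ Y * (Y * (1 + 1) + Y + 1) :=
  cost_vecT_le hd fun _ => cost_bind_le (cost_tab_le hd fun _ => le_rfl) fun _ => hd

theorem cost_clipGradT_le (z : Sample d) (w : Vec d) (κ : ℝ) :
    (clipGradT z w κ).cost ≤ 3 * Y + (1 + (1 + (1 + (1 + (1 + 2 * Y))))) :=
  cost_bind_le (cost_dotT_le hd _ _) fun _ => cost_bind_le le_rfl fun _ =>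
    cost_bind_le le_rfl fun _ => cost_bind_le le_rfl fun _ => cost_bind_le le_rfl fun _ =>
    cost_bind_le le_rfl fun _ => cost_scaleT_le hd _ _

variable (hY : 1 ≤ Y)
include hY

-- Lets lower powers of the common size bound be absorbed into the highest one.
omit hd in
theorem pow_chain : Y ≤ Y ^ 2 ∧ Y ^ 2 ≤ Y ^ 3 ∧ Y ^ 3 ≤ Y ^ 4 ∧ Y ^ 4 ≤ Y ^ 5 ∧ Y ^ 5 ≤ Y ^ 6 :=
  ⟨by simpa using Nat.pow_le_pow_right hY (show 1 ≤ 2 by norm_num),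
    Nat.pow_le_pow_right hY (by norm_num), Nat.pow_le_pow_right hY (by norm_num),
    Nat.pow_le_pow_right hY (by norm_num), Nat.pow_le_pow_right hY (by norm_num)⟩

theorem cost_avgClipGradT_le {S : Batch d} (hS : S.size ≤ Y) (w : Vec d) (κ : ℝ) :
    (avgClipGradT S w κ).cost ≤ 16 * Y ^ 2 := by
  have h : (avgClipGradT S w κ).cost ≤ Y * (3 * Y + (1 + (1 + (1 + (1 + (1 + 2 * Y))))) + 1) +
      (Y * (Y + 1) + (1 + 2 * Y)) :=
    cost_bind_le (cost_tab_le hS fun _ => cost_clipGradT_le hd _ _ _) fun _ =>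
      cost_bind_le (cost_vsumT_le hd hS _) fun _ => cost_bind_le le_rfl fun _ =>
      cost_scaleT_le hd _ _
  nlinarith [pow_chain hY]

theorem cost_avgSqResidualT_le {S : Batch d} (hS : S.size ≤ Y) (w : Vec d) :
    (avgSqResidualT S w).cost ≤ 8 * Y ^ 2 := by
  have h : (avgSqResidualT S w).cost ≤ Y * (3 * Y + (1 + 1) + 1) + (Y + 1) :=
    cost_bind_le (cost_tab_le hS fun _ => cost_bind_le (cost_dotT_le hd _ _) fun _ =>
      cost_bind_le le_rfl fun _ => le_rfl) fun _ => cost_bind_le hS fun _ => le_rfl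
  nlinarith [pow_chain hY]

theorem cost_clipEst_le (τ : Tuning) {S : Batch d} (hS : S.size ≤ Y) (w : Vec d)
    {ε δ' σ C C₁ : ℝ} (hT : ⌈τ.cClip * Real.log (1 / δ')⌉₊ ≤ Y) :
    (clipEst τ S w ε δ' σ C C₁).cost ≤ 25 * Y ^ 3 := by
  have h : (clipEst τ S w ε δ' σ C C₁).cost ≤ 4 + (Y * (8 * Y ^ 2 + 1) + ((Y ^ 2 + 1) + 10)) :=
    cost_charge_bind_le <| cost_bind_le (cost_tab_le hT fun _ => cost_avgSqResidualT_le hd hY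
      ((Nat.div_le_self _ _).trans hS) w) fun _ =>
      cost_bind_le (Nat.succ_le_succ (Nat.pow_le_pow_left hT 2)) fun _ => le_rfl
  obtain ⟨h1, h2, h3, h4, h5⟩ := pow_chain hY
  have e : Y * (8 * Y ^ 2 + 1) = 8 * Y ^ 3 + Y := by ring
  omega

theorem cost_gradSubEst_le {B : Arr (Batch d)} (hB : B.size ≤ Y)
    (hb : ∀ b, (B.get b).size ≤ Y) (κ : ℝ) (w : Vec d) {l : ℕ} (hl : l ≤ Y) :
    (gradSubEst B κ w l).cost ≤ 50 * Y ^ 3 := by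
  have hpart : ∀ b q, ((B.get b).part 2 q).size ≤ Y := fun b q =>
    (Nat.div_le_self _ _).trans (hb b)
  have h : (gradSubEst B κ w l).cost ≤ Y * (16 * Y ^ 2 + 1) + (Y * (16 * Y ^ 2 + 1) +
      (Y * (Y * (Y * (1 + (1 + 1) + 1) + (Y + 1) + 1) + 1) + (Y ^ 3 +
        Y * (Y * (Y * (1 + 1) + Y + 1) + 1)))) :=
    cost_bind_le (cost_tab_le hB fun b => cost_avgClipGradT_le hd hY (hpart b 0) _ _) fun _ =>
    cost_bind_le (cost_tab_le hB fun b => cost_avgClipGradT_le hd hY (hpart b 1) _ _) fun _ =>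
    cost_bind_le (cost_matT_le hd fun _ _ => cost_bind_le (cost_tab_le hB fun _ =>
      cost_bind_le le_rfl fun _ => cost_bind_le le_rfl fun _ => le_rfl) fun _ =>
      cost_bind_le hB fun _ => le_rfl) fun _ =>
    cost_bind_le (Nat.pow_le_pow_left hd 3) fun _ => cost_matT_le hd fun _ _ =>
      cost_bind_le (cost_tab_le hl fun _ => le_rfl) fun _ => hl
  obtain ⟨h1, h2, h3, h4, h5⟩ := pow_chain hY
  have e : Y * (16 * Y ^ 2 + 1) + (Y * (16 * Y ^ 2 + 1) +
      (Y * (Y * (Y * (1 + (1 + 1) + 1) + (Y + 1) + 1) + 1) + (Y ^ 3 +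
        Y * (Y * (Y * (1 + 1) + Y + 1) + 1)))) = 41 * Y ^ 3 + 3 * Y ^ 2 + 4 * Y := by ring
  omega

theorem cost_gradEst_le (τ : Tuning) {B : Arr (Batch d)} (hB : B.size ≤ Y)
    (hb : ∀ b, (B.get b).size ≤ Y) {S : Batch d} (hS : S.size ≤ Y) (κ : ℝ) (w : Vec d)
    (P : Matrix (Fin d) (Fin d) ℝ) {ε δ' C₁ : ℝ}
    (hT₁ : 2 * ⌈τ.cTest * Real.log (B.size / δ')⌉₊ ≤ Y)
    (hT₂ : ⌈τ.cEst * Real.log (1 / δ')⌉₊ ≤ Y) :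
    (gradEst τ B S κ w P ε δ' C₁).cost ≤ 150 * Y ^ 4 := by
  have hsz : ∀ b (p q : ℕ), (B.get b).size / p / q ≤ Y := fun b p q =>
    (Nat.div_le_self _ _).trans ((Nat.div_le_self _ _).trans (hb b))
  have hT₁' : ⌈τ.cTest * Real.log (B.size / δ')⌉₊ ≤ Y := by omega
  have hM := cost_mulVecT_le hd P
  have h : (gradEst τ B S κ w P ε δ' C₁).cost ≤ 4 + (4 + (5 + (Y * (16 * Y ^ 2 + 1) +
      (Y * (Y * (16 * Y ^ 2 + 1) + (Y * (2 * Y + (2 * Y + (Y * (Y * (1 + 1) + Y + 1) +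
        (Y * (Y * (1 + 1) + Y + 1) + 3 * Y))) + 1) + ((Y ^ 2 + 1) + 1)) + 1) + (Y +
      (Y * (Y * ((16 * Y ^ 2 + Y * (Y * (1 + 1) + Y + 1)) + 1) + (Y * (Y + 1) + (1 + 2 * Y)) + 1) +
      (Y * (Y * (2 * Y + (3 * Y + 1) + 1) + (Y ^ 2 + 1) + 1) + ((Y + 1) + 0)))))))) :=
    cost_charge_bind_le <| cost_charge_bind_le <| cost_bind_le le_rfl fun _ =>
    cost_bind_le (cost_tab_le hT₁ fun _ => cost_avgClipGradT_le hd hY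
      ((Nat.div_le_self _ _).trans hS) _ _) fun _ =>
    cost_bind_le (cost_tab_le hB fun b =>
      cost_bind_le (cost_tab_le hT₁ fun _ => cost_avgClipGradT_le hd hY (hsz b _ _) _ _) fun _ =>
      cost_bind_le (cost_tab_le hT₁' fun _ => cost_bind_le (cost_vsubT_le hd _ _) fun _ =>
        cost_bind_le (cost_vsubT_le hd _ _) fun _ => cost_bind_le (hM _) fun _ =>
        cost_bind_le (hM _) fun _ => cost_dotT_le hd _ _) fun _ =>
      cost_bind_le (Nat.succ_le_succ (Nat.pow_le_pow_left hT₁' 2)) fun _ => le_rfl) fun _ =>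
    cost_bind_le hB fun _ =>
    cost_bind_le (cost_tab_le hT₂ fun _ =>
      cost_bind_le (cost_tab_le hB fun b => by
        split_ifs
        · exact cost_bind_le (cost_avgClipGradT_le hd hY (hsz b _ _) _ _) fun _ => hM _
        · exact Nat.zero_le _) fun _ =>
      cost_bind_le (cost_vsumT_le hd hB _) fun _ => cost_bind_le le_rfl fun _ =>
      cost_scaleT_le hd _ _) fun _ =>
    cost_bind_le (cost_tab_le hT₂ fun _ => cost_bind_le (cost_tab_le hT₂ fun _ =>
      cost_distT_le hd _ _) fun _ => Nat.succ_le_succ (Nat.pow_le_pow_left hT₂ 2)) fun _ =>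
    cost_bind_le (Nat.succ_le_succ hT₂) fun o => by
      cases o <;> exact le_rfl
  obtain ⟨h1, h2, h3, h4, h5⟩ := pow_chain hY
  refine h.trans ?_
  ring_nf
  omega

/-- The sizes of all collections and the numbers of repetitions are at most `Y`. -/
theorem cost_mainAlgorithm_le (q : Params) {δ : ℝ} {Bs Bm : Arr (Batch d)} {S : Batch d}
    (hBs : Bs.size ≤ Y) (hbs : ∀ b, (Bs.get b).size ≤ Y) (hBm : Bm.size ≤ Y)
    (hbm : ∀ b, (Bm.get b).size ≤ Y) (hS : S.size ≤ Y) (hR : numRounds q.C₁ q.M q.ε q.σ ≤ Y)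
    (hT : ⌈3 * Real.log (1 / (δ / (5 * numRounds q.C₁ q.M q.ε q.σ)))⌉₊ ≤ Y)
    (hT₁ : 2 * ⌈3 * Real.log ((Bm.size / numRounds q.C₁ q.M q.ε q.σ : ℕ) /
      (δ / (5 * numRounds q.C₁ q.M q.ε q.σ)))⌉₊ ≤ Y) :
    (mainAlgorithm tuning q δ Bs Bm S).cost ≤ 300 * Y ^ 5 := by
  have hiter : ∀ {R : ℕ} (step : Fin R → Vec d → Timed (Vec d)) (c : ℕ)
      (_ : ∀ r x, (step r x).cost ≤ c) (a : Vec d) (r : ℕ) (hr : r ≤ R),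
      (iterT step a r hr).cost ≤ r * c := by
    intro R step c hc a r
    induction r with
    | zero => exact fun _ => Nat.zero_le _
    | succ r ih =>
      intro hr
      refine (cost_bind_le (ih _) fun x => hc _ x).trans (le_of_eq ?_)
      ring
  have hpart : ∀ {α : Type} (a : Arr α), a.size ≤ Y → ∀ p (j : Fin p), (a.part p j).size ≤ Y :=
    fun a ha p j => (Nat.div_le_self _ _).trans ha
  have h : (mainAlgorithm tuning q δ Bs Bm S).cost ≤ 8 + (8 + (8 + (2 +
      numRounds q.C₁ q.M q.ε q.σ *
        (25 * Y ^ 3 + (50 * Y ^ 3 + (150 * Y ^ 4 + (2 * Y + 2 * Y))))))) := by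
    refine cost_charge_bind_le <| cost_bind_le le_rfl fun _ => cost_charge_bind_le <|
      cost_charge_bind_le <| hiter _ _ (fun r w => ?_) _ _ _
    refine cost_bind_le (cost_clipEst_le hd hY tuning (hpart _ hS _ _) w hT) fun _ => ?_
    refine cost_bind_le (cost_gradSubEst_le hd hY (hpart _ hBs _ _) (fun b => hbs _) _ _
      ((min_le_right _ _).trans hd)) fun _ => ?_
    refine cost_bind_le (cost_gradEst_le hd hY tuning (hpart _ hBm _ _) (fun b => hbm _)
      (hpart _ hS _ _) _ _ _ hT₁ hT) fun _ => ?_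
    exact cost_bind_le (cost_scaleT_le hd _ _) fun _ => cost_vsubT_le hd _ _
  obtain ⟨h1, h2, h3, h4, h5⟩ := pow_chain hY
  refine h.trans ((Nat.add_le_add_left (Nat.add_le_add_left (Nat.add_le_add_left
    (Nat.add_le_add_left (Nat.mul_le_mul_right _ hR) _) _) _) _).trans ?_)
  ring_nf
  omega

theorem cost_listAlgorithm_le {Ns Nm : ℕ} {ns : Fin Ns → ℕ} {nm : Fin Nm → ℕ} (q : Params)
    (hns : ∑ b, ns b ≤ Y) (hnm : ∑ b, nm b ≤ Y) (hNs : Ns ≤ Y) (hNm : Nm ≤ Y)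
    (hruns : numRuns tuning q.αm q.δ ≤ Y) (hR : numRounds q.C₁ q.M q.ε q.σ ≤ Y)
    (hT : ⌈3 * Real.log (1 / (q.δ / (2 * numRuns tuning q.αm q.δ) /
      (5 * numRounds q.C₁ q.M q.ε q.σ)))⌉₊ ≤ Y)
    (hT₁ : 2 * ⌈3 * Real.log (((Nm - 1) / numRounds q.C₁ q.M q.ε q.σ : ℕ) /
      (q.δ / (2 * numRuns tuning q.αm q.δ) / (5 * numRounds q.C₁ q.M q.ε q.σ)))⌉₊ ≤ Y)
    (data : Data d ns nm) (s : Seed ns nm (numRuns tuning q.αm q.δ)) :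
    (listAlgorithm tuning q data s).cost ≤ 400 * Y ^ 6 := by
  have hns' : ∀ b, ns b ≤ Y := fun b =>
    (Finset.single_le_sum (fun _ _ => Nat.zero_le _) (Finset.mem_univ b)).trans hns
  have hnm' : ∀ b, nm b ≤ Y := fun b =>
    (Finset.single_le_sum (fun _ _ => Nat.zero_le _) (Finset.mem_univ b)).trans hnm
  have hshuf : ∀ {N : ℕ} {f : Fin N → ℕ} (x : (b : Fin N) → Fin (f b) → Sample d)
      (π : (b : Fin N) → Equiv.Perm (Fin (f b))), ∑ b, f b ≤ Y → N ≤ Y →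
      (tab fun b => shuffleT (π b) (x b)).cost ≤ 3 * Y := by
    intro N f x π hf hN
    change ∑ b, (2 * f b + 1) ≤ _
    rw [Finset.sum_add_distrib, ← Finset.mul_sum]
    simp only [Finset.sum_const, Finset.card_univ, Fintype.card_fin, smul_eq_mul, mul_one]
    omega
  have h : (listAlgorithm tuning q data s).cost ≤ 8 + (2 + (Y * (3 * Y + (3 * Y + (2 * Y +
      (2 * Y + 300 * Y ^ 5))) + 1) + 0)) := by
    refine cost_charge_bind_le <| cost_charge_bind_le <| cost_bind_le
      (cost_tab_le hruns fun t => ?_) fun _ => le_rfl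
    refine add_le_add (hshuf _ _ hns hNs) (add_le_add (hshuf _ _ hnm hNm)
      (add_le_add (Nat.mul_le_mul_left 2 hNs) (add_le_add (Nat.mul_le_mul_left 2 hNm) ?_)))
    refine cost_mainAlgorithm_le hd hY q hNs (fun b => hns' _) ((Nat.sub_le _ _).trans hNm)
      (fun b => hnm' _) ?_ hR hT hT₁
    unfold headBatch
    split_ifs
    · exact hnm' _
    · exact Nat.zero_le _
  obtain ⟨h1, h2, h3, h4, h5⟩ := pow_chain hY
  refine h.trans ?_
  ring_nf
  omega

end Cost

/-! ### The numbers of runs and rounds, and the total running time -/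

theorem log_natCast_le (n : ℕ) : Real.log n ≤ n :=
  Real.log_le_self (Nat.cast_nonneg n)

theorem ceil_le_of_le {x y : ℝ} (hx : x ≤ y) (hy : 0 ≤ y) : (⌈x⌉₊ : ℝ) ≤ y + 1 :=
  (Nat.cast_le.2 (Nat.ceil_mono hx)).trans (Nat.ceil_lt_add_one hy).le

theorem length_listAlgorithm {d Ns Nm : ℕ} {ns : Fin Ns → ℕ} {nm : Fin Nm → ℕ} (τ : Tuning)
    (q : Params) (data : Data d ns nm) (s : Seed ns nm (numRuns τ q.αm q.δ)) :
    (listAlgorithm τ q data s).val.length = numRuns τ q.αm q.δ :=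
  List.length_ofFn

section Runs

variable {αm δ : ℝ} (hα : 0 < αm) (hα1 : αm ≤ 1) (hδ : 0 < δ) (hδ1 : δ ≤ 1)
include hα hα1 hδ hδ1

theorem log_two_le_runs : Real.log 2 ≤ Real.log (2 / (αm * δ)) :=
  Real.log_le_log (by norm_num) ((le_div_iff₀ (by positivity)).2 (by nlinarith))

theorem half_le_runs : 1 / 2 ≤ 1 / αm * Real.log (2 / (αm * δ)) := by
  have h1 := log_two_le_runs hα hα1 hδ hδ1
  have h2 := Real.log_two_gt_d9
  have h3 : 1 ≤ 1 / αm := (one_le_div hα).2 hα1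
  nlinarith

theorem numRuns_le : (numRuns tuning αm δ : ℝ) ≤ 4 * (1 / αm) * Real.log (2 / (αm * δ)) := by
  -- With z = (1/αm) log(2/(αmδ)) ≥ 1/2, the ceiling costs 2z + 1 ≤ 4z.
  have h := half_le_runs hα hα1 hδ hδ1
  refine (ceil_le_of_le (le_refl (2 * (1 / αm) * Real.log (2 / (αm * δ)))) ?_).trans ?_ <;>
  nlinarith

theorem numRuns_pos : 0 < numRuns tuning αm δ :=
  Nat.ceil_pos.2 (by
    have := half_le_runs hα hα1 hδ hδ1
    change 0 < 2 * (1 / αm) * Real.log (2 / (αm * δ))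
    nlinarith)

omit hα1 hδ1 in
theorem log_runs_le : Real.log (2 / (αm * δ)) ≤ 1 / αm + Real.log (1 / δ) := by
  have e : 2 / (αm * δ) = 2 * (1 / αm) * (1 / δ) := by field_simp
  rw [e, Real.log_mul (by positivity) (by positivity), Real.log_mul (by norm_num) (by positivity)]
  have h1 := Real.log_le_sub_one_of_pos (show 0 < 1 / αm by positivity)
  have h2 := Real.log_two_lt_d9
  linarith

end Runs

theorem log_div_div_le {δ : ℝ} (hδ : 0 < δ) {N T R : ℕ} (hN : 0 < N) (hT : 0 < T) (hR : 0 < R) :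
    Real.log (N / (δ / (2 * T) / (5 * R))) =
      Real.log N + (Real.log (1 / δ) + Real.log 10 + Real.log T + Real.log R) := by
  have hN' : (0 : ℝ) < N := Nat.cast_pos.2 hN
  have hT' : (0 : ℝ) < T := Nat.cast_pos.2 hT
  have hR' : (0 : ℝ) < R := Nat.cast_pos.2 hR
  have e : (N : ℝ) / (δ / (2 * T) / (5 * R)) = N * (1 / δ * 10 * T * R) := by
    field_simp
    ring
  rw [e, Real.log_mul (by positivity) (by positivity), Real.log_mul (by positivity) (by positivity),
    Real.log_mul (by positivity) (by positivity), Real.log_mul (by positivity) (by positivity)]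

theorem numRounds_pos {C₁ M ε σ : ℝ} (hC₁ : 0 < C₁) (hM : 0 ≤ M) (hε : 0 < ε) (hσ : 0 < σ) :
    0 < numRounds C₁ M ε σ :=
  Nat.ceil_pos.2 (mul_pos (by linarith) (Real.log_pos (by
    have : 0 ≤ M / (ε * σ) := by positivity
    linarith)))

/-- A common bound on all sizes and numbers of repetitions. -/
theorem exists_size_bound {C₁ αm σ M ε δ X : ℝ} (hC₁ : 0 < C₁) (hα : 0 < αm) (hα1 : αm ≤ 1)
    (hσ : 0 < σ) (hM : 0 ≤ M) (hε : 0 < ε) (hδ : 0 < δ) (hδ1 : δ ≤ 1)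
    (hX1 : 1 ≤ X) (hX : 1 / αm + Real.log (1 / δ) + Real.log (2 + M / (ε * σ)) ≤ X) :
    ∃ Y : ℕ, (Y : ℝ) ≤ (24 * C₁ + 101) * X ^ 2 ∧ (∀ n : ℕ, (n : ℝ) ≤ X → n ≤ Y) ∧
      numRuns tuning αm δ ≤ Y ∧ numRounds C₁ M ε σ ≤ Y ∧
      ∀ N : ℕ, (N : ℝ) ≤ X → 2 * ⌈3 * Real.log (N / (δ / (2 * numRuns tuning αm δ) /
        (5 * numRounds C₁ M ε σ)))⌉₊ ≤ Y := by
  have hα' : 1 ≤ 1 / αm := (one_le_div hα).2 hα1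
  have hδ' : 0 ≤ Real.log (1 / δ) := Real.log_nonneg ((one_le_div hδ).2 hδ1)
  have hlog : 0 ≤ Real.log (2 + M / (ε * σ)) := Real.log_nonneg (by
    have : 0 ≤ M / (ε * σ) := by positivity
    linarith)
  have hX2 : X ≤ X ^ 2 := le_self_pow₀ hX1 two_ne_zero
  have hCX : C₁ * X ≤ C₁ * X ^ 2 := mul_le_mul_of_nonneg_left hX2 hC₁.le
  have hCX0 : 0 < C₁ * X ^ 2 := by positivity
  have hT0 := numRuns_pos hα hα1 hδ hδ1
  have hR0 := numRounds_pos hC₁ hM hε hσ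
  have hTX : (numRuns tuning αm δ : ℝ) ≤ 4 * X ^ 2 := by
    refine (numRuns_le hα hα1 hδ hδ1).trans ?_
    have h1 : Real.log (2 / (αm * δ)) ≤ X := (log_runs_le hα hδ).trans (by linarith)
    have h2 : 1 / αm ≤ X := by linarith
    have h3 := log_two_le_runs hα hα1 hδ hδ1
    have h4 := Real.log_two_gt_d9
    have h5 := mul_le_mul h2 h1 (by linarith) (by linarith)
    linarith
  have hRX : (numRounds C₁ M ε σ : ℝ) ≤ 4 * (C₁ * X ^ 2) + X ^ 2 := by
    refine (ceil_le_of_le (le_refl (4 * C₁ * Real.log (2 + M / (ε * σ)))) (by positivity)).trans ?_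
    have h := mul_le_mul_of_nonneg_left (show Real.log (2 + M / (ε * σ)) ≤ X by linarith) hC₁.le
    linarith
  have hC : ∀ {N : ℕ}, (N : ℝ) ≤ X → ((2 * ⌈3 * Real.log (N / (δ / (2 * numRuns tuning αm δ) /
      (5 * numRounds C₁ M ε σ)))⌉₊ : ℕ) : ℝ) ≤ (24 * C₁ + 100) * X ^ 2 := by
    intro N hN
    have h0 : Real.log (N / (δ / (2 * numRuns tuning αm δ) / (5 * numRounds C₁ M ε σ))) ≤
        4 * (C₁ * X ^ 2) + 16 * X ^ 2 := by
      rcases N.eq_zero_or_pos with h | h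
      -- If there are no batches the argument is 0, where `Real.log` takes the value 0.
      · rw [h, Nat.cast_zero, zero_div, Real.log_zero]
        positivity
      · rw [log_div_div_le hδ h hT0 hR0]
        have h1 := log_natCast_le N
        have h2 := log_natCast_le (numRuns tuning αm δ)
        have h3 := log_natCast_le (numRounds C₁ M ε σ)
        have h4 : Real.log 10 ≤ 9 := (Real.log_le_sub_one_of_pos (by norm_num)).trans (by norm_num)
        linarith
    have h1 := ceil_le_of_le (mul_le_mul_of_nonneg_left h0 (show (0 : ℝ) ≤ 3 by norm_num))
      (by positivity)
    push_cast
    linarith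
  have hle : ∀ {n : ℕ}, (n : ℝ) ≤ (24 * C₁ + 100) * X ^ 2 →
      n ≤ ⌈(24 * C₁ + 100) * X ^ 2⌉₊ := fun {n} hn => Nat.cast_le.1 (hn.trans (Nat.le_ceil _))
  refine ⟨⌈(24 * C₁ + 100) * X ^ 2⌉₊, (ceil_le_of_le le_rfl (by positivity)).trans ?_,
    fun n hn => hle ?_, hle ?_, hle ?_, fun N hN => hle (hC hN)⟩ <;> linarith

/-- The common size bound is quadratic in the input measure X, as the number of runs is about (1/αm)
log(2/(αmδ)), and the cost is a sixth power of that bound; hence the exponent 12. -/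
theorem cost_le_pow (C₁ : ℝ) (hC₁ : 0 < C₁) {d k Ns Nm : ℕ} {αs αm σ C M ε δ : ℝ} (hd : 0 < d)
    (hα : 0 < αm) (hα1 : αm ≤ 1) (hσ : 0 < σ) (hM : 0 ≤ M) (hε : 0 < ε) (hδ : 0 < δ)
    (hδ1 : δ ≤ 1) {ns : Fin Ns → ℕ} {nm : Fin Nm → ℕ} (hns : ∀ b, 2 ≤ ns b) (hnm : ∀ b, 1 ≤ nm b)
    (data : Data d ns nm) (s : Seed ns nm (numRuns tuning αm δ)) {p : ℕ} (hp : 12 ≤ p) :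
    ((listAlgorithm tuning ⟨k, αs, αm, σ, C, C₁, M, ε, δ⟩ data s).cost : ℝ) ≤
      400 * (24 * C₁ + 101) ^ 6 * (d + (∑ b, ns b : ℕ) + (∑ b, nm b : ℕ) + 1 / αm +
        Real.log (1 / δ) + Real.log (2 + M / (ε * σ))) ^ p := by
  obtain ⟨X, hX⟩ : ∃ X : ℝ, (d + (∑ b, ns b : ℕ) + (∑ b, nm b : ℕ) + 1 / αm +
    Real.log (1 / δ) + Real.log (2 + M / (ε * σ)) : ℝ) = X := ⟨_, rfl⟩
  rw [hX]
  have hd' : (1 : ℝ) ≤ d := Nat.one_le_cast.2 hd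
  have hα' : 1 ≤ 1 / αm := (one_le_div hα).2 hα1
  have hδ' : 0 ≤ Real.log (1 / δ) := Real.log_nonneg ((one_le_div hδ).2 hδ1)
  have hlog : 0 ≤ Real.log (2 + M / (ε * σ)) := Real.log_nonneg (by
    have : 0 ≤ M / (ε * σ) := by positivity
    linarith)
  have hs0 : (0 : ℝ) ≤ (∑ b, ns b : ℕ) := Nat.cast_nonneg _
  have hm0 : (0 : ℝ) ≤ (∑ b, nm b : ℕ) := Nat.cast_nonneg _
  have hX1 : 1 ≤ X := by linarith
  have hNs : Ns ≤ ∑ b, ns b := by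
    simpa using Finset.sum_le_sum fun b (_ : b ∈ Finset.univ) => (show 1 ≤ ns b by linarith [hns b])
  have hNm : Nm ≤ ∑ b, nm b := by
    simpa using Finset.sum_le_sum fun b (_ : b ∈ Finset.univ) => hnm b
  have hcast : ∀ {a b : ℕ}, a ≤ b → (b : ℝ) ≤ X → (a : ℝ) ≤ X := fun h h' =>
    (Nat.cast_le.2 h).trans h'
  have hsX : ((∑ b, ns b : ℕ) : ℝ) ≤ X := by linarith
  have hmX : ((∑ b, nm b : ℕ) : ℝ) ≤ X := by linarith
  have h1X : ((1 : ℕ) : ℝ) ≤ X := by simpa using hX1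
  obtain ⟨Y, hYX, hlin, hT, hR, hlog'⟩ := exists_size_bound hC₁ hα hα1 hσ hM hε hδ hδ1 hX1
    (by linarith)
  have key := cost_listAlgorithm_le (Y := Y) (d := d) (hlin _ (by linarith)) (hlin 1 h1X)
    ⟨k, αs, αm, σ, C, C₁, M, ε, δ⟩ (hlin _ hsX) (hlin _ hmX)
    (hlin _ (hcast hNs hsX)) (hlin _ (hcast hNm hmX)) hT hR
    (by
      have := hlog' 1 h1X
      rw [Nat.cast_one] at this
      exact (Nat.le_mul_of_pos_left _ two_pos).trans this)
    (hlog' _ (hcast ((Nat.div_le_self _ _).trans ((Nat.sub_le _ _).trans hNm)) hmX)) data s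
  have h1 : ((400 * Y ^ 6 : ℕ) : ℝ) ≤ 400 * ((24 * C₁ + 101) * X ^ 2) ^ 6 := by
    push_cast
    exact mul_le_mul_of_nonneg_left (pow_le_pow_left₀ (Nat.cast_nonneg _) hYX 6) (by norm_num)
  have h2 : 400 * ((24 * C₁ + 101) * X ^ 2) ^ 6 = 400 * (24 * C₁ + 101) ^ 6 * X ^ 12 := by
    rw [mul_pow, ← pow_mul, mul_assoc]
  exact ((Nat.cast_le.2 key).trans h1).trans (h2.le.trans (mul_le_mul_of_nonneg_left
    (pow_le_pow_right₀ hX1 hp) (by positivity)))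

/- ## Random orders -/

section Perm

variable {α : Type} [Fintype α] [DecidableEq α] (A : Finset α)

/-- The number of the positions in `S` at which the order `π` has an element of `A`. -/
def hits (S : Finset α) (π : Equiv.Perm α) : ℕ := (S.filter fun p => π p ∈ A).card

theorem hits_univ (π : Equiv.Perm α) : hits A Finset.univ π = A.card := by
  refine Finset.card_bij (fun p _ => π p) (fun p hp => (Finset.mem_filter.1 hp).2)
    (fun p _ q _ h => π.injective h) fun a ha => ⟨π.symm a, ?_, π.apply_symm_apply a⟩
  simpa using ha

/-- Exchangeability: composing with the transposition of two positions permutes the orders and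
exchanges the roles of these positions. -/
theorem sum_perm_swap (g : Equiv.Perm α → ℝ) {p q : α} (hg : ∀ π, g (π * Equiv.swap p q) = g π) :
    ∑ π, g π * (if π p ∈ A then 1 else 0) = ∑ π, g π * (if π q ∈ A then 1 else 0) := by
  refine Fintype.sum_equiv (Equiv.mulRight (Equiv.swap p q)) _ _ fun π => ?_
  rw [Equiv.coe_mulRight, hg, Equiv.Perm.mul_apply, Equiv.swap_apply_right]

omit [Fintype α] in
theorem hits_mul_swap {S : Finset α} {p q : α} (hp : p ∉ S) (hq : q ∉ S) (π : Equiv.Perm α) :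
    hits A S (π * Equiv.swap p q) = hits A S π := by
  unfold hits
  congr 1
  refine Finset.filter_congr fun x hx => ?_
  rw [Equiv.Perm.mul_apply, Equiv.swap_apply_of_ne_of_ne (ne_of_mem_of_not_mem hx hp)
    (ne_of_mem_of_not_mem hx hq)]

theorem card_mul_sum_mem (p : α) :
    (Fintype.card α : ℝ) * ∑ π : Equiv.Perm α, (if π p ∈ A then (1 : ℝ) else 0) =
      A.card * Fintype.card (Equiv.Perm α) := by
  have h : ∀ q, ∑ π : Equiv.Perm α, (if π p ∈ A then (1 : ℝ) else 0) =
      ∑ π : Equiv.Perm α, (if π q ∈ A then (1 : ℝ) else 0) := fun q => by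
    simpa using sum_perm_swap A (fun _ => 1) (p := p) (q := q) fun _ => rfl
  have h2 : (Fintype.card α : ℝ) * ∑ π : Equiv.Perm α, (if π p ∈ A then (1 : ℝ) else 0) =
      ∑ q : α, ∑ π : Equiv.Perm α, (if π q ∈ A then (1 : ℝ) else 0) := by
    rw [Finset.sum_congr rfl fun q _ => (h q).symm, Finset.sum_const, nsmul_eq_mul,
      Finset.card_univ]
  rw [h2, Finset.sum_comm]
  have h3 : ∀ π : Equiv.Perm α, ∑ q, (if π q ∈ A then (1 : ℝ) else 0) = A.card := fun π => by
    rw [← hits_univ A π, hits, Finset.sum_boole]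
  rw [Finset.sum_congr rfl fun π _ => h3 π, Finset.sum_const, nsmul_eq_mul, Finset.card_univ,
    mul_comm]

theorem card_mul_sum_hits (S : Finset α) :
    (Fintype.card α : ℝ) * ∑ π : Equiv.Perm α, (hits A S π : ℝ) =
      S.card * (A.card * Fintype.card (Equiv.Perm α)) := by
  have h : ∀ π : Equiv.Perm α, (hits A S π : ℝ) = ∑ p ∈ S, if π p ∈ A then (1 : ℝ) else 0 :=
    fun π => by rw [Finset.sum_boole, hits]
  rw [Finset.sum_congr rfl fun π _ => h π, Finset.sum_comm, Finset.mul_sum,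
    Finset.sum_congr rfl fun p _ => card_mul_sum_mem A p, Finset.sum_const, nsmul_eq_mul]

omit [Fintype α] in
theorem hits_insert {S : Finset α} {p : α} (hp : p ∉ S) (π : Equiv.Perm α) :
    (1 / 2 : ℝ) ^ hits A (insert p S) π =
      (1 / 2) ^ hits A S π - 1 / 2 * ((1 / 2) ^ hits A S π * if π p ∈ A then 1 else 0) := by
  unfold hits
  rw [Finset.filter_insert]
  split_ifs with h
  · rw [Finset.card_insert_of_notMem fun h' => hp (Finset.mem_filter.1 h').1, pow_succ]
    ring
  · ring

/-- The number of hits is negatively associated with the hits at further positions. -/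
theorem sum_half_pow_hits_le (hα : 0 < Fintype.card α) (S : Finset α) :
    ∑ π : Equiv.Perm α, (1 / 2 : ℝ) ^ hits A S π ≤
      Fintype.card (Equiv.Perm α) * (1 - A.card / (2 * Fintype.card α)) ^ S.card := by
  have hN : (0 : ℝ) < Fintype.card α := Nat.cast_pos.2 hα
  have hAN : (A.card : ℝ) ≤ Fintype.card α := Nat.cast_le.2 (Finset.card_le_univ A)
  induction S using Finset.induction_on with
  | empty => simp [hits]
  | insert p S hp ih =>
    set G := ∑ π : Equiv.Perm α, (1 / 2 : ℝ) ^ hits A S π with hG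
    -- By exchangeability all positions outside `S` contribute equally, and the hits inside and
    -- outside `S` add up to |A|.
    have hsym : ((Sᶜ).card : ℝ) *
        ∑ π : Equiv.Perm α, (1 / 2 : ℝ) ^ hits A S π * (if π p ∈ A then 1 else 0) =
        A.card * G - ∑ π : Equiv.Perm α, (1 / 2 : ℝ) ^ hits A S π * hits A S π := by
      have h : ∀ q ∈ Sᶜ, ∑ π : Equiv.Perm α, (1 / 2 : ℝ) ^ hits A S π *
          (if π q ∈ A then 1 else 0) =
          ∑ π : Equiv.Perm α, (1 / 2 : ℝ) ^ hits A S π * (if π p ∈ A then 1 else 0) :=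
        fun q hq => (sum_perm_swap A (fun π => (1 / 2 : ℝ) ^ hits A S π) fun π => by
          rw [hits_mul_swap A (Finset.mem_compl.1 hq) hp])
      have h2 := Finset.sum_congr rfl h
      rw [Finset.sum_const, nsmul_eq_mul, Finset.sum_comm] at h2
      rw [← h2, hG, Finset.mul_sum, ← Finset.sum_sub_distrib]
      refine Finset.sum_congr rfl fun π _ => ?_
      rw [← Finset.mul_sum]
      have h3 := Finset.sum_add_sum_compl S fun q => if π q ∈ A then (1 : ℝ) else 0
      have h4 : ∑ q, (if π q ∈ A then (1 : ℝ) else 0) = A.card := by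
        rw [← hits_univ A π, hits, Finset.sum_boole]
      have h5 : ∑ q ∈ S, (if π q ∈ A then (1 : ℝ) else 0) = hits A S π := by
        rw [Finset.sum_boole, hits]
      rw [h4, h5] at h3
      rw [← h3]
      ring
    -- Chebyshev's sum inequality: 2^(-hits) decreases when the number of hits grows.
    have hcheb : (Fintype.card (Equiv.Perm α) : ℝ) *
        ∑ π : Equiv.Perm α, (1 / 2 : ℝ) ^ hits A S π * hits A S π ≤
        G * ∑ π : Equiv.Perm α, (hits A S π : ℝ) := by
      have hanti : Antivary (fun π : Equiv.Perm α => (1 / 2 : ℝ) ^ hits A S π)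
          fun π => (hits A S π : ℝ) := fun π ρ h =>
        pow_le_pow_of_le_one (by norm_num) (by norm_num) (Nat.cast_le.1 h.le)
      exact hanti.card_mul_sum_le_sum_mul_sum
    have hm := card_mul_sum_hits A S
    have hP : (0 : ℝ) < Fintype.card (Equiv.Perm α) := Nat.cast_pos.2 Fintype.card_pos
    have hc : ((Sᶜ).card : ℝ) = Fintype.card α - S.card := by
      rw [Finset.card_compl, Nat.cast_sub (Finset.card_le_univ S)]
    have hc0 : (0 : ℝ) < (Sᶜ).card :=
      Nat.cast_pos.2 (Finset.card_pos.2 ⟨p, Finset.mem_compl.2 hp⟩)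
    set V := ∑ π : Equiv.Perm α, (1 / 2 : ℝ) ^ hits A S π * hits A S π with hV
    set W := ∑ π : Equiv.Perm α, (1 / 2 : ℝ) ^ hits A S π * (if π p ∈ A then (1 : ℝ) else 0) with hW
    have hVle : Fintype.card α * V ≤ G * (S.card * A.card) := by
      refine le_of_mul_le_mul_left ?_ hP
      calc _ = Fintype.card α * ((Fintype.card (Equiv.Perm α) : ℝ) * V) := by ring
        _ ≤ Fintype.card α * (G * ∑ π : Equiv.Perm α, (hits A S π : ℝ)) := by gcongr
        _ = G * (Fintype.card α * ∑ π : Equiv.Perm α, (hits A S π : ℝ)) := by ring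
        _ = _ := by rw [hm]; ring
    -- Few hits in `S` leave more of `A` for the other positions. Under the weight 2^(-hits) the
    -- next position is therefore hit at least as often as without it, and the factor for
    -- independent draws remains an upper bound.
    have hWge : A.card / Fintype.card α * G ≤ W := by
      rw [div_mul_eq_mul_div, div_le_iff₀ hN]
      refine le_of_mul_le_mul_left ?_ hc0
      calc _ = Fintype.card α * (A.card * G) - G * (S.card * A.card) := by rw [hc]; ring
        _ ≤ Fintype.card α * (A.card * G) - Fintype.card α * V := by linarith
        _ = _ := by rw [← mul_sub, ← hsym]; ring
    rw [Finset.sum_congr rfl fun π _ => hits_insert A hp π, Finset.sum_sub_distrib,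
      ← Finset.mul_sum, Finset.card_insert_of_notMem hp, pow_succ, ← mul_assoc]
    have hq : 0 ≤ 1 - (A.card : ℝ) / (2 * Fintype.card α) := by
      rw [sub_nonneg, div_le_one (by positivity)]
      linarith
    calc _ ≤ G - 1 / 2 * (A.card / Fintype.card α * G) := by linarith
      _ = G * (1 - A.card / (2 * Fintype.card α)) := by field_simp
      _ ≤ _ := mul_le_mul_of_nonneg_right ih hq

end Perm

/- ## Uniform random choices -/

section Freq

open scoped Classical in
/-- The probability of an event under the uniform distribution. -/
def freq {S : Type} [Fintype S] (p : S → Prop) : ℝ :=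
  (Finset.univ.filter p).card / Fintype.card S

variable {S A B : Type} [Fintype S] [Fintype A] [Fintype B]

theorem freq_eq (p : S → Prop) [DecidablePred p] :
    freq p = (Finset.univ.filter p).card / Fintype.card S := by
  unfold freq
  congr!

theorem freq_nonneg (p : S → Prop) : 0 ≤ freq p := by unfold freq; positivity

theorem freq_mono {p q : S → Prop} (h : ∀ s, p s → q s) : freq p ≤ freq q := by
  unfold freq
  gcongr
  exact h _

theorem freq_or_le (p q : S → Prop) : freq (fun s => p s ∨ q s) ≤ freq p + freq q := by
  classical
  simp only [freq_eq]
  rw [← add_div]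
  gcongr
  rw [Finset.filter_or]
  exact_mod_cast Finset.card_union_le _ _

theorem freq_exists_le {κ : Type} (J : Finset κ) (p : κ → S → Prop) {c : ℝ}
    (h : ∀ j ∈ J, freq (p j) ≤ c) : freq (fun s => ∃ j ∈ J, p j s) ≤ J.card * c := by
  classical
  have h1 : freq (fun s => ∃ j ∈ J, p j s) ≤ ∑ j ∈ J, freq (p j) := by
    simp only [freq_eq]
    rw [← Finset.sum_div]
    gcongr
    have : (Finset.univ.filter fun s => ∃ j ∈ J, p j s) ⊆
        J.biUnion fun j => Finset.univ.filter (p j) := fun s hs => by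
      simpa using hs
    exact_mod_cast (Finset.card_le_card this).trans Finset.card_biUnion_le
  exact h1.trans ((Finset.sum_le_card_nsmul _ _ _ h).trans (nsmul_eq_mul _ _).le)

theorem freq_comp_fst [Nonempty B] (e : S ≃ A × B) (p : A → Prop) :
    freq (fun s => p (e s).1) = freq p := by
  classical
  simp only [freq_eq]
  have h1 : (Finset.univ.filter fun s => p (e s).1).card =
      (Finset.univ.filter p).card * Fintype.card B := by
    rw [← Finset.card_univ (α := B), ← Finset.card_product]
    refine Finset.card_bij (fun s _ => e s) (fun s hs => ?_) (fun s _ t _ h => e.injective h)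
      fun x hx => ⟨e.symm x, ?_, e.apply_symm_apply x⟩
    · simpa using hs
    · simpa using hx
  rw [h1, Fintype.card_congr e, Fintype.card_prod]
  have hB : (Fintype.card B : ℝ) ≠ 0 := Nat.cast_ne_zero.2 Fintype.card_ne_zero
  push_cast
  rw [mul_div_mul_right _ _ hB]

theorem freq_eval [Nonempty A] {T : ℕ} (t : Fin T) (p : A → Prop) :
    freq (fun s : Fin T → A => p (s t)) = freq p := by
  have := freq_comp_fst (Equiv.funSplitAt t A) p
  simpa using this

theorem freq_forall {T : ℕ} (p : A → Prop) :
    freq (fun s : Fin T → A => ∀ t, p (s t)) = freq p ^ T := by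
  classical
  simp only [freq_eq]
  have h : (Finset.univ.filter fun s : Fin T → A => ∀ t, p (s t)) =
      Fintype.piFinset fun _ => Finset.univ.filter p := by
    ext s
    simp
  rw [h, Fintype.card_piFinset, div_pow]
  simp

/-- The union bound over the uniform random choices and the data. -/
theorem jointProb_le {Ω : Type} [MeasurableSpace Ω] {μ : Measure Ω} [IsProbabilityMeasure μ]
    [Nonempty S] {E : Ω → S → Prop} {bad : S → Prop} {x y : ℝ} (hx : 0 ≤ x) (hbad : freq bad ≤ y)
    (h : ∀ s, ¬ bad s → μ {ω | E ω s} ≤ ENNReal.ofReal x) :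
    jointProb μ E ≤ ENNReal.ofReal (x + y) := by
  classical
  have hS : (0 : ℝ) < Fintype.card S := Nat.cast_pos.2 Fintype.card_pos
  have h1 : ∀ s, μ {ω | E ω s} ≤ ENNReal.ofReal (x + if bad s then 1 else 0) := fun s => by
    split_ifs with hs
    · refine prob_le_one.trans ?_
      rw [← ENNReal.ofReal_one]
      exact ENNReal.ofReal_le_ofReal (by linarith)
    · simpa using h s hs
  unfold jointProb
  refine (mul_le_mul_right (Finset.sum_le_sum fun s _ => h1 s) _).trans ?_
  rw [← ENNReal.ofReal_sum_of_nonneg fun s _ => by split_ifs <;> linarith,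
    ← ENNReal.ofReal_natCast, ← ENNReal.ofReal_inv_of_pos hS,
    ← ENNReal.ofReal_mul (inv_nonneg.2 hS.le)]
  refine ENNReal.ofReal_le_ofReal ?_
  rw [Finset.sum_add_distrib, Finset.sum_boole, Finset.sum_const, nsmul_eq_mul, Finset.card_univ,
    mul_add, inv_mul_cancel_left₀ hS.ne']
  refine add_le_add_right (le_trans (le_of_eq ?_) hbad) x
  rw [freq_eq, inv_mul_eq_div]

end Freq

/-! ### Hits of a large set by a random order -/

section PermFreq

variable {α : Type} [Fintype α] [DecidableEq α] {A : Finset α} {a : ℝ}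
  (hA : a * Fintype.card α ≤ A.card) (hα : 0 < Fintype.card α)
include hA hα

theorem freq_perm_notMem_le (p : α) :
    freq (fun π : Equiv.Perm α => ¬ π p ∈ A) ≤ 1 - a := by
  have hN : (0 : ℝ) < Fintype.card α := Nat.cast_pos.2 hα
  have hP : (0 : ℝ) < Fintype.card (Equiv.Perm α) := Nat.cast_pos.2 Fintype.card_pos
  have h := card_mul_sum_mem A p
  rw [Finset.sum_boole] at h
  have h2 : ((Finset.univ.filter fun π : Equiv.Perm α => π p ∈ A).card : ℝ) +
      (Finset.univ.filter fun π : Equiv.Perm α => ¬ π p ∈ A).card =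
      Fintype.card (Equiv.Perm α) := by
    rw [← Finset.card_univ]
    exact_mod_cast Finset.card_filter_add_card_filter_not _
  simp only [freq_eq]
  rw [div_le_iff₀ hP]
  have h3 : a * Fintype.card (Equiv.Perm α) ≤
      (Finset.univ.filter fun π : Equiv.Perm α => π p ∈ A).card := by
    refine le_of_mul_le_mul_left ?_ hN
    rw [h]
    nlinarith
  linarith

/-- A random set of positions contains its share of a large set, up to a factor `2`. -/
theorem freq_hits_lt_le (ha : 0 ≤ a) (S : Finset α) :
    freq (fun π : Equiv.Perm α => (hits A S π : ℝ) < a / 2 * S.card) ≤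
      Real.exp (-(a * S.card / 8)) := by
  classical
  have hN : (0 : ℝ) < Fintype.card α := Nat.cast_pos.2 hα
  have hP : (0 : ℝ) < Fintype.card (Equiv.Perm α) := Nat.cast_pos.2 Fintype.card_pos
  have hAN : (A.card : ℝ) ≤ Fintype.card α := Nat.cast_le.2 (Finset.card_le_univ A)
  simp only [freq_eq]
  rw [div_le_iff₀ hP]
  have hl2 := Real.log_two_lt_d9
  -- Markov's inequality for 2^(-hits).
  have h1 : ∀ π : Equiv.Perm α, (hits A S π : ℝ) < a / 2 * S.card →
      1 ≤ Real.exp (a / 2 * S.card * Real.log 2) * (1 / 2) ^ hits A S π := fun π hπ => by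
    have e : (1 / 2 : ℝ) ^ hits A S π = Real.exp (-(hits A S π * Real.log 2)) := by
      rw [Real.exp_neg, ← Real.log_pow, Real.exp_log (by positivity), one_div, inv_pow]
    rw [e, ← Real.exp_add, Real.one_le_exp_iff]
    nlinarith [Real.log_two_gt_d9]
  have h2 := sum_half_pow_hits_le A hα S
  have h3 : (1 - (A.card : ℝ) / (2 * Fintype.card α)) ^ S.card ≤ Real.exp (-(a / 2 * S.card)) := by
    have hq : a / 2 ≤ (A.card : ℝ) / (2 * Fintype.card α) := by
      rw [div_le_div_iff₀ (by norm_num) (by positivity)]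
      linarith
    have hq0 : 0 ≤ 1 - (A.card : ℝ) / (2 * Fintype.card α) := by
      rw [sub_nonneg, div_le_one (by positivity)]
      linarith
    calc _ ≤ Real.exp (-(a / 2)) ^ S.card := by
          refine pow_le_pow_left₀ hq0 ?_ _
          linarith [Real.add_one_le_exp (-(a / 2))]
      _ = _ := by rw [← Real.exp_nat_mul]; congr 1; ring
  calc _ = ∑ π ∈ Finset.univ.filter
        (fun π : Equiv.Perm α => (hits A S π : ℝ) < a / 2 * S.card), (1 : ℝ) := by simp
    _ ≤ ∑ π : Equiv.Perm α, Real.exp (a / 2 * S.card * Real.log 2) * (1 / 2) ^ hits A S π := by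
        refine (Finset.sum_le_sum fun π hπ => h1 π (Finset.mem_filter.1 hπ).2).trans ?_
        exact Finset.sum_le_sum_of_subset_of_nonneg (Finset.filter_subset _ _)
          fun _ _ _ => by positivity
    _ ≤ Real.exp (a / 2 * S.card * Real.log 2) *
        (Fintype.card (Equiv.Perm α) * Real.exp (-(a / 2 * S.card))) := by
        rw [← Finset.mul_sum]
        gcongr
        exact h2.trans (by gcongr)
    _ = Real.exp (a / 2 * S.card * Real.log 2 + -(a / 2 * S.card)) *
        Fintype.card (Equiv.Perm α) := by rw [Real.exp_add]; ring
    -- The exponent is (a|S|/2)(log 2 - 1), and (1 - log 2)/2 > 1/8.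
    _ ≤ _ := by
        gcongr
        have : 0 ≤ a * S.card := by positivity
        nlinarith

end PermFreq

/- ## The samples as one family of independent variables -/

section Flatten

variable {d k Ns Nm : ℕ} (ns : Fin Ns → ℕ) (nm : Fin Nm → ℕ)

/-- The indices of all samples. -/
abbrev SampleIdx : Type := (Σ b : Fin Ns, Fin (ns b)) ⊕ (Σ b : Fin Nm, Fin (nm b))

variable {ns nm}

def toData (ω : SampleIdx ns nm → Sample d) : Data d ns nm :=
  (fun b t => ω (Sum.inl ⟨b, t⟩), fun b t => ω (Sum.inr ⟨b, t⟩))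

/-- The laws of the samples. -/
def sampleLaw (D : Fin k → Measure (Sample d)) (cs : Fin Ns → Fin k) (cm : Fin Nm → Fin k) :
    SampleIdx ns nm → Measure (Sample d) :=
  fun p => D (Sum.elim (fun p => cs p.1) (fun p => cm p.1) p)

instance (D : Fin k → Measure (Sample d)) [∀ i, IsProbabilityMeasure (D i)] (cs : Fin Ns → Fin k)
    (cm : Fin Nm → Fin k) (p : SampleIdx ns nm) : IsProbabilityMeasure (sampleLaw D cs cm p) :=
  inferInstanceAs (IsProbabilityMeasure (D _))

theorem measurePreserving_curry {N : ℕ} (n : Fin N → ℕ) (D : Fin k → Measure (Sample d))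
    [∀ i, IsProbabilityMeasure (D i)] (c : Fin N → Fin k) :
    MeasurePreserving (MeasurableEquiv.piCurry fun (b : Fin N) (_ : Fin (n b)) => Sample d)
      (Measure.pi fun p : Σ b, Fin (n b) => D (c p.1))
      (Measure.pi fun b => Measure.pi fun _ : Fin (n b) => D (c b)) := by
  refine ⟨MeasurableEquiv.measurable _, ?_⟩
  have h := Measure.infinitePi_map_piCurry (X := fun (b : Fin N) (_ : Fin (n b)) => Sample d)
    fun (b : Fin N) (_ : Fin (n b)) => D (c b)
  simpa only [Measure.infinitePi_eq_pi] using h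

theorem measurePreserving_toData (D : Fin k → Measure (Sample d))
    [∀ i, IsProbabilityMeasure (D i)] (cs : Fin Ns → Fin k) (cm : Fin Nm → Fin k) :
    MeasurePreserving (toData (d := d) (ns := ns) (nm := nm)) (Measure.pi (sampleLaw D cs cm))
      (dataLaw D ns nm cs cm) :=
  ((measurePreserving_curry ns D cs).prod (measurePreserving_curry nm D cm)).comp
    (measurePreserving_sumPiEquivProdPi (sampleLaw D cs cm))

/-- Rearranging the samples into one family is a measurable equivalence, so the event need not be
measurable; its measurability for the list algorithm is never required. -/
theorem dataLaw_apply (D : Fin k → Measure (Sample d)) [∀ i, IsProbabilityMeasure (D i)]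
    (cs : Fin Ns → Fin k) (cm : Fin Nm → Fin k) (E : Set (Data d ns nm)) :
    dataLaw D ns nm cs cm E = Measure.pi (sampleLaw D cs cm) (toData ⁻¹' E) :=
  (MeasurePreserving.measure_preimage_equiv
    (f := (MeasurableEquiv.sumPiEquivProdPi fun _ : SampleIdx ns nm => Sample d).trans
      ((MeasurableEquiv.piCurry fun (b : Fin Ns) (_ : Fin (ns b)) => Sample d).prodCongr
        (MeasurableEquiv.piCurry fun (b : Fin Nm) (_ : Fin (nm b)) => Sample d)))
    (measurePreserving_toData D cs cm) E).symm

instance (D : Fin k → Measure (Sample d)) [∀ i, IsProbabilityMeasure (D i)]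
    (cs : Fin Ns → Fin k) (cm : Fin Nm → Fin k) :
    IsProbabilityMeasure (dataLaw D ns nm cs cm) := by
  unfold dataLaw
  infer_instance

end Flatten

/- ## The samples of one run -/

section Index

variable {d k Ns Nm : ℕ} {ns : Fin Ns → ℕ} {nm : Fin Nm → ℕ} (s : RunSeed ns nm)

def smallIdx : Arr (Arr (SampleIdx ns nm)) :=
  ⟨Ns, fun b => ⟨ns (s.1 b), fun t => Sum.inl ⟨s.1 b, s.2.2.1 (s.1 b) t⟩⟩⟩

def mediumIdx : Arr (Arr (SampleIdx ns nm)) :=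
  ⟨Nm, fun b => ⟨nm (s.2.1 b), fun t => Sum.inr ⟨s.2.1 b, s.2.2.2 (s.2.1 b) t⟩⟩⟩

def starIdx (h : 0 < Nm) : Arr (SampleIdx ns nm) := (mediumIdx s).get ⟨0, h⟩

/-- For a fixed seed a run is a function of independent samples read through permuted indices. -/
theorem val_oneRun (τ : Tuning) (q : Params) (δ : ℝ) (h : 0 < Nm)
    (ω : SampleIdx ns nm → Sample d) :
    (oneRun τ q δ (toData ω) s).val = (mainAlgorithm τ q δ ((smallIdx s).map (Arr.map ω))
      ((mediumIdx s).tail.map (Arr.map ω)) ((starIdx s h).map ω)).val := by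
  have e : headBatch ((mediumIdx s).map (Arr.map ω)) = (starIdx s h).map ω := dif_pos h
  rw [← e]
  rfl

theorem smallIdx_injective (b : Fin Ns) : Function.Injective ((smallIdx s).get b).get := by
  intro t t' h
  have h1 := Sum.inl_injective h
  simp only [Sigma.mk.injEq, heq_eq_eq, true_and] at h1
  exact (s.2.2.1 (s.1 b)).injective h1

theorem mediumIdx_injective (b : Fin Nm) : Function.Injective ((mediumIdx s).get b).get := by
  intro t t' h
  have h1 := Sum.inr_injective h
  simp only [Sigma.mk.injEq, heq_eq_eq, true_and] at h1
  exact (s.2.2.2 (s.2.1 b)).injective h1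

theorem disjoint_smallIdx :
    Pairwise (Function.onFun Disjoint fun b => ((smallIdx s).get b).idx) := by
  intro b b' hb
  refine Set.disjoint_left.2 ?_
  rintro _ ⟨t, rfl⟩ ⟨t', h⟩
  exact hb (s.1.injective (congrArg Sigma.fst (Sum.inl_injective h))).symm

theorem disjoint_mediumIdx :
    Pairwise (Function.onFun Disjoint fun b => ((mediumIdx s).get b).idx) := by
  intro b b' hb
  refine Set.disjoint_left.2 ?_
  rintro _ ⟨t, rfl⟩ ⟨t', h⟩
  exact hb (s.2.1.injective (congrArg Sigma.fst (Sum.inr_injective h))).symm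

theorem disjoint_small_medium (b : Fin Ns) (b' : Fin Nm) :
    Disjoint ((smallIdx s).get b).idx ((mediumIdx s).get b').idx := by
  refine Set.disjoint_left.2 ?_
  rintro _ ⟨t, rfl⟩ ⟨t', h⟩
  exact Sum.inr_ne_inl h

/-- The number of times that `i` occurs in a part. -/
def partCount (a : Arr (Fin k)) (R : ℕ) (r : Fin R) (i : Fin k) : ℕ :=
  (Finset.univ.filter fun t => (a.part R r).get t = i).card

/-- The numbers of repetitions and the requirements on the numbers and sizes of the batches. -/
structure SizeSetup (d k Ns Nm n R T T₁ l : ℕ) (αs αm ε₂ C C₁ b m δ : ℝ) : Prop where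
  clip_size : 128 * C ≤ (n / (2 * R) / T : ℕ)
  small_pos : 0 < Ns / R
  small_size : Real.log (2 * d / δ) ≤ (Ns / R : ℕ) * (αs ^ 2 * ε₂ ^ 4 * C₁ / (16 * b ^ 2))
  test_size : 6144 * Real.sqrt l ≤ ε₂ ^ 2 * m
  le_test : m ≤ (n / 2 / (2 * T₁) : ℕ)
  le_star : m ≤ (n / (2 * R) / (2 * T₁) : ℕ)
  le_est : m ≤ (n / 2 / T : ℕ)
  medium_size : Real.sqrt l ≤ αm / 2 * ((Nm - 1) / R : ℕ)
  T_ge : 3 * Real.log (1 / δ) ≤ T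
  T₁_ge : 3 * Real.log (((Nm - 1) / R : ℕ) / δ) ≤ T₁
  rank_eq : l = subspaceDim d k αs ε₂

variable {D : Fin k → Measure (Sample d)} {cs : Fin Ns → Fin k} {cm : Fin Nm → Fin k} {i : Fin k}
  {n R T T₁ l : ℕ} {αs αm ε₂ C C₁ b m δ : ℝ}

/-- The order is such that every part contains its share of batches of component `i`. -/
def Balanced (cs : Fin Ns → Fin k) (cm : Fin Nm → Fin k) (αs αm : ℝ) (R : ℕ) (i : Fin k)
    (s : RunSeed ns nm) : Prop :=
  ∀ r : Fin R, αs / 2 * (Ns / R : ℕ) ≤ partCount ⟨Ns, fun b => cs (s.1 b)⟩ R r i ∧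
    αm / 2 * ((Nm - 1) / R : ℕ) ≤
      partCount (Arr.tail ⟨Nm, fun b => cm (s.2.1 b)⟩) R r i

def runSetup (hns : ∀ b, 2 ≤ ns b) (hnm : ∀ b, n ≤ nm b) (h0 : 0 < Nm)
    (hi : cm (s.2.1 ⟨0, h0⟩) = i) (hs : Balanced cs cm αs αm R i s)
    (h : SizeSetup d k Ns Nm n R T T₁ l αs αm ε₂ C C₁ b m δ) :
    RunSetup (sampleLaw D cs cm) D i (smallIdx s) (mediumIdx s).tail (starIdx s h0) R T T₁ l
      αs ε₂ C C₁ b δ where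
  cs := fun b => cs (s.1 b)
  cm := (Arr.tail ⟨Nm, fun b => cm (s.2.1 b)⟩).get
  m := m
  law_small _ _ := rfl
  law_medium _ _ := rfl
  law_star _ := congrArg D hi
  inj_small := smallIdx_injective s
  inj_medium _ := mediumIdx_injective s _
  inj_star := mediumIdx_injective s _
  disj_small := disjoint_smallIdx s
  disj_medium b b' hb := disjoint_mediumIdx s fun he => hb (Fin.ext (by
    have := congrArg Fin.val he
    simpa using this))
  disj_small_star := Set.disjoint_iUnion_left.2 fun b => disjoint_small_medium s b _
  disj_medium_star := Set.disjoint_iUnion_left.2 fun b => disjoint_mediumIdx s fun he => by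
    have := congrArg Fin.val he
    simp at this
  disj_small_medium := Set.disjoint_iUnion_left.2 fun b => Set.disjoint_iUnion_right.2 fun b' =>
    disjoint_small_medium s b _
  two_le _ := hns _
  clip_size := h.clip_size.trans (Nat.cast_le.2
    (Nat.div_le_div_right (Nat.div_le_div_right (hnm _))))
  small_pos := h.small_pos
  small_size := h.small_size
  small_count r := (hs r).1
  test_size := h.test_size
  le_test _ := h.le_test.trans (Nat.cast_le.2
    (Nat.div_le_div_right (Nat.div_le_div_right (hnm _))))
  le_star := h.le_star.trans (Nat.cast_le.2
    (Nat.div_le_div_right (Nat.div_le_div_right (hnm _))))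
  le_est _ := h.le_est.trans (Nat.cast_le.2
    (Nat.div_le_div_right (Nat.div_le_div_right (hnm _))))
  medium_count r := h.medium_size.trans (hs r).2
  T_ge := h.T_ge
  T₁_ge := h.T₁_ge
  rank_eq := h.rank_eq

/-- One run with a good order succeeds with high probability. -/
theorem measure_oneRun_le (hB : ∀ j, IsBounded (D j) C₁ b) [∀ j, IsProbabilityMeasure (D j)]
    {w₀ : Vec d} {q : Params} {δ₀ : ℝ} (hM : IsRegressionModel q.C q.C₁ q.σ (D i) w₀) (hd : 0 < d)
    (hC : 0 < q.C) (hσ : 0 < q.σ) (hb : 0 < b) (hα : 0 < q.αs) (hα1 : q.αs ≤ 1) (hε : 0 < q.ε)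
    (hε1 : q.ε ≤ 1) (hM0 : 0 ≤ q.M) (hw : ‖w₀‖ ≤ q.M) (hCC : C₁ = q.C₁)
    (hns : ∀ b, 2 ≤ ns b) (hnm : ∀ b, n ≤ nm b) (h0 : 0 < Nm)
    (hi : cm (s.2.1 ⟨0, h0⟩) = i) (hR : R = numRounds q.C₁ q.M q.ε q.σ)
    (hε₂ : ε₂ = accuracy q.C q.C₁ q.ε) (hδ : δ = δ₀ / (5 * R)) (hδ0 : 0 < δ) (hδ1 : δ ≤ 1)
    (hs : Balanced cs cm q.αs αm R i s)
    (h : SizeSetup d q.k Ns Nm n R ⌈3 * Real.log (1 / δ)⌉₊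
      ⌈3 * Real.log (((Nm - 1) / R : ℕ) / δ)⌉₊ l q.αs αm ε₂ q.C q.C₁ b m δ) (hk : q.k = k) :
    Measure.pi (sampleLaw D cs cm)
      {ω | ¬ ‖(oneRun tuning q δ₀ (toData ω) s).val - w₀‖ ≤ q.ε * q.σ} ≤
      ENNReal.ofReal (R * (4 * δ)) := by
  subst hCC
  have hC₁ := one_le_of_isRegressionModel (hB i) hM hd
  have hl : l = subspaceDim d q.k q.αs ε₂ := h.rank_eq
  rw [hk] at h
  refine (measure_mono fun ω hω => ?_).trans
    ((runSetup (D := D) s hns hnm h0 hi hs h).measure_le hB hM hd hC hσ hb hα hα1 hε hε1 hδ0 hδ1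
      hε₂ hw)
  intro hc
  refine hω ?_
  rw [val_oneRun s tuning q δ₀ h0 ω,
    val_mainAlgorithm q δ₀ δ ε₂ R l _ _ _ hR hε₂ hl hδ]
  refine le_trans hc ?_
  have := pow_numRounds_le hC₁ hM0 hε hσ
  rw [← hR] at this
  linarith

end Index

/- ## The random choices -/

section Balance

variable {k : ℕ} {i : Fin k} {a : ℝ}

theorem freq_card_lt_le {N m : ℕ} {c : Fin N → Fin k}
    (hc : a * N ≤ (Finset.univ.filter fun b => c b = i).card) (hN : 0 < N) (ha : 0 ≤ a)
    {f : Fin m → Fin N} (hf : Function.Injective f) :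
    freq (fun π : Equiv.Perm (Fin N) =>
      ((Finset.univ.filter fun t => c (π (f t)) = i).card : ℝ) < a / 2 * m) ≤
      Real.exp (-(a * m / 8)) := by
  have h := freq_hits_lt_le (A := Finset.univ.filter fun b => c b = i) (a := a)
    (by rwa [Fintype.card_fin]) (by rwa [Fintype.card_fin]) ha (Finset.univ.image f)
  rw [Finset.card_image_of_injective _ hf, Finset.card_univ, Fintype.card_fin] at h
  have e : ∀ π : Equiv.Perm (Fin N), hits (Finset.univ.filter fun b => c b = i)
      (Finset.univ.image f) π = (Finset.univ.filter fun t => c (π (f t)) = i).card := fun π => by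
    rw [hits, Finset.filter_image, Finset.card_image_of_injective _ hf]
    simp
  simpa only [e] using h

variable {Ns Nm : ℕ} {ns : Fin Ns → ℕ} {nm : Fin Nm → ℕ} {cs : Fin Ns → Fin k}
  {cm : Fin Nm → Fin k} {αs αm : ℝ}

theorem freq_small_order (p : Equiv.Perm (Fin Ns) → Prop) :
    freq (fun s : RunSeed ns nm => p s.1) = freq p :=
  freq_comp_fst (Equiv.refl (RunSeed ns nm)) p

theorem freq_medium_order (p : Equiv.Perm (Fin Nm) → Prop) :
    freq (fun s : RunSeed ns nm => p s.2.1) = freq p :=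
  freq_comp_fst (S := RunSeed ns nm) (A := Equiv.Perm (Fin Nm))
    (B := Equiv.Perm (Fin Ns) × ((b : Fin Ns) → Equiv.Perm (Fin (ns b))) ×
      ((b : Fin Nm) → Equiv.Perm (Fin (nm b))))
    ⟨fun s => (s.2.1, s.1, s.2.2), fun s => (s.2.1, s.1, s.2.2), fun _ => rfl, fun _ => rfl⟩ p

theorem freq_not_balanced_le (hs : αs * Ns ≤ (Finset.univ.filter fun b => cs b = i).card)
    (hm : αm * Nm ≤ (Finset.univ.filter fun b => cm b = i).card) (hNs : 0 < Ns) (hNm : 0 < Nm)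
    (hαs : 0 ≤ αs) (hαm : 0 ≤ αm) (R : ℕ) :
    freq (fun s : RunSeed ns nm => ¬ Balanced cs cm αs αm R i s) ≤
      R * (Real.exp (-(αs * (Ns / R : ℕ) / 8)) + Real.exp (-(αm * ((Nm - 1) / R : ℕ) / 8))) := by
  have h1 : ∀ r : Fin R, freq (fun s : RunSeed ns nm =>
      (partCount ⟨Ns, fun b => cs (s.1 b)⟩ R r i : ℝ) < αs / 2 * (Ns / R : ℕ)) ≤
      Real.exp (-(αs * (Ns / R : ℕ) / 8)) := fun r => by
    rw [freq_small_order fun π : Equiv.Perm (Fin Ns) =>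
      (partCount ⟨Ns, fun b => cs (π b)⟩ R r i : ℝ) < αs / 2 * (Ns / R : ℕ)]
    exact freq_card_lt_le hs hNs hαs
      (f := fun t : Fin (Ns / R) => ⟨r * (Ns / R) + t, part_index_lt r t⟩) fun t t' h => by
        simpa [Fin.ext_iff] using h
  have h2 : ∀ r : Fin R, freq (fun s : RunSeed ns nm =>
      (partCount (Arr.tail ⟨Nm, fun b => cm (s.2.1 b)⟩) R r i : ℝ) <
        αm / 2 * ((Nm - 1) / R : ℕ)) ≤ Real.exp (-(αm * ((Nm - 1) / R : ℕ) / 8)) := fun r => by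
    rw [freq_medium_order fun π : Equiv.Perm (Fin Nm) => (partCount (Arr.tail ⟨Nm, fun b => cm (π b)⟩) R r i : ℝ) <
        αm / 2 * ((Nm - 1) / R : ℕ)]
    -- The positions are shifted by one because the batch at position 0 is the distinguished one.
    exact freq_card_lt_le hm hNm hαm (f := fun t : Fin ((Nm - 1) / R) =>
      ⟨r * ((Nm - 1) / R) + t + 1, by have := part_index_lt r t; omega⟩) fun t t' h => by
        simpa [Fin.ext_iff] using h
  have h3 := freq_exists_le Finset.univ (fun (r : Fin R) (s : RunSeed ns nm) =>
    (partCount ⟨Ns, fun b => cs (s.1 b)⟩ R r i : ℝ) < αs / 2 * (Ns / R : ℕ) ∨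
    (partCount (Arr.tail ⟨Nm, fun b => cm (s.2.1 b)⟩) R r i : ℝ) < αm / 2 * ((Nm - 1) / R : ℕ))
    fun r _ => (freq_or_le _ _).trans (add_le_add (h1 r) (h2 r))
  rw [Finset.card_univ, Fintype.card_fin] at h3
  refine (freq_mono fun s hs => ?_).trans h3
  obtain ⟨r, hr⟩ := not_forall.1 hs
  exact ⟨r, Finset.mem_univ r, by simpa only [not_and_or, not_le] using hr⟩

/-- The runs are independent and each misses component i with probability at most 1 - αm. -/
theorem freq_not_hit_le (hm : αm * Nm ≤ (Finset.univ.filter fun b => cm b = i).card)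
    (hNm : 0 < Nm) (T : ℕ) :
    freq (fun s : Seed ns nm T => ∀ t, ¬ cm ((s t).2.1 ⟨0, hNm⟩) = i) ≤
      Real.exp (-(αm * T)) := by
  rw [freq_forall fun s : RunSeed ns nm => ¬ cm (s.2.1 ⟨0, hNm⟩) = i,
    freq_medium_order fun π : Equiv.Perm (Fin Nm) => ¬ cm (π ⟨0, hNm⟩) = i]
  have h := freq_perm_notMem_le (A := Finset.univ.filter fun b => cm b = i) (a := αm)
    (by rwa [Fintype.card_fin]) (by rwa [Fintype.card_fin]) ⟨0, hNm⟩
  simp only [Finset.mem_filter, Finset.mem_univ, true_and] at h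
  calc _ ≤ Real.exp (-αm) ^ T := by
        refine pow_le_pow_left₀ (freq_nonneg _) (h.trans ?_) _
        linarith [Real.add_one_le_exp (-αm)]
    _ = _ := by rw [← Real.exp_nat_mul]; congr 1; ring

/-- Disjoint sets of batches, each an `αm` fraction. This makes the union bound over I independent
of k. -/
theorem card_le_of_fraction {I : Finset (Fin k)} (hα : 0 < αm) (hNm : 0 < Nm)
    (h : ∀ i ∈ I, αm * Nm ≤ (Finset.univ.filter fun b => cm b = i).card) :
    (I.card : ℝ) ≤ 1 / αm := by
  have hN : (0 : ℝ) < Nm := Nat.cast_pos.2 hNm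
  have h1 : (I.card : ℝ) * (αm * Nm) ≤ Nm := by
    calc _ = ∑ i ∈ I, αm * Nm := by rw [Finset.sum_const, nsmul_eq_mul]
      _ ≤ ∑ i ∈ I, ((Finset.univ.filter fun b => cm b = i).card : ℝ) := Finset.sum_le_sum h
      _ ≤ ∑ i, ((Finset.univ.filter fun b => cm b = i).card : ℝ) :=
          Finset.sum_le_sum_of_subset_of_nonneg (Finset.subset_univ _) fun _ _ _ =>
            Nat.cast_nonneg _
      _ = Nm := by
          rw [← Nat.cast_sum, ← Finset.card_eq_sum_card_fiberwise fun _ _ => Finset.mem_univ _,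
            Finset.card_univ, Fintype.card_fin]
  rw [le_div_iff₀ hα]
  refine le_of_mul_le_mul_right ?_ hN
  linarith

/-- The order of some run is unbalanced, or some component is not hit by any run. -/
def BadSeed (I : Finset (Fin k)) (cs : Fin Ns → Fin k) (cm : Fin Nm → Fin k) (αs αm : ℝ) (R : ℕ)
    (hNm : 0 < Nm) {T : ℕ} (s : Seed ns nm T) : Prop :=
  (∃ i ∈ I, ∀ t, ¬ cm ((s t).2.1 ⟨0, hNm⟩) = i) ∨
    ∃ i ∈ I, ∃ t ∈ (Finset.univ : Finset (Fin T)), ¬ Balanced cs cm αs αm R i (s t)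

/-- Balance is demanded for all of I in every run, whichever component the distinguished batch has,
so no conditioning on that batch is necessary. -/
theorem freq_badSeed_le {I : Finset (Fin k)} (hNs : 0 < Ns) (hNm : 0 < Nm) (hαs : 0 ≤ αs)
    (hαm : 0 < αm)
    (hs : ∀ i ∈ I, αs * Ns ≤ (Finset.univ.filter fun b => cs b = i).card)
    (hm : ∀ i ∈ I, αm * Nm ≤ (Finset.univ.filter fun b => cm b = i).card) {R T : ℕ} {x y : ℝ}
    (hx : Real.exp (-(αm * T)) ≤ x)
    (hys : Real.exp (-(αs * (Ns / R : ℕ) / 8)) ≤ y)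
    (hym : Real.exp (-(αm * ((Nm - 1) / R : ℕ) / 8)) ≤ y) :
    freq (fun s : Seed ns nm T => BadSeed I cs cm αs αm R hNm s) ≤
      1 / αm * x + 1 / αm * (T * (R * (y + y))) := by
  have hI := card_le_of_fraction hαm hNm hm
  have hx0 := (Real.exp_nonneg _).trans hx
  have hy0 := (Real.exp_nonneg _).trans hys
  refine (freq_or_le _ _).trans (add_le_add ?_ ?_)
  · exact (freq_exists_le I _ fun i hi => (freq_not_hit_le (hm i hi) hNm T).trans hx).trans
      (mul_le_mul_of_nonneg_right hI hx0)
  · have h : ∀ i ∈ I, freq (fun s : Seed ns nm T => ∃ t ∈ (Finset.univ : Finset (Fin T)),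
        ¬ Balanced cs cm αs αm R i (s t)) ≤ T * (R * (y + y)) := fun i hi => by
      refine (freq_exists_le Finset.univ _ (c := R * (y + y)) fun t _ => ?_).trans
        (by rw [Finset.card_univ, Fintype.card_fin])
      rw [freq_eval t fun s : RunSeed ns nm => ¬ Balanced cs cm αs αm R i s]
      refine (freq_not_balanced_le (hs i hi) (hm i hi) hNs hNm hαs hαm.le R).trans ?_
      gcongr
    exact (freq_exists_le I _ h).trans (mul_le_mul_of_nonneg_right hI (by positivity))

end Balance

/- ## All runs -/

/-- For a seed that is not bad, every component of I supplies the distinguished batch of some run.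
It is enough that each run whose distinguished batch belongs to I succeeds for that component, so
the union bound over the data is over runs and not over pairs of runs and components. -/
theorem jointProb_listAlgorithm_le {d k Ns Nm n R l : ℕ} {ns : Fin Ns → ℕ} {nm : Fin Nm → ℕ}
    {D : Fin k → Measure (Sample d)} {w : Fin k → Vec d} {cs : Fin Ns → Fin k}
    {cm : Fin Nm → Fin k} {ε₂ b m δ' x y : ℝ} (q : Params)
    (hB : ∀ j, IsBounded (D j) q.C₁ b) (hd : 0 < d) (hC : 0 < q.C) (hσ : 0 < q.σ) (hb : 0 < b)
    (hα : 0 < q.αs) (hα1 : q.αs ≤ 1) (hαm : 0 < q.αm) (hε : 0 < q.ε)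
    (hε1 : q.ε ≤ 1) (hM0 : 0 ≤ q.M) (hk : q.k = k)
    (hw : ∀ i ∈ largeComponents q.C q.C₁ q.σ q.αs q.αm D w cs cm, ‖w i‖ ≤ q.M)
    (hns : ∀ b, 2 ≤ ns b) (hnm : ∀ b, n ≤ nm b) (hNs : 0 < Ns) (hNm : 0 < Nm)
    (hR : R = numRounds q.C₁ q.M q.ε q.σ) (hε₂ : ε₂ = accuracy q.C q.C₁ q.ε)
    (hδ : δ' = q.δ / (2 * numRuns tuning q.αm q.δ) / (5 * R)) (hδ0 : 0 < δ') (hδ1 : δ' ≤ 1)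
    (h : SizeSetup d q.k Ns Nm n R ⌈3 * Real.log (1 / δ')⌉₊
      ⌈3 * Real.log (((Nm - 1) / R : ℕ) / δ')⌉₊ l q.αs q.αm ε₂ q.C q.C₁ b m δ')
    (hx : Real.exp (-(q.αm * numRuns tuning q.αm q.δ)) ≤ x)
    (hys : Real.exp (-(q.αs * (Ns / R : ℕ) / 8)) ≤ y)
    (hym : Real.exp (-(q.αm * ((Nm - 1) / R : ℕ) / 8)) ≤ y) :
    jointProb (dataLaw D ns nm cs cm)
      (fun (data : Data d ns nm) (s : Seed ns nm (numRuns tuning q.αm q.δ)) =>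
        ¬ ∀ i ∈ largeComponents q.C q.C₁ q.σ q.αs q.αm D w cs cm,
          ∃ v ∈ (listAlgorithm tuning q data s).val, ‖v - w i‖ ≤ q.ε * q.σ) ≤
      ENNReal.ofReal (numRuns tuning q.αm q.δ * (R * (4 * δ')) + (1 / q.αm * x + 1 / q.αm *
        (numRuns tuning q.αm q.δ * (R * (y + y))))) := by
  classical
  have : ∀ j, IsProbabilityMeasure (D j) := fun j => (hB j).prob
  set I : Finset (Fin k) := Finset.univ.filter fun i =>
    i ∈ largeComponents q.C q.C₁ q.σ q.αs q.αm D w cs cm with hI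
  have hmem : ∀ {i}, i ∈ I ↔ i ∈ largeComponents q.C q.C₁ q.σ q.αs q.αm D w cs cm := by
    simp [hI]
  refine jointProb_le (by positivity) (freq_badSeed_le (I := I) hNs hNm hα.le hαm
    (fun i hi => (hmem.1 hi).1) (fun i hi => (hmem.1 hi).2.1) hx hys hym) fun s hs => ?_
  simp only [BadSeed, not_or, not_exists, not_and, not_forall, not_not] at hs
  obtain ⟨hhit, hbal⟩ := hs
  rw [dataLaw_apply]
  refine (measure_mono (t := ⋃ t, {ω | cm ((s t).2.1 ⟨0, hNm⟩) ∈ I ∧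
    ¬ ‖(oneRun tuning q (q.δ / (2 * numRuns tuning q.αm q.δ)) (toData ω) (s t)).val -
      w (cm ((s t).2.1 ⟨0, hNm⟩))‖ ≤ q.ε * q.σ}) fun ω hω => ?_).trans ?_
  · obtain ⟨i, hi⟩ := not_forall.1 hω
    obtain ⟨hi, hi'⟩ := Classical.not_imp.1 hi
    obtain ⟨t, ht⟩ := hhit i (hmem.2 hi)
    refine Set.mem_iUnion.2 ⟨t, ?_, fun hc => hi' ⟨_, List.mem_ofFn.2 ⟨t, rfl⟩, ?_⟩⟩
    · rw [ht]; exact hmem.2 hi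
    · rw [ht] at hc
      exact hc
  · refine (measure_iUnion_fintype_le _ _).trans ((Finset.sum_le_sum (g := fun _ =>
      ENNReal.ofReal (R * (4 * δ'))) fun t _ => ?_).trans (le_of_eq ?_))
    · by_cases hi : cm ((s t).2.1 ⟨0, hNm⟩) ∈ I
      · refine (measure_mono fun ω hω => hω.2).trans
          (measure_oneRun_le (s t) hB (hmem.1 hi).2.2 hd hC hσ hb hα hα1 hε hε1 hM0
          (hw _ (hmem.1 hi)) rfl hns hnm hNm rfl hR hε₂ hδ hδ0 hδ1
          (hbal _ hi t (Finset.mem_univ t)) h hk)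
      · refine le_trans (le_of_eq ?_) zero_le
        exact (congrArg _ (Set.eq_empty_of_forall_notMem fun ω hω => hi hω.1)).trans measure_empty
    · rw [Finset.sum_const, Finset.card_univ, Fintype.card_fin, nsmul_eq_mul,
        ENNReal.ofReal_mul (p := numRuns tuning q.αm q.δ) (Nat.cast_nonneg _),
        ENNReal.ofReal_natCast]

/- ## Sample sizes -/

/-- Rounding down loses less than 1, which the summand 1 pays for. -/
theorem le_natDiv {x : ℝ} {N R : ℕ} (hR : 0 < R) (h : (x + 1) * R ≤ N) : x ≤ (N / R : ℕ) := by
  have hR' : (0 : ℝ) < R := Nat.cast_pos.2 hR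
  have h1 : (N : ℝ) < (N / R : ℕ) * R + R := by
    exact_mod_cast (Nat.lt_div_mul_add hR : N < N / R * R + R)
  have h2 : (x + 1) * R < ((N / R : ℕ) + 1) * R := by linarith
  linarith [lt_of_mul_lt_mul_right h2 hR'.le]

theorem le_natDiv_div {x : ℝ} {n p q : ℕ} (hp : 0 < p) (hq : 0 < q)
    (h : (x + 1) * (p * q) ≤ n) : x ≤ (n / p / q : ℕ) := by
  rw [Nat.div_div_eq_div_mul]
  exact le_natDiv (Nat.mul_pos hp hq) (by push_cast; exact h)

theorem exp_neg_le_of_log_le {u v z : ℝ} (hu : 0 < u) (hv : 0 < v)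
    (h : Real.log (1 / u) + Real.log (1 / v) ≤ z) : Real.exp (-z) ≤ u * v := by
  rw [one_div, one_div, Real.log_inv, Real.log_inv] at h
  rw [← Real.exp_log (mul_pos hu hv), Real.log_mul hu.ne' hv.ne']
  exact Real.exp_le_exp.2 (by linarith)

/-! ### Logarithms bounded by the common logarithmic factor -/

section LogFactor

variable {d : ℕ} {αs αm σ M ε δ : ℝ} (hd : 0 < d) (hαs : 0 < αs) (hαs1 : αs ≤ 1) (hαm : 0 < αm)
  (hαm1 : αm ≤ 1) (hσ : 0 < σ) (hM : 0 ≤ M) (hε : 0 < ε) (hε1 : ε ≤ 1) (hδ : 0 < δ) (hδ1 : δ ≤ 1)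
include hd hαs hαs1 hαm hαm1 hσ hM hε hε1 hδ hδ1

theorem logFactor_bounds :
    1 ≤ logFactor d αs αm σ M ε δ ∧
    Real.log (2 + M / (ε * σ)) ≤ 2 * logFactor d αs αm σ M ε δ ∧
    Real.log (2 / (αm * δ)) ≤ 2 * logFactor d αs αm σ M ε δ ∧
    Real.log (1 / δ) ≤ logFactor d αs αm σ M ε δ ∧
    Real.log (1 / αm) ≤ logFactor d αs αm σ M ε δ ∧
    Real.log d ≤ logFactor d αs αm σ M ε δ := by
  have hd1 : (1 : ℝ) ≤ d := Nat.one_le_cast.2 hd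
  obtain ⟨u, hu, hu1⟩ : ∃ u, u = 1 / αs ∧ 1 ≤ u := ⟨_, rfl, (one_le_div hαs).2 hαs1⟩
  obtain ⟨v, hv, hv1⟩ : ∃ v, v = 1 / αm ∧ 1 ≤ v := ⟨_, rfl, (one_le_div hαm).2 hαm1⟩
  obtain ⟨e, he, he1⟩ : ∃ e, e = 1 / ε ∧ 1 ≤ e := ⟨_, rfl, (one_le_div hε).2 hε1⟩
  obtain ⟨t, ht, ht1⟩ : ∃ t, t = 1 / δ ∧ 1 ≤ t := ⟨_, rfl, (one_le_div hδ).2 hδ1⟩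
  have hx0 : 0 ≤ M / σ := by positivity
  have hprod : (d : ℝ) / (αs * αm * ε * δ) = d * u * v * e * t := by
    rw [hu, hv, he, ht]; field_simp
  have hle : ∀ y : ℝ, 0 < y → y ≤ 2 + d * u * v * e * t + M / σ →
      Real.log y ≤ logFactor d αs αm σ M ε δ := fun y hy h => by
    rw [logFactor, hprod]
    exact Real.log_le_log hy h
  have hdu : 1 ≤ d * u := one_le_mul_of_one_le_of_one_le hd1 hu1
  have hduv : 1 ≤ d * u * v := one_le_mul_of_one_le_of_one_le hdu hv1
  have hduve : 1 ≤ d * u * v * e := one_le_mul_of_one_le_of_one_le hduv he1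
  have hall : 1 ≤ d * u * v * e * t := one_le_mul_of_one_le_of_one_le hduve ht1
  have h1 : d * u * v ≤ d * u * v * e := le_mul_of_one_le_right (by linarith) he1
  have h2 : d * u * v * e ≤ d * u * v * e * t := le_mul_of_one_le_right (by linarith) ht1
  have h3 : v ≤ d * u * v := le_mul_of_one_le_left (by linarith) hdu
  have h4 : (d : ℝ) ≤ d * u := le_mul_of_one_le_right (by linarith) hu1
  have h5 : d * u ≤ d * u * v := le_mul_of_one_le_right (by linarith) hv1
  have h6 : e ≤ d * u * v * e := le_mul_of_one_le_left (by linarith) hduv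
  have h7 : t ≤ d * u * v * e * t := le_mul_of_one_le_left (by linarith) hduve
  have l2 := hle 2 (by norm_num) (by linarith)
  have lv := hle v (by linarith) (by linarith)
  have le := hle e (by linarith) (by linarith)
  have lt := hle t (by linarith) (by linarith)
  have lM := hle (2 + M / σ) (by linarith) (by linarith)
  -- The argument of the logarithm is at least 3 > e, so the logarithmic factor is at least 1 and
  -- absorbs additive constants.
  have l3 := hle 3 (by norm_num) (by linarith)
  have lvt := hle (v * t) (by positivity) (by
    have : v * t ≤ d * u * v * e * t :=
      mul_le_mul_of_nonneg_right (h3.trans h1) (by linarith)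
    linarith)
  refine ⟨?_, ?_, ?_, ht ▸ lt, hv ▸ lv, hle d (by linarith) (by linarith)⟩
  · refine le_trans ?_ l3
    rw [Real.le_log_iff_exp_le (by norm_num)]
    linarith [Real.exp_one_lt_d9]
  · have h8 : 2 + M / (ε * σ) ≤ (2 + M / σ) * e := by
      have e1 : M / (ε * σ) = M / σ * e := by rw [he]; field_simp
      rw [e1]
      nlinarith
    have h9 : 0 < 2 + M / (ε * σ) := by positivity
    refine (Real.log_le_log h9 h8).trans ?_
    rw [Real.log_mul (by positivity) (by positivity)]
    linarith
  · have e1 : 2 / (αm * δ) = 2 * (v * t) := by rw [hv, ht]; field_simp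
    rw [e1, Real.log_mul (by norm_num) (by positivity)]
    linarith

theorem numRounds_le (C₁ : ℝ) (hC₁ : 0 < C₁) :
    (numRounds C₁ M ε σ : ℝ) ≤ (8 * C₁ + 1) * logFactor d αs αm σ M ε δ := by
  obtain ⟨h1, h2, -⟩ := logFactor_bounds hd hαs hαs1 hαm hαm1 hσ hM hε hε1 hδ hδ1
  have h3 := mul_le_mul_of_nonneg_left h2 (show 0 ≤ 4 * C₁ by linarith)
  refine (ceil_le_of_le h3 (by positivity)).trans ?_
  linarith

/-- The failure probability of one stage is δ divided by 10 times the numbers of runs and rounds.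
The summands contribute 1 for δ, 9 for the logarithm of 10, 9 for the runs and 8C₁ + 1 for the
rounds. -/
theorem log_failure_le (C₁ : ℝ) (hC₁ : 0 < C₁) :
    Real.log (1 / (δ / (2 * numRuns tuning αm δ) / (5 * numRounds C₁ M ε σ))) ≤
      (8 * C₁ + 20) * logFactor d αs αm σ M ε δ := by
  obtain ⟨h1, h2, h3, h4, h5, h6⟩ := logFactor_bounds hd hαs hαs1 hαm hαm1 hσ hM hε hε1 hδ hδ1
  have hR := numRounds_le hd hαs hαs1 hαm hαm1 hσ hM hε hε1 hδ hδ1 C₁ hC₁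
  set Λ := logFactor d αs αm σ M ε δ
  have hT0 := numRuns_pos hαm hαm1 hδ hδ1
  have e := log_div_div_le hδ (N := 1) one_pos hT0 (numRounds_pos hC₁ hM hε hσ)
  rw [Nat.cast_one, Real.log_one] at e
  rw [e]
  have hlR := (log_natCast_le (numRounds C₁ M ε σ)).trans hR
  have h10 : Real.log 10 ≤ 9 := (Real.log_le_sub_one_of_pos (by norm_num)).trans (by norm_num)
  have hT : (numRuns tuning αm δ : ℝ) ≤ 8 * ((1 / αm) * Λ) := by
    refine (numRuns_le hαm hαm1 hδ hδ1).trans ?_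
    have := mul_le_mul_of_nonneg_left h3 (show 0 ≤ 4 * (1 / αm) by positivity)
    linarith
  have hlT : Real.log (numRuns tuning αm δ) ≤ 9 * Λ := by
    refine (Real.log_le_log (Nat.cast_pos.2 hT0) hT).trans ?_
    rw [Real.log_mul (by norm_num) (by positivity), Real.log_mul (by positivity) (by positivity)]
    have h8 : Real.log 8 ≤ 7 := (Real.log_le_sub_one_of_pos (by norm_num)).trans (by norm_num)
    have := Real.log_le_sub_one_of_pos (show 0 < Λ by linarith)
    linarith
  linarith

end LogFactor

/-- The constant in `accuracy C C₁ ε = Θ(ε)`. -/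
def accuracyConst (C C₁ : ℝ) : ℝ :=
  (1 / 4096) / (C₁ * Real.sqrt (C + 1)) * min 1 (1 / Real.sqrt C₁)

/-! ### The dimension of the subspace and the factor min {√k, 1/(ε√αs)} -/

section Dim

variable {C C₁ ε α : ℝ} (hC : 0 < C) (hC₁ : 0 < C₁) (hε : 0 < ε) (hε1 : ε ≤ 1)
include hC hC₁

theorem accuracyConst_pos : 0 < accuracyConst C C₁ := by
  unfold accuracyConst; positivity

include hε hε1

theorem le_accuracy : accuracyConst C C₁ * ε ≤ accuracy C C₁ ε := by
  unfold accuracyConst accuracy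
  rw [mul_assoc]
  refine mul_le_mul_of_nonneg_left (le_min ?_ ?_) (by positivity)
  · exact mul_le_of_le_one_left hε.le (min_le_left _ _)
  · exact (mul_le_of_le_one_right (by positivity) hε1).trans (min_le_right _ _)

/-- The dimension is at most k and at most a constant times 1/(ε²α); the square roots are the two
terms of `dimFactor`. The summand 1 in the constant pays for the ceiling. -/
theorem sqrt_subspaceDim_le {d k : ℕ} (hα : 0 < α) (hα1 : α ≤ 1) :
    Real.sqrt (subspaceDim d k α (accuracy C C₁ ε)) ≤
      Real.sqrt (1 / accuracyConst C C₁ ^ 2 + 1) * dimFactor k α ε := by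
  have hc := accuracyConst_pos hC hC₁
  have hle := le_accuracy hC hC₁ hε hε1
  set c := accuracyConst C C₁
  have hl : subspaceDim d k α (accuracy C C₁ ε) ≤
      min k ⌈1 / (2 * α * accuracy C C₁ ε ^ 2)⌉₊ := min_le_left _ _
  have hb : 1 ≤ Real.sqrt (1 / c ^ 2 + 1) := Real.one_le_sqrt.2 (by
    have : 0 < 1 / c ^ 2 := by positivity
    linarith)
  unfold dimFactor
  rw [mul_min_of_nonneg _ _ (by positivity), le_min_iff]
  constructor
  · refine (Real.sqrt_le_sqrt (Nat.cast_le.2 (hl.trans (min_le_left _ _)))).trans ?_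
    exact le_mul_of_one_le_left (Real.sqrt_nonneg _) hb
  · have h1 : (⌈1 / (2 * α * accuracy C C₁ ε ^ 2)⌉₊ : ℝ) ≤
        (1 / c ^ 2 + 1) * (1 / (ε ^ 2 * α)) := by
      have h2 : 1 / (2 * α * accuracy C C₁ ε ^ 2) ≤ 1 / c ^ 2 * (1 / (ε ^ 2 * α)) := by
        rw [one_div_mul_one_div]
        refine one_div_le_one_div_of_le (by positivity) ?_
        have h3 : (c * ε) ^ 2 ≤ accuracy C C₁ ε ^ 2 := pow_le_pow_left₀ (by positivity) hle 2
        have h4 := mul_le_mul_of_nonneg_right h3 hα.le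
        have h5 : 0 ≤ accuracy C C₁ ε ^ 2 * α := by positivity
        nlinarith
      refine (ceil_le_of_le h2 (by positivity)).trans ?_
      have h6 : 1 ≤ 1 / (ε ^ 2 * α) := (one_le_div (by positivity)).2
        (mul_le_one₀ (pow_le_one₀ hε.le hε1) hα.le hα1)
      linarith
    refine (Real.sqrt_le_sqrt ((Nat.cast_le.2 (hl.trans (min_le_right _ _))).trans h1)).trans
      (le_of_eq ?_)
    rw [Real.sqrt_mul (by positivity), one_div (ε ^ 2 * α), Real.sqrt_inv,
      Real.sqrt_mul (by positivity), Real.sqrt_sq hε.le, one_div (ε * _)]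

omit hC hC₁ in
theorem one_le_dimFactor {k : ℕ} (hk : 0 < k) (hα : 0 < α) (hα1 : α ≤ 1) :
    1 ≤ dimFactor k α ε :=
  le_min (Real.one_le_sqrt.2 (Nat.one_le_cast.2 hk)) ((one_le_div (by positivity)).2
    (mul_le_one₀ hε1 (Real.sqrt_nonneg _) (Real.sqrt_le_one.2 hα1)))

end Dim

/-- Batches of this size can be divided into sufficiently large parts. -/
theorem batch_size_bounds {a c C F ε Λ : ℝ} {n R T T₁ : ℕ} (ha : 1 ≤ a) (hc : 0 ≤ c) (hC : 0 ≤ C)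
    (hF : 1 ≤ F) (hε : 0 < ε) (hε1 : ε ≤ 1) (hΛ : 1 ≤ Λ) (hR0 : 0 < R) (hT0 : 0 < T)
    (hT₁0 : 0 < T₁) (hR : R ≤ a * Λ) (hT : T ≤ 4 * (a * Λ)) (hT₁ : T₁ ≤ 4 * (a * Λ))
    (hn : 16 * a ^ 2 * (c + 128 * C + 1) * (F * (1 / ε ^ 2)) * Λ ^ 2 ≤ n) :
    128 * C ≤ (n / (2 * R) / T : ℕ) ∧ c * (F * (1 / ε ^ 2)) ≤ (n / 2 / (2 * T₁) : ℕ) ∧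
      c * (F * (1 / ε ^ 2)) ≤ (n / (2 * R) / (2 * T₁) : ℕ) ∧
      c * (F * (1 / ε ^ 2)) ≤ (n / 2 / T : ℕ) := by
  have hG : 1 ≤ F * (1 / ε ^ 2) := one_le_mul_of_one_le_of_one_le hF
    ((one_le_div (by positivity)).2 (pow_le_one₀ hε.le hε1))
  set G := F * (1 / ε ^ 2)
  set z := a * Λ with hz
  have hz1 : 1 ≤ z := one_le_mul_of_one_le_of_one_le ha hΛ
  -- Each nested division is by at most 16 z² in total, where z bounds the number of rounds and, up
  -- to a factor 4, the numbers of repetitions.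
  have key : ∀ {x : ℝ} {p q : ℕ}, 0 < p → 0 < q → 0 ≤ x → x + 1 ≤ (c + 128 * C + 1) * G →
      (p : ℝ) * q ≤ 16 * z ^ 2 → x ≤ (n / p / q : ℕ) := fun {x p q} hp hq hx hxG hpq => by
    refine le_natDiv_div hp hq (le_trans ?_ hn)
    calc (x + 1) * (p * q) ≤ (c + 128 * C + 1) * G * (16 * z ^ 2) :=
          mul_le_mul hxG hpq (by positivity) (by positivity)
      _ = _ := by rw [hz]; ring
  have hzz : z ≤ z ^ 2 := le_self_pow₀ hz1 two_ne_zero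
  have hRT : ∀ {t : ℕ}, (t : ℝ) ≤ 4 * z → (R : ℝ) * t ≤ 4 * z ^ 2 := fun {t} ht => by
    calc (R : ℝ) * t ≤ z * (4 * z) := mul_le_mul hR ht (by positivity) (by positivity)
      _ = _ := by ring
  have hc1 : c * G + 1 ≤ (c + 128 * C + 1) * G := by nlinarith [mul_nonneg hC (show 0 ≤ G by linarith)]
  have hC1 : 128 * C + 1 ≤ (c + 128 * C + 1) * G := by
    nlinarith [mul_nonneg hc (show 0 ≤ G by linarith)]
  have h2 := hRT hT
  have h3 := hRT hT₁
  refine ⟨key (by omega) hT0 (by positivity) hC1 ?_, key two_pos (by omega) (by positivity) hc1 ?_,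
    key (by omega) (by omega) (by positivity) hc1 ?_, key two_pos hT0 (by positivity) hc1 ?_⟩ <;>
  · push_cast
    nlinarith

/-- The two summands of `X` serve two purposes: the first gives the number of batches for the
Bernstein inequality, where b²d in the denominator uses up the factor d of the sample size; the
second makes the random orders balanced. -/
theorem small_count_bounds {a b c C₁ α β ε ε₂ δ Λ X : ℝ} {d N R : ℕ} (hd : 0 < d) (ha : 1 ≤ a)
    (hb : 0 < b) (hc : 0 < c) (hC₁ : 0 < C₁) (hα : 0 < α) (hα1 : α ≤ 1) (hβ : 0 < β) (hε : 0 < ε)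
    (hε1 : ε ≤ 1) (hε₂ : c * ε ≤ ε₂) (hδ : 0 < δ) (hΛ : 1 ≤ Λ) (hR0 : 0 < R) (hR : R ≤ a * Λ)
    (hlδ : Real.log (1 / δ) ≤ a * Λ) (hlβ : Real.log (1 / β) ≤ Λ) (hld : Real.log d ≤ Λ)
    (hX : X = (a + 2) * (16 * b ^ 2) / (c ^ 4 * C₁) + 8 * (a + 1))
    (hN : 2 * a * X * (d / (α ^ 2 * ε ^ 4)) * Λ ^ 2 ≤ N) :
    0 < N / R ∧
    Real.log (2 * d / δ) ≤
      (N / R : ℕ) * (α ^ 2 * ε₂ ^ 4 * C₁ / (16 * (b * Real.sqrt d) ^ 2)) ∧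
    Real.exp (-(α * (N / R : ℕ) / 8)) ≤ δ * β := by
  have hd1 : (1 : ℝ) ≤ d := Nat.one_le_cast.2 hd
  have hG1 : 1 / α ≤ d / (α ^ 2 * ε ^ 4) := by
    rw [div_le_div_iff₀ hα (by positivity), one_mul]
    have h1 : α ^ 2 * ε ^ 4 ≤ α ^ 2 := mul_le_of_le_one_right (by positivity)
      (pow_le_one₀ hε.le hε1)
    nlinarith
  have hα' : 1 ≤ 1 / α := (one_le_div hα).2 hα1
  have hX8 : 8 * (a + 1) ≤ X := by
    rw [hX]
    have : 0 ≤ (a + 2) * (16 * b ^ 2) / (c ^ 4 * C₁) := by positivity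
    linarith
  have hXb : (a + 2) * (16 * b ^ 2) / (c ^ 4 * C₁) ≤ X := by rw [hX]; linarith
  set G := (d : ℝ) / (α ^ 2 * ε ^ 4) with hG
  have hG0 : 0 < G := by linarith
  have hXG : 1 ≤ X * G * Λ := by
    have h1 : 1 ≤ X * G := one_le_mul_of_one_le_of_one_le (by linarith) (by linarith)
    exact one_le_mul_of_one_le_of_one_le h1 hΛ
  have hms : X * G * Λ ≤ (N / R : ℕ) := by
    refine le_natDiv hR0 (le_trans ?_ hN)
    calc (X * G * Λ + 1) * R ≤ (2 * (X * G * Λ)) * (a * Λ) :=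
          mul_le_mul (by linarith) hR (by positivity) (by positivity)
      _ = _ := by ring
  refine ⟨Nat.cast_pos.1 (lt_of_lt_of_le (by linarith) hms : (0 : ℝ) < (N / R : ℕ)), ?_, ?_⟩
  · have h1 : Real.log (2 * d / δ) ≤ (a + 2) * Λ := by
      have e : 2 * d / δ = 2 * d * (1 / δ) := by ring
      rw [e, Real.log_mul (by positivity) (by positivity),
        Real.log_mul (by norm_num) (by positivity)]
      have := Real.log_two_lt_d9
      linarith
    have h2 : (c * ε) ^ 4 ≤ ε₂ ^ 4 := pow_le_pow_left₀ (by positivity) hε₂ 4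
    calc _ ≤ (a + 2) * Λ := h1
      _ = (a + 2) * (16 * b ^ 2) / (c ^ 4 * C₁) * G * Λ *
          (α ^ 2 * (c * ε) ^ 4 * C₁ / (16 * (b ^ 2 * d))) := by
          rw [hG]; field_simp
      _ ≤ X * G * Λ * (α ^ 2 * ε₂ ^ 4 * C₁ / (16 * (b ^ 2 * d))) := by gcongr
      _ ≤ (N / R : ℕ) * (α ^ 2 * ε₂ ^ 4 * C₁ / (16 * (b ^ 2 * d))) := by
          gcongr
      _ = _ := by rw [mul_pow, Real.sq_sqrt (by positivity)]
  · refine exp_neg_le_of_log_le hδ hβ ?_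
    have h1 : (a + 1) * Λ ≤ α * (X * G * Λ) / 8 := by
      have h2 : 8 * (a + 1) * 1 ≤ X * (G * α) := mul_le_mul hX8 (by
        rw [← div_le_iff₀ hα]; exact hG1) zero_le_one (by linarith)
      nlinarith
    have h3 : α * (X * G * Λ) / 8 ≤ α * (N / R : ℕ) / 8 := by gcongr
    linarith

/-- In the constant, 2b provides √ℓ batches of the component in each part, and 8(a + 1) makes the
random orders balanced. -/
theorem medium_count_bounds {a b s β δ F Λ : ℝ} {N R : ℕ} (ha : 1 ≤ a) (hb : 0 ≤ b)
    (hβ : 0 < β) (hβ1 : β ≤ 1) (hδ : 0 < δ) (hΛ : 1 ≤ Λ) (hF : 1 ≤ F) (hR0 : 0 < R)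
    (hR : R ≤ a * Λ) (hlδ : Real.log (1 / δ) ≤ a * Λ) (hlβ : Real.log (1 / β) ≤ Λ)
    (hs : s ≤ b * F) (hN : 3 * a * (2 * b + 8 * (a + 1)) * (1 / β * F) * Λ ^ 2 ≤ N) :
    0 < N ∧ 0 < (N - 1) / R ∧ s ≤ β / 2 * ((N - 1) / R : ℕ) ∧
    Real.exp (-(β * ((N - 1) / R : ℕ) / 8)) ≤ δ * β := by
  set X := 2 * b + 8 * (a + 1) with hX
  have hβ' : 1 ≤ 1 / β := (one_le_div hβ).2 hβ1
  have hG1 : 1 ≤ 1 / β * F := one_le_mul_of_one_le_of_one_le hβ' hF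
  set G := 1 / β * F with hG
  have hGβ : β * G = F := by rw [hG]; field_simp
  have hXG : 1 ≤ X * G * Λ := by
    have h1 : 1 ≤ X * G := one_le_mul_of_one_le_of_one_le (by linarith) (by linarith)
    exact one_le_mul_of_one_le_of_one_le h1 hΛ
  have hR1 : (1 : ℝ) ≤ R := Nat.one_le_cast.2 hR0
  -- One unit pays for rounding, the other for the batch that is set aside.
  have h3 : (X * G * Λ + 2) * R ≤ N := by
    refine le_trans ?_ hN
    calc (X * G * Λ + 2) * R ≤ (3 * (X * G * Λ)) * (a * Λ) :=
          mul_le_mul (by linarith) hR (by positivity) (by positivity)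
      _ = _ := by ring
  have hN0 : 0 < N := Nat.cast_pos.1 (lt_of_lt_of_le (by positivity) h3 : (0 : ℝ) < N)
  have hms : X * G * Λ ≤ ((N - 1) / R : ℕ) := by
    refine le_natDiv hR0 ?_
    rw [Nat.cast_sub hN0, Nat.cast_one]
    linarith
  refine ⟨hN0, Nat.cast_pos.1 (lt_of_lt_of_le (by linarith) hms : (0 : ℝ) < ((N - 1) / R : ℕ)),
    ?_, exp_neg_le_of_log_le hδ hβ ?_⟩
  · have h4 : β / 2 * (X * G * Λ) ≤ β / 2 * ((N - 1) / R : ℕ) := by gcongr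
    have h5 : β / 2 * (X * G * Λ) = X / 2 * F * Λ := by rw [← hGβ]; ring
    have h6 : b * F ≤ X / 2 * F := mul_le_mul_of_nonneg_right (by linarith) (by linarith)
    have h7 : X / 2 * F ≤ X / 2 * F * Λ := le_mul_of_one_le_right (by positivity) hΛ
    linarith
  · have h4 : β * (X * G * Λ) / 8 ≤ β * ((N - 1) / R : ℕ) / 8 := by gcongr
    have h5 : β * (X * G * Λ) / 8 = X / 8 * F * Λ := by rw [← hGβ]; ring
    have h6 : (a + 1) * 1 ≤ X / 8 * F := mul_le_mul (by linarith) hF zero_le_one (by linarith)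
    have h7 := mul_le_mul_of_nonneg_right h6 (show 0 ≤ Λ by linarith)
    linarith

theorem mul_pow_le_of_mul_pow_le {K K' G L : ℝ} {p q : ℕ} {N : ℝ} (hK : K' ≤ K) (hK' : 0 ≤ K')
    (hG : 0 ≤ G) (hL : 1 ≤ L) (hpq : q ≤ p) (h : K * G * L ^ p ≤ N) : K' * G * L ^ q ≤ N :=
  (mul_le_mul (mul_le_mul_of_nonneg_right hK hG) (pow_le_pow_right₀ hL hpq) (by positivity)
    (mul_nonneg (hK'.trans hK) hG)).trans h

theorem jointProb_of_isEmpty {Ω S : Type} [MeasurableSpace Ω] [Fintype S] (μ : Measure Ω)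
    {E : Ω → S → Prop} (h : ∀ ω s, ¬ E ω s) : jointProb μ E = 0 := by
  have h1 : ∀ s, {ω | E ω s} = ∅ := fun s => Set.eq_empty_of_forall_notMem fun ω => h ω s
  simp [jointProb, h1]

/-- The failure probability of the list algorithm, for sufficiently many sufficiently large
batches. -/
theorem jointProb_listAlgorithm_le_delta {C C₁ C₂ : ℝ} (hC : 0 < C) (hC₁ : 0 < C₁) (hC₂ : 0 < C₂)
    {a c b X : ℝ} (ha : a = 8 * C₁ + 20) (hc : c = accuracyConst C C₁)
    (hb : b = Real.sqrt (1 / c ^ 2 + 1))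
    (hX : X = (a + 2) * (16 * C₂ ^ 2) / (c ^ 4 * C₁) + 8 * (a + 1))
    {d k Ns Nm n : ℕ} {αs αm σ M ε δ : ℝ} (hd : 0 < d) (hαs : 0 < αs) (hαs1 : αs ≤ 1)
    (hαm : 0 < αm) (hαm1 : αm ≤ 1) (hσ : 0 < σ) (hM : 0 ≤ M) (hε : 0 < ε) (hε1 : ε ≤ 1)
    (hδ : 0 < δ) (hδ1 : δ ≤ 1) {D : Fin k → Measure (Sample d)} {w : Fin k → Vec d}
    {ns : Fin Ns → ℕ} {nm : Fin Nm → ℕ} {cs : Fin Ns → Fin k} {cm : Fin Nm → Fin k}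
    (hB : ∀ i, IsBounded (D i) C₁ (C₂ * Real.sqrt d))
    (hw : ∀ i ∈ largeComponents C C₁ σ αs αm D w cs cm, ‖w i‖ ≤ M)
    (hns : ∀ b, 2 ≤ ns b) (hnm : ∀ b, n ≤ nm b)
    (hNs : 2 * a * X * (d / (αs ^ 2 * ε ^ 4)) * logFactor d αs αm σ M ε δ ^ 2 ≤ Ns)
    (hn : 16 * a ^ 2 * (6144 * b / c ^ 2 + 128 * C + 1) * (dimFactor k αs ε * (1 / ε ^ 2)) *
      (logFactor d αs αm σ M ε δ + Real.log Nm) ^ 2 ≤ n)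
    (hNm : 3 * a * (2 * b + 8 * (a + 1)) * (1 / αm * dimFactor k αs ε) *
      logFactor d αs αm σ M ε δ ^ 2 ≤ Nm) :
    jointProb (dataLaw D ns nm cs cm)
      (fun (data : Data d ns nm) (s : Seed ns nm (numRuns tuning αm δ)) =>
        ¬ ∀ i ∈ largeComponents C C₁ σ αs αm D w cs cm,
          ∃ v ∈ (listAlgorithm tuning ⟨k, αs, αm, σ, C, C₁, M, ε, δ⟩ data s).val,
            ‖v - w i‖ ≤ ε * σ) ≤ ENNReal.ofReal δ := by
  rcases Nat.eq_zero_or_pos k with hk | hk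
  -- Without components `dimFactor` is 0 and the size assumptions are empty, but then there is
  -- nothing to estimate.
  · subst hk
    exact (jointProb_of_isEmpty _ fun ω s h => h fun i => i.elim0).le.trans zero_le
  obtain ⟨hΛ, -, -, -, hlα, hld⟩ := logFactor_bounds hd hαs hαs1 hαm hαm1 hσ hM hε hε1 hδ hδ1
  have hRle := numRounds_le hd hαs hαs1 hαm hαm1 hσ hM hε hε1 hδ hδ1 C₁ hC₁
  have hlδ := log_failure_le hd hαs hαs1 hαm hαm1 hσ hM hε hε1 hδ hδ1 C₁ hC₁
  have hF := one_le_dimFactor hε hε1 hk hαs hαs1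
  have hl := sqrt_subspaceDim_le (d := d) (k := k) hC hC₁ hε hε1 hαs hαs1
  have hε₂ := le_accuracy hC hC₁ hε hε1
  have hT0 := numRuns_pos hαm hαm1 hδ hδ1
  have hR0 := numRounds_pos hC₁ hM hε hσ
  have hc0 : 0 < c := hc ▸ accuracyConst_pos hC hC₁
  rw [← hc] at hl hε₂
  rw [← hb] at hl
  have hb0 : 0 ≤ b := hb ▸ Real.sqrt_nonneg _
  have ha1 : 1 ≤ a := by linarith
  rw [← ha] at hlδ
  obtain ⟨δ', hδ'⟩ : ∃ δ', δ' = δ / (2 * numRuns tuning αm δ) / (5 * numRounds C₁ M ε σ) :=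
    ⟨_, rfl⟩
  rw [← hδ'] at hlδ
  have hT1 : (1 : ℝ) ≤ numRuns tuning αm δ := Nat.one_le_cast.2 hT0
  have hR1 : (1 : ℝ) ≤ numRounds C₁ M ε σ := Nat.one_le_cast.2 hR0
  -- All stages of all rounds and runs share the budget: the number of runs times the number of
  -- rounds times δ' is δ/10.
  have hTR : numRuns tuning αm δ * (numRounds C₁ M ε σ * δ') = δ / 10 := by
    rw [hδ']; field_simp; norm_num
  have hδ'0 : 0 < δ' := by rw [hδ']; positivity
  have hδ'1 : δ' ≤ 1 / 10 := by
    have h1 : δ' ≤ numRounds C₁ M ε σ * δ' := le_mul_of_one_le_left hδ'0.le hR1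
    have h2 := h1.trans (le_mul_of_one_le_left (h1.trans' hδ'0.le) hT1)
    linarith
  have hlog0 : 0 < Real.log (1 / δ') := Real.log_pos ((one_lt_div hδ'0).2 (by linarith))
  have hRa : (numRounds C₁ M ε σ : ℝ) ≤ a * logFactor d αs αm σ M ε δ :=
    hRle.trans (mul_le_mul_of_nonneg_right (by linarith) (by linarith))
  obtain ⟨hNs0, hss, hys⟩ := small_count_bounds hd ha1 hC₂ hc0 hC₁ hαs hαs1 hαm hε hε1 hε₂ hδ'0
    hΛ hR0 hRa hlδ hlα hld hX hNs
  obtain ⟨hNm0, hmm0, hms, hym⟩ := medium_count_bounds ha1 hb0 hαm hαm1 hδ'0 hΛ hF hR0 hRa hlδ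
    hlα hl hNm
  have hlN : 0 ≤ Real.log Nm := Real.log_natCast_nonneg _
  have haN : Real.log Nm ≤ a * Real.log Nm := le_mul_of_one_le_left hlN ha1
  have haΛ : 1 ≤ a * logFactor d αs αm σ M ε δ := one_le_mul_of_one_le_of_one_le ha1 hΛ
  have hmm1 : (1 : ℝ) ≤ ((Nm - 1) / numRounds C₁ M ε σ : ℕ) := Nat.one_le_cast.2 hmm0
  have hlm : Real.log (((Nm - 1) / numRounds C₁ M ε σ : ℕ) / δ') =
      Real.log ((Nm - 1) / numRounds C₁ M ε σ : ℕ) + Real.log (1 / δ') := by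
    rw [← Real.log_mul (by positivity) (by positivity), mul_one_div]
  have hlm0 := Real.log_nonneg hmm1
  have hlmN : Real.log ((Nm - 1) / numRounds C₁ M ε σ : ℕ) ≤ Real.log Nm :=
    Real.log_le_log (by linarith) (Nat.cast_le.2 ((Nat.div_le_self _ _).trans (Nat.sub_le _ _)))
  have hT : (⌈3 * Real.log (1 / δ')⌉₊ : ℝ) ≤
      4 * (a * (logFactor d αs αm σ M ε δ + Real.log Nm)) := by
    refine (ceil_le_of_le le_rfl (by positivity)).trans ?_
    linarith
  have hT₁ : (⌈3 * Real.log (((Nm - 1) / numRounds C₁ M ε σ : ℕ) / δ')⌉₊ : ℝ) ≤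
      4 * (a * (logFactor d αs αm σ M ε δ + Real.log Nm)) := by
    rw [hlm]
    refine (ceil_le_of_le le_rfl (by positivity)).trans ?_
    linarith
  obtain ⟨hclip, htest, hstar, hest⟩ := batch_size_bounds (c := 6144 * b / c ^ 2) ha1
    (by positivity) hC.le hF hε hε1 (hΛ.trans (le_add_of_nonneg_right hlN)) hR0
    (Nat.ceil_pos.2 (by positivity)) (Nat.ceil_pos.2 (by rw [hlm]; positivity))
    (hRa.trans (by linarith)) hT hT₁ hn
  have hsize : SizeSetup d k Ns Nm n (numRounds C₁ M ε σ) ⌈3 * Real.log (1 / δ')⌉₊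
      ⌈3 * Real.log (((Nm - 1) / numRounds C₁ M ε σ : ℕ) / δ')⌉₊
      (subspaceDim d k αs (accuracy C C₁ ε)) αs αm (accuracy C C₁ ε) C C₁ (C₂ * Real.sqrt d)
      (6144 * b / c ^ 2 * (dimFactor k αs ε * (1 / ε ^ 2))) δ' :=
    { clip_size := hclip
      small_pos := hNs0
      small_size := hss
      test_size := by
        calc _ ≤ 6144 * (b * dimFactor k αs ε) := by gcongr
          _ = (c * ε) ^ 2 * (6144 * b / c ^ 2 * (dimFactor k αs ε * (1 / ε ^ 2))) := by
            field_simp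
          _ ≤ _ := by gcongr
      le_test := htest
      le_star := hstar
      le_est := hest
      medium_size := hms
      T_ge := Nat.le_ceil _
      T₁_ge := Nat.le_ceil _
      rank_eq := rfl }
  -- The number of runs is at least (2/αm) log(2/(αmδ)). The square leaves enough after the union
  -- bound over at most 1/αm components.
  have hx : Real.exp (-(αm * numRuns tuning αm δ)) ≤ αm * δ / 2 * (αm * δ / 2) := by
    refine exp_neg_le_of_log_le (by positivity) (by positivity) ?_
    rw [one_div_div]
    have h1 : 2 * (1 / αm) * Real.log (2 / (αm * δ)) ≤ numRuns tuning αm δ := Nat.le_ceil _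
    have h2 := mul_le_mul_of_nonneg_left h1 hαm.le
    have h3 : αm * (2 * (1 / αm) * Real.log (2 / (αm * δ))) = 2 * Real.log (2 / (αm * δ)) := by
      field_simp
    linarith
  refine (jointProb_listAlgorithm_le (R := numRounds C₁ M ε σ) (δ' := δ')
    ⟨k, αs, αm, σ, C, C₁, M, ε, δ⟩ hB hd hC hσ (by positivity) hαs hαs1 hαm hε hε1
    hM rfl hw hns hnm (Nat.pos_of_ne_zero fun h => by simp [h] at hNs0) hNm0 rfl rfl hδ' hδ'0
    (by linarith) hsize hx hys hym).trans (ENNReal.ofReal_le_ofReal ?_)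
  -- The failure probabilities add up to (4/10 + 1/4 + 2/10)δ: four stages per round, components
  -- missed by all runs, unbalanced orders.
  have e1 : (numRuns tuning αm δ : ℝ) * (numRounds C₁ M ε σ * (4 * δ')) = 4 * (δ / 10) := by
    rw [← hTR]; ring
  have e2 : 1 / αm * (numRuns tuning αm δ * (numRounds C₁ M ε σ * (δ' * αm + δ' * αm))) =
      2 * (δ / 10) := by
    rw [← hTR]; field_simp; ring
  have e3 : 1 / αm * (αm * δ / 2 * (αm * δ / 2)) = αm * δ * δ / 4 := by field_simp; ring
  have e4 : αm * δ * δ ≤ δ := mul_le_of_le_one_left hδ.le (mul_le_one₀ hαm1 hδ.le hδ1)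
  refine (add_le_add e1.le (add_le_add e3.le e2.le)).trans ?_
  linarith

end BatchRegression

end

/-! ### The main theorem -/

theorem mainTheorem2 :
    ∃ (τ : Tuning) (p : ℕ), ∀ C C₁ C₂ : ℝ, 0 < C → 0 < C₁ → 0 < C₂ →
    ∃ K : ℝ, 0 < K ∧
    ∀ (d k Ns Nm n : ℕ) (αs αm σ M ε δ : ℝ), 0 < d →
      0 < αs → αs ≤ 1 → 0 < αm → αm ≤ 1 → 0 < σ → 0 ≤ M →
      0 < ε → ε ≤ 1 → 0 < δ → δ ≤ 1 →
    ∀ (D : Fin k → Measure (Sample d)) (w : Fin k → Vec d)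
      (ns : Fin Ns → ℕ) (nm : Fin Nm → ℕ) (cs : Fin Ns → Fin k) (cm : Fin Nm → Fin k),
      (∀ i, IsProbabilityMeasure (D i)) →
      (∀ i, specNorm (secondMoment (D i)) ≤ C₁) →
      (∀ i, ∀ᵐ z ∂(D i), ‖z.1‖ ≤ C₂ * Real.sqrt d) →
      (∀ i ∈ largeComponents C C₁ σ αs αm D w cs cm, ‖w i‖ ≤ M) →
      (∀ b, 2 ≤ ns b) →
      (∀ b, n ≤ nm b) →
      K * (d / (αs ^ 2 * ε ^ 4)) * logFactor d αs αm σ M ε δ ^ p ≤ Ns →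
      K * (dimFactor k αs ε * (1 / ε ^ 2)) *
        (logFactor d αs αm σ M ε δ + Real.log Nm) ^ p ≤ n →
      K * ((1 / αm) * dimFactor k αs ε) * logFactor d αs αm σ M ε δ ^ p ≤ Nm →
      -- polynomial running time and size of the list, for all data and random choices
      (∀ (data : Data d ns nm) (s : Seed ns nm (numRuns τ αm δ)),
        ((listAlgorithm τ ⟨k, αs, αm, σ, C, C₁, M, ε, δ⟩ data s).cost : ℝ) ≤
          K * (d + (∑ b, ns b : ℕ) + (∑ b, nm b : ℕ) + 1 / αm + Real.log (1 / δ)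
            + Real.log (2 + M / (ε * σ))) ^ p ∧
        ((listAlgorithm τ ⟨k, αs, αm, σ, C, C₁, M, ε, δ⟩ data s).val.length : ℝ) ≤
          K * (1 / αm) * Real.log (2 / (αm * δ))) ∧
      -- the probability that some component of `I` has no accurate estimate is at most `δ`
      jointProb (dataLaw D ns nm cs cm)
        (fun (data : Data d ns nm) (s : Seed ns nm (numRuns τ αm δ)) =>
          ¬ ∀ i ∈ largeComponents C C₁ σ αs αm D w cs cm,
            ∃ v ∈ (listAlgorithm τ ⟨k, αs, αm, σ, C, C₁, M, ε, δ⟩ data s).val,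
              ‖v - w i‖ ≤ ε * σ) ≤ ENNReal.ofReal δ := by
  -- The exponent 12 comes from the running time; the sample sizes need only squares of the
  -- logarithms.
  refine ⟨tuning, 12, fun C C₁ C₂ hC hC₁ hC₂ => ?_⟩
  have hc0 := accuracyConst_pos hC hC₁
  obtain ⟨c, hc⟩ : ∃ c, c = accuracyConst C C₁ := ⟨_, rfl⟩
  rw [← hc] at hc0
  obtain ⟨a, ha⟩ : ∃ a, a = 8 * C₁ + 20 := ⟨_, rfl⟩
  obtain ⟨b, hb⟩ : ∃ b, b = Real.sqrt (1 / c ^ 2 + 1) := ⟨_, rfl⟩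
  obtain ⟨X, hX⟩ : ∃ X, X = (a + 2) * (16 * C₂ ^ 2) / (c ^ 4 * C₁) + 8 * (a + 1) := ⟨_, rfl⟩
  have ha0 : 0 < a := by rw [ha]; positivity
  have hb0 : 0 ≤ b := hb ▸ Real.sqrt_nonneg _
  have hX0 : 0 < X := by rw [hX]; positivity
  have hK₁ : 0 < 2 * a * X := by positivity
  have hK₂ : 0 < 16 * a ^ 2 * (6144 * b / c ^ 2 + 128 * C + 1) := by positivity
  have hK₃ : 0 < 3 * a * (2 * b + 8 * (a + 1)) := by positivity
  have hK₄ : 0 < 400 * (24 * C₁ + 101) ^ 6 := by positivity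
  -- One constant for each of the three sample sizes, one for the running time and 4 for the length
  -- of the list; the sum dominates all.
  refine ⟨2 * a * X + 16 * a ^ 2 * (6144 * b / c ^ 2 + 128 * C + 1) +
    3 * a * (2 * b + 8 * (a + 1)) + 400 * (24 * C₁ + 101) ^ 6 + 4, by positivity, ?_⟩
  obtain ⟨K, hK⟩ : ∃ K, K = 2 * a * X + 16 * a ^ 2 * (6144 * b / c ^ 2 + 128 * C + 1) +
    3 * a * (2 * b + 8 * (a + 1)) + 400 * (24 * C₁ + 101) ^ 6 + 4 := ⟨_, rfl⟩
  rw [← hK]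
  intro d k Ns Nm n αs αm σ M ε δ hd hαs hαs1 hαm hαm1 hσ hM hε hε1 hδ hδ1 D w ns nm cs cm hD hsec
    hbd hw hns hnm hNs hn hNm
  have hΛ := (logFactor_bounds hd hαs hαs1 hαm hαm1 hσ hM hε hε1 hδ hδ1).1
  have hlN : 0 ≤ Real.log Nm := Real.log_natCast_nonneg _
  have hF0 : 0 ≤ dimFactor k αs ε := le_min (Real.sqrt_nonneg _) (by positivity)
  have hK0 : 0 < K := by rw [hK]; positivity
  refine ⟨fun data s => ⟨?_, ?_⟩, ?_⟩
  · have hnm1 : ∀ b, 1 ≤ nm b := fun b => by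
      refine le_trans ?_ (hnm b)
      -- A medium batch has a component, so k is positive and the lower bound on `n` is not void.
      have hF := one_le_dimFactor hε hε1 (cm b).pos hαs hαs1
      refine Nat.cast_pos.1 (lt_of_lt_of_le ?_ hn : (0 : ℝ) < n)
      have h1 : 0 < logFactor d αs αm σ M ε δ + Real.log Nm := by linarith
      have h2 : 0 < dimFactor k αs ε := by linarith
      positivity
    have hδ0 : 0 ≤ Real.log (1 / δ) := Real.log_nonneg ((one_le_div hδ).2 hδ1)
    have hlog : 0 ≤ Real.log (2 + M / (ε * σ)) := Real.log_nonneg (by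
      have : 0 ≤ M / (ε * σ) := by positivity
      linarith)
    refine (cost_le_pow C₁ hC₁ hd hαm hαm1 hσ hM hε hδ hδ1 hns hnm1 data s (p := 12) le_rfl).trans
      (mul_le_mul_of_nonneg_right ?_ (by positivity))
    linarith
  · rw [length_listAlgorithm]
    refine (numRuns_le hαm hαm1 hδ hδ1).trans ?_
    have h1 : 0 ≤ Real.log (2 / (αm * δ)) :=
      (Real.log_nonneg (by norm_num)).trans (log_two_le_runs hαm hαm1 hδ hδ1)
    have h2 : 4 ≤ K := by linarith
    gcongr
  · exact jointProb_listAlgorithm_le_delta hC hC₁ hC₂ ha hc hb hX hd hαs hαs1 hαm hαm1 hσ hM hε hε1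
      hδ hδ1 (fun i => ⟨hD i, hsec i, hbd i⟩) hw hns hnm
      (mul_pow_le_of_mul_pow_le (by linarith) hK₁.le (by positivity) hΛ (by norm_num) hNs)
      (mul_pow_le_of_mul_pow_le (p := 12) (K := K) (by linarith) hK₂.le (by positivity)
        (hΛ.trans (le_add_of_nonneg_right hlN)) (by norm_num) (by rw [← mul_assoc] at hn ⊢; exact hn))
      (mul_pow_le_of_mul_pow_le (by linarith) hK₃.le (by positivity) hΛ (by norm_num) hNm)
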